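/- For real numbers $\kappa,\tau$ with $\tau\neq 0$ and $\kappa\neq 4\tau^2$, let $E(\kappa,\tau)$ be the simply connected homogeneous Riemannian $3$-manifold that fibers over the complete simply connected surface $\mathbb{M}^2(\kappa)$ of constant curvature $\kappa$ by a Riemannian submersion $\Pi:E(\kappa,\tau)\to\mathbb{M}^2(\kappa)$ with bundle curvature $\tau$, and let $\xi$ be the unit Killing field tangent to the fibers. (For $\kappa>0$ it is the unit sphere $\mathbb{S}^3\subset\mathbb{C}^2$ with the metric $\frac4\kappa\big[\langle X,Y\rangle+(\frac{4\tau^2}{\kappa}-1)\langle X,ip\rangle\langle Y,ip\rangle\big]$ at $p$; for $\kappa\le 0$ it is $\{(x,y,z)\in\mathbb{R}^3: 1+\frac\kappa4(x^2+y^2)>0\}$ with the metric $\lambda^2(dx^2+dy^2)+(dz+\tau\lambda(y\,dx-x\,dy))^2$, $\lambda=(1+\frac\kappa4(x^2+y^2))^{-1}$.) Let $f:M\to E(\kappa,\tau)$ be a smooth immersion of a compact connected surface $M$ (without boundary, orientable or not) of constant mean curvature $H$. Let $N$ be a choice of unit normal vector at each point of $M$ with respect to which the shape operator $A$ satisfies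 $\operatorname{tr}A=2H$, let $\Phi=A-HI$, let $C=\langle\xi,N\rangle$ be the angle function, and let $d\sigma$ be the area measure of the induced metric. Then $$\int_M\Big\{|\Phi|^4-\big[2(H^2+\tau^2)+(\kappa-4\tau^2)(5C^2-1)\big]|\Phi|^2+2(\kappa-4\tau^2)(H^2+\tau^2)(3C^2-1)\Big\}\,d\sigma\ \ge\ 0 .$$ Equality holds if and only if the second fundamental form of $f$ is parallel. In that case $M$ is a Hopf cylinder, that is, $f(M)=\Pi^{-1}(\gamma)$ for a regular closed curve $\gamma$ in $\mathbb{M}^2(\kappa)$, and $|A|^2=2(2H^2+\tau^2)$ everywhere on $M$. -/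

import Mathlib

open Set MeasureTheory Matrix
open scoped Manifold ContDiff Topology

noncomputable section

namespace CMCSurface

/-- The coordinate space `ℝⁿ`. -/
abbrev Coord (n : ℕ) := EuclideanSpace ℝ (Fin n)

/-! ### The homogeneous spaces `E(κ,τ)` -/

/-- The data of a Riemannian manifold realised as a submanifold `carrier` of `ℝ^dim` together with
a vector field `xi` on it and a projection `proj` onto a surface `base ⊆ ℝ³`.
`tangent p` is the tangent space of `carrier` at `p` and `metric p` is the Riemannian metric at `p`
(evaluated on tangent vectors). -/
structure FiberedModel where
  dim : ℕ
  carrier : Set (Coord dim)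
  tangent : Coord dim → Submodule ℝ (Coord dim)
  metric : Coord dim → Coord dim → Coord dim → ℝ
  xi : Coord dim → Coord dim
  base : Set (Coord 3)
  proj : Coord dim → Coord 3

/-- Multiplication by `i` on `ℂ² = ℝ⁴`. -/
def mulI (p : Coord 4) : Coord 4 := !₂[-p 1, p 0, -p 3, p 2]

/-- The Berger sphere, for `κ > 0`: the unit sphere of `ℂ²` with the metric
`(4/κ) (⟨X,Y⟩ + (4τ²/κ - 1) ⟨X,ip⟩ ⟨Y,ip⟩)`, fibered over the sphere of curvature `κ` in `ℝ³`
by the Hopf map `(z,w) ↦ κ^(-1/2) (2 z w̄, |z|² - |w|²)`; `xi` is the unit field along the fibers. -/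
def bergerSphere (κ τ : ℝ) : FiberedModel where
  dim := 4
  carrier := Metric.sphere 0 1
  tangent p := (Submodule.span ℝ {p})ᗮ
  metric p X Y :=
    4 / κ * (inner ℝ X Y + (4 * τ ^ 2 / κ - 1) * (inner ℝ X (mulI p) * inner ℝ Y (mulI p)))
  xi p := (κ / (4 * τ)) • mulI p
  base := Metric.sphere 0 (1 / √κ)
  proj p := (1 / √κ) • !₂[2 * (p 0 * p 2 + p 1 * p 3), 2 * (p 1 * p 2 - p 0 * p 3),
    p 0 ^ 2 + p 1 ^ 2 - p 2 ^ 2 - p 3 ^ 2]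

/-- The conformal factor `λ = 1 / (1 + κ (x² + y²) / 4)`. -/
def conformalFactor (κ : ℝ) (p : Coord 3) : ℝ := 1 / (1 + κ / 4 * (p 0 ^ 2 + p 1 ^ 2))

/-- The connection form `dz + τ λ (y dx - x dy)`. -/
def connectionForm (κ τ : ℝ) (p X : Coord 3) : ℝ :=
  X 2 + τ * conformalFactor κ p * (p 1 * X 0 - p 0 * X 1)

/-- The space `E(κ,τ)` for `κ ≤ 0` (the Heisenberg group for `κ = 0`, the universal cover of
`SL₂(ℝ)` for `κ < 0`): the set `{1 + κ (x² + y²) / 4 > 0}` of `ℝ³` with the metric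
`λ² (dx² + dy²) + (dz + τ λ (y dx - x dy))²`, `xi = ∂_z`, fibered by `(x,y,z) ↦ (x,y)` over the
disc or plane of curvature `κ`, here written as a subset of `{z = 0}`. -/
def cartanModel (κ τ : ℝ) : FiberedModel where
  dim := 3
  carrier := {p | 0 < 1 + κ / 4 * (p 0 ^ 2 + p 1 ^ 2)}
  tangent _ := ⊤
  metric p X Y := conformalFactor κ p ^ 2 * (X 0 * Y 0 + X 1 * Y 1)
    + connectionForm κ τ p X * connectionForm κ τ p Y
  xi _ := !₂[0, 0, 1]
  base := {q | 0 < 1 + κ / 4 * (q 0 ^ 2 + q 1 ^ 2) ∧ q 2 = 0}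
  proj p := !₂[p 0, p 1, 0]

/-- The simply connected homogeneous 3-manifold `E(κ,τ)`, for `τ ≠ 0`. -/
def homSpace (κ τ : ℝ) : FiberedModel :=
  if 0 < κ then bergerSphere κ τ else cartanModel κ τ

/-! ### Parametrised surfaces -/

/-- The partial derivative `∂ᵢ F`. -/
def pd {V : Type*} [NormedAddCommGroup V] [NormedSpace ℝ V] (i : Fin 2) (F : Coord 2 → V)
    (u : Coord 2) : V :=
  fderiv ℝ F u (EuclideanSpace.single i 1)

section patch

variable {n : ℕ}

/-- Christoffel symbols of the first kind of a metric `G`, that is `G(D_X Y, Z)` for the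
Levi-Civita connection `D` and constant fields `X`, `Y`, `Z` (Koszul formula). -/
def christoffel (G : Coord n → Coord n → Coord n → ℝ) (p X Y Z : Coord n) : ℝ :=
  (fderiv ℝ (fun q => G q Y Z) p X + fderiv ℝ (fun q => G q X Z) p Y
    - fderiv ℝ (fun q => G q X Y) p Z) / 2

/-- The induced metric `gᵢⱼ` of a patch `F`. -/
def firstForm (G : Coord n → Coord n → Coord n → ℝ) (F : Coord 2 → Coord n) (u : Coord 2) :
    Matrix (Fin 2) (Fin 2) ℝ :=
  Matrix.of fun i j => G (F u) (pd i F u) (pd j F u)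

/-- The second fundamental form `hᵢⱼ = G(D_{∂ᵢ} ∂ⱼF, ν)` of a patch `F` in the normal direction `ν`.
If `F` takes its values in a submanifold of `ℝⁿ` to which `ν` is tangent, the Levi-Civita
connection of the submanifold gives the same number, as it is the tangential part of `D`. -/
def secondForm (G : Coord n → Coord n → Coord n → ℝ) (F : Coord 2 → Coord n) (ν : Coord n)
    (u : Coord 2) : Matrix (Fin 2) (Fin 2) ℝ :=
  Matrix.of fun i j => G (F u) (pd i (pd j F) u) ν + christoffel G (F u) (pd i F u) (pd j F u) ν

/-- The matrix `hⁱⱼ = gⁱᵏ hₖⱼ` of the shape operator. -/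
def shapeMatrix (G : Coord n → Coord n → Coord n → ℝ) (F : Coord 2 → Coord n) (ν : Coord n)
    (u : Coord 2) : Matrix (Fin 2) (Fin 2) ℝ :=
  (firstForm G F u)⁻¹ * secondForm G F ν u

/-- The Christoffel symbols `Γˡₖᵢ` of the induced metric of a patch. -/
def inducedChristoffel (G : Coord n → Coord n → Coord n → ℝ) (F : Coord 2 → Coord n) (u : Coord 2)
    (l k i : Fin 2) : ℝ :=
  ∑ m, (firstForm G F u)⁻¹ l m *
    ((pd k (fun v => firstForm G F v i m) u + pd i (fun v => firstForm G F v k m) u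
      - pd m (fun v => firstForm G F v k i) u) / 2)

/-- The covariant derivative `∇ₖ hᵢⱼ` of the second fundamental form of a patch with normal
field `ν`. -/
def covDerivSecondForm (G : Coord n → Coord n → Coord n → ℝ) (F ν : Coord 2 → Coord n)
    (u : Coord 2) (k i j : Fin 2) : ℝ :=
  pd k (fun v => secondForm G F (ν v) v i j) u
    - ∑ l, inducedChristoffel G F u l k i * secondForm G F (ν u) u l j
    - ∑ l, inducedChristoffel G F u l k j * secondForm G F (ν u) u i l

end patch

/-! ### Immersed surfaces -/

section surface

variable (E : FiberedModel) {M : Type*} [TopologicalSpace M] [ChartedSpace (Coord 2) M]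

/-- `f` is a smooth immersion of the surface `M` into the Riemannian manifold `E`. -/
structure IsSmoothImmersion (f : M → Coord E.dim) : Prop where
  mem_carrier : ∀ p, f p ∈ E.carrier
  contMDiff : ContMDiff (𝓡 2) 𝓘(ℝ, Coord E.dim) ∞ f
  injective_mfderiv : ∀ p, Function.Injective (mfderiv (𝓡 2) 𝓘(ℝ, Coord E.dim) f p)

/-- `ν` is one of the two unit normal vectors of `f` at `p`, tangent to `E`. -/
structure IsUnitNormal (f : M → Coord E.dim) (p : M) (ν : Coord E.dim) : Prop where
  mem_tangent : ν ∈ E.tangent (f p)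
  unit : E.metric (f p) ν ν = 1
  normal : ∀ v : TangentSpace (𝓡 2) p,
    E.metric (f p) (mfderiv (𝓡 2) 𝓘(ℝ, Coord E.dim) f p v) ν = 0

/-- `f` written in the chart at `p`. -/
def patch (f : M → Coord E.dim) (p : M) : Coord 2 → Coord E.dim :=
  f ∘ (chartAt (Coord 2) p).symm

/-- The shape operator `A` of `f` at `p` with respect to the unit normal `ν` at `p`, as a matrix in
the coordinate basis of the chart at `p`. -/
def shapeOperator (f : M → Coord E.dim) (p : M) (ν : Coord E.dim) : Matrix (Fin 2) (Fin 2) ℝ :=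
  shapeMatrix E.metric (patch E f p) ν (chartAt (Coord 2) p p)

/-- `|A|² = tr A²` (`A` is self-adjoint). -/
def normSqA (f : M → Coord E.dim) (N : M → Coord E.dim) (p : M) : ℝ :=
  (shapeOperator E f p (N p) * shapeOperator E f p (N p)).trace

/-- `|Φ|² = tr Φ²` for `Φ = A - H I`. -/
def normSqPhi (f : M → Coord E.dim) (N : M → Coord E.dim) (H : ℝ) (p : M) : ℝ :=
  ((shapeOperator E f p (N p) - H • (1 : Matrix (Fin 2) (Fin 2) ℝ)) *
    (shapeOperator E f p (N p) - H • (1 : Matrix (Fin 2) (Fin 2) ℝ))).trace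

/-- The angle function `C = ⟨ξ, N⟩`. -/
def angle (f : M → Coord E.dim) (N : M → Coord E.dim) (p : M) : ℝ :=
  E.metric (f p) (E.xi (f p)) (N p)

/-- The surface has constant mean curvature `H` with respect to the unit normals `N`:
`tr A = 2H` everywhere. -/
def HasConstantMeanCurvature (f : M → Coord E.dim) (N : M → Coord E.dim) (H : ℝ) : Prop :=
  ∀ p, (shapeOperator E f p (N p)).trace = 2 * H

/-- The second fundamental form is parallel: `∇h = 0` at every point `p`, where `h` is taken with
respect to a smooth unit normal field defined near `p`. -/
def HasParallelSecondForm (f : M → Coord E.dim) : Prop :=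
  ∀ p, ∃ (U : Set M) (ν : M → Coord E.dim), IsOpen U ∧ p ∈ U ∧
    ContMDiffOn (𝓡 2) 𝓘(ℝ, Coord E.dim) ∞ ν U ∧ (∀ q ∈ U, IsUnitNormal E f q (ν q)) ∧
    ∀ k i j, covDerivSecondForm E.metric (patch E f p) (patch E ν p) (chartAt (Coord 2) p p)
      k i j = 0

/-- The area measure `dσ` of the induced metric: the least measure that dominates
`√(det g) du₁ du₂` on the domain of every chart; as these local measures agree on overlaps,
it equals `√(det g) du₁ du₂` on each of these domains. -/
def areaMeasure [MeasurableSpace M] (f : M → Coord E.dim) : Measure M :=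
  ⨆ p : M, Measure.map (chartAt (Coord 2) p).symm
    ((volume.restrict (chartAt (Coord 2) p).target).withDensity
      fun u => ENNReal.ofReal √(firstForm E.metric (patch E f p) u).det)

/-- The image of `f` is a Hopf cylinder: the preimage under the fibration of a regular closed curve
in the base surface. -/
def IsHopfCylinder (f : M → Coord E.dim) : Prop :=
  ∃ (γ : ℝ → Coord 3) (L : ℝ), 0 < L ∧ ContDiff ℝ ∞ γ ∧ Function.Periodic γ L ∧
    (∀ t, γ t ∈ E.base ∧ deriv γ t ≠ 0) ∧
    range f = {x | x ∈ E.carrier ∧ E.proj x ∈ range γ}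

end surface

/-- The function
`|Φ|⁴ - [2(H² + τ²) + (κ - 4τ²)(5C² - 1)] |Φ|² + 2(κ - 4τ²)(H² + τ²)(3C² - 1)` on `M`. -/
def simonsIntegrand {M : Type*} [TopologicalSpace M] [ChartedSpace (Coord 2) M] (κ τ H : ℝ)
    (f N : M → Coord (homSpace κ τ).dim) (p : M) : ℝ :=
  normSqPhi (homSpace κ τ) f N H p ^ 2
    - (2 * (H ^ 2 + τ ^ 2) + (κ - 4 * τ ^ 2) * (5 * angle (homSpace κ τ) f N p ^ 2 - 1))
      * normSqPhi (homSpace κ τ) f N H p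
    + 2 * (κ - 4 * τ ^ 2) * (H ^ 2 + τ ^ 2) * (3 * angle (homSpace κ τ) f N p ^ 2 - 1)

end CMCSurface

end

open CMCSurface

open Set MeasureTheory Matrix
open scoped Manifold ContDiff Topology

noncomputable section

/-! Write c = κ - 4τ², let T be the tangential part of ξ, J the rotation of the tangent planes by a
right angle in the orientation given by N, and Q the integrand. The proof rests on a formula of
Simons type for the tangent field V = ∇|Φ|²/2 - 2cC(HT + τJT), namely div V = |∇A|² - Q
(`simons_divergence`). It follows from the Gauss and Codazzi equations and from D_X ξ = τ X × ξ.
Codazzi contributes derivatives of cCT to the Laplacian of |Φ|²; the correction term in V absorbs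
them, so that only functions of C and |Φ|² remain beside |∇A|². Moreover, Codazzi prescribes two
linear combinations of the components of ∇A in terms of cCT, and completing squares gives |∇A|² ≥
c²C²|T|² = c²C²(1 - C²) (`simons_formula`). Integration over the closed surface yields ∫ Q ≥ ∫
c²C²(1 - C²) ≥ 0 (`integral_angleTerm_le`).

If ∫ Q = 0, then C² takes only the values 0 and 1, and by connectedness only one of them. The value
1 is excluded because the horizontal distribution is not integrable for τ ≠ 0, so C = 0 and ξ is
tangent to the surface (`angle_eq_zero`). Then the derivative of C and the trace determine A
completely, and A is parallel with |Φ|² = 2(H² + τ²) and Q = 0 (`coordCovDeriv_of_vertical`,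
`halfNormSq_of_vertical`). Conversely, a parallel A makes the Codazzi term cCT vanish, which leads
to C = 0 in the same way (`angle_sq_mul_of_parallel`).

For κ ≤ 0 a compact surface cannot have C = 0: at a maximum of the height z its tangent plane would
have to be both dz = 0 and vertical (`cartan_not_vertical`). For κ > 0 an explicit vector of ℝ³
attached to each point is constant along a vertical surface, so the Hopf projection lies on a
circle. The image is compact and relatively open in the preimage of this circle, which is connected,
hence it is the whole preimage (`isHopfCylinder_of_vertical`).

The local computations are identities between derivations of a commutative ℝ-algebra, applied to the
smooth functions on the image of a chart. Both models enter only through an orthonormal coframe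
whose connection is D_X Y = dY(X) + (τX + α(X)ξ) × Y (`Coframe`). No continuity of N is assumed. For
H ≠ 0 the condition tr A = 2H determines N and makes it smooth; for H = 0 its sign is arbitrary, but
only C², HC and CJ occur, which do not depend on it. For the same reason no orientation of the
surface is needed. -/

namespace CMCSurface

set_option linter.unusedSectionVars false

/-! ### Simons' formula in an orthonormal frame -/

section frame

variable {A : Type*} [CommRing A] [Algebra ℝ A] (E₁ E₂ : Derivation ℝ A A)

theorem derivation_pow_two (E : Derivation ℝ A A) (a : A) : E (a ^ 2) = 2 * a * E a := by
  rw [pow_two, Derivation.leibniz, smul_eq_mul]; ring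

/-- The traceless form Φ has rows (a, b) and (b, -a), so that a² + b² = |Φ|²/2. The pair p₁, p₂ is
the connection form of the frame and t₁, t₂ are the components of T. The terms with p₁, p₂ on the
left complete the derivatives of the components to a divergence. The reason is Bochner's: Codazzi
expresses the Laplacians of a and b by commutators, which Gauss evaluates. -/
theorem simons_divergence {H τ c a b C t₁ t₂ p₁ p₂ : A}
    (hH₁ : E₁ H = 0) (hH₂ : E₂ H = 0) (hτ₁ : E₁ τ = 0) (hτ₂ : E₂ τ = 0)
    (hc₁ : E₁ c = 0) (hc₂ : E₂ c = 0)
    (hC₁ : E₁ C = -(H + a) * t₁ - b * t₂ + τ * t₂) (hC₂ : E₂ C = -b * t₁ - (H - a) * t₂ - τ * t₁)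
    (h₁₁ : E₁ t₁ = p₁ * t₂ + (H + a) * C) (h₂₁ : E₂ t₁ = p₂ * t₂ + b * C + τ * C)
    (h₁₂ : E₁ t₂ = -p₁ * t₁ + b * C - τ * C) (h₂₂ : E₂ t₂ = -p₂ * t₁ + (H - a) * C)
    (hT : t₁ ^ 2 + t₂ ^ 2 + C ^ 2 = 1)
    (hab : E₁ (E₂ a) - E₂ (E₁ a) = -p₁ * E₁ a - p₂ * E₂ a)
    (hbb : E₁ (E₂ b) - E₂ (E₁ b) = -p₁ * E₁ b - p₂ * E₂ b)
    (gauss : E₁ p₂ - E₂ p₁ + p₁ ^ 2 + p₂ ^ 2 = -(H ^ 2 - a ^ 2 - b ^ 2 + τ ^ 2 + c * C ^ 2))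
    (cod₁ : (E₁ a - 2 * p₁ * b) + (E₂ b + 2 * p₂ * a) = c * C * t₁)
    (cod₂ : (E₁ b + 2 * p₁ * a) - (E₂ a - 2 * p₂ * b) = c * C * t₂) :
    E₁ (E₁ (a ^ 2 + b ^ 2) - 2 * c * C * (H * t₁ - τ * t₂))
      + E₂ (E₂ (a ^ 2 + b ^ 2) - 2 * c * C * (H * t₂ + τ * t₁))
      + p₂ * (E₁ (a ^ 2 + b ^ 2) - 2 * c * C * (H * t₁ - τ * t₂))
      - p₁ * (E₂ (a ^ 2 + b ^ 2) - 2 * c * C * (H * t₂ + τ * t₁))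
    = 2 * ((E₁ a - 2 * p₁ * b) ^ 2 + (E₂ a - 2 * p₂ * b) ^ 2
        + (E₁ b + 2 * p₁ * a) ^ 2 + (E₂ b + 2 * p₂ * a) ^ 2)
      - ((2 * (a ^ 2 + b ^ 2)) ^ 2
        - (2 * (H ^ 2 + τ ^ 2) + c * (5 * C ^ 2 - 1)) * (2 * (a ^ 2 + b ^ 2))
        + 2 * c * (H ^ 2 + τ ^ 2) * (3 * C ^ 2 - 1)) := by
  -- Codazzi solved for the two derivatives along `E₁`. Differentiating these two equations along
  -- both frame vectors gives the relations between the second derivatives of `a` and `b`.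
  have e₁ : E₁ a = 2 * p₁ * b - E₂ b - 2 * p₂ * a + c * C * t₁ := by linear_combination cod₁
  have e₂ : E₁ b = -2 * p₁ * a + E₂ a - 2 * p₂ * b + c * C * t₂ := by linear_combination cod₂
  have two₁ : E₁ 2 = 0 := by simpa using E₁.map_natCast 2
  have two₂ : E₂ 2 = 0 := by simpa using E₂.map_natCast 2
  have n₁ := congrArg E₁ e₁
  have n₂ := congrArg E₁ e₂
  have m₁ := congrArg E₂ e₁
  have m₂ := congrArg E₂ e₂
  simp only [map_add, map_sub, map_neg, Derivation.leibniz, smul_eq_mul, derivation_pow_two, two₁,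
    two₂, hH₁, hH₂, hτ₁, hτ₂, hc₁, hc₂, hC₁, hC₂, h₁₁, h₂₁, h₁₂, h₂₂] at n₁ n₂ m₁ m₂ ⊢
  generalize E₁ (E₁ a) = a₁₁, E₁ (E₁ b) = b₁₁, E₁ (E₂ a) = a₁₂, E₁ (E₂ b) = b₁₂,
    E₂ (E₁ a) = a₂₁, E₂ (E₁ b) = b₂₁, E₂ (E₂ a) = a₂₂, E₂ (E₂ b) = b₂₂ at *
  rw [e₁] at n₂ hab ⊢
  rw [e₂] at n₁ hbb ⊢
  rw [e₁] at n₁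
  rw [e₂] at n₂
  -- In `n₁ - hbb - m₂` the mixed derivatives of `b` cancel and E₁E₁a + E₂E₂a is left; `n₂ + hab +
  -- m₁` does the same for `b`. The multiple of `hT` replaces |T|² by 1 - C².
  linear_combination 2 * a * (n₁ - hbb - m₂) + 2 * b * (n₂ + hab + m₁)
    - 4 * (a ^ 2 + b ^ 2) * gauss + 2 * c * (H ^ 2 + τ ^ 2 - a ^ 2 - b ^ 2) * hT
end frame

/-! ### Structure equations of E(κ,τ) along a surface -/

section ambient

variable {A : Type*} [CommRing A] [Algebra ℝ A]

/-- The vertical unit vector. -/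
def vert (A : Type*) [CommRing A] : Fin 3 → A := ![0, 0, 1]

/-- The covariant derivative of a vector field in an orthonormal frame with connection form
`τ x + α e₃`. -/
def cov (D : Derivation ℝ A A) (τ : A) (x : Fin 3 → A) (α : A) (v : Fin 3 → A) : Fin 3 → A :=
  (fun i => D (v i)) + (τ • x + α • vert A) ⨯₃ v

theorem ext_three {v w : Fin 3 → A} (h₀ : v 0 = w 0) (h₁ : v 1 = w 1) (h₂ : v 2 = w 2) :
    v = w := by
  ext i
  fin_cases i <;> assumption

theorem cross_zero (v w : Fin 3 → A) : (v ⨯₃ w) 0 = v 1 * w 2 - v 2 * w 1 := by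
  simp [cross_apply]

theorem cross_one (v w : Fin 3 → A) : (v ⨯₃ w) 1 = v 2 * w 0 - v 0 * w 2 := by
  simp [cross_apply]

theorem cross_two (v w : Fin 3 → A) : (v ⨯₃ w) 2 = v 0 * w 1 - v 1 * w 0 := by
  simp [cross_apply]

theorem cov_zero (D : Derivation ℝ A A) (τ : A) (x : Fin 3 → A) (α : A) (v : Fin 3 → A) :
    cov D τ x α v 0 = D (v 0) + τ * (x 1 * v 2 - x 2 * v 1) - α * v 1 := by
  simp only [cov, Pi.add_apply, cross_zero, Pi.smul_apply, smul_eq_mul, vert]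
  simp
  ring

theorem cov_one (D : Derivation ℝ A A) (τ : A) (x : Fin 3 → A) (α : A) (v : Fin 3 → A) :
    cov D τ x α v 1 = D (v 1) + τ * (x 2 * v 0 - x 0 * v 2) + α * v 0 := by
  simp only [cov, Pi.add_apply, cross_one, Pi.smul_apply, smul_eq_mul, vert]
  simp
  ring

theorem cov_two (D : Derivation ℝ A A) (τ : A) (x : Fin 3 → A) (α : A) (v : Fin 3 → A) :
    cov D τ x α v 2 = D (v 2) + τ * (x 0 * v 1 - x 1 * v 0) := by
  simp only [cov, Pi.add_apply, cross_two, Pi.smul_apply, smul_eq_mul, vert]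
  simp
  ring

/-- The connection is metric because taking the cross product with a fixed vector is skew-symmetric.
-/
theorem cov_dot (D : Derivation ℝ A A) (τ : A) (x : Fin 3 → A) (α : A) (v w : Fin 3 → A) :
    D (v ⬝ᵥ w) = cov D τ x α v ⬝ᵥ w + v ⬝ᵥ cov D τ x α w := by
  simp only [dotProduct, Fin.sum_univ_three, cov_zero, cov_one, cov_two, map_add,
    Derivation.leibniz, smul_eq_mul]
  ring

theorem cov_smul (D : Derivation ℝ A A) (τ : A) (x : Fin 3 → A) (α : A) (f : A) (v : Fin 3 → A) :
    cov D τ x α (f • v) = D f • v + f • cov D τ x α v := by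
  ext i
  fin_cases i <;> simp [cov_zero, cov_one, cov_two] <;> ring

theorem cov_add (D : Derivation ℝ A A) (τ : A) (x : Fin 3 → A) (α : A) (v w : Fin 3 → A) :
    cov D τ x α (v + w) = cov D τ x α v + cov D τ x α w := by
  ext i
  fin_cases i <;> simp [cov_zero, cov_one, cov_two] <;> ring

theorem cov_linear (D₁ D₂ : Derivation ℝ A A) (τ : A) (x₁ x₂ : Fin 3 → A) (α₁ α₂ b₁ b₂ : A)
    (v : Fin 3 → A) :
    cov (b₁ • D₁ + b₂ • D₂) τ (b₁ • x₁ + b₂ • x₂) (b₁ * α₁ + b₂ * α₂) v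
      = b₁ • cov D₁ τ x₁ α₁ v + b₂ • cov D₂ τ x₂ α₂ v := by
  ext i
  fin_cases i <;> simp [cov_zero, cov_one, cov_two] <;> ring

/-- The last component of `v` is its product with ξ. Since ξ × ξ = 0, the connection form α does not
enter D_X ξ = τ X × ξ. -/
theorem apply_two (D : Derivation ℝ A A) (τ : A) (x : Fin 3 → A) (α : A) (v : Fin 3 → A) :
    D (v 2) = cov D τ x α v 2 - τ * (x ⨯₃ v) 2 := by
  rw [cov_two, cross_two]; ring

/-- The structure equations of the homogeneous space `E(κ,τ)`, `c = κ - 4τ²`, pulled back by a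
patch: `x i` and `α i` are the components of `∂ᵢF` and of the connection. -/
structure AmbientEquations (D : Fin 2 → Derivation ℝ A A) (τ c : A) (x : Fin 2 → Fin 3 → A)
    (α : Fin 2 → A) : Prop where
  comm : ∀ φ, D 0 (D 1 φ) = D 1 (D 0 φ)
  torsion : cov (D 0) τ (x 0) (α 0) (x 1) = cov (D 1) τ (x 1) (α 1) (x 0)
  curv : D 0 (α 1) - D 1 (α 0) = -c * (x 0 ⨯₃ x 1) 2
  deriv_tau : ∀ i, D i τ = 0
  deriv_c : ∀ i, D i c = 0

variable {D : Fin 2 → Derivation ℝ A A} {τ c : A} {x : Fin 2 → Fin 3 → A} {α : Fin 2 → A}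

/-- Put ω = τx + αξ. The curvature acts by the cross product with dω + ω₀ × ω₁. The torsion equation
turns τ dx into -2τ² x₀ × x₁ plus mixed terms, which cancel against those of ω₀ × ω₁ and leave -τ²
x₀ × x₁. The equation for dα supplies the part along ξ. -/
theorem AmbientEquations.curvature (h : AmbientEquations D τ c x α) (v : Fin 3 → A) :
    cov (D 0) τ (x 0) (α 0) (cov (D 1) τ (x 1) (α 1) v)
      - cov (D 1) τ (x 1) (α 1) (cov (D 0) τ (x 0) (α 0) v)
    = (-τ ^ 2 • (x 0 ⨯₃ x 1) - (c * (x 0 ⨯₃ x 1) 2) • vert A) ⨯₃ v := by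
  have c0 := h.comm (v 0)
  have c1 := h.comm (v 1)
  have c2 := h.comm (v 2)
  have t0 := congrFun h.torsion 0
  have t1 := congrFun h.torsion 1
  have t2 := congrFun h.torsion 2
  have k := h.curv
  have d0 := h.deriv_tau 0
  have d1 := h.deriv_tau 1
  simp only [cov_zero, cov_one, cov_two, cross_two] at t0 t1 t2 k
  apply ext_three <;>
  simp only [cov_zero, cov_one, cov_two, cross_zero, cross_one, cross_two, Pi.sub_apply,
    Pi.smul_apply, smul_eq_mul, vert, cons_val] <;>
  simp only [map_add, map_sub, Derivation.leibniz, smul_eq_mul, d0, d1]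
  · linear_combination c0 + τ * v 2 * t1 - τ * v 1 * t2 - v 1 * k
  · linear_combination c1 + τ * v 0 * t2 - τ * v 2 * t0 + v 0 * k
  · linear_combination c2 + τ * v 1 * t0 - τ * v 0 * t1

/-- An orthonormal frame `e` of a surface with unit normal `y`, with coefficients `B` in the
coordinate frame `x`. -/
structure AdaptedFrame (x : Fin 2 → Fin 3 → A) (B : Fin 2 → Fin 2 → A) (e : Fin 2 → Fin 3 → A)
    (y : Fin 3 → A) : Prop where
  expand : ∀ a, e a = B a 0 • x 0 + B a 1 • x 1
  unit : ∀ a, e a ⬝ᵥ e a = 1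
  orth : e 0 ⬝ᵥ e 1 = 0
  cross : e 0 ⨯₃ e 1 = y
  det_unit : IsUnit (B 0 0 * B 1 1 - B 0 1 * B 1 0)

variable {B : Fin 2 → Fin 2 → A} {e : Fin 2 → Fin 3 → A} {y : Fin 3 → A}

theorem eq_zero_of_two_mul_eq_zero {a : A} (h : 2 * a = 0) : a = 0 := by
  have : algebraMap ℝ A (1 / 2) * 2 = 1 := by
    rw [← map_ofNat (algebraMap ℝ A) 2, ← map_mul]; norm_num
  linear_combination algebraMap ℝ A (1 / 2) * h - a * this

/-- The derivation along a frame vector. -/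
def frameD (D : Fin 2 → Derivation ℝ A A) (B : Fin 2 → Fin 2 → A) (a : Fin 2) :
    Derivation ℝ A A := B a 0 • D 0 + B a 1 • D 1

/-- The covariant derivative along a frame vector. -/
def frameCov (D : Fin 2 → Derivation ℝ A A) (τ : A) (x : Fin 2 → Fin 3 → A) (α : Fin 2 → A)
    (B : Fin 2 → Fin 2 → A) (a : Fin 2) (v : Fin 3 → A) : Fin 3 → A :=
  cov (frameD D B a) τ (B a 0 • x 0 + B a 1 • x 1) (B a 0 * α 0 + B a 1 * α 1) v

namespace AdaptedFrame

theorem cross_right (h : AdaptedFrame x B e y) : e 1 ⨯₃ y = e 0 := by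
  rw [← h.cross, cross_cross_eq_smul_sub_smul', h.unit, h.orth]; simp

theorem cross_left (h : AdaptedFrame x B e y) : e 0 ⨯₃ y = - e 1 := by
  rw [← h.cross, cross_cross_eq_smul_sub_smul', h.unit, h.orth]; simp

theorem dot_left (h : AdaptedFrame x B e y) : e 0 ⬝ᵥ y = 0 := by
  rw [← h.cross, dot_self_cross]

theorem dot_right (h : AdaptedFrame x B e y) : e 1 ⬝ᵥ y = 0 := by
  rw [← h.cross, dot_cross_self]

theorem normal_unit (h : AdaptedFrame x B e y) : y ⬝ᵥ y = 1 := by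
  rw [← h.cross, cross_dot_cross, h.unit, h.unit, h.orth]; ring

/-- The matrix with rows e₀, e₁, y has a right inverse, its transpose. Over a commutative ring this
is also a left inverse, which is the completeness relation used here. -/
theorem parseval (h : AdaptedFrame x B e y) (v w : Fin 3 → A) :
    v ⬝ᵥ w = (v ⬝ᵥ e 0) * (w ⬝ᵥ e 0) + (v ⬝ᵥ e 1) * (w ⬝ᵥ e 1) + (v ⬝ᵥ y) * (w ⬝ᵥ y) := by
  have key : Matrix.of ![e 0, e 1, y] * (Matrix.of ![e 0, e 1, y])ᵀ = 1 := by
    have h1 := h.unit 0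
    have h2 := h.unit 1
    have h3 := h.normal_unit
    have h4 := h.orth
    have h5 := h.dot_left
    have h6 := h.dot_right
    ext i j
    fin_cases i <;> fin_cases j <;>
    simp [Matrix.mul_apply, Fin.sum_univ_three, dotProduct] at h1 h2 h3 h4 h5 h6 ⊢ <;>
    first
      | assumption
      | linear_combination h4
      | linear_combination h5
      | linear_combination h6
  have key' := mul_eq_one_comm.mp key
  have e00 := congrFun₂ key' 0 0
  have e11 := congrFun₂ key' 1 1
  have e22 := congrFun₂ key' 2 2
  have e01 := congrFun₂ key' 0 1
  have e02 := congrFun₂ key' 0 2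
  have e12 := congrFun₂ key' 1 2
  simp [Matrix.mul_apply, Fin.sum_univ_three] at e00 e11 e22 e01 e02 e12
  simp only [dotProduct, Fin.sum_univ_three]
  linear_combination - v 0 * w 0 * e00 - v 1 * w 1 * e11 - v 2 * w 2 * e22
    - (v 0 * w 1 + v 1 * w 0) * e01 - (v 0 * w 2 + v 2 * w 0) * e02
    - (v 1 * w 2 + v 2 * w 1) * e12

theorem two_eq (h : AdaptedFrame x B e y) (v : Fin 3 → A) :
    v 2 = (v ⬝ᵥ e 0) * e 0 2 + (v ⬝ᵥ e 1) * e 1 2 + (v ⬝ᵥ y) * y 2 := by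
  have := h.parseval v (vert A)
  simpa [vert, dotProduct, Fin.sum_univ_three] using this

theorem vert_sq (h : AdaptedFrame x B e y) : e 0 2 ^ 2 + e 1 2 ^ 2 + y 2 ^ 2 = 1 := by
  have := h.parseval (vert A) (vert A)
  simp [vert, dotProduct, Fin.sum_univ_three] at this
  linear_combination - this

theorem normal_eq (h : AdaptedFrame x B e y) :
    y = (B 0 0 * B 1 1 - B 0 1 * B 1 0) • (x 0 ⨯₃ x 1) := by
  rw [← h.cross, h.expand, h.expand]
  ext i
  fin_cases i <;> simp [cross_zero, cross_one, cross_two] <;> ring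

end AdaptedFrame

/-- The connection form of a frame. -/
def frameConn (D : Fin 2 → Derivation ℝ A A) (τ : A) (x : Fin 2 → Fin 3 → A) (α : Fin 2 → A)
    (B : Fin 2 → Fin 2 → A) (e : Fin 2 → Fin 3 → A) (a : Fin 2) : A :=
  frameCov D τ x α B a (e 0) ⬝ᵥ e 1

/-- The second fundamental form in a frame. -/
def frameForm (D : Fin 2 → Derivation ℝ A A) (τ : A) (x : Fin 2 → Fin 3 → A) (α : Fin 2 → A)
    (B : Fin 2 → Fin 2 → A) (e : Fin 2 → Fin 3 → A) (y : Fin 3 → A) (a b : Fin 2) : A :=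
  frameCov D τ x α B a (e b) ⬝ᵥ y

theorem frameCov_dot (a : Fin 2) (v w : Fin 3 → A) :
    frameD D B a (v ⬝ᵥ w) = frameCov D τ x α B a v ⬝ᵥ w + v ⬝ᵥ frameCov D τ x α B a w :=
  cov_dot _ _ _ _ _ _

theorem frameD_apply (a : Fin 2) (φ : A) : frameD D B a φ = B a 0 * D 0 φ + B a 1 * D 1 φ := by
  simp [frameD]

theorem frameCov_eq (a : Fin 2) (v : Fin 3 → A) :
    frameCov D τ x α B a v = B a 0 • cov (D 0) τ (x 0) (α 0) v
      + B a 1 • cov (D 1) τ (x 1) (α 1) v :=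
  cov_linear _ _ _ _ _ _ _ _ _ _

/-- The components of the Lie bracket of the frame fields in the coordinate frame. -/
def frameBracket (D : Fin 2 → Derivation ℝ A A) (B : Fin 2 → Fin 2 → A) (i : Fin 2) : A :=
  frameD D B 0 (B 1 i) - frameD D B 1 (B 0 i)

theorem frameD_comm (hA : AmbientEquations D τ c x α) (φ : A) :
    frameD D B 0 (frameD D B 1 φ) - frameD D B 1 (frameD D B 0 φ)
      = frameBracket D B 0 * D 0 φ + frameBracket D B 1 * D 1 φ := by
  have := hA.comm φ
  simp only [frameBracket, frameD_apply, map_add, Derivation.leibniz, smul_eq_mul]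
  linear_combination (B 0 0 * B 1 1 - B 0 1 * B 1 0) * this

theorem frameCov_comm (hA : AmbientEquations D τ c x α) (hF : AdaptedFrame x B e y)
    (v : Fin 3 → A) :
    frameCov D τ x α B 0 (frameCov D τ x α B 1 v) - frameCov D τ x α B 1 (frameCov D τ x α B 0 v)
      = (-τ ^ 2 • y - (c * y 2) • vert A) ⨯₃ v
        + frameBracket D B 0 • cov (D 0) τ (x 0) (α 0) v
        + frameBracket D B 1 • cov (D 1) τ (x 1) (α 1) v := by
  have := hA.curvature v
  rw [hF.normal_eq]
  simp only [frameCov_eq, cov_add, cov_smul, frameBracket, frameD_apply] at this ⊢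
  have h₀ := congrFun this 0
  have h₁ := congrFun this 1
  have h₂ := congrFun this 2
  simp only [Pi.sub_apply, Pi.smul_apply, smul_eq_mul, cross_zero, cross_one, cross_two] at h₀ h₁ h₂
  apply ext_three <;>
  simp only [Pi.sub_apply, Pi.add_apply, Pi.smul_apply, smul_eq_mul, cross_zero, cross_one,
    cross_two]
  · linear_combination (B 0 0 * B 1 1 - B 0 1 * B 1 0) * h₀
  · linear_combination (B 0 0 * B 1 1 - B 0 1 * B 1 0) * h₁
  · linear_combination (B 0 0 * B 1 1 - B 0 1 * B 1 0) * h₂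

namespace AdaptedFrame

/-- Vanishing torsion: the second derivatives drop out, and only the derivatives of the coefficients
`B` survive. -/
theorem frameCov_frame_comm (hA : AmbientEquations D τ c x α) (hF : AdaptedFrame x B e y) :
    frameCov D τ x α B 0 (e 1) - frameCov D τ x α B 1 (e 0)
      = frameBracket D B 0 • x 0 + frameBracket D B 1 • x 1 := by
  have t := hA.torsion
  rw [hF.expand 0, hF.expand 1]
  simp only [frameCov_eq, cov_add, cov_smul, frameBracket, frameD_apply, t]
  apply ext_three <;>
  simp only [Pi.sub_apply, Pi.add_apply, Pi.smul_apply, smul_eq_mul] <;> ring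

theorem cov_zero_zero (hF : AdaptedFrame x B e y) (a : Fin 2) :
    frameCov D τ x α B a (e 0) ⬝ᵥ e 0 = 0 := by
  have := frameCov_dot (D := D) (τ := τ) (x := x) (α := α) (B := B) a (e 0) (e 0)
  rw [hF.unit, Derivation.map_one_eq_zero, dotProduct_comm (e 0)] at this
  exact eq_zero_of_two_mul_eq_zero (by linear_combination -this)

theorem cov_one_one (hF : AdaptedFrame x B e y) (a : Fin 2) :
    frameCov D τ x α B a (e 1) ⬝ᵥ e 1 = 0 := by
  have := frameCov_dot (D := D) (τ := τ) (x := x) (α := α) (B := B) a (e 1) (e 1)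
  rw [hF.unit, Derivation.map_one_eq_zero, dotProduct_comm (e 1)] at this
  exact eq_zero_of_two_mul_eq_zero (by linear_combination -this)

theorem cov_normal_normal (hF : AdaptedFrame x B e y) (a : Fin 2) :
    frameCov D τ x α B a y ⬝ᵥ y = 0 := by
  have := frameCov_dot (D := D) (τ := τ) (x := x) (α := α) (B := B) a y y
  rw [hF.normal_unit, Derivation.map_one_eq_zero, dotProduct_comm y] at this
  exact eq_zero_of_two_mul_eq_zero (by linear_combination -this)

theorem cov_one_zero (hF : AdaptedFrame x B e y) (a : Fin 2) :
    frameCov D τ x α B a (e 1) ⬝ᵥ e 0 = -frameConn D τ x α B e a := by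
  have := frameCov_dot (D := D) (τ := τ) (x := x) (α := α) (B := B) a (e 0) (e 1)
  rw [hF.orth, map_zero, dotProduct_comm (e 0)] at this
  rw [frameConn]
  linear_combination -this

theorem cov_normal_frame (hF : AdaptedFrame x B e y) (a b : Fin 2) :
    frameCov D τ x α B a y ⬝ᵥ e b = -frameForm D τ x α B e y a b := by
  have := frameCov_dot (D := D) (τ := τ) (x := x) (α := α) (B := B) a (e b) y
  have h0 : e b ⬝ᵥ y = 0 := by
    fin_cases b
    exacts [hF.dot_left, hF.dot_right]
  rw [h0, map_zero, dotProduct_comm (e b)] at this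
  rw [frameForm]
  linear_combination -this

theorem coord_dot_normal (hF : AdaptedFrame x B e y) (i : Fin 2) : x i ⬝ᵥ y = 0 := by
  rw [hF.normal_eq, dotProduct_smul]
  fin_cases i
  · simp [dot_self_cross]
  · simp [dot_cross_self]

/-- Crossing the relation with one coordinate vector and pairing with x₀ × x₁ isolates one
coefficient times |x₀ × x₁|². This square is invertible because a multiple of x₀ × x₁ is the unit
normal. -/
theorem eq_zero_of_combination (hF : AdaptedFrame x B e y) {q : Fin 2 → A}
    (h : q 0 • x 0 + q 1 • x 1 = 0) : q = 0 := by
  have hn := hF.normal_unit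
  rw [hF.normal_eq] at hn
  have h0 := congrArg (· ⨯₃ x 1 ⬝ᵥ x 0 ⨯₃ x 1) h
  have h1 := congrArg (x 0 ⨯₃ · ⬝ᵥ x 0 ⨯₃ x 1) h
  simp only [map_add, LinearMap.add_apply, map_smul, LinearMap.smul_apply, cross_self, smul_zero,
    add_zero, zero_add, smul_dotProduct, smul_eq_mul, map_zero, LinearMap.zero_apply,
    zero_dotProduct, dotProduct_smul] at h0 h1 hn
  have h0' : q 0 = 0 := by
    linear_combination (B 0 0 * B 1 1 - B 0 1 * B 1 0) ^ 2 * h0 - q 0 * hn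
  have h1' : q 1 = 0 := by
    linear_combination (B 0 0 * B 1 1 - B 0 1 * B 1 0) ^ 2 * h1 - q 1 * hn
  funext i
  fin_cases i <;> assumption

theorem ext_dot (hF : AdaptedFrame x B e y) {v w : Fin 3 → A} (h₀ : v ⬝ᵥ e 0 = w ⬝ᵥ e 0)
    (h₁ : v ⬝ᵥ e 1 = w ⬝ᵥ e 1) (h₂ : v ⬝ᵥ y = w ⬝ᵥ y) : v = w := by
  apply dotProduct_eq
  intro u
  rw [hF.parseval v u, hF.parseval w u, h₀, h₁, h₂]

/-- The bracket of two tangent fields is tangent, hence has no component along `y`. -/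
theorem frameForm_symm (hA : AmbientEquations D τ c x α) (hF : AdaptedFrame x B e y) :
    frameForm D τ x α B e y 0 1 = frameForm D τ x α B e y 1 0 := by
  have := congrArg (· ⬝ᵥ y) (hF.frameCov_frame_comm hA)
  simp only [sub_dotProduct, add_dotProduct, smul_dotProduct, hF.coord_dot_normal] at this
  rw [frameForm, frameForm]
  linear_combination this

/-- The bracket is D₀e₁ - D₁e₀, whose components along e₀ and e₁ are read off from the connection
form. The coefficients in the coordinate frame then agree because x₀ and x₁ are independent. -/
theorem bracket_eq (hA : AmbientEquations D τ c x α) (hF : AdaptedFrame x B e y) (i : Fin 2) :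
    frameBracket D B i
      = -frameConn D τ x α B e 0 * B 0 i - frameConn D τ x α B e 1 * B 1 i := by
  have h := hF.frameCov_frame_comm hA
  have key : frameBracket D B 0 • x 0 + frameBracket D B 1 • x 1
      = -frameConn D τ x α B e 0 • e 0 - frameConn D τ x α B e 1 • e 1 := by
    rw [← h]
    apply hF.ext_dot
    · simp only [sub_dotProduct, smul_dotProduct, hF.cov_one_zero, hF.cov_zero_zero, hF.unit,
        dotProduct_comm (e 1) (e 0), hF.orth, smul_eq_mul]
      ring
    · simp only [sub_dotProduct, smul_dotProduct, hF.cov_one_one, hF.unit, hF.orth, smul_eq_mul,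
        frameConn]
      ring
    · simp only [sub_dotProduct, smul_dotProduct, hF.dot_left, hF.dot_right, smul_eq_mul]
      have := hF.frameForm_symm hA
      rw [frameForm, frameForm] at this
      linear_combination this
  have := hF.eq_zero_of_combination (q := fun i => frameBracket D B i
      + frameConn D τ x α B e 0 * B 0 i + frameConn D τ x α B e 1 * B 1 i) (by
    rw [hF.expand 0, hF.expand 1] at key
    apply ext_three
    · have := congrFun key 0
      simp at this ⊢
      linear_combination this
    · have := congrFun key 1
      simp at this ⊢
      linear_combination this
    · have := congrFun key 2
      simp at this ⊢
      linear_combination this)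
  have := congrFun this i
  simp only [Pi.zero_apply] at this
  linear_combination this

theorem bracket_apply (hA : AmbientEquations D τ c x α) (hF : AdaptedFrame x B e y) (φ : A) :
    frameD D B 0 (frameD D B 1 φ) - frameD D B 1 (frameD D B 0 φ)
      = -frameConn D τ x α B e 0 * frameD D B 0 φ - frameConn D τ x α B e 1 * frameD D B 1 φ := by
  rw [frameD_comm hA, hF.bracket_eq hA, hF.bracket_eq hA, frameD_apply, frameD_apply]
  ring

theorem curvature (hA : AmbientEquations D τ c x α) (hF : AdaptedFrame x B e y)
    (v : Fin 3 → A) :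
    frameCov D τ x α B 0 (frameCov D τ x α B 1 v) - frameCov D τ x α B 1 (frameCov D τ x α B 0 v)
      = (-τ ^ 2 • y - (c * y 2) • vert A) ⨯₃ v
        - frameConn D τ x α B e 0 • frameCov D τ x α B 0 v
        - frameConn D τ x α B e 1 • frameCov D τ x α B 1 v := by
  rw [frameCov_comm hA hF, hF.bracket_eq hA, hF.bracket_eq hA, frameCov_eq, frameCov_eq]
  module

/-- The component of the curvature of e₀ along e₁. Products of first derivatives, expanded in the
frame, keep only their normal parts, which give the determinant of the second fundamental form. -/
theorem frame_gauss (hA : AmbientEquations D τ c x α) (hF : AdaptedFrame x B e y) :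
    frameD D B 0 (frameConn D τ x α B e 1) - frameD D B 1 (frameConn D τ x α B e 0)
      + frameConn D τ x α B e 0 ^ 2 + frameConn D τ x α B e 1 ^ 2
    = -(frameForm D τ x α B e y 0 0 * frameForm D τ x α B e y 1 1
        - frameForm D τ x α B e y 0 1 ^ 2 + τ ^ 2 + c * y 2 ^ 2) := by
  have h := congrArg (· ⬝ᵥ e 1) (hF.curvature hA (e 0))
  have d₀ := frameCov_dot (D := D) (τ := τ) (x := x) (α := α) (B := B) 0
    (frameCov D τ x α B 1 (e 0)) (e 1)
  have d₁ := frameCov_dot (D := D) (τ := τ) (x := x) (α := α) (B := B) 1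
    (frameCov D τ x α B 0 (e 0)) (e 1)
  rw [hF.parseval (frameCov D τ x α B 1 (e 0)) (frameCov D τ x α B 0 (e 1))] at d₀
  rw [hF.parseval (frameCov D τ x α B 0 (e 0)) (frameCov D τ x α B 1 (e 1))] at d₁
  -- Cyclic invariance of the triple product moves the cross product onto e₀ × e₁ = y.
  have hr : (-τ ^ 2 • y - (c * y 2) • vert A) ⨯₃ e 0 ⬝ᵥ e 1 = -τ ^ 2 - c * y 2 ^ 2 := by
    rw [dotProduct_comm, ← triple_product_permutation, ← triple_product_permutation, hF.cross,
      sub_dotProduct, smul_dotProduct, smul_dotProduct, hF.normal_unit]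
    simp [vert, dotProduct, Fin.sum_univ_three]
    ring
  simp only [sub_dotProduct, smul_dotProduct, hr, smul_eq_mul, hF.cov_zero_zero, hF.cov_one_one]
    at h d₀ d₁
  have hs := hF.frameForm_symm hA
  simp only [frameConn, frameForm] at *
  linear_combination h + d₀ - d₁ - (frameCov D τ x α B 0 (e 1) ⬝ᵥ y) * hs

/-- The Codazzi equations. -/
theorem frame_codazzi (hA : AmbientEquations D τ c x α) (hF : AdaptedFrame x B e y) (b : Fin 2) :
    frameD D B 0 (frameForm D τ x α B e y 1 b) - frameD D B 1 (frameForm D τ x α B e y 0 b)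
      + frameConn D τ x α B e 0 * frameForm D τ x α B e y 0 b
      + frameConn D τ x α B e 1 * frameForm D τ x α B e y 1 b
    = (-τ ^ 2 • y - (c * y 2) • vert A) ⨯₃ e b ⬝ᵥ y
      + (frameCov D τ x α B 1 (e b) ⬝ᵥ frameCov D τ x α B 0 y
        - frameCov D τ x α B 0 (e b) ⬝ᵥ frameCov D τ x α B 1 y) := by
  have h := congrArg (· ⬝ᵥ y) (hF.curvature hA (e b))
  have d₀ := frameCov_dot (D := D) (τ := τ) (x := x) (α := α) (B := B) 0
    (frameCov D τ x α B 1 (e b)) y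
  have d₁ := frameCov_dot (D := D) (τ := τ) (x := x) (α := α) (B := B) 1
    (frameCov D τ x α B 0 (e b)) y
  simp only [sub_dotProduct, smul_dotProduct, smul_eq_mul] at h
  simp only [frameForm]
  linear_combination h + d₀ - d₁

theorem frame_codazzi_zero (hA : AmbientEquations D τ c x α) (hF : AdaptedFrame x B e y) :
    frameD D B 0 (frameForm D τ x α B e y 1 0) - frameD D B 1 (frameForm D τ x α B e y 0 0)
      + frameConn D τ x α B e 0 * frameForm D τ x α B e y 0 0
      + frameConn D τ x α B e 1 * frameForm D τ x α B e y 1 0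
      + frameConn D τ x α B e 1 * frameForm D τ x α B e y 0 1
      - frameConn D τ x α B e 0 * frameForm D τ x α B e y 1 1
    = c * y 2 * e 1 2 := by
  have h := hF.frame_codazzi hA 0
  have hr : (-τ ^ 2 • y - (c * y 2) • vert A) ⨯₃ e 0 ⬝ᵥ y = c * y 2 * e 1 2 := by
    rw [dotProduct_comm, ← triple_product_permutation, ← triple_product_permutation,
      hF.cross_left, sub_dotProduct, smul_dotProduct, smul_dotProduct, dotProduct_neg,
      dotProduct_comm y, hF.dot_right]
    simp [vert, dotProduct, Fin.sum_univ_three]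
  rw [hr, hF.parseval (frameCov D τ x α B 1 (e 0)), hF.parseval (frameCov D τ x α B 0 (e 0))] at h
  simp only [hF.cov_normal_frame, hF.cov_zero_zero, hF.cov_normal_normal] at h
  simp only [frameConn] at *
  linear_combination h

theorem frame_codazzi_one (hA : AmbientEquations D τ c x α) (hF : AdaptedFrame x B e y) :
    frameD D B 0 (frameForm D τ x α B e y 1 1) - frameD D B 1 (frameForm D τ x α B e y 0 1)
      + frameConn D τ x α B e 0 * frameForm D τ x α B e y 0 1
      + frameConn D τ x α B e 1 * frameForm D τ x α B e y 1 1
      - frameConn D τ x α B e 1 * frameForm D τ x α B e y 0 0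
      + frameConn D τ x α B e 0 * frameForm D τ x α B e y 1 0
    = -(c * y 2 * e 0 2) := by
  have h := hF.frame_codazzi hA 1
  have hr : (-τ ^ 2 • y - (c * y 2) • vert A) ⨯₃ e 1 ⬝ᵥ y = -(c * y 2 * e 0 2) := by
    rw [dotProduct_comm, ← triple_product_permutation, ← triple_product_permutation,
      hF.cross_right, sub_dotProduct, smul_dotProduct, smul_dotProduct,
      dotProduct_comm y, hF.dot_left]
    simp [vert, dotProduct, Fin.sum_univ_three]
  rw [hr, hF.parseval (frameCov D τ x α B 1 (e 1)), hF.parseval (frameCov D τ x α B 0 (e 1))] at h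
  simp only [hF.cov_normal_frame, hF.cov_one_one, hF.cov_normal_normal, hF.cov_one_zero] at h
  linear_combination h

/-- Source of all derivatives of C and of the components of T: these are the last components of `y`,
e₀ and e₁. -/
theorem frameD_two (hF : AdaptedFrame x B e y) (a : Fin 2) (v : Fin 3 → A) :
    frameD D B a (v 2) = (frameCov D τ x α B a v ⬝ᵥ e 0) * e 0 2
      + (frameCov D τ x α B a v ⬝ᵥ e 1) * e 1 2 + (frameCov D τ x α B a v ⬝ᵥ y) * y 2
      - τ * (e a ⨯₃ v) 2 := by
  rw [← hF.two_eq, hF.expand a]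
  exact apply_two _ _ _ _ _

end AdaptedFrame

end ambient

/-! ### Simons' formula with the Codazzi lower bound -/

section ambient

variable {A : Type*} [CommRing A] [Algebra ℝ A]
variable {D : Fin 2 → Derivation ℝ A A} {τ c H : A} {x : Fin 2 → Fin 3 → A} {α : Fin 2 → A}
variable {B : Fin 2 → Fin 2 → A} {e : Fin 2 → Fin 3 → A} {y : Fin 3 → A}

namespace AdaptedFrame

theorem frameD_angle_zero (hF : AdaptedFrame x B e y) :
    frameD D B 0 (y 2) = -frameForm D τ x α B e y 0 0 * e 0 2
      - frameForm D τ x α B e y 0 1 * e 1 2 + τ * e 1 2 := by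
  rw [hF.frameD_two (τ := τ) (α := α) 0 y, hF.cov_normal_frame, hF.cov_normal_frame,
    hF.cov_normal_normal, hF.cross_left, Pi.neg_apply]
  ring

theorem frameD_angle_one (hF : AdaptedFrame x B e y) :
    frameD D B 1 (y 2) = -frameForm D τ x α B e y 1 0 * e 0 2
      - frameForm D τ x α B e y 1 1 * e 1 2 - τ * e 0 2 := by
  rw [hF.frameD_two (τ := τ) (α := α) 1 y, hF.cov_normal_frame, hF.cov_normal_frame,
    hF.cov_normal_normal, hF.cross_right]
  ring

theorem frameD_zero_zero (hF : AdaptedFrame x B e y) :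
    frameD D B 0 (e 0 2) = frameConn D τ x α B e 0 * e 1 2
      + frameForm D τ x α B e y 0 0 * y 2 := by
  rw [hF.frameD_two (τ := τ) (α := α) 0 (e 0), hF.cov_zero_zero, cross_self]
  simp [frameConn, frameForm]

theorem frameD_one_zero (hF : AdaptedFrame x B e y) :
    frameD D B 1 (e 0 2) = frameConn D τ x α B e 1 * e 1 2
      + frameForm D τ x α B e y 1 0 * y 2 + τ * y 2 := by
  rw [hF.frameD_two (τ := τ) (α := α) 1 (e 0), hF.cov_zero_zero, ← cross_anticomm, hF.cross]
  simp [frameConn, frameForm]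

theorem frameD_zero_one (hF : AdaptedFrame x B e y) :
    frameD D B 0 (e 1 2) = -frameConn D τ x α B e 0 * e 0 2
      + frameForm D τ x α B e y 0 1 * y 2 - τ * y 2 := by
  rw [hF.frameD_two (τ := τ) (α := α) 0 (e 1), hF.cov_one_zero, hF.cov_one_one, hF.cross]
  simp [frameForm]

theorem frameD_one_one (hF : AdaptedFrame x B e y) :
    frameD D B 1 (e 1 2) = -frameConn D τ x α B e 1 * e 0 2
      + frameForm D τ x α B e y 1 1 * y 2 := by
  rw [hF.frameD_two (τ := τ) (α := α) 1 (e 1), hF.cov_one_zero, hF.cov_one_one, cross_self]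
  simp [frameForm]

/-- Half of the squared norm of the traceless second fundamental form, in a frame. -/
def halfNormSq (D : Fin 2 → Derivation ℝ A A) (τ H : A) (x : Fin 2 → Fin 3 → A) (α : Fin 2 → A)
    (B : Fin 2 → Fin 2 → A) (e : Fin 2 → Fin 3 → A) (y : Fin 3 → A) : A :=
  (frameForm D τ x α B e y 0 0 - H) ^ 2 + frameForm D τ x α B e y 0 1 ^ 2

/-- The components in a frame of the vector field `∇|Φ|²/2 - 2cC(HT + τJT)`. -/
def simonsField (D : Fin 2 → Derivation ℝ A A) (τ c H : A) (x : Fin 2 → Fin 3 → A)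
    (α : Fin 2 → A) (B : Fin 2 → Fin 2 → A) (e : Fin 2 → Fin 3 → A) (y : Fin 3 → A) : Fin 2 → A :=
  ![frameD D B 0 (halfNormSq D τ H x α B e y) - 2 * c * y 2 * (H * e 0 2 - τ * e 1 2),
    frameD D B 1 (halfNormSq D τ H x α B e y) - 2 * c * y 2 * (H * e 1 2 + τ * e 0 2)]

/-- Simons' integrand as a function of `S = |Φ|²/2` and of the angle function. -/
def simonsPoly (τ c H S C : A) : A :=
  (2 * S) ^ 2 - (2 * (H ^ 2 + τ ^ 2) + c * (5 * C ^ 2 - 1)) * (2 * S)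
    + 2 * c * (H ^ 2 + τ ^ 2) * (3 * C ^ 2 - 1)

theorem frameD_const (h : ∀ i, D i H = 0) (a : Fin 2) : frameD D B a H = 0 := by
  rw [frameD_apply, h, h]; ring

/-- The components of ∇Φ come in two pairs whose sum or difference is fixed by Codazzi as cCt₁ and
cCt₂. From 2(u² + v²) = (u + v)² + (u - v)² the fixed combinations contribute c²C²|T|², and |T|² = 1
- C². The complementary combinations are q₁ and q₂; two of the four squares are not needed and are
taken to be zero. -/
theorem simons_formula (hA : AmbientEquations D τ c x α) (hF : AdaptedFrame x B e y)
    (hH : ∀ i, D i H = 0)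
    (tr : frameForm D τ x α B e y 0 0 + frameForm D τ x α B e y 1 1 = 2 * H) :
    ∃ q₁ q₂ q₃ q₄ : A,
      frameD D B 0 (simonsField D τ c H x α B e y 0)
        + frameD D B 1 (simonsField D τ c H x α B e y 1)
        + frameConn D τ x α B e 1 * simonsField D τ c H x α B e y 0
        - frameConn D τ x α B e 0 * simonsField D τ c H x α B e y 1
      = (c * y 2) ^ 2 * (1 - y 2 ^ 2) + (q₁ ^ 2 + q₂ ^ 2 + q₃ ^ 2 + q₄ ^ 2)
        - simonsPoly τ c H (halfNormSq D τ H x α B e y) (y 2) := by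
  set h := frameForm D τ x α B e y with hh
  set p := frameConn D τ x α B e with hp
  have sy : h 1 0 = h 0 1 := (hF.frameForm_symm hA).symm
  have h₁ : h 1 1 = H - (h 0 0 - H) := by linear_combination tr
  have h₀ : h 0 0 = H + (h 0 0 - H) := by ring
  have hH₀ := frameD_const (B := B) hH 0
  have hH₁ := frameD_const (B := B) hH 1
  have hτ₀ := frameD_const (B := B) hA.deriv_tau 0
  have hτ₁ := frameD_const (B := B) hA.deriv_tau 1
  have z₀ : frameD D B 0 (h 0 0 - H) = frameD D B 0 (h 0 0) := by rw [map_sub, hH₀, sub_zero]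
  have z₁ : frameD D B 1 (h 0 0 - H) = frameD D B 1 (h 0 0) := by rw [map_sub, hH₁, sub_zero]
  have y₀ : frameD D B 0 (h 1 1) = - frameD D B 0 (h 0 0) := by
    rw [h₁, map_sub, z₀, hH₀, zero_sub]
  have y₁ : frameD D B 1 (h 1 1) = - frameD D B 1 (h 0 0) := by
    rw [h₁, map_sub, z₁, hH₁, zero_sub]
  have cod₀ := hF.frame_codazzi_zero hA
  have cod₁ := hF.frame_codazzi_one hA
  rw [← hh, ← hp, sy] at cod₀ cod₁
  rw [y₀] at cod₁
  have key := simons_divergence (frameD D B 0) (frameD D B 1) (H := H) (τ := τ) (c := c)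
    (a := h 0 0 - H) (b := h 0 1) (C := y 2) (t₁ := e 0 2) (t₂ := e 1 2) (p₁ := p 0) (p₂ := p 1)
    hH₀ hH₁ hτ₀ hτ₁ (frameD_const hA.deriv_c 0) (frameD_const hA.deriv_c 1)
    (by rw [hF.frameD_angle_zero (τ := τ) (α := α), ← hh]; ring)
    (by rw [hF.frameD_angle_one (τ := τ) (α := α), ← hh, sy, h₁])
    (by rw [hF.frameD_zero_zero (τ := τ) (α := α), ← hh, ← hp]; ring)
    (by rw [hF.frameD_one_zero (τ := τ) (α := α), ← hh, sy])
    (by rw [hF.frameD_zero_one (τ := τ) (α := α)])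
    (by rw [hF.frameD_one_one (τ := τ) (α := α), ← hh, h₁])
    hF.vert_sq
    (hF.bracket_apply hA _) (hF.bracket_apply hA _)
    (by rw [hF.frame_gauss hA, ← hh, h₁]; ring)
    (by rw [z₀]; linear_combination -cod₁ + p 1 * h₁)
    (by rw [z₁]; linear_combination cod₀ + p 0 * h₁)
  have cod₀' : (frameD D B 0 (h 0 1) + 2 * p 0 * (h 0 0 - H))
      - (frameD D B 1 (h 0 0 - H) - 2 * p 1 * h 0 1) = c * y 2 * e 1 2 := by
    rw [z₁]; linear_combination cod₀ + p 0 * h₁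
  have cod₁' : (frameD D B 0 (h 0 0 - H) - 2 * p 0 * h 0 1)
      + (frameD D B 1 (h 0 1) + 2 * p 1 * (h 0 0 - H)) = c * y 2 * e 0 2 := by
    rw [z₀]; linear_combination -cod₁ + p 1 * h₁
  refine ⟨(frameD D B 0 (h 0 0 - H) - 2 * p 0 * h 0 1)
      - (frameD D B 1 (h 0 1) + 2 * p 1 * (h 0 0 - H)), (frameD D B 0 (h 0 1)
      + 2 * p 0 * (h 0 0 - H)) + (frameD D B 1 (h 0 0 - H) - 2 * p 1 * h 0 1), 0, 0, ?_⟩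
  simp only [simonsField, halfNormSq, simonsPoly, cons_val, ← hh]
  rw [key]
  have s₀ := congrArg (· ^ 2) cod₀'
  have s₁ := congrArg (· ^ 2) cod₁'
  beta_reduce at s₀ s₁
  linear_combination s₀ + s₁ + (c * y 2) ^ 2 * hF.vert_sq
/-- The divergence in a frame agrees with the coordinate divergence for a density `ρ`. -/
theorem divergence_eq (hA : AmbientEquations D τ c x α) (hF : AdaptedFrame x B e y) {ρ : A}
    (hρ : ρ ^ 2 * (B 0 0 * B 1 1 - B 0 1 * B 1 0) ^ 2 = 1) (W : Fin 2 → A) :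
    D 0 (ρ * (B 0 0 * W 0 + B 1 0 * W 1)) + D 1 (ρ * (B 0 1 * W 0 + B 1 1 * W 1))
      = ρ * (frameD D B 0 (W 0) + frameD D B 1 (W 1) + frameConn D τ x α B e 1 * W 0
        - frameConn D τ x α B e 0 * W 1) := by
  set δ := B 0 0 * B 1 1 - B 0 1 * B 1 0 with hδ
  -- `ρ` is the inverse of δ up to sign. Differentiating `hρ` gives its derivative without a choice
  -- of this sign.
  have hd : ∀ i, D i ρ = -ρ ^ 3 * δ * D i δ := by
    intro i
    have := congrArg (D i) hρ
    rw [Derivation.leibniz, derivation_pow_two, derivation_pow_two, Derivation.map_one_eq_zero,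
      smul_eq_mul, smul_eq_mul] at this
    have h' : 2 * (ρ * δ ^ 2 * D i ρ + ρ ^ 2 * δ * D i δ) = 0 := by linear_combination this
    have h'' := eq_zero_of_two_mul_eq_zero h'
    linear_combination ρ * h'' - D i ρ * hρ
  -- The derivatives of `B` in the coordinate divergence combine to the components of the bracket
  -- [e₀, e₁], that is, to the connection form.
  have b₀ := hF.bracket_eq hA 0
  have b₁ := hF.bracket_eq hA 1
  have e₀ := hd 0
  have e₁ := hd 1
  rw [hδ] at e₀ e₁
  simp only [map_sub, map_add, Derivation.leibniz, smul_eq_mul, frameBracket, frameD_apply]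
    at e₀ e₁ b₀ b₁ ⊢
  set p₀ := frameConn D τ x α B e 0
  set p₁ := frameConn D τ x α B e 1
  rw [e₀, e₁]
  rw [hδ] at hρ
  linear_combination ρ ^ 3 * δ * W 0 * (B 0 1 * b₀ - B 0 0 * b₁)
    - ρ * (D 0 (B 0 0) + D 1 (B 0 1) - p₁) * W 0 * hρ
    + ρ ^ 3 * δ * W 1 * (B 1 1 * b₀ - B 1 0 * b₁)
    - ρ * (D 0 (B 1 0) + D 1 (B 1 1) + p₀) * W 1 * hρ

end AdaptedFrame

end ambient

/-! ### The second fundamental form in coordinates; vertical surfaces -/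

section ambient

variable {A : Type*} [CommRing A] [Algebra ℝ A]
variable {D : Fin 2 → Derivation ℝ A A} {τ c H : A} {x : Fin 2 → Fin 3 → A} {α : Fin 2 → A}
variable {B : Fin 2 → Fin 2 → A} {e : Fin 2 → Fin 3 → A} {y : Fin 3 → A}

/-- The second fundamental form in coordinates. -/
def coordForm (D : Fin 2 → Derivation ℝ A A) (τ : A) (x : Fin 2 → Fin 3 → A) (α : Fin 2 → A)
    (y : Fin 3 → A) (i j : Fin 2) : A :=
  cov (D i) τ (x i) (α i) (x j) ⬝ᵥ y

/-- The covariant derivative of the second fundamental form in coordinates, for given Christoffel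
symbols. -/
def coordCovDeriv (D : Fin 2 → Derivation ℝ A A) (τ : A) (x : Fin 2 → Fin 3 → A) (α : Fin 2 → A)
    (y : Fin 3 → A) (Γ : Fin 2 → Fin 2 → Fin 2 → A) (k i j : Fin 2) : A :=
  D k (coordForm D τ x α y i j) - ∑ l, Γ l k i * coordForm D τ x α y l j
    - ∑ l, Γ l k j * coordForm D τ x α y i l

/-- `Γ` are the Christoffel symbols of the induced metric (Gauss formula). -/
def GaussFormula (D : Fin 2 → Derivation ℝ A A) (τ : A) (x : Fin 2 → Fin 3 → A) (α : Fin 2 → A)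
    (y : Fin 3 → A) (Γ : Fin 2 → Fin 2 → Fin 2 → A) : Prop :=
  ∀ k i, cov (D k) τ (x k) (α k) (x i)
    = Γ 0 k i • x 0 + Γ 1 k i • x 1 + coordForm D τ x α y k i • y

theorem cov_dot_eq (hxy : ∀ i, x i ⬝ᵥ y = 0) (i j : Fin 2) :
    x j ⬝ᵥ cov (D i) τ (x i) (α i) y = - coordForm D τ x α y i j := by
  have := cov_dot (D i) τ (x i) (α i) (x j) y
  rw [hxy, map_zero] at this
  rw [coordForm]
  linear_combination -this

theorem cov_unit_dot (hy : y ⬝ᵥ y = 1) (i : Fin 2) : y ⬝ᵥ cov (D i) τ (x i) (α i) y = 0 := by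
  have := cov_dot (D i) τ (x i) (α i) y y
  rw [hy, Derivation.map_one_eq_zero, dotProduct_comm _ y] at this
  exact eq_zero_of_two_mul_eq_zero (by linear_combination -this)

theorem cov_coord_symm (hA : AmbientEquations D τ c x α) (i j : Fin 2) :
    cov (D i) τ (x i) (α i) (x j) = cov (D j) τ (x j) (α j) (x i) := by
  fin_cases i <;> fin_cases j
  · rfl
  · exact hA.torsion
  · exact hA.torsion.symm
  · rfl

/-- The Koszul formula for the induced metric. -/
theorem koszul (hA : AmbientEquations D τ c x α) (k i m : Fin 2) :
    D k (x i ⬝ᵥ x m) + D i (x k ⬝ᵥ x m) - D m (x k ⬝ᵥ x i)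
      = 2 * (cov (D k) τ (x k) (α k) (x i) ⬝ᵥ x m) := by
  rw [cov_dot (D k) τ (x k) (α k), cov_dot (D i) τ (x i) (α i), cov_dot (D m) τ (x m) (α m),
    cov_coord_symm hA i k, cov_coord_symm hA i m, cov_coord_symm hA m k,
    dotProduct_comm (cov (D k) τ (x k) (α k) (x m)) (x i)]
  ring

/-- Codazzi in coordinates. The symmetry of the Christoffel symbols removes the terms with Γ in the
first two slots, and the remaining ones match the tangential parts of the second covariant
derivatives. If ∇h = 0, the curvature term on the right must vanish. -/
theorem coord_codazzi (hA : AmbientEquations D τ c x α) (hxy : ∀ i, x i ⬝ᵥ y = 0)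
    (hy : y ⬝ᵥ y = 1) {Γ : Fin 2 → Fin 2 → Fin 2 → A} (hΓ : GaussFormula D τ x α y Γ)
    (hs : ∀ l, Γ l 0 1 = Γ l 1 0) (j : Fin 2) :
    coordCovDeriv D τ x α y Γ 0 1 j - coordCovDeriv D τ x α y Γ 1 0 j
      = (-τ ^ 2 • (x 0 ⨯₃ x 1) - (c * (x 0 ⨯₃ x 1) 2) • vert A) ⨯₃ x j ⬝ᵥ y := by
  have h := congrArg (· ⬝ᵥ y) (hA.curvature (x j))
  have d₀ := cov_dot (D 0) τ (x 0) (α 0) (cov (D 1) τ (x 1) (α 1) (x j)) y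
  have d₁ := cov_dot (D 1) τ (x 1) (α 1) (cov (D 0) τ (x 0) (α 0) (x j)) y
  have e₀ : cov (D 1) τ (x 1) (α 1) (x j) ⬝ᵥ cov (D 0) τ (x 0) (α 0) y
      = -(Γ 0 1 j * coordForm D τ x α y 0 0 + Γ 1 1 j * coordForm D τ x α y 0 1) := by
    rw [hΓ, add_dotProduct, add_dotProduct, smul_dotProduct, smul_dotProduct, smul_dotProduct,
      cov_dot_eq hxy, cov_dot_eq hxy, cov_unit_dot hy]
    simp only [smul_eq_mul]; ring
  have e₁ : cov (D 0) τ (x 0) (α 0) (x j) ⬝ᵥ cov (D 1) τ (x 1) (α 1) y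
      = -(Γ 0 0 j * coordForm D τ x α y 1 0 + Γ 1 0 j * coordForm D τ x α y 1 1) := by
    rw [hΓ, add_dotProduct, add_dotProduct, smul_dotProduct, smul_dotProduct, smul_dotProduct,
      cov_dot_eq hxy, cov_dot_eq hxy, cov_unit_dot hy]
    simp only [smul_eq_mul]; ring
  rw [e₀] at d₀
  rw [e₁] at d₁
  simp only [sub_dotProduct] at h
  rw [← coordForm] at d₀ d₁
  rw [← h]
  simp only [coordCovDeriv, Fin.sum_univ_two, hs]
  linear_combination d₀ - d₁

namespace AdaptedFrame

/-- The product in the other order expresses that the frame is orthonormal, and a one-sided inverse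
of a square matrix is two-sided. -/
theorem dual_mul (hF : AdaptedFrame x B e y) :
    (Matrix.of fun i a => x i ⬝ᵥ e a) * Matrix.of B = 1 := by
  rw [mul_eq_one_comm]
  have key : ∀ a b, e a ⬝ᵥ e b = B a 0 * (x 0 ⬝ᵥ e b) + B a 1 * (x 1 ⬝ᵥ e b) := by
    intro a b
    conv_lhs => rw [hF.expand a]
    simp
  ext a b
  rw [Matrix.mul_apply, Fin.sum_univ_two]
  simp only [Matrix.of_apply]
  rw [← key]
  fin_cases a <;> fin_cases b <;> simp [hF.unit, hF.orth, dotProduct_comm (e 1) (e 0)]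

theorem dual_mul_apply (hF : AdaptedFrame x B e y) (i j : Fin 2) :
    (x i ⬝ᵥ e 0) * B 0 j + (x i ⬝ᵥ e 1) * B 1 j = if i = j then 1 else 0 := by
  have := congrFun₂ hF.dual_mul i j
  rwa [Matrix.mul_apply, Fin.sum_univ_two, Matrix.one_apply] at this

theorem cov_eq_frameCov (hF : AdaptedFrame x B e y) (i : Fin 2) (v : Fin 3 → A) :
    cov (D i) τ (x i) (α i) v = (x i ⬝ᵥ e 0) • frameCov D τ x α B 0 v
      + (x i ⬝ᵥ e 1) • frameCov D τ x α B 1 v := by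
  have k₀ := hF.dual_mul_apply i 0
  have k₁ := hF.dual_mul_apply i 1
  rw [frameCov_eq, frameCov_eq]
  have : (x i ⬝ᵥ e 0) • (B 0 0 • cov (D 0) τ (x 0) (α 0) v + B 0 1 • cov (D 1) τ (x 1) (α 1) v)
      + (x i ⬝ᵥ e 1) • (B 1 0 • cov (D 0) τ (x 0) (α 0) v + B 1 1 • cov (D 1) τ (x 1) (α 1) v)
    = ((x i ⬝ᵥ e 0) * B 0 0 + (x i ⬝ᵥ e 1) * B 1 0) • cov (D 0) τ (x 0) (α 0) v
      + ((x i ⬝ᵥ e 0) * B 0 1 + (x i ⬝ᵥ e 1) * B 1 1) • cov (D 1) τ (x 1) (α 1) v := by module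
  rw [this, k₀, k₁]
  fin_cases i <;> simp

theorem coordForm_eq (hF : AdaptedFrame x B e y) (i j : Fin 2) :
    coordForm D τ x α y i j
      = ∑ a, ∑ b, (x i ⬝ᵥ e a) * (x j ⬝ᵥ e b) * frameForm D τ x α B e y a b := by
  have h := cov_dot_eq (D := D) (τ := τ) (α := α) hF.coord_dot_normal i j
  have hp := hF.parseval (x j) (cov (D i) τ (x i) (α i) y)
  rw [hF.coord_dot_normal, h, hF.cov_eq_frameCov] at hp
  simp only [add_dotProduct, smul_dotProduct, hF.cov_normal_frame, smul_eq_mul] at hp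
  simp only [Fin.sum_univ_two]
  linear_combination -hp

theorem metric_eq (hF : AdaptedFrame x B e y) (i j : Fin 2) :
    x i ⬝ᵥ x j = ∑ a, (x i ⬝ᵥ e a) * (x j ⬝ᵥ e a) := by
  rw [hF.parseval, hF.coord_dot_normal, Fin.sum_univ_two]
  ring

section vertical

variable (hF : AdaptedFrame x B e y) (hC : y 2 = 0)
  (tr : frameForm D τ x α B e y 0 0 + frameForm D τ x α B e y 1 1 = 2 * H)

include hF hC tr

/-- If C vanishes identically, the formulas for its derivatives say AT = -τJT. Since |T| = 1, this
and the trace leave no freedom for A. -/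
theorem frameForm_of_vertical (hA : AmbientEquations D τ c x α) :
    frameForm D τ x α B e y 0 0 = 2 * τ * (e 0 2 * e 1 2) + 2 * H * e 1 2 ^ 2 ∧
    frameForm D τ x α B e y 0 1 = -τ * (e 0 2 ^ 2 - e 1 2 ^ 2) - 2 * H * (e 0 2 * e 1 2) ∧
    frameForm D τ x α B e y 1 1 = -2 * τ * (e 0 2 * e 1 2) + 2 * H * e 0 2 ^ 2 := by
  have r₀ := hF.frameD_angle_zero (D := D) (τ := τ) (α := α)
  have r₁ := hF.frameD_angle_one (D := D) (τ := τ) (α := α)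
  have hs := hF.frameForm_symm hA
  have n := hF.vert_sq
  rw [hC, map_zero] at r₀ r₁
  rw [hC] at n
  rw [← hs] at r₁
  refine ⟨?_, ?_, ?_⟩
  · linear_combination e 0 2 * r₀ - e 1 2 * r₁ - frameForm D τ x α B e y 0 0 * n
      + e 1 2 ^ 2 * tr
  · linear_combination e 1 2 * r₀ + e 0 2 * r₁ - frameForm D τ x α B e y 0 1 * n
      - e 0 2 * e 1 2 * tr
  · linear_combination -e 0 2 * r₀ + e 1 2 * r₁ - frameForm D τ x α B e y 1 1 * n
      + e 0 2 ^ 2 * tr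

theorem halfNormSq_of_vertical (hA : AmbientEquations D τ c x α) :
    halfNormSq D τ H x α B e y = H ^ 2 + τ ^ 2 := by
  obtain ⟨h₀, h₁, -⟩ := hF.frameForm_of_vertical hC tr hA
  have n := hF.vert_sq
  rw [hC] at n
  rw [halfNormSq, h₀, h₁]
  linear_combination ((H ^ 2 + τ ^ 2) * (e 0 2 ^ 2 + e 1 2 ^ 2 + 1)
    + 4 * H * τ * e 0 2 * e 1 2 + 2 * H ^ 2 * (e 1 2 ^ 2 - e 0 2 ^ 2)
    + H ^ 2 * (e 0 2 ^ 2 + e 1 2 ^ 2 - 1)) * n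

/-- Let η be the covector dual to y × ξ, whose value on ∂ᵢF is `x i 0 * y 1 - x i 1 * y 0`. Then h =
-τ(ξ ⊗ η + η ⊗ ξ) + 2H η ⊗ η with ξ read as a covector. In this form h has constant coefficients. -/
theorem coordForm_of_vertical (hA : AmbientEquations D τ c x α) (i j : Fin 2) :
    coordForm D τ x α y i j
      = -τ * (x i 2 * (x j 0 * y 1 - x j 1 * y 0) + (x i 0 * y 1 - x i 1 * y 0) * x j 2)
        + 2 * H * ((x i 0 * y 1 - x i 1 * y 0) * (x j 0 * y 1 - x j 1 * y 0)) := by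
  obtain ⟨h₀, h₁, h₂⟩ := hF.frameForm_of_vertical hC tr hA
  have hs := hF.frameForm_symm hA
  have hx : ∀ k, x k 2 = (x k ⬝ᵥ e 0) * e 0 2 + (x k ⬝ᵥ e 1) * e 1 2 := by
    intro k
    rw [hF.two_eq (x k), hC]
    ring
  have hn : ∀ k, x k 0 * y 1 - x k 1 * y 0 = -(x k ⬝ᵥ e 0) * e 1 2 + (x k ⬝ᵥ e 1) * e 0 2 := by
    intro k
    have e₀ := congrFun hF.cross_left 2
    have e₁ := congrFun hF.cross_right 2
    rw [Pi.neg_apply] at e₀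
    have h : x k = (x k ⬝ᵥ e 0) • e 0 + (x k ⬝ᵥ e 1) • e 1 := by
      apply hF.ext_dot <;>
      simp only [add_dotProduct, smul_dotProduct, hF.unit, hF.orth, dotProduct_comm (e 1) (e 0),
        hF.dot_left, hF.dot_right, hF.coord_dot_normal, smul_eq_mul] <;> ring
    have h₀ := congrFun h 0
    have h₁ := congrFun h 1
    simp only [Pi.add_apply, Pi.smul_apply, smul_eq_mul] at h₀ h₁
    rw [cross_two] at e₀ e₁
    linear_combination y 1 * h₀ - y 0 * h₁ + (x k ⬝ᵥ e 0) * e₀ + (x k ⬝ᵥ e 1) * e₁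
  rw [hF.coordForm_eq, hx, hx, hn, hn]
  simp only [Fin.sum_univ_two]
  rw [← hs, h₀, h₁, h₂]
  ring

/-- Both covectors in `coordForm_of_vertical` are parallel on a vertical surface, and the
coefficients τ and H are constant. -/
theorem coordCovDeriv_of_vertical (hA : AmbientEquations D τ c x α) (hH : ∀ i, D i H = 0)
    {Γ : Fin 2 → Fin 2 → Fin 2 → A} (hΓ : GaussFormula D τ x α y Γ) (k i j : Fin 2) :
    coordCovDeriv D τ x α y Γ k i j = 0 := by
  have hn : (x 0 ⨯₃ x 1) 2 = 0 := by
    have h := congrFun hF.normal_eq 2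
    rw [hC, Pi.smul_apply, smul_eq_mul] at h
    exact (hF.det_unit.mul_right_eq_zero).mp h.symm
  have hn' : ∀ k i, (x k ⨯₃ x i) 2 = 0 := by
    intro k i
    fin_cases k <;> fin_cases i
    · simp [cross_self]
    · exact hn
    · rw [← cross_anticomm]; simpa using hn
    · simp [cross_self]
  have hy := hF.normal_unit
  -- Here ξ is tangent, so D_X ξ = τ X × ξ is normal for tangent X. Hence the covector dual to ξ is
  -- parallel.
  have hξ : ∀ k i, D k (x i 2) = Γ 0 k i * x 0 2 + Γ 1 k i * x 1 2 := by
    intro k i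
    rw [apply_two (D k) τ (x k) (α k), hn', hΓ k i]
    simp [hC]
  -- The covector η is parallel as well, being a parallel unit covector turned by a right angle.
  have hw : ∀ k i, D k (x i 0 * y 1 - x i 1 * y 0)
      = Γ 0 k i * (x 0 0 * y 1 - x 0 1 * y 0) + Γ 1 k i * (x 1 0 * y 1 - x 1 1 * y 0) := by
    intro k i
    have c₀ := congrFun (hΓ k i) 0
    have c₁ := congrFun (hΓ k i) 1
    simp only [cov_zero, cov_one, Pi.add_apply, Pi.smul_apply, smul_eq_mul] at c₀ c₁
    have a₁ := hF.coord_dot_normal i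
    have a₂ := hF.coord_dot_normal k
    have a₃ := congrArg (D k) hF.normal_unit
    have a₄ := hn' k i
    simp only [dotProduct, Fin.sum_univ_three, hC, cross_two, mul_zero, add_zero, map_add,
      Derivation.leibniz, smul_eq_mul, Derivation.map_one_eq_zero] at hy a₁ a₂ a₃ a₄
    have a₅ : y 0 * D k (y 0) + y 1 * D k (y 1) = 0 :=
      eq_zero_of_two_mul_eq_zero (by linear_combination a₃)
    simp only [map_sub, Derivation.leibniz, smul_eq_mul]
    linear_combination y 1 * c₀ - y 0 * c₁ + α k * a₁ - τ * (x i 2 * a₂ - x k 2 * a₁)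
      + (x i 0 * y 1 - x i 1 * y 0) * a₅ + (y 0 * D k (y 1) - y 1 * D k (y 0)) * a₁
      - (x i 0 * D k (y 1) - x i 1 * D k (y 0)) * hy
  have h : ∀ i j, coordForm D τ x α y i j = _ := hF.coordForm_of_vertical hC tr hA
  simp only [coordCovDeriv, Fin.sum_univ_two, h, map_add, map_sub, map_neg, Derivation.leibniz,
    smul_eq_mul, hξ]
  have w₁ := hw k i
  have w₂ := hw k j
  have τ0 := hA.deriv_tau k
  have H0 := hH k
  have two : D k 2 = 0 := by simpa using (D k).map_natCast 2
  simp only [map_sub, Derivation.leibniz, smul_eq_mul] at w₁ w₂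
  rw [τ0, H0, two]
  linear_combination (-τ * x j 2 + 2 * H * (x j 0 * y 1 - x j 1 * y 0)) * w₁
    + (-τ * x i 2 + 2 * H * (x i 0 * y 1 - x i 1 * y 0)) * w₂

end vertical

/-- Non-integrability of the horizontal planes: the derivatives of the vertical components of e₁
along e₀ and of e₀ along e₁ give h₀₁C = τC and h₁₀C = -τC, which contradict the symmetry of h unless
τC = 0. -/
theorem tau_mul_angle_of_horizontal (hA : AmbientEquations D τ c x α)
    (hF : AdaptedFrame x B e y) (h : ∀ a, e a 2 = 0) : τ * y 2 = 0 := by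
  have r₀ := hF.frameD_zero_one (D := D) (τ := τ) (α := α)
  have r₁ := hF.frameD_one_zero (D := D) (τ := τ) (α := α)
  have hs := hF.frameForm_symm hA
  rw [h, h, map_zero] at r₀ r₁
  exact eq_zero_of_two_mul_eq_zero (by linear_combination r₀ - r₁ + y 2 * hs)

end AdaptedFrame

end ambient

open TopologicalSpace

/-! ### The algebra of smooth functions on an open subset of the plane -/

section smoothFun

/-- The algebra of smooth functions on an open subset of the plane. -/
def SmoothFun (U : Opens (Coord 2)) : Subalgebra ℝ (U → ℝ) where
  carrier := {φ | ∃ Φ : Coord 2 → ℝ, ContDiffOn ℝ ∞ Φ U ∧ ∀ u : U, φ u = Φ u}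
  mul_mem' := by
    rintro a b ⟨Φ, hΦ, ha⟩ ⟨Ψ, hΨ, hb⟩
    exact ⟨_, hΦ.mul hΨ, fun u => by simp [ha, hb]⟩
  add_mem' := by
    rintro a b ⟨Φ, hΦ, ha⟩ ⟨Ψ, hΨ, hb⟩
    exact ⟨_, hΦ.add hΨ, fun u => by simp [ha, hb]⟩
  algebraMap_mem' r := ⟨fun _ => r, contDiffOn_const, fun _ => rfl⟩

variable {U : Opens (Coord 2)}

namespace SmoothFun

/-- The element of `SmoothFun U` given by a function that is smooth on `U`. -/
def mk (Φ : Coord 2 → ℝ) (h : ContDiffOn ℝ ∞ Φ U) : SmoothFun U :=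
  ⟨fun u => Φ u, Φ, h, fun _ => rfl⟩

/-- The extension by zero. -/
def ext (a : SmoothFun U) : Coord 2 → ℝ := Function.extend Subtype.val a.1 0

theorem ext_apply (a : SmoothFun U) (u : U) : ext a u = a.1 u :=
  Subtype.val_injective.extend_apply _ _ _

theorem ext_mk {Φ : Coord 2 → ℝ} (h : ContDiffOn ℝ ∞ Φ U) : EqOn (ext (mk Φ h)) Φ U :=
  fun u hu => ext_apply (mk Φ h) ⟨u, hu⟩

theorem ext_eq {a b : SmoothFun U} (h : EqOn (ext a) (ext b) U) : a = b := by
  apply Subtype.ext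
  funext u
  rw [← ext_apply, ← ext_apply]
  exact h u.2

theorem contDiffOn_ext (a : SmoothFun U) : ContDiffOn ℝ ∞ (ext a) U := by
  obtain ⟨Φ, hΦ, h⟩ := a.2
  exact hΦ.congr fun u hu => (ext_apply a ⟨u, hu⟩).trans (h ⟨u, hu⟩)

theorem ext_add (a b : SmoothFun U) : EqOn (ext (a + b)) (ext a + ext b) U :=
  fun u hu => by
    rw [Pi.add_apply, ext_apply _ ⟨u, hu⟩, ext_apply a ⟨u, hu⟩, ext_apply b ⟨u, hu⟩]; rfl

theorem ext_mul (a b : SmoothFun U) : EqOn (ext (a * b)) (ext a * ext b) U :=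
  fun u hu => by
    rw [Pi.mul_apply, ext_apply _ ⟨u, hu⟩, ext_apply a ⟨u, hu⟩, ext_apply b ⟨u, hu⟩]; rfl

theorem ext_smul (r : ℝ) (a : SmoothFun U) : EqOn (ext (r • a)) (r • ext a) U :=
  fun u hu => by
    rw [Pi.smul_apply, ext_apply _ ⟨u, hu⟩, ext_apply a ⟨u, hu⟩]; rfl

theorem differentiableAt_ext (a : SmoothFun U) {u : Coord 2} (hu : u ∈ U) :
    DifferentiableAt ℝ (ext a) u :=
  ((contDiffOn_ext a).contDiffAt (U.isOpen.mem_nhds hu)).differentiableAt (by simp)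

end SmoothFun

theorem pd_congr {V : Type*} [NormedAddCommGroup V] [NormedSpace ℝ V] {F G : Coord 2 → V}
    (h : EqOn F G U) (i : Fin 2) : EqOn (pd i F) (pd i G) U := fun u hu => by
  rw [pd, pd, (h.eventuallyEq_of_mem (U.isOpen.mem_nhds hu)).fderiv_eq]

theorem contDiffOn_pd {V : Type*} [NormedAddCommGroup V] [NormedSpace ℝ V] {F : Coord 2 → V}
    (h : ContDiffOn ℝ ∞ F U) (i : Fin 2) : ContDiffOn ℝ ∞ (pd i F) U :=
  (h.fderiv_of_isOpen U.isOpen (by simp)).clm_apply contDiffOn_const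

open SmoothFun in
/-- The partial derivatives as derivations of the algebra of smooth functions. -/
def partialD (U : Opens (Coord 2)) (i : Fin 2) : Derivation ℝ (SmoothFun U) (SmoothFun U) where
  toFun a := mk (pd i (ext a)) (contDiffOn_pd (contDiffOn_ext a) i)
  map_add' a b := by
    apply Subtype.ext
    funext u
    change pd i (ext (a + b)) u = pd i (ext a) u + pd i (ext b) u
    rw [pd_congr (ext_add a b) i u.2]
    simp only [pd]
    rw [fderiv_add (differentiableAt_ext a u.2) (differentiableAt_ext b u.2)]
    rfl
  map_smul' r a := by
    apply Subtype.ext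
    funext u
    change pd i (ext (r • a)) u = r * pd i (ext a) u
    rw [pd_congr (ext_smul r a) i u.2]
    simp only [pd]
    rw [fderiv_const_smul (differentiableAt_ext a u.2)]
    rfl
  map_one_eq_zero' := by
    apply Subtype.ext
    funext u
    change pd i (ext 1) u = 0
    rw [pd_congr (G := fun _ => 1) (fun v hv => ext_apply (1 : SmoothFun U) ⟨v, hv⟩) i u.2]
    simp [pd]
  leibniz' a b := by
    apply Subtype.ext
    funext u
    change pd i (ext (a * b)) u = a.1 u * pd i (ext b) u + b.1 u * pd i (ext a) u
    rw [pd_congr (ext_mul a b) i u.2]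
    simp only [pd]
    rw [fderiv_mul (differentiableAt_ext a u.2) (differentiableAt_ext b u.2)]
    simp [ext_apply]

namespace SmoothFun

theorem partialD_mk (i : Fin 2) {Φ : Coord 2 → ℝ} (h : ContDiffOn ℝ ∞ Φ U) :
    partialD U i (mk Φ h) = mk (pd i Φ) (contDiffOn_pd h i) := by
  apply Subtype.ext
  funext u
  exact pd_congr (ext_mk h) i u.2

theorem mk_ext (a : SmoothFun U) : mk (ext a) (contDiffOn_ext a) = a :=
  ext_eq (ext_mk _)

theorem mk_congr {Φ Ψ : Coord 2 → ℝ} (h : ContDiffOn ℝ ∞ Φ U) (h' : ContDiffOn ℝ ∞ Ψ U)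
    (e : EqOn Φ Ψ U) : mk Φ h = mk Ψ h' :=
  Subtype.ext (funext fun u => e u.2)

end SmoothFun

theorem pd_comm {V : Type*} [NormedAddCommGroup V] [NormedSpace ℝ V] {F : Coord 2 → V}
    {u : Coord 2} (h : ContDiffAt ℝ ∞ F u) (i j : Fin 2) :
    pd i (pd j F) u = pd j (pd i F) u := by
  have hd : DifferentiableAt ℝ (fderiv ℝ F) u :=
    (h.fderiv_right (m := ∞) (by simp)).differentiableAt (by simp)
  have key : ∀ i j, pd i (pd j F) u
      = fderiv ℝ (fderiv ℝ F) u (EuclideanSpace.single i 1) (EuclideanSpace.single j 1) := by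
    intro i j
    simp only [pd]
    have : pd j F = fun v => fderiv ℝ F v (EuclideanSpace.single j 1) := rfl
    rw [this, fderiv_clm_apply hd (differentiableAt_const _)]
    simp
  rw [key, key]
  exact (h.isSymmSndFDerivAt (by
    rw [minSmoothness_of_isRCLikeNormedField]
    exact WithTop.coe_le_coe.2 (le_top : (2 : ℕ∞) ≤ ⊤))) _ _

theorem partialD_comm (a : SmoothFun U) :
    partialD U 0 (partialD U 1 a) = partialD U 1 (partialD U 0 a) := by
  rw [← SmoothFun.mk_ext a, SmoothFun.partialD_mk, SmoothFun.partialD_mk, SmoothFun.partialD_mk,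
    SmoothFun.partialD_mk]
  exact SmoothFun.mk_congr _ _ fun u hu =>
    pd_comm ((SmoothFun.contDiffOn_ext a).contDiffAt (U.isOpen.mem_nhds hu)) 0 1

theorem partialD_algebraMap (i : Fin 2) (r : ℝ) :
    partialD U i (algebraMap ℝ (SmoothFun U) r) = 0 :=
  Derivation.map_algebraMap _ r

end smoothFun

/-! ### The two models and their structure equations -/

/-- An orthonormal coframe `θ` on a fibered model, with dual frame `frame` and `θ 2` dual to `ξ`,
for which the Levi-Civita connection is `D_X Y = dY(X) + (τ X + α(X) ξ) × Y`, together with the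
structure equations of `E(κ,τ)`. -/
structure Coframe (E : FiberedModel) (κ τ : ℝ) where
  dom : Set (Coord E.dim)
  isOpen_dom : IsOpen dom
  carrier_subset : E.carrier ⊆ dom
  θ : Fin 3 → Coord E.dim → Coord E.dim →L[ℝ] ℝ
  α : Coord E.dim → Coord E.dim →L[ℝ] ℝ
  frame : Fin 3 → Coord E.dim → Coord E.dim
  contDiffOn_θ : ∀ j, ContDiffOn ℝ ∞ (θ j) dom
  contDiffOn_α : ContDiffOn ℝ ∞ α dom
  contDiffOn_frame : ∀ j, ContDiffOn ℝ ∞ (frame j) dom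
  frame_mem : ∀ p ∈ E.carrier, ∀ j, frame j p ∈ E.tangent p
  θ_frame : ∀ p ∈ E.carrier, ∀ i j, θ i p (frame j p) = if i = j then 1 else 0
  expand : ∀ p ∈ E.carrier, ∀ X ∈ E.tangent p, X = ∑ j, θ j p X • frame j p
  -- Only `Y` is assumed tangent. The identity is needed for X = ∂ᵢ∂ⱼF, which is in general not
  -- tangent to the sphere.
  metric_eq : ∀ p ∈ E.carrier, ∀ X, ∀ Y ∈ E.tangent p, E.metric p X Y = ∑ j, θ j p X * θ j p Y
  xi_eq : ∀ p ∈ E.carrier, E.xi p = frame 2 p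
  fderiv_mem : ∀ (F : Coord 2 → Coord E.dim) (u : Coord 2), DifferentiableAt ℝ F u →
    (∀ᶠ v in 𝓝 u, F v ∈ E.carrier) → ∀ w, fderiv ℝ F u w ∈ E.tangent (F u)
  torsion : ∀ p ∈ E.carrier, ∀ X ∈ E.tangent p, ∀ Y ∈ E.tangent p, ∀ j,
    fderiv ℝ (fun q => θ j q Y) p X
      + ((τ • (fun i => θ i p X) + α p X • vert ℝ) ⨯₃ fun i => θ i p Y) j
    = fderiv ℝ (fun q => θ j q X) p Y
      + ((τ • (fun i => θ i p Y) + α p Y • vert ℝ) ⨯₃ fun i => θ i p X) j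
  curv : ∀ p ∈ E.carrier, ∀ X ∈ E.tangent p, ∀ Y ∈ E.tangent p,
    fderiv ℝ (fun q => α q Y) p X - fderiv ℝ (fun q => α q X) p Y
      = -(κ - 4 * τ ^ 2) * (θ 0 p X * θ 1 p Y - θ 1 p X * θ 0 p Y)
  koszul : ∀ p ∈ E.carrier, ∀ X ∈ E.tangent p, ∀ Y ∈ E.tangent p, ∀ Z ∈ E.tangent p,
    christoffel E.metric p X Y Z = ∑ j, θ j p Z * (fderiv ℝ (fun q => θ j q Y) p X
      + ((τ • (fun i => θ i p X) + α p X • vert ℝ) ⨯₃ fun i => θ i p Y) j)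

/-! ### The Cartan model, κ ≤ 0 -/

section cartan

/-- The coordinate forms. -/
abbrev dx {n : ℕ} (i : Fin n) : Coord n →L[ℝ] ℝ := EuclideanSpace.proj i

theorem hasFDerivAt_conformalFactor {κ : ℝ} {p : Coord 3}
    (hp : 0 < 1 + κ / 4 * (p 0 ^ 2 + p 1 ^ 2)) :
    HasFDerivAt (conformalFactor κ)
      (-(κ / 2 * conformalFactor κ p ^ 2) • (p 0 • dx 0 + p 1 • dx 1 : Coord 3 →L[ℝ] ℝ)) p := by
  have h0 : HasFDerivAt (fun q : Coord 3 => q 0) (dx 0 : Coord 3 →L[ℝ] ℝ) p :=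
    (dx 0 : Coord 3 →L[ℝ] ℝ).hasFDerivAt
  have h1 : HasFDerivAt (fun q : Coord 3 => q 1) (dx 1 : Coord 3 →L[ℝ] ℝ) p :=
    (dx 1 : Coord 3 →L[ℝ] ℝ).hasFDerivAt
  have hq := (((h0.pow 2).add (h1.pow 2)).const_mul (κ / 4)).const_add 1
  have := (hasDerivAt_inv hp.ne').comp_hasFDerivAt p hq
  have he : (Inv.inv ∘ fun q : Coord 3 => 1 + κ / 4 * (q 0 ^ 2 + q 1 ^ 2))
      = conformalFactor κ := by
    funext q
    simp [conformalFactor]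
  refine (he ▸ this).congr_fderiv ?_
  ext X
  simp [conformalFactor]
  ring

theorem contDiffOn_conformalFactor (κ : ℝ) :
    ContDiffOn ℝ ∞ (conformalFactor κ) {p | 0 < 1 + κ / 4 * (p 0 ^ 2 + p 1 ^ 2)} := by
  unfold conformalFactor
  refine ContDiffOn.div contDiffOn_const ?_ (fun p hp => ne_of_gt hp)
  fun_prop

/-- Expanding the three derivatives of Σ θⱼ ⊗ θⱼ and adding the torsion equations of the three pairs
of vectors, each weighted by the coframe at the third vector, leaves twice the required expression.
-/
theorem koszul_of_eq {E : FiberedModel} {τ : ℝ} {θ : Fin 3 → Coord E.dim → Coord E.dim →L[ℝ] ℝ}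
    {α : Coord E.dim → Coord E.dim →L[ℝ] ℝ}
    (h : ∀ q X Y, E.metric q X Y = ∑ j, θ j q X * θ j q Y) {p : Coord E.dim}
    (hd : ∀ j, DifferentiableAt ℝ (θ j) p)
    (torsion : ∀ X Y, ∀ j, fderiv ℝ (fun q => θ j q Y) p X
      + ((τ • (fun i => θ i p X) + α p X • vert ℝ) ⨯₃ fun i => θ i p Y) j
    = fderiv ℝ (fun q => θ j q X) p Y
      + ((τ • (fun i => θ i p Y) + α p Y • vert ℝ) ⨯₃ fun i => θ i p X) j) (X Y Z : Coord E.dim) :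
    christoffel E.metric p X Y Z = ∑ j, θ j p Z * (fderiv ℝ (fun q => θ j q Y) p X
      + ((τ • (fun i => θ i p X) + α p X • vert ℝ) ⨯₃ fun i => θ i p Y) j) := by
  have hf : ∀ X j, DifferentiableAt ℝ (fun q => θ j q X) p := fun X j =>
    (hd j).clm_apply (differentiableAt_const X)
  have key : ∀ X Y Z, fderiv ℝ (fun q => E.metric q Y Z) p X
      = ∑ j, (θ j p Y * fderiv ℝ (fun q => θ j q Z) p X
        + θ j p Z * fderiv ℝ (fun q => θ j q Y) p X) := by
    intro X Y Z
    have H := (((hf Y 0).hasFDerivAt.mul (hf Z 0).hasFDerivAt).add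
      ((hf Y 1).hasFDerivAt.mul (hf Z 1).hasFDerivAt)).add
      ((hf Y 2).hasFDerivAt.mul (hf Z 2).hasFDerivAt)
    have H' : HasFDerivAt (fun q => E.metric q Y Z) _ p :=
      H.congr_of_eventuallyEq (.of_forall fun q => by simp [h, Fin.sum_univ_three])
    rw [H'.fderiv]
    simp [Fin.sum_univ_three]
  rw [christoffel, key, key, key]
  have t₀ := torsion X Y
  have t₁ := torsion X Z
  have t₂ := torsion Y Z
  have a₀ := t₀ 0
  have a₁ := t₀ 1
  have a₂ := t₀ 2
  have b₀ := t₁ 0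
  have b₁ := t₁ 1
  have b₂ := t₁ 2
  have c₀ := t₂ 0
  have c₁ := t₂ 1
  have c₂ := t₂ 2
  simp only [Fin.sum_univ_three, cross_zero, cross_one, cross_two, Pi.add_apply, Pi.smul_apply,
    smul_eq_mul, vert, cons_val] at *
  linear_combination (-θ 0 p Z * a₀ - θ 1 p Z * a₁ - θ 2 p Z * a₂ + θ 0 p Y * b₀ + θ 1 p Y * b₁
    + θ 2 p Y * b₂ + θ 0 p X * c₀ + θ 1 p X * c₁ + θ 2 p X * c₂) / 2

/-- The orthonormal coframe `λ dx, λ dy, dz + τλ(y dx - x dy)`. -/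
def cartanForm (κ τ : ℝ) : Fin 3 → Coord 3 → Coord 3 →L[ℝ] ℝ :=
  ![fun p => conformalFactor κ p • dx 0, fun p => conformalFactor κ p • dx 1,
    fun p => dx 2 + (τ * conformalFactor κ p) • (p 1 • dx 0 - p 0 • dx 1)]

theorem fderiv_cartanForm {κ τ : ℝ} {p : Coord 3} (hp : 0 < 1 + κ / 4 * (p 0 ^ 2 + p 1 ^ 2))
    (X Y : Coord 3) :
    fderiv ℝ (fun q => cartanForm κ τ 0 q Y) p X
      = -(κ / 2 * conformalFactor κ p ^ 2) * (p 0 * X 0 + p 1 * X 1) * Y 0 ∧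
    fderiv ℝ (fun q => cartanForm κ τ 1 q Y) p X
      = -(κ / 2 * conformalFactor κ p ^ 2) * (p 0 * X 0 + p 1 * X 1) * Y 1 ∧
    fderiv ℝ (fun q => cartanForm κ τ 2 q Y) p X
      = τ * (-(κ / 2 * conformalFactor κ p ^ 2) * (p 0 * X 0 + p 1 * X 1)
        * (p 1 * Y 0 - p 0 * Y 1) + conformalFactor κ p * (X 1 * Y 0 - X 0 * Y 1)) := by
  have hl := hasFDerivAt_conformalFactor hp
  have h0 : HasFDerivAt (fun q : Coord 3 => q 0) (dx 0 : Coord 3 →L[ℝ] ℝ) p :=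
    (dx 0 : Coord 3 →L[ℝ] ℝ).hasFDerivAt
  have h1 : HasFDerivAt (fun q : Coord 3 => q 1) (dx 1 : Coord 3 →L[ℝ] ℝ) p :=
    (dx 1 : Coord 3 →L[ℝ] ℝ).hasFDerivAt
  refine ⟨?_, ?_, ?_⟩
  · have h : HasFDerivAt (fun q => cartanForm κ τ 0 q Y) _ p := hl.mul_const (Y 0)
    rw [h.fderiv]
    simp
    ring
  · have h : HasFDerivAt (fun q => cartanForm κ τ 1 q Y) _ p := hl.mul_const (Y 1)
    rw [h.fderiv]
    simp
    ring
  · have h : HasFDerivAt (fun q => cartanForm κ τ 2 q Y) _ p :=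
      ((hl.const_mul τ).mul ((h1.mul_const (Y 0)).sub (h0.mul_const (Y 1)))).const_add (Y 2)
    rw [h.fderiv]
    simp
    ring

theorem contDiffOn_cartanForm (κ τ : ℝ) (j : Fin 3) :
    ContDiffOn ℝ ∞ (cartanForm κ τ j) {p | 0 < 1 + κ / 4 * (p 0 ^ 2 + p 1 ^ 2)} := by
  have h := contDiffOn_conformalFactor κ
  fin_cases j <;> simp only [cartanForm, Fin.zero_eta, Fin.mk_one, Fin.reduceFinMk, cons_val]
  · exact h.smul contDiffOn_const
  · exact h.smul contDiffOn_const
  · exact contDiffOn_const.add ((contDiffOn_const.mul h).smul (by fun_prop))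

/-- The connection form of `cartanForm`. -/
def cartanConn (κ τ : ℝ) (p : Coord 3) : Coord 3 →L[ℝ] ℝ :=
  (κ / 2 * conformalFactor κ p) • (p 1 • dx 0 - p 0 • dx 1) - (2 * τ) • cartanForm κ τ 2 p

theorem contDiffOn_cartanConn (κ τ : ℝ) :
    ContDiffOn ℝ ∞ (cartanConn κ τ) {p | 0 < 1 + κ / 4 * (p 0 ^ 2 + p 1 ^ 2)} := by
  have h := contDiffOn_conformalFactor κ
  have h2 := contDiffOn_cartanForm κ τ 2
  have h1 : ContDiffOn ℝ ∞ (fun p : Coord 3 => (p 1 • dx 0 - p 0 • dx 1 : Coord 3 →L[ℝ] ℝ))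
    {p | 0 < 1 + κ / 4 * (p 0 ^ 2 + p 1 ^ 2)} := by fun_prop
  exact ((contDiffOn_const.mul h).smul h1).sub (h2.const_smul (2 * τ))

theorem fderiv_cartanConn {κ τ : ℝ} {p : Coord 3} (hp : 0 < 1 + κ / 4 * (p 0 ^ 2 + p 1 ^ 2))
    (X Y : Coord 3) :
    fderiv ℝ (fun q => cartanConn κ τ q Y) p X
      = (κ / 2 - 2 * τ ^ 2) * (-(κ / 2 * conformalFactor κ p ^ 2) * (p 0 * X 0 + p 1 * X 1)
        * (p 1 * Y 0 - p 0 * Y 1) + conformalFactor κ p * (X 1 * Y 0 - X 0 * Y 1)) := by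
  have hl := hasFDerivAt_conformalFactor hp
  have h0 : HasFDerivAt (fun q : Coord 3 => q 0) (dx 0 : Coord 3 →L[ℝ] ℝ) p :=
    (dx 0 : Coord 3 →L[ℝ] ℝ).hasFDerivAt
  have h1 : HasFDerivAt (fun q : Coord 3 => q 1) (dx 1 : Coord 3 →L[ℝ] ℝ) p :=
    (dx 1 : Coord 3 →L[ℝ] ℝ).hasFDerivAt
  have hw := (h1.mul_const (Y 0)).sub (h0.mul_const (Y 1))
  have h : HasFDerivAt (fun q => cartanConn κ τ q Y) _ p :=
    ((hl.const_mul (κ / 2)).mul hw).sub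
      ((((hl.const_mul τ).mul hw).const_add (Y 2)).const_mul (2 * τ))
  rw [h.fderiv]
  simp
  ring

theorem conformalFactor_eq {κ : ℝ} {p : Coord 3} (hp : 0 < 1 + κ / 4 * (p 0 ^ 2 + p 1 ^ 2)) :
    conformalFactor κ p * (1 + κ / 4 * (p 0 ^ 2 + p 1 ^ 2)) = 1 := by
  rw [conformalFactor, one_div_mul_cancel hp.ne']

/-- The equations for dθ₀ and dθ₁ hold for any function in place of the reciprocal of 1 + κ(x² +
y²)/4 with the stated derivative. The one for dθ₂ compares λ with λ² and needs the relation
`conformalFactor_eq`. -/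
theorem cartan_torsion {κ τ : ℝ} {p : Coord 3} (hp : 0 < 1 + κ / 4 * (p 0 ^ 2 + p 1 ^ 2))
    (X Y : Coord 3) (j : Fin 3) :
    fderiv ℝ (fun q => cartanForm κ τ j q Y) p X
      + ((τ • (fun i => cartanForm κ τ i p X) + cartanConn κ τ p X • vert ℝ)
        ⨯₃ fun i => cartanForm κ τ i p Y) j
    = fderiv ℝ (fun q => cartanForm κ τ j q X) p Y
      + ((τ • (fun i => cartanForm κ τ i p Y) + cartanConn κ τ p Y • vert ℝ)
        ⨯₃ fun i => cartanForm κ τ i p X) j := by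
  obtain ⟨a₀, a₁, a₂⟩ := fderiv_cartanForm (τ := τ) hp X Y
  obtain ⟨b₀, b₁, b₂⟩ := fderiv_cartanForm (τ := τ) hp Y X
  have hl := conformalFactor_eq hp
  have c0 : ∀ Z : Coord 3, cartanForm κ τ 0 p Z = conformalFactor κ p * Z 0 := fun Z => rfl
  have c1 : ∀ Z : Coord 3, cartanForm κ τ 1 p Z = conformalFactor κ p * Z 1 := fun Z => rfl
  have c2 : ∀ Z : Coord 3, cartanForm κ τ 2 p Z
    = Z 2 + τ * conformalFactor κ p * (p 1 * Z 0 - p 0 * Z 1) := fun Z => rfl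
  have cc : ∀ Z : Coord 3, cartanConn κ τ p Z
    = κ / 2 * conformalFactor κ p * (p 1 * Z 0 - p 0 * Z 1) - 2 * τ * cartanForm κ τ 2 p Z :=
    fun Z => rfl
  fin_cases j
  · simp only [Fin.zero_eta, a₀, b₀, cross_zero, Pi.add_apply, Pi.smul_apply, smul_eq_mul, vert,
      cons_val, cc, c1, c2]
    ring
  · simp only [Fin.mk_one, a₁, b₁, cross_one, Pi.add_apply, Pi.smul_apply, smul_eq_mul, vert,
      cons_val, cc, c0, c2]
    ring
  · simp only [Fin.reduceFinMk, a₂, b₂, cross_two, Pi.add_apply, Pi.smul_apply, smul_eq_mul, vert,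
      cons_val, cc, c0, c1, c2]
    linear_combination (2 * τ * conformalFactor κ p * (X 0 * Y 1 - X 1 * Y 0)) * hl

/-- The domain of the Cartan model. -/
def cartanDomain (κ : ℝ) : Set (Coord 3) := {p | 0 < 1 + κ / 4 * (p 0 ^ 2 + p 1 ^ 2)}

theorem isOpen_cartanDomain (κ : ℝ) : IsOpen (cartanDomain κ) :=
  isOpen_lt continuous_const
    (by fun_prop : Continuous fun p : Coord 3 => 1 + κ / 4 * (p 0 ^ 2 + p 1 ^ 2))

/-- The frame dual to `cartanForm`. -/
def cartanFrame (κ τ : ℝ) : Fin 3 → Coord 3 → Coord 3 :=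
  ![fun p => !₂[1 + κ / 4 * (p 0 ^ 2 + p 1 ^ 2), 0, -τ * p 1],
    fun p => !₂[0, 1 + κ / 4 * (p 0 ^ 2 + p 1 ^ 2), τ * p 0], fun _ => !₂[0, 0, 1]]

theorem contDiff_cartanFrame (κ τ : ℝ) (j : Fin 3) : ContDiff ℝ ∞ (cartanFrame κ τ j) := by
  rw [contDiff_euclidean]
  intro i
  fin_cases j <;> fin_cases i <;> simp [cartanFrame] <;> first | exact contDiff_const | fun_prop

theorem cartanForm_frame {κ τ : ℝ} {p : Coord 3} (hp : p ∈ cartanDomain κ) (i j : Fin 3) :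
    cartanForm κ τ i p (cartanFrame κ τ j p) = if i = j then 1 else 0 := by
  have hl := conformalFactor_eq hp
  fin_cases i <;> fin_cases j <;> simp [cartanForm, cartanFrame]
  · exact hl
  · exact hl
  · linear_combination τ * p 1 * hl
  · linear_combination -τ * p 0 * hl

theorem cartan_expand {κ τ : ℝ} {p : Coord 3} (hp : p ∈ cartanDomain κ) (X : Coord 3) :
    X = ∑ j, cartanForm κ τ j p X • cartanFrame κ τ j p := by
  have hl := conformalFactor_eq hp
  ext i
  fin_cases i <;> simp [cartanForm, cartanFrame, Fin.sum_univ_three]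
  · linear_combination -X 0 * hl
  · linear_combination -X 1 * hl
  · ring

theorem cartan_metric (κ τ : ℝ) (p X Y : Coord 3) :
    (cartanModel κ τ).metric p X Y = ∑ j, cartanForm κ τ j p X * cartanForm κ τ j p Y := by
  simp [cartanForm, cartanModel, Fin.sum_univ_three, connectionForm]
  ring

/-- Up to the closed form -2τ dz, the connection form is (κ/2 - 2τ²)λ(y dx - x dy). Thus the
computation is the one for dθ₂ with another constant. -/
theorem cartan_curv {κ τ : ℝ} {p : Coord 3} (hp : p ∈ cartanDomain κ) (X Y : Coord 3) :
    fderiv ℝ (fun q => cartanConn κ τ q Y) p X - fderiv ℝ (fun q => cartanConn κ τ q X) p Y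
      = -(κ - 4 * τ ^ 2) * (cartanForm κ τ 0 p X * cartanForm κ τ 1 p Y
        - cartanForm κ τ 1 p X * cartanForm κ τ 0 p Y) := by
  have hl := conformalFactor_eq hp
  rw [fderiv_cartanConn hp, fderiv_cartanConn hp]
  have c0 : ∀ Z : Coord 3, cartanForm κ τ 0 p Z = conformalFactor κ p * Z 0 := fun Z => rfl
  have c1 : ∀ Z : Coord 3, cartanForm κ τ 1 p Z = conformalFactor κ p * Z 1 := fun Z => rfl
  rw [c0, c0, c1, c1]
  linear_combination ((κ - 4 * τ ^ 2) * conformalFactor κ p * (X 0 * Y 1 - X 1 * Y 0)) * hl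

/-- The structure equations of the spaces `E(κ,τ)` with `κ ≤ 0`. -/
def cartanCoframe (κ τ : ℝ) : Coframe (cartanModel κ τ) κ τ where
  dom := cartanDomain κ
  isOpen_dom := isOpen_cartanDomain κ
  carrier_subset := subset_rfl
  θ := cartanForm κ τ
  α := cartanConn κ τ
  frame := cartanFrame κ τ
  contDiffOn_θ := contDiffOn_cartanForm κ τ
  contDiffOn_α := contDiffOn_cartanConn κ τ
  contDiffOn_frame j := (contDiff_cartanFrame κ τ j).contDiffOn
  frame_mem _ _ _ := (Submodule.mem_top : _ ∈ (⊤ : Submodule ℝ (Coord 3)))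
  θ_frame p hp i j := cartanForm_frame hp i j
  expand p hp X _ := cartan_expand hp X
  metric_eq p hp X Y _ := cartan_metric κ τ p X Y
  xi_eq p hp := rfl
  fderiv_mem _ _ _ _ _ := (Submodule.mem_top : _ ∈ (⊤ : Submodule ℝ (Coord 3)))
  torsion p hp X _ Y _ j := cartan_torsion hp X Y j
  curv p hp X _ Y _ := cartan_curv hp X Y
  koszul p hp X _ Y _ Z _ := koszul_of_eq (E := cartanModel κ τ) (cartan_metric κ τ)
    (fun j => ((contDiffOn_cartanForm κ τ j).contDiffAt
      ((isOpen_cartanDomain κ).mem_nhds hp)).differentiableAt (by simp))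
    (cartan_torsion hp) X Y Z

end cartan

/-! ### The Berger spheres, κ > 0 -/

section berger

/-- The orthonormal coframe of the Berger sphere. -/
def bergerForm (κ τ : ℝ) : Fin 3 → Coord 4 → Coord 4 →L[ℝ] ℝ :=
  ![fun p => (2 / √κ) • (-p 3 • dx 0 - p 2 • dx 1 + p 1 • dx 2 + p 0 • dx 3),
    fun p => (2 / √κ) • (-p 2 • dx 0 + p 3 • dx 1 + p 0 • dx 2 - p 1 • dx 3),
    fun p => (4 * τ / κ) • (-p 1 • dx 0 + p 0 • dx 1 - p 3 • dx 2 + p 2 • dx 3)]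

/-- The frame dual to `bergerForm` on the sphere. -/
def bergerFrame (κ τ : ℝ) : Fin 3 → Coord 4 → Coord 4 :=
  ![fun p => (√κ / 2) • !₂[-p 3, -p 2, p 1, p 0], fun p => (√κ / 2) • !₂[-p 2, p 3, p 0, -p 1],
    fun p => (κ / (4 * τ)) • mulI p]

theorem bergerForm_zero (κ τ : ℝ) (p W : Coord 4) : bergerForm κ τ 0 p W
    = 2 / √κ * (-p 3 * W 0 - p 2 * W 1 + p 1 * W 2 + p 0 * W 3) := rfl

theorem bergerForm_one (κ τ : ℝ) (p W : Coord 4) : bergerForm κ τ 1 p W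
    = 2 / √κ * (-p 2 * W 0 + p 3 * W 1 + p 0 * W 2 - p 1 * W 3) := rfl

theorem bergerForm_two (κ τ : ℝ) (p W : Coord 4) : bergerForm κ τ 2 p W
    = 4 * τ / κ * (-p 1 * W 0 + p 0 * W 1 - p 3 * W 2 + p 2 * W 3) := rfl

theorem bergerFrame_eq (κ τ : ℝ) (p : Coord 4) (i : Fin 4) :
    bergerFrame κ τ 0 p i = √κ / 2 * ![-p 3, -p 2, p 1, p 0] i ∧
    bergerFrame κ τ 1 p i = √κ / 2 * ![-p 2, p 3, p 0, -p 1] i ∧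
    bergerFrame κ τ 2 p i = κ / (4 * τ) * ![-p 1, p 0, -p 3, p 2] i :=
  ⟨rfl, rfl, rfl⟩

theorem bergerFrame_orthogonal (κ τ : ℝ) (p : Coord 4) (j : Fin 3) :
    p 0 * bergerFrame κ τ j p 0 + p 1 * bergerFrame κ τ j p 1 + p 2 * bergerFrame κ τ j p 2
      + p 3 * bergerFrame κ τ j p 3 = 0 := by
  fin_cases j <;> simp only [Fin.zero_eta, Fin.mk_one, Fin.reduceFinMk, bergerFrame_eq,
    cons_val] <;> ring

theorem fderiv_of_isLinearMap {n : ℕ} {f : Coord n → ℝ} (hf : IsLinearMap ℝ f) (p X : Coord n) :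
    fderiv ℝ f p X = f X := by
  have : f = (hf.mk' f).toContinuousLinearMap := rfl
  rw [this, ContinuousLinearMap.fderiv]

theorem isLinearMap_bergerForm (κ τ : ℝ) (j : Fin 3) (Y : Coord 4) :
    IsLinearMap ℝ fun q => bergerForm κ τ j q Y := by
  constructor
  · intro p q
    fin_cases j <;> simp only [Fin.zero_eta, Fin.mk_one, Fin.reduceFinMk, bergerForm_zero,
      bergerForm_one, bergerForm_two, PiLp.add_apply] <;> ring
  · intro r p
    fin_cases j <;> simp only [Fin.zero_eta, Fin.mk_one, Fin.reduceFinMk, bergerForm_zero,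
      bergerForm_one, bergerForm_two, PiLp.smul_apply, smul_eq_mul] <;> ring

theorem contDiff_bergerForm (κ τ : ℝ) (j : Fin 3) : ContDiff ℝ ∞ (bergerForm κ τ j) := by
  fin_cases j <;> simp only [bergerForm, Fin.zero_eta, Fin.mk_one, Fin.reduceFinMk, cons_val] <;>
  fun_prop

theorem contDiff_bergerFrame (κ τ : ℝ) (j : Fin 3) : ContDiff ℝ ∞ (bergerFrame κ τ j) := by
  rw [contDiff_euclidean]
  intro i
  fin_cases j <;> fin_cases i <;> simp only [Fin.zero_eta, Fin.mk_one, Fin.reduceFinMk,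
    bergerFrame_eq, cons_val] <;> fun_prop

theorem sphere_eq {p : Coord 4} (hp : p ∈ Metric.sphere (0 : Coord 4) 1) :
    p 0 ^ 2 + p 1 ^ 2 + p 2 ^ 2 + p 3 ^ 2 = 1 := by
  have := EuclideanSpace.norm_sq_eq p
  rw [mem_sphere_zero_iff_norm.mp hp, Fin.sum_univ_four] at this
  simpa using this.symm

theorem mem_tangent_sphere {p X : Coord 4} :
    X ∈ (Submodule.span ℝ {p})ᗮ ↔ p 0 * X 0 + p 1 * X 1 + p 2 * X 2 + p 3 * X 3 = 0 := by
  rw [Submodule.mem_orthogonal_singleton_iff_inner_right, PiLp.inner_apply, Fin.sum_univ_four]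
  simp [mul_comm]

theorem bergerForm_frame {κ τ : ℝ} (hκ : 0 < κ) (hτ : τ ≠ 0) {p : Coord 4}
    (hp : p ∈ Metric.sphere (0 : Coord 4) 1) (i j : Fin 3) :
    bergerForm κ τ i p (bergerFrame κ τ j p) = if i = j then 1 else 0 := by
  have hn := sphere_eq hp
  have hk : √κ ≠ 0 := (Real.sqrt_pos.2 hκ).ne'
  fin_cases i <;> fin_cases j <;> simp only [Fin.zero_eta, Fin.mk_one, Fin.reduceFinMk,
    bergerForm_zero, bergerForm_one, bergerForm_two, bergerFrame_eq, cons_val, Fin.reduceEq,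
    if_true, if_false] <;> field_simp <;> first | ring1 | linear_combination hn

theorem berger_expand {κ τ : ℝ} (hκ : 0 < κ) (hτ : τ ≠ 0) {p X : Coord 4}
    (hp : p ∈ Metric.sphere (0 : Coord 4) 1)
    (hX : p 0 * X 0 + p 1 * X 1 + p 2 * X 2 + p 3 * X 3 = 0) :
    X = ∑ j, bergerForm κ τ j p X • bergerFrame κ τ j p := by
  have hn := sphere_eq hp
  have hk : √κ ≠ 0 := (Real.sqrt_pos.2 hκ).ne'
  ext i
  simp only [Fin.sum_univ_three, PiLp.add_apply, PiLp.smul_apply, smul_eq_mul, bergerForm_zero,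
    bergerForm_one, bergerForm_two, bergerFrame_eq]
  fin_cases i <;> simp only [Fin.zero_eta, Fin.mk_one, Fin.reduceFinMk, cons_val] <;> field_simp
  · linear_combination -X 0 * hn + p 0 * hX
  · linear_combination -X 1 * hn + p 1 * hX
  · linear_combination -X 2 * hn + p 2 * hX
  · linear_combination -X 3 * hn + p 3 * hX

/-- These are the Maurer–Cartan equations of S³. The forms are linear in the base point, so the
derivative of θⱼ(Y) in the direction X is θⱼ with base point X, which occurs on the left. They need
|p| = 1 and both vectors tangent at `p`. -/
theorem berger_products {κ τ : ℝ} (hκ : 0 < κ) (hτ : τ ≠ 0) {p X Y : Coord 4}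
    (hp : p ∈ Metric.sphere (0 : Coord 4) 1)
    (hX : p 0 * X 0 + p 1 * X 1 + p 2 * X 2 + p 3 * X 3 = 0)
    (hY : p 0 * Y 0 + p 1 * Y 1 + p 2 * Y 2 + p 3 * Y 3 = 0) :
    bergerForm κ τ 0 X Y = κ / (4 * τ) * (bergerForm κ τ 2 p X * bergerForm κ τ 1 p Y
        - bergerForm κ τ 1 p X * bergerForm κ τ 2 p Y) ∧
    bergerForm κ τ 1 X Y = κ / (4 * τ) * (bergerForm κ τ 0 p X * bergerForm κ τ 2 p Y
        - bergerForm κ τ 2 p X * bergerForm κ τ 0 p Y) ∧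
    bergerForm κ τ 2 X Y = τ * (bergerForm κ τ 1 p X * bergerForm κ τ 0 p Y
        - bergerForm κ τ 0 p X * bergerForm κ τ 1 p Y) := by
  have hn := sphere_eq hp
  have hk : √κ ≠ 0 := (Real.sqrt_pos.2 hκ).ne'
  have hs : √κ ^ 2 = κ := Real.sq_sqrt hκ.le
  refine ⟨?_, ?_, ?_⟩
  · simp only [bergerForm_zero, bergerForm_one, bergerForm_two]
    field_simp
    linear_combination (-(-X 3 * Y 0 - X 2 * Y 1 + X 1 * Y 2 + X 0 * Y 3)) * hn
      + (-p 3 * Y 0 - p 2 * Y 1 + p 1 * Y 2 + p 0 * Y 3) * hX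
      - (-p 3 * X 0 - p 2 * X 1 + p 1 * X 2 + p 0 * X 3) * hY
  · simp only [bergerForm_zero, bergerForm_one, bergerForm_two]
    field_simp
    linear_combination (-(-X 2 * Y 0 + X 3 * Y 1 + X 0 * Y 2 - X 1 * Y 3)) * hn
      + (-p 2 * Y 0 + p 3 * Y 1 + p 0 * Y 2 - p 1 * Y 3) * hX
      - (-p 2 * X 0 + p 3 * X 1 + p 0 * X 2 - p 1 * X 3) * hY
  · simp only [bergerForm_zero, bergerForm_one, bergerForm_two]
    field_simp
    rw [hs]
    linear_combination 4 * κ * ((-(-X 1 * Y 0 + X 0 * Y 1 - X 3 * Y 2 + X 2 * Y 3)) * hn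
      + (-p 1 * Y 0 + p 0 * Y 1 - p 3 * Y 2 + p 2 * Y 3) * hX
      - (-p 1 * X 0 + p 0 * X 1 - p 3 * X 2 + p 2 * X 3) * hY)

/-- The connection form of `bergerForm`. -/
def bergerConn (κ τ : ℝ) (p : Coord 4) : Coord 4 →L[ℝ] ℝ :=
  ((κ - 4 * τ ^ 2) / (2 * τ)) • bergerForm κ τ 2 p

theorem fderiv_bergerForm (κ τ : ℝ) (j : Fin 3) (p X Y : Coord 4) :
    fderiv ℝ (fun q => bergerForm κ τ j q Y) p X = bergerForm κ τ j X Y :=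
  fderiv_of_isLinearMap (isLinearMap_bergerForm κ τ j Y) p X

theorem fderiv_bergerConn (κ τ : ℝ) (p X Y : Coord 4) :
    fderiv ℝ (fun q => bergerConn κ τ q Y) p X
      = (κ - 4 * τ ^ 2) / (2 * τ) * bergerForm κ τ 2 X Y := by
  have h := isLinearMap_bergerForm κ τ 2 Y
  refine fderiv_of_isLinearMap (f := fun q => bergerConn κ τ q Y) ⟨fun a b => ?_, fun r a => ?_⟩ p X
  · simp only [bergerConn, _root_.smul_apply, h.map_add, smul_add]
  · simp only [bergerConn, _root_.smul_apply, h.map_smul, smul_comm r]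

theorem bergerForm_antisymm (κ τ : ℝ) (j : Fin 3) (X Y : Coord 4) :
    bergerForm κ τ j X Y = -bergerForm κ τ j Y X := by
  fin_cases j <;> simp only [Fin.zero_eta, Fin.mk_one, Fin.reduceFinMk, bergerForm_zero,
    bergerForm_one, bergerForm_two] <;> ring

theorem berger_torsion {κ τ : ℝ} (hκ : 0 < κ) (hτ : τ ≠ 0) {p X Y : Coord 4}
    (hp : p ∈ Metric.sphere (0 : Coord 4) 1)
    (hX : p 0 * X 0 + p 1 * X 1 + p 2 * X 2 + p 3 * X 3 = 0)
    (hY : p 0 * Y 0 + p 1 * Y 1 + p 2 * Y 2 + p 3 * Y 3 = 0) (j : Fin 3) :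
    fderiv ℝ (fun q => bergerForm κ τ j q Y) p X
      + ((τ • (fun i => bergerForm κ τ i p X) + bergerConn κ τ p X • vert ℝ)
        ⨯₃ fun i => bergerForm κ τ i p Y) j
    = fderiv ℝ (fun q => bergerForm κ τ j q X) p Y
      + ((τ • (fun i => bergerForm κ τ i p Y) + bergerConn κ τ p Y • vert ℝ)
        ⨯₃ fun i => bergerForm κ τ i p X) j := by
  obtain ⟨h₀, h₁, h₂⟩ := berger_products hκ hτ hp hX hY
  have cc : ∀ Z, bergerConn κ τ p Z = (κ - 4 * τ ^ 2) / (2 * τ) * bergerForm κ τ 2 p Z :=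
    fun Z => rfl
  rw [fderiv_bergerForm, fderiv_bergerForm, bergerForm_antisymm κ τ j Y X]
  fin_cases j
  · simp only [Fin.zero_eta, cross_zero, Pi.add_apply, Pi.smul_apply, smul_eq_mul, vert,
      cons_val, cc, h₀]
    field_simp
    ring
  · simp only [Fin.mk_one, cross_one, Pi.add_apply, Pi.smul_apply, smul_eq_mul, vert,
      cons_val, cc, h₁]
    field_simp
    ring
  · simp only [Fin.reduceFinMk, cross_two, Pi.add_apply, Pi.smul_apply, smul_eq_mul, vert,
      cons_val, h₂]
    ring

theorem berger_curv {κ τ : ℝ} (hκ : 0 < κ) (hτ : τ ≠ 0) {p X Y : Coord 4}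
    (hp : p ∈ Metric.sphere (0 : Coord 4) 1)
    (hX : p 0 * X 0 + p 1 * X 1 + p 2 * X 2 + p 3 * X 3 = 0)
    (hY : p 0 * Y 0 + p 1 * Y 1 + p 2 * Y 2 + p 3 * Y 3 = 0) :
    fderiv ℝ (fun q => bergerConn κ τ q Y) p X - fderiv ℝ (fun q => bergerConn κ τ q X) p Y
      = -(κ - 4 * τ ^ 2) * (bergerForm κ τ 0 p X * bergerForm κ τ 1 p Y
        - bergerForm κ τ 1 p X * bergerForm κ τ 0 p Y) := by
  obtain ⟨-, -, h₂⟩ := berger_products hκ hτ hp hX hY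
  rw [fderiv_bergerConn, fderiv_bergerConn, bergerForm_antisymm κ τ 2 Y X, h₂]
  field_simp
  ring

/-- Separates the dependence on the base point, which is confined to θ₂. This makes the metric easy
to differentiate, and it holds for all vectors of ℝ⁴. -/
theorem berger_metric_eq {κ τ : ℝ} (hκ : 0 < κ) (hτ : τ ≠ 0) (p X Y : Coord 4) :
    (bergerSphere κ τ).metric p X Y
      = 4 / κ * (X 0 * Y 0 + X 1 * Y 1 + X 2 * Y 2 + X 3 * Y 3)
        + (1 - κ / (4 * τ ^ 2)) * (bergerForm κ τ 2 p X * bergerForm κ τ 2 p Y) := by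
  have h1 : ∀ V W : Coord 4, inner ℝ V W = V 0 * W 0 + V 1 * W 1 + V 2 * W 2 + V 3 * W 3 :=
    fun V W => by
      rw [PiLp.inner_apply, Fin.sum_univ_four]
      simp only [RCLike.inner_apply, conj_trivial, mul_comm]
  have h2 : ∀ W : Coord 4, inner ℝ W (mulI p) = -p 1 * W 0 + p 0 * W 1 - p 3 * W 2 + p 2 * W 3 :=
    fun W => by
      rw [h1]
      simp only [mulI, cons_val]
      ring
  simp only [bergerSphere]
  rw [h1 X Y, h2, h2, bergerForm_two, bergerForm_two]
  field_simp

/-- The vectors p, ip and the two horizontal ones form an orthonormal basis of ℝ⁴. The component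
along `p` drops out of the inner product as soon as one of the two vectors is tangent. -/
theorem berger_metric {κ τ : ℝ} (hκ : 0 < κ) (hτ : τ ≠ 0) {p : Coord 4} (X : Coord 4) {Y : Coord 4}
    (hp : p ∈ Metric.sphere (0 : Coord 4) 1)
    (hY : p 0 * Y 0 + p 1 * Y 1 + p 2 * Y 2 + p 3 * Y 3 = 0) :
    (bergerSphere κ τ).metric p X Y = ∑ j, bergerForm κ τ j p X * bergerForm κ τ j p Y := by
  have hn := sphere_eq hp
  have hk : √κ ≠ 0 := (Real.sqrt_pos.2 hκ).ne'
  have hs : (2 / √κ) ^ 2 = 4 / κ := by rw [div_pow, Real.sq_sqrt hκ.le]; norm_num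
  have hh : κ / (4 * τ ^ 2) * (4 * τ / κ) ^ 2 = 4 / κ := by field_simp
  rw [berger_metric_eq hκ hτ, Fin.sum_univ_three, bergerForm_zero, bergerForm_zero,
    bergerForm_one, bergerForm_one, bergerForm_two, bergerForm_two]
  linear_combination 4 / κ * (-(X 0 * Y 0 + X 1 * Y 1 + X 2 * Y 2 + X 3 * Y 3) * hn
      + (p 0 * X 0 + p 1 * X 1 + p 2 * X 2 + p 3 * X 3) * hY)
    - ((-p 3 * X 0 - p 2 * X 1 + p 1 * X 2 + p 0 * X 3)
        * (-p 3 * Y 0 - p 2 * Y 1 + p 1 * Y 2 + p 0 * Y 3)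
      + (-p 2 * X 0 + p 3 * X 1 + p 0 * X 2 - p 1 * X 3)
        * (-p 2 * Y 0 + p 3 * Y 1 + p 0 * Y 2 - p 1 * Y 3)) * hs
    - ((-p 1 * X 0 + p 0 * X 1 - p 3 * X 2 + p 2 * X 3)
        * (-p 1 * Y 0 + p 0 * Y 1 - p 3 * Y 2 + p 2 * Y 3)) * hh

/-- The general `koszul_of_eq` is not available, because Σ θⱼ ⊗ θⱼ equals the metric only at points
of the sphere and against tangent vectors. The derivatives of the metric are computed from
`berger_metric_eq` instead. -/
theorem berger_koszul {κ τ : ℝ} (hκ : 0 < κ) (hτ : τ ≠ 0) {p X Y Z : Coord 4}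
    (hp : p ∈ Metric.sphere (0 : Coord 4) 1)
    (hX : p 0 * X 0 + p 1 * X 1 + p 2 * X 2 + p 3 * X 3 = 0)
    (hY : p 0 * Y 0 + p 1 * Y 1 + p 2 * Y 2 + p 3 * Y 3 = 0)
    (hZ : p 0 * Z 0 + p 1 * Z 1 + p 2 * Z 2 + p 3 * Z 3 = 0) :
    christoffel (n := 4) (bergerSphere κ τ).metric p X Y Z
      = ∑ j, bergerForm κ τ j p Z * (fderiv ℝ (fun q => bergerForm κ τ j q Y) p X
      + ((τ • (fun i => bergerForm κ τ i p X) + bergerConn κ τ p X • vert ℝ)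
        ⨯₃ fun i => bergerForm κ τ i p Y) j) := by
  have key : ∀ X Y Z : Coord 4, fderiv ℝ (fun q : Coord 4 => (bergerSphere κ τ).metric q Y Z) p X
      = (1 - κ / (4 * τ ^ 2)) * (bergerForm κ τ 2 p Y * bergerForm κ τ 2 X Z
        + bergerForm κ τ 2 X Y * bergerForm κ τ 2 p Z) := by
    intro X Y Z
    have hf : ∀ Y, DifferentiableAt ℝ (fun q => bergerForm κ τ 2 q Y) p := fun Y =>
      ((contDiff_bergerForm κ τ 2).differentiable (by simp)).differentiableAt.clm_apply
        (differentiableAt_const Y)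
    have H := ((((hf Y).hasFDerivAt.mul (hf Z).hasFDerivAt).const_mul
      (1 - κ / (4 * τ ^ 2))).const_add (4 / κ * (Y 0 * Z 0 + Y 1 * Z 1 + Y 2 * Z 2 + Y 3 * Z 3)))
    have H' : HasFDerivAt (fun q : Coord 4 => (bergerSphere κ τ).metric q Y Z) _ p :=
      H.congr_of_eventuallyEq (.of_forall fun q => berger_metric_eq hκ hτ q Y Z)
    rw [H'.fderiv]
    simp only [_root_.smul_apply, _root_.add_apply, smul_eq_mul,
      fderiv_bergerForm]
    ring
  obtain ⟨-, -, a⟩ := berger_products hκ hτ hp hX hY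
  obtain ⟨-, -, b⟩ := berger_products hκ hτ hp hX hZ
  obtain ⟨-, -, c⟩ := berger_products hκ hτ hp hY hZ
  obtain ⟨h₀, h₁, -⟩ := berger_products hκ hτ hp hX hY
  have cc : ∀ Z, bergerConn κ τ p Z = (κ - 4 * τ ^ 2) / (2 * τ) * bergerForm κ τ 2 p Z :=
    fun Z => rfl
  have hc : christoffel (n := 4) (bergerSphere κ τ).metric p X Y Z
    = (fderiv ℝ (fun q : Coord 4 => (bergerSphere κ τ).metric q Y Z) p X
      + fderiv ℝ (fun q : Coord 4 => (bergerSphere κ τ).metric q X Z) p Y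
      - fderiv ℝ (fun q : Coord 4 => (bergerSphere κ τ).metric q X Y) p Z) / 2 := rfl
  rw [hc, key, key, key, bergerForm_antisymm κ τ 2 Y X, bergerForm_antisymm κ τ 2 Z X,
    bergerForm_antisymm κ τ 2 Z Y, a, b, c]
  simp only [Fin.sum_univ_three, fderiv_bergerForm, h₀, h₁, a, cross_zero, cross_one, cross_two,
    Pi.add_apply, Pi.smul_apply, smul_eq_mul, vert, cons_val, cc]
  field_simp
  ring

theorem fderiv_mem_tangent_sphere {F : Coord 2 → Coord 4} {u : Coord 2}
    (hF : DifferentiableAt ℝ F u) (h : ∀ᶠ v in 𝓝 u, F v ∈ Metric.sphere (0 : Coord 4) 1)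
    (w : Coord 2) : fderiv ℝ F u w ∈ (Submodule.span ℝ {F u})ᗮ := by
  rw [Submodule.mem_orthogonal_singleton_iff_inner_right]
  have h1 : HasFDerivAt (fun v => inner ℝ (F v) (F v)) _ u := hF.hasFDerivAt.inner ℝ hF.hasFDerivAt
  have h2 : HasFDerivAt (fun v => inner ℝ (F v) (F v)) (0 : Coord 2 →L[ℝ] ℝ) u := by
    refine (hasFDerivAt_const (1 : ℝ) u).congr_of_eventuallyEq ?_
    filter_upwards [h] with v hv
    rw [real_inner_self_eq_norm_sq, mem_sphere_zero_iff_norm.mp hv, one_pow]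
  have := congrArg (· w) (h1.unique h2)
  simp [real_inner_comm] at this
  exact this

/-- The structure equations of the Berger spheres. -/
def bergerCoframe {κ τ : ℝ} (hκ : 0 < κ) (hτ : τ ≠ 0) : Coframe (bergerSphere κ τ) κ τ where
  dom := univ
  isOpen_dom := isOpen_univ
  carrier_subset := subset_univ _
  θ := bergerForm κ τ
  α := bergerConn κ τ
  frame := bergerFrame κ τ
  contDiffOn_θ j := (contDiff_bergerForm κ τ j).contDiffOn
  contDiffOn_α := ((contDiff_bergerForm κ τ 2).const_smul _).contDiffOn
  contDiffOn_frame j := (contDiff_bergerFrame κ τ j).contDiffOn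
  frame_mem p _ j :=
    mem_tangent_sphere.2 (bergerFrame_orthogonal κ τ p j)
  θ_frame _ hp i j := bergerForm_frame hκ hτ hp i j
  expand _ hp _ hX := berger_expand hκ hτ hp (mem_tangent_sphere.1 hX)
  metric_eq _ hp X _ hY := berger_metric hκ hτ X hp (mem_tangent_sphere.1 hY)
  xi_eq _ _ := rfl
  fderiv_mem _ _ hF h w := fderiv_mem_tangent_sphere hF h w
  torsion _ hp _ hX _ hY j :=
    berger_torsion hκ hτ hp (mem_tangent_sphere.1 hX) (mem_tangent_sphere.1 hY) j
  curv _ hp _ hX _ hY :=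
    berger_curv hκ hτ hp (mem_tangent_sphere.1 hX) (mem_tangent_sphere.1 hY)
  koszul _ hp _ hX _ hY _ hZ := berger_koszul hκ hτ hp (mem_tangent_sphere.1 hX)
    (mem_tangent_sphere.1 hY) (mem_tangent_sphere.1 hZ)

end berger

/-! ### Evaluation at points; patches and their pulled-back structure equations -/

section eval

variable {U : Opens (Coord 2)}

namespace SmoothFun

/-- Evaluation at a point. -/
def eval (u : U) : SmoothFun U →ₐ[ℝ] ℝ where
  toFun a := a.1 u
  map_one' := rfl
  map_mul' _ _ := rfl
  map_zero' := rfl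
  map_add' _ _ := rfl
  commutes' _ := rfl

theorem eval_mk {Φ : Coord 2 → ℝ} (h : ContDiffOn ℝ ∞ Φ U) (u : U) : eval u (mk Φ h) = Φ u := rfl

theorem eval_ext (a : SmoothFun U) (u : U) : ext a u = eval u a := ext_apply a u

theorem eq_of_eval {a b : SmoothFun U} (h : ∀ u, eval u a = eval u b) : a = b :=
  Subtype.ext (funext h)

theorem eval_partialD (i : Fin 2) (a : SmoothFun U) (u : U) :
    eval u (partialD U i a) = pd i (ext a) u := rfl

theorem eval_partialD_mk (i : Fin 2) {Φ : Coord 2 → ℝ} (h : ContDiffOn ℝ ∞ Φ U) (u : U) :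
    eval u (partialD U i (mk Φ h)) = pd i Φ u := by
  rw [partialD_mk, eval_mk]

end SmoothFun

end eval

section algHom

variable {A A' : Type*} [CommRing A] [CommRing A'] [Algebra ℝ A] [Algebra ℝ A']

theorem map_cross (φ : A →+* A') (v w : Fin 3 → A) :
    φ ∘ (v ⨯₃ w) = (φ ∘ v) ⨯₃ (φ ∘ w) := by
  apply ext_three <;> simp only [Function.comp_apply, cross_zero, cross_one, cross_two, map_sub,
    map_mul]

theorem map_dot (φ : A →+* A') (v w : Fin 3 → A) : φ (v ⬝ᵥ w) = (φ ∘ v) ⬝ᵥ (φ ∘ w) := by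
  simp only [dotProduct, map_sum, map_mul, Function.comp_apply]

end algHom

theorem pd_form {n : ℕ} {η : Coord n → Coord n →L[ℝ] ℝ} {F W : Coord 2 → Coord n} {u : Coord 2}
    (hη : DifferentiableAt ℝ η (F u)) (hF : DifferentiableAt ℝ F u) (hW : DifferentiableAt ℝ W u)
    (i : Fin 2) : pd i (fun v => η (F v) (W v)) u
      = fderiv ℝ (fun q => η q (W u)) (F u) (pd i F u) + η (F u) (pd i W u) := by
  have h₁ : HasFDerivAt (fun v => η (F v)) _ u := hη.hasFDerivAt.comp u hF.hasFDerivAt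
  have h₂ := h₁.clm_apply hW.hasFDerivAt
  have h₃ := hη.hasFDerivAt.clm_apply (hasFDerivAt_const (W u) (F u))
  rw [pd, h₂.fderiv, h₃.fderiv]
  simp [pd, add_comm]

namespace Coframe

variable {E : FiberedModel} {κ τ : ℝ} (K : Coframe E κ τ)

/-- The components of a vector in the orthonormal frame. -/
def coords (p X : Coord E.dim) : Fin 3 → ℝ := fun j => K.θ j p X

/-- The vector with given components. -/
def ofCoords (p : Coord E.dim) (v : Fin 3 → ℝ) : Coord E.dim := ∑ j, v j • K.frame j p

theorem ofCoords_mem {p : Coord E.dim} (hp : p ∈ E.carrier) (v : Fin 3 → ℝ) :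
    K.ofCoords p v ∈ E.tangent p :=
  Submodule.sum_mem _ fun j _ => Submodule.smul_mem _ _ (K.frame_mem p hp j)

theorem coords_ofCoords {p : Coord E.dim} (hp : p ∈ E.carrier) (v : Fin 3 → ℝ) :
    K.coords p (K.ofCoords p v) = v := by
  funext j
  simp [coords, ofCoords, K.θ_frame p hp]

theorem ofCoords_coords {p X : Coord E.dim} (hp : p ∈ E.carrier) (hX : X ∈ E.tangent p) :
    K.ofCoords p (K.coords p X) = X := (K.expand p hp X hX).symm

theorem metric_eq_dot {p X Y : Coord E.dim} (hp : p ∈ E.carrier) (hY : Y ∈ E.tangent p) :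
    E.metric p X Y = K.coords p X ⬝ᵥ K.coords p Y := K.metric_eq p hp X Y hY

theorem metric_xi {p Y : Coord E.dim} (hp : p ∈ E.carrier) (hY : Y ∈ E.tangent p) :
    E.metric p (E.xi p) Y = K.coords p Y 2 := by
  rw [K.metric_eq p hp _ _ hY, K.xi_eq p hp, Fin.sum_univ_three]
  simp [K.θ_frame p hp, coords]

variable (F : Coord 2 → Coord E.dim)

/-- The components of the covariant derivative `D_{∂ᵢ} ∂ⱼF` along a patch. -/
def coordCov (i j : Fin 2) (u : Coord 2) : Fin 3 → ℝ :=
  (fun l => pd i (fun v => K.coords (F v) (pd j F v) l) u)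
    + (τ • K.coords (F u) (pd i F u) + K.α (F u) (pd i F u) • vert ℝ)
      ⨯₃ K.coords (F u) (pd j F u)

end Coframe

/-- `F` is a smooth immersion of the open set `U` into `E`. -/
structure IsImmersedPatch (E : FiberedModel) (F : Coord 2 → Coord E.dim) (U : Opens (Coord 2)) :
    Prop where
  contDiffOn : ContDiffOn ℝ ∞ F U
  mem : ∀ u ∈ U, F u ∈ E.carrier
  injective : ∀ u ∈ U, Function.Injective (fderiv ℝ F u)

namespace IsImmersedPatch

variable {E : FiberedModel} {κ τ : ℝ} {F : Coord 2 → Coord E.dim} {U : Opens (Coord 2)}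
  (hP : IsImmersedPatch E F U) (K : Coframe E κ τ)

include hP

theorem contDiffAt {u : Coord 2} (hu : u ∈ U) : ContDiffAt ℝ ∞ F u :=
  hP.contDiffOn.contDiffAt (U.isOpen.mem_nhds hu)

theorem differentiableAt {u : Coord 2} (hu : u ∈ U) : DifferentiableAt ℝ F u :=
  (hP.contDiffAt hu).differentiableAt (by simp)

theorem differentiableAt_pd {u : Coord 2} (hu : u ∈ U) (i : Fin 2) :
    DifferentiableAt ℝ (pd i F) u :=
  ((contDiffOn_pd hP.contDiffOn i).contDiffAt (U.isOpen.mem_nhds hu)).differentiableAt (by simp)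

include K in
theorem pd_mem {u : Coord 2} (hu : u ∈ U) (i : Fin 2) : pd i F u ∈ E.tangent (F u) := by
  refine K.fderiv_mem F u (hP.differentiableAt hu) ?_ _
  filter_upwards [U.isOpen.mem_nhds hu] with v hv using hP.mem v hv

theorem mapsTo_dom : MapsTo F U K.dom := fun u hu => K.carrier_subset (hP.mem u hu)

theorem differentiableAt_θ {u : Coord 2} (hu : u ∈ U) (j : Fin 3) :
    DifferentiableAt ℝ (K.θ j) (F u) :=
  ((K.contDiffOn_θ j).contDiffAt (K.isOpen_dom.mem_nhds (hP.mapsTo_dom K hu))).differentiableAt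
    (by simp)

theorem differentiableAt_α {u : Coord 2} (hu : u ∈ U) : DifferentiableAt ℝ K.α (F u) :=
  (K.contDiffOn_α.contDiffAt (K.isOpen_dom.mem_nhds (hP.mapsTo_dom K hu))).differentiableAt
    (by simp)

theorem contDiffOn_coords {W : Coord 2 → Coord E.dim} (hW : ContDiffOn ℝ ∞ W U) (j : Fin 3) :
    ContDiffOn ℝ ∞ (fun u => K.coords (F u) (W u) j) U :=
  ((K.contDiffOn_θ j).comp hP.contDiffOn (hP.mapsTo_dom K)).clm_apply hW

/-- The components of `∂ᵢF`. -/
def vec (i : Fin 2) (j : Fin 3) : SmoothFun U :=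
  SmoothFun.mk (fun u => K.coords (F u) (pd i F u) j)
    (hP.contDiffOn_coords K (contDiffOn_pd hP.contDiffOn i) j)

/-- The connection form on `∂ᵢF`. -/
def conn (i : Fin 2) : SmoothFun U :=
  SmoothFun.mk (fun u => K.α (F u) (pd i F u))
    ((K.contDiffOn_α.comp hP.contDiffOn (hP.mapsTo_dom K)).clm_apply
      (contDiffOn_pd hP.contDiffOn i))

theorem eval_vec (u : U) (i : Fin 2) :
    SmoothFun.eval u ∘ hP.vec K i = K.coords (F u) (pd i F u) := rfl

theorem eval_cov (u : U) (i j : Fin 2) :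
    SmoothFun.eval u ∘ cov (partialD U i) (algebraMap ℝ _ τ) (hP.vec K i) (hP.conn K i)
      (hP.vec K j) = K.coordCov F i j u := by
  have h := map_cross (SmoothFun.eval u : SmoothFun U →+* ℝ)
    (algebraMap ℝ (SmoothFun U) τ • hP.vec K i + hP.conn K i • vert (SmoothFun U)) (hP.vec K j)
  funext l
  have hl := congrFun h l
  rw [Function.comp_apply, cov, Pi.add_apply, map_add, Coframe.coordCov, Pi.add_apply]
  refine congrArg₂ (· + ·) (SmoothFun.eval_partialD_mk _ _ _) (hl.trans ?_)
  congr 3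

theorem pd_coords {u : Coord 2} (hu : u ∈ U) (i j : Fin 2) (l : Fin 3) :
    pd i (fun v => K.coords (F v) (pd j F v) l) u
      = fderiv ℝ (fun q => K.θ l q (pd j F u)) (F u) (pd i F u)
        + K.θ l (F u) (pd i (pd j F) u) :=
  pd_form (hP.differentiableAt_θ K hu l) (hP.differentiableAt hu) (hP.differentiableAt_pd hu j) i

theorem coordCov_apply {u : Coord 2} (hu : u ∈ U) (i j : Fin 2) (l : Fin 3) :
    K.coordCov F i j u l = fderiv ℝ (fun q => K.θ l q (pd j F u)) (F u) (pd i F u)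
      + ((τ • (fun m => K.θ m (F u) (pd i F u)) + K.α (F u) (pd i F u) • vert ℝ) ⨯₃
        fun m => K.θ m (F u) (pd j F u)) l + K.θ l (F u) (pd i (pd j F) u) := by
  rw [Coframe.coordCov, Pi.add_apply, hP.pd_coords K hu, add_right_comm]
  rfl

/-- The structure equations pull back to the patch because the terms with ∂₀∂₁F and ∂₁∂₀F cancel. -/
theorem ambientEquations : AmbientEquations (partialD U) (algebraMap ℝ _ τ)
    (algebraMap ℝ _ (κ - 4 * τ ^ 2)) (hP.vec K) (hP.conn K) where
  comm := partialD_comm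
  torsion := by
    funext l
    refine SmoothFun.eq_of_eval fun u => ?_
    have h₀ := congrFun (hP.eval_cov K u 0 1) l
    have h₁ := congrFun (hP.eval_cov K u 1 0) l
    rw [Function.comp_apply] at h₀ h₁
    rw [h₀, h₁, hP.coordCov_apply K u.2, hP.coordCov_apply K u.2,
      K.torsion _ (hP.mem u u.2) _ (hP.pd_mem K u.2 0) _ (hP.pd_mem K u.2 1) l,
      pd_comm (hP.contDiffAt u.2)]
  curv := by
    refine SmoothFun.eq_of_eval fun u => ?_
    rw [map_sub, conn, conn, SmoothFun.eval_partialD_mk, SmoothFun.eval_partialD_mk,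
      pd_form (hP.differentiableAt_α K u.2) (hP.differentiableAt u.2)
        (hP.differentiableAt_pd u.2 _),
      pd_form (hP.differentiableAt_α K u.2) (hP.differentiableAt u.2)
        (hP.differentiableAt_pd u.2 _), pd_comm (hP.contDiffAt u.2) 1 0]
    have h := K.curv _ (hP.mem u u.2) _ (hP.pd_mem K u.2 0) _ (hP.pd_mem K u.2 1)
    change _ = -(κ - 4 * τ ^ 2) * (K.θ 0 (F u) (pd 0 F u) * K.θ 1 (F u) (pd 1 F u)
      - K.θ 1 (F u) (pd 0 F u) * K.θ 0 (F u) (pd 1 F u))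
    rw [← h]
    exact add_sub_add_right_eq_sub _ _ _
  deriv_tau i := partialD_algebraMap i _
  deriv_c i := partialD_algebraMap i _

theorem firstForm_eq {u : Coord 2} (hu : u ∈ U) (i j : Fin 2) :
    firstForm E.metric F u i j
      = K.coords (F u) (pd i F u) ⬝ᵥ K.coords (F u) (pd j F u) := by
  rw [firstForm, Matrix.of_apply, K.metric_eq_dot (hP.mem u hu) (hP.pd_mem K hu j)]

/-- Ties the definition by Christoffel symbols of the ambient metric to the connection of the
coframe. It relies on `koszul` for the tangent arguments and on `metric_eq` for the second
derivative, which may leave the tangent space. -/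
theorem secondForm_eq {u : Coord 2} (hu : u ∈ U) {ν : Coord E.dim} (hν : ν ∈ E.tangent (F u))
    (i j : Fin 2) :
    secondForm E.metric F ν u i j = K.coordCov F i j u ⬝ᵥ K.coords (F u) ν := by
  rw [secondForm, Matrix.of_apply, K.metric_eq_dot (hP.mem u hu) hν,
    K.koszul _ (hP.mem u hu) _ (hP.pd_mem K hu i) _ (hP.pd_mem K hu j) _ hν]
  simp only [dotProduct, ← Finset.sum_add_distrib, hP.coordCov_apply K hu]
  refine Finset.sum_congr rfl fun l _ => ?_
  simp only [Coframe.coords]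
  ring

end IsImmersedPatch

/-! ### Linear algebra: conjugate matrices, normals, Gram–Schmidt -/

theorem inv_mul_congr {n : Type*} [Fintype n] [DecidableEq n] {J g h : Matrix n n ℝ}
    (hJ : IsUnit J.det) : (J * g * Jᵀ)⁻¹ * (J * h * Jᵀ) = (Jᵀ)⁻¹ * (g⁻¹ * h) * Jᵀ := by
  rw [Matrix.mul_inv_rev, Matrix.mul_inv_rev]
  have : J⁻¹ * J = 1 := Matrix.nonsing_inv_mul _ hJ
  calc _ = (Jᵀ)⁻¹ * (g⁻¹ * (J⁻¹ * J) * (h * Jᵀ)) := by simp only [Matrix.mul_assoc]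
    _ = _ := by rw [this]; simp only [Matrix.mul_assoc, Matrix.mul_one]

theorem conj_sub_smul_one {n : Type*} [Fintype n] [DecidableEq n] {P S : Matrix n n ℝ}
    (hP : IsUnit P.det) (r : ℝ) : P⁻¹ * S * P - r • (1 : Matrix n n ℝ) = P⁻¹ * (S - r • 1) * P := by
  rw [Matrix.mul_sub, Matrix.sub_mul]
  simp [Matrix.nonsing_inv_mul _ hP]

theorem trace_conj {n : Type*} [Fintype n] [DecidableEq n] {P S : Matrix n n ℝ}
    (hP : IsUnit P.det) : (P⁻¹ * S * P).trace = S.trace := by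
  rw [Matrix.trace_mul_cycle, Matrix.mul_nonsing_inv _ hP, Matrix.one_mul]

theorem trace_conj_mul_self {n : Type*} [Fintype n] [DecidableEq n] {P S : Matrix n n ℝ}
    (hP : IsUnit P.det) : ((P⁻¹ * S * P) * (P⁻¹ * S * P)).trace = (S * S).trace := by
  have : (P⁻¹ * S * P) * (P⁻¹ * S * P) = P⁻¹ * (S * S) * P := by
    calc _ = P⁻¹ * S * (P * P⁻¹) * (S * P) := by simp only [Matrix.mul_assoc]
      _ = _ := by rw [Matrix.mul_nonsing_inv _ hP]; simp only [Matrix.mul_assoc, Matrix.one_mul]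
  rw [this, trace_conj hP]

/-- A vector of `ℝ³` orthogonal to two independent vectors is a multiple of their cross product. -/
theorem cross_smul_of_orthogonal {a b v : Fin 3 → ℝ} (ha : a ⬝ᵥ v = 0) (hb : b ⬝ᵥ v = 0) :
    ((a ⨯₃ b) ⬝ᵥ (a ⨯₃ b)) • v = ((a ⨯₃ b) ⬝ᵥ v) • (a ⨯₃ b) := by
  simp only [dotProduct, Fin.sum_univ_three] at ha hb
  apply ext_three <;>
  simp only [dotProduct, Fin.sum_univ_three, Pi.smul_apply, smul_eq_mul, cross_zero, cross_one,
    cross_two]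
  · linear_combination ((a 0 * b 1 - a 1 * b 0) * b 1 - (a 2 * b 0 - a 0 * b 2) * b 2) * ha
      - ((a 0 * b 1 - a 1 * b 0) * a 1 - (a 2 * b 0 - a 0 * b 2) * a 2) * hb
  · linear_combination ((a 1 * b 2 - a 2 * b 1) * b 2 - (a 0 * b 1 - a 1 * b 0) * b 0) * ha
      - ((a 1 * b 2 - a 2 * b 1) * a 2 - (a 0 * b 1 - a 1 * b 0) * a 0) * hb
  · linear_combination ((a 2 * b 0 - a 0 * b 2) * b 0 - (a 1 * b 2 - a 2 * b 1) * b 1) * ha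
      - ((a 2 * b 0 - a 0 * b 2) * a 0 - (a 1 * b 2 - a 2 * b 1) * a 1) * hb

theorem cross_dot_self (a b : Fin 3 → ℝ) :
    (a ⨯₃ b) ⬝ᵥ (a ⨯₃ b) = (a ⬝ᵥ a) * (b ⬝ᵥ b) - (a ⬝ᵥ b) * (b ⬝ᵥ a) := by
  rw [cross_dot_cross, dotProduct_comm b a]

theorem eq_or_eq_neg_of_orthogonal {a b v : Fin 3 → ℝ} {q : ℝ} (ha : a ⬝ᵥ v = 0)
    (hb : b ⬝ᵥ v = 0) (hv : v ⬝ᵥ v = 1) (hq : q ^ 2 * ((a ⨯₃ b) ⬝ᵥ (a ⨯₃ b)) = 1) :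
    v = q • (a ⨯₃ b) ∨ v = -(q • (a ⨯₃ b)) := by
  have h := cross_smul_of_orthogonal ha hb
  have hv' : v = (q ^ 2 * ((a ⨯₃ b) ⬝ᵥ v)) • (a ⨯₃ b) := by
    rw [mul_smul, ← h, smul_smul, hq, one_smul]
  have hs : (q * ((a ⨯₃ b) ⬝ᵥ v)) ^ 2 = 1 := by
    have := congrArg (· ⬝ᵥ v) hv'
    simp only [smul_dotProduct, smul_eq_mul, hv] at this
    rw [this]; ring
  rw [sq] at hs
  rcases mul_self_eq_one_iff.mp hs with h1 | h1
  · left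
    rw [show q ^ 2 * ((a ⨯₃ b) ⬝ᵥ v) = q * (q * ((a ⨯₃ b) ⬝ᵥ v)) by ring, h1, mul_one] at hv'
    exact hv'
  · right
    rw [show q ^ 2 * ((a ⨯₃ b) ⬝ᵥ v) = q * (q * ((a ⨯₃ b) ⬝ᵥ v)) by ring, h1, mul_neg, mul_one,
      neg_smul] at hv'
    exact hv'

theorem trace_inv_mul_fin_two (g h : Matrix (Fin 2) (Fin 2) ℝ) : (g⁻¹ * h).trace
    = (g.det)⁻¹ * (g 1 1 * h 0 0 - g 0 1 * h 1 0 - g 1 0 * h 0 1 + g 0 0 * h 1 1) := by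
  rw [Matrix.inv_def, Matrix.adjugate_fin_two, Matrix.trace_fin_two]
  simp [Matrix.mul_apply, Fin.sum_univ_two]
  ring

/-- The adapted frame whose first vector is tangent to the first coordinate direction. -/
theorem adaptedFrame_of_invSqrt {A : Type*} [CommRing A] [Algebra ℝ A] {x : Fin 2 → Fin 3 → A}
    {q r ε : A} (hq : q ^ 2 * ((x 0 ⨯₃ x 1) ⬝ᵥ (x 0 ⨯₃ x 1)) = 1) (hr : r ^ 2 * (x 0 ⬝ᵥ x 0) = 1)
    (hε : ε ^ 2 = 1) :
    AdaptedFrame x ![![r, 0], ![-(ε * q * r * (x 0 ⬝ᵥ x 1)), ε * q * r * (x 0 ⬝ᵥ x 0)]]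
      ![r • x 0, ((ε * q) • (x 0 ⨯₃ x 1)) ⨯₃ (r • x 0)] ((ε * q) • (x 0 ⨯₃ x 1)) where
  expand a := by
    fin_cases a
    · simp
    · simp only [Fin.mk_one, cons_val, map_smul, LinearMap.smul_apply,
        cross_cross_eq_smul_sub_smul, dotProduct_comm (x 1) (x 0)]
      module
  unit a := by
    fin_cases a
    · simp only [Fin.zero_eta, cons_val, smul_dotProduct, dotProduct_smul, smul_eq_mul]
      linear_combination hr
    · rw [cross_dot_cross] at hq
      simp only [Fin.mk_one, cons_val, cross_dot_cross, smul_dotProduct, dotProduct_smul,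
        smul_eq_mul, dotProduct_comm (x 0 ⨯₃ x 1) (x 0), dot_self_cross]
      linear_combination (ε ^ 2 * q ^ 2 * ((x 0 ⬝ᵥ x 0) * (x 1 ⬝ᵥ x 1)
        - (x 0 ⬝ᵥ x 1) * (x 1 ⬝ᵥ x 0))) * hr + ε ^ 2 * hq + hε
  orth := by
    simp only [cons_val, dot_cross_self]
  cross := by
    simp only [cons_val, cross_cross_eq_smul_sub_smul', smul_dotProduct, dotProduct_smul,
      dotProduct_comm (x 0 ⨯₃ x 1) (x 0), dot_self_cross, smul_eq_mul]
    rw [show r * (r * (x 0 ⬝ᵥ x 0)) = 1 by linear_combination hr]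
    simp
  det_unit := by
    refine IsUnit.of_mul_eq_one (ε * q * ((x 0 ⨯₃ x 1) ⬝ᵥ (x 0 ⨯₃ x 1))) ?_
    simp only [cons_val]
    linear_combination (ε ^ 2 * q ^ 2 * ((x 0 ⨯₃ x 1) ⬝ᵥ (x 0 ⨯₃ x 1))) * hr + ε ^ 2 * hq + hε

/-- The factor `q` is the inverse length of x₀ × x₁, so q|x₀ × x₁|² is this length itself, the area
density. The determinant of the coefficients is its reciprocal up to the sign `ε`. -/
theorem adaptedFrame_det {A : Type*} [CommRing A] [Algebra ℝ A] {x : Fin 2 → Fin 3 → A}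
    {q r ε : A} (hq : q ^ 2 * ((x 0 ⨯₃ x 1) ⬝ᵥ (x 0 ⨯₃ x 1)) = 1) (hr : r ^ 2 * (x 0 ⬝ᵥ x 0) = 1)
    (hε : ε ^ 2 = 1) {B : Fin 2 → Fin 2 → A}
    (hB : B = ![![r, 0], ![-(ε * q * r * (x 0 ⬝ᵥ x 1)), ε * q * r * (x 0 ⬝ᵥ x 0)]]) :
    (q * ((x 0 ⨯₃ x 1) ⬝ᵥ (x 0 ⨯₃ x 1))) ^ 2 * (B 0 0 * B 1 1 - B 0 1 * B 1 0) ^ 2 = 1 := by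
  rw [hB]
  simp only [cons_val]
  linear_combination (ε ^ 2 * q ^ 4 * ((x 0 ⨯₃ x 1) ⬝ᵥ (x 0 ⨯₃ x 1)) ^ 2
    * (r ^ 2 * (x 0 ⬝ᵥ x 0) + 1)) * hr
    + ε ^ 2 * (q ^ 2 * ((x 0 ⨯₃ x 1) ⬝ᵥ (x 0 ⨯₃ x 1)) + 1) * hq + hε

namespace SmoothFun

variable {U : Opens (Coord 2)}

theorem eval_dot (u : U) (v w : Fin 3 → SmoothFun U) :
    eval u (v ⬝ᵥ w) = (eval u ∘ v) ⬝ᵥ (eval u ∘ w) :=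
  map_dot (eval u : SmoothFun U →+* ℝ) v w

theorem eval_cross (u : U) (v w : Fin 3 → SmoothFun U) :
    eval u ∘ (v ⨯₃ w) = (eval u ∘ v) ⨯₃ (eval u ∘ w) :=
  map_cross (eval u : SmoothFun U →+* ℝ) v w

theorem eval_smul (u : U) (a : SmoothFun U) (v : Fin 3 → SmoothFun U) :
    eval u ∘ (a • v) = eval u a • (eval u ∘ v) := by
  funext j
  simp only [Function.comp_apply, Pi.smul_apply, smul_eq_mul, map_mul]

theorem exists_invSqrt (a : SmoothFun U) (h : ∀ u, 0 < eval u a) :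
    ∃ b : SmoothFun U, b ^ 2 * a = 1 ∧ ∀ u, eval u b = (√(eval u a))⁻¹ := by
  have hs : ContDiffOn ℝ ∞ (fun u => (√(ext a u))⁻¹) U := by
    refine ContDiffOn.inv ((contDiffOn_ext a).sqrt fun u hu => ?_) fun u hu => ?_
    · rw [eval_ext a ⟨u, hu⟩]; exact (h _).ne'
    · rw [eval_ext a ⟨u, hu⟩]; exact (Real.sqrt_pos.2 (h _)).ne'
  have he : ∀ u, eval u (mk _ hs) = (√(eval u a))⁻¹ := fun u => by rw [eval_mk, eval_ext]
  refine ⟨mk _ hs, eq_of_eval fun u => ?_, he⟩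
  rw [map_mul, map_pow, he, map_one, inv_pow, Real.sq_sqrt (h u).le, inv_mul_cancel₀ (h u).ne']

end SmoothFun

/-! ### Unit normals and adapted frames of a patch -/

/-- `ν` is a unit normal vector of the patch `F` at `u`. -/
structure IsPatchNormal (E : FiberedModel) (F : Coord 2 → Coord E.dim) (u : Coord 2)
    (ν : Coord E.dim) : Prop where
  mem_tangent : ν ∈ E.tangent (F u)
  unit : E.metric (F u) ν ν = 1
  normal : ∀ i, E.metric (F u) (pd i F u) ν = 0

namespace IsImmersedPatch

variable {E : FiberedModel} {κ τ : ℝ} {F : Coord 2 → Coord E.dim} {U : Opens (Coord 2)}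
  (hP : IsImmersedPatch E F U) (K : Coframe E κ τ)

include hP

/-- Only non-vanishing is at issue. The immersion makes the components of ∂₀F and ∂₁F independent.
-/
theorem cross_pos {u : Coord 2} (hu : u ∈ U) :
    0 < (K.coords (F u) (pd 0 F u) ⨯₃ K.coords (F u) (pd 1 F u))
      ⬝ᵥ (K.coords (F u) (pd 0 F u) ⨯₃ K.coords (F u) (pd 1 F u)) := by
  set a := K.coords (F u) (pd 0 F u) with ha
  set b := K.coords (F u) (pd 1 F u) with hb
  have hind : ∀ r s : ℝ, r • a + s • b = 0 → r = 0 ∧ s = 0 := by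
    intro r s h
    have h0 : K.coords (F u) (r • pd 0 F u + s • pd 1 F u) = 0 := by
      rw [← h]; funext j; simp [ha, hb, Coframe.coords]
    have hm : r • pd 0 F u + s • pd 1 F u ∈ E.tangent (F u) :=
      add_mem (Submodule.smul_mem _ _ (hP.pd_mem K hu 0)) (Submodule.smul_mem _ _ (hP.pd_mem K hu 1))
    have h1 := K.ofCoords_coords (hP.mem u hu) hm
    rw [h0] at h1
    have h2 : fderiv ℝ F u (r • EuclideanSpace.single 0 1 + s • EuclideanSpace.single 1 1)
        = fderiv ℝ F u 0 := by
      rw [map_add, map_smul, map_smul, map_zero]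
      exact h1.symm.trans (by simp [Coframe.ofCoords])
    have h3 := hP.injective u hu h2
    refine ⟨?_, ?_⟩
    · simpa using congrArg (fun v : Coord 2 => v 0) h3
    · simpa using congrArg (fun v : Coord 2 => v 1) h3
  have hnn : ∀ v : Fin 3 → ℝ, 0 ≤ v ⬝ᵥ v := fun v => by
    simp only [dotProduct, Fin.sum_univ_three]; nlinarith [sq_nonneg (v 0), sq_nonneg (v 1), sq_nonneg (v 2)]
  refine (hnn _).lt_of_ne' fun h => ?_
  -- Expanding (a × b) × a turns the vanishing of a × b into a linear relation between `a` and `b`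
  -- with coefficient |a|² at `b`.
  have hz : a ⨯₃ b = 0 := dotProduct_self_eq_zero.mp h
  have hc := cross_cross_eq_smul_sub_smul a b a
  rw [hz, map_zero, LinearMap.zero_apply] at hc
  obtain ⟨-, h1⟩ := hind (-(b ⬝ᵥ a)) (a ⬝ᵥ a) (by rw [hc]; module)
  have ha0 : a = 0 := dotProduct_self_eq_zero.mp h1
  simpa using (hind 1 0 (by simp [ha0])).1

theorem det_firstForm {u : Coord 2} (hu : u ∈ U) : (firstForm E.metric F u).det
    = (K.coords (F u) (pd 0 F u) ⨯₃ K.coords (F u) (pd 1 F u))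
      ⬝ᵥ (K.coords (F u) (pd 0 F u) ⨯₃ K.coords (F u) (pd 1 F u)) := by
  rw [Matrix.det_fin_two, hP.firstForm_eq K hu, hP.firstForm_eq K hu, hP.firstForm_eq K hu,
    hP.firstForm_eq K hu, cross_dot_self]

/-- With M the matrix of products of ∂ᵢF and eₐ one has g = MMᵀ and h = M(sk)Mᵀ, k being the form in
the frame, so g⁻¹h is conjugate to sk. The factor `s` admits a normal opposite to that of the frame.
-/
theorem shapeMatrix_eq {B : Fin 2 → Fin 2 → SmoothFun U} {e : Fin 2 → Fin 3 → SmoothFun U}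
    {y : Fin 3 → SmoothFun U} (hF : AdaptedFrame (hP.vec K) B e y) (u : U) {ν : Coord E.dim}
    (hν : ν ∈ E.tangent (F u)) (s : ℝ) (hs : K.coords (F u) ν = s • (SmoothFun.eval u ∘ y)) :
    ∃ P : Matrix (Fin 2) (Fin 2) ℝ, IsUnit P.det ∧ shapeMatrix E.metric F ν u
      = P⁻¹ * (s • Matrix.of fun a b => SmoothFun.eval u (frameForm (partialD U)
        (algebraMap ℝ _ τ) (hP.vec K) (hP.conn K) B e y a b)) * P := by
  set M : Matrix (Fin 2) (Fin 2) ℝ := Matrix.of fun i a => SmoothFun.eval u (hP.vec K i ⬝ᵥ e a)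
    with hM
  set k : Matrix (Fin 2) (Fin 2) ℝ := Matrix.of fun a b => SmoothFun.eval u (frameForm (partialD U)
        (algebraMap ℝ _ τ) (hP.vec K) (hP.conn K) B e y a b) with hk
  have hMu : IsUnit M.det := by
    have h := hF.dual_mul
    have h' : M * (Matrix.of fun a j => SmoothFun.eval u (B a j)) = 1 := by
      ext i j
      have := congrArg (SmoothFun.eval u) (congrFun₂ h i j)
      rw [Matrix.mul_apply, map_sum] at this
      simp only [map_mul, Matrix.one_apply] at this ⊢
      rw [Matrix.mul_apply]
      refine this.trans ?_
      split_ifs <;> simp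
    exact (Matrix.isUnit_iff_isUnit_det M).mp (IsUnit.of_mul_eq_one _ h')
  have h1 : firstForm E.metric F u = M * 1 * Mᵀ := by
    ext i j
    rw [hP.firstForm_eq K u.2, Matrix.mul_one, Matrix.mul_apply]
    have := congrArg (SmoothFun.eval u : SmoothFun U →+* ℝ) (hF.metric_eq i j)
    simp only [RingHom.coe_coe, SmoothFun.eval_dot, hP.eval_vec] at this
    rw [this]
    simp [hM, SmoothFun.eval_dot]
  have h2 : secondForm E.metric F ν u = M * (s • k) * Mᵀ := by
    ext i j
    rw [hP.secondForm_eq K u.2 hν, hs, dotProduct_smul, ← hP.eval_cov K u]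
    have := congrArg (SmoothFun.eval u : SmoothFun U →+* ℝ)
      (hF.coordForm_eq (D := partialD U) (τ := algebraMap ℝ _ τ) (α := hP.conn K) i j)
    rw [RingHom.coe_coe, coordForm, SmoothFun.eval_dot] at this
    rw [this]
    simp [hM, hk, Matrix.mul_apply, Fin.sum_univ_two]
    ring
  refine ⟨Mᵀ, by rwa [Matrix.det_transpose], ?_⟩
  rw [shapeMatrix, h1, h2, inv_mul_congr hMu, inv_one, Matrix.one_mul]

theorem isPatchNormal_coords {u : Coord 2} (hu : u ∈ U) {ν : Coord E.dim}
    (hν : IsPatchNormal E F u ν) : K.coords (F u) ν ⬝ᵥ K.coords (F u) ν = 1 ∧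
      ∀ i, K.coords (F u) (pd i F u) ⬝ᵥ K.coords (F u) ν = 0 := by
  refine ⟨?_, fun i => ?_⟩
  · rw [← K.metric_eq_dot (hP.mem u hu) hν.mem_tangent, hν.unit]
  · rw [← K.metric_eq_dot (hP.mem u hu) hν.mem_tangent, hν.normal]

theorem isPatchNormal_of_coords {u : Coord 2} (hu : u ∈ U) {v : Fin 3 → ℝ} (h : v ⬝ᵥ v = 1)
    (h' : ∀ i, K.coords (F u) (pd i F u) ⬝ᵥ v = 0) :
    IsPatchNormal E F u (K.ofCoords (F u) v) := by
  have hp := hP.mem u hu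
  have hm := K.ofCoords_mem hp v
  refine ⟨hm, ?_, fun i => ?_⟩
  · rw [K.metric_eq_dot hp hm, K.coords_ofCoords hp, h]
  · rw [K.metric_eq_dot hp hm, K.coords_ofCoords hp, h']

theorem eval_cross_dot (u : U) :
    SmoothFun.eval u ((hP.vec K 0 ⨯₃ hP.vec K 1) ⬝ᵥ (hP.vec K 0 ⨯₃ hP.vec K 1))
      = (firstForm E.metric F u).det := by
  rw [hP.det_firstForm K u.2, SmoothFun.eval_dot, SmoothFun.eval_cross, hP.eval_vec, hP.eval_vec]

include K in
theorem det_firstForm_pos {u : Coord 2} (hu : u ∈ U) : 0 < (firstForm E.metric F u).det := by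
  rw [hP.det_firstForm K hu]; exact hP.cross_pos K hu

theorem eval_vec_dot_pos (u : U) : 0 < SmoothFun.eval u (hP.vec K 0 ⬝ᵥ hP.vec K 0) := by
  have h1 := hP.cross_pos K u.2
  rw [cross_dot_self, dotProduct_comm (K.coords _ (pd 1 F u)) (K.coords _ (pd 0 F u))] at h1
  have hnn : ∀ v : Fin 3 → ℝ, 0 ≤ v ⬝ᵥ v := fun v => by
    simp only [dotProduct, Fin.sum_univ_three]
    nlinarith [sq_nonneg (v 0), sq_nonneg (v 1), sq_nonneg (v 2)]
  rw [SmoothFun.eval_dot, hP.eval_vec]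
  refine (hnn _).lt_of_ne' fun h3 => ?_
  rw [h3, zero_mul, zero_sub] at h1
  exact absurd (neg_pos.mp h1) (not_lt.2 (mul_self_nonneg _))

set_option maxHeartbeats 2000000 in
/-- The sign and the normalising factors of a smooth unit normal with prescribed mean curvature. -/
theorem exists_smooth_normal {H : ℝ} (hH : ∀ u ∈ U, ∃ ν, IsPatchNormal E F u ν ∧
      (shapeMatrix E.metric F ν u).trace = 2 * H) :
    ∃ q r ε : SmoothFun U,
      q ^ 2 * ((hP.vec K 0 ⨯₃ hP.vec K 1) ⬝ᵥ (hP.vec K 0 ⨯₃ hP.vec K 1)) = 1 ∧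
      r ^ 2 * (hP.vec K 0 ⬝ᵥ hP.vec K 0) = 1 ∧ ε ^ 2 = 1 ∧
      (∀ u : U, SmoothFun.eval u (q * ((hP.vec K 0 ⨯₃ hP.vec K 1) ⬝ᵥ (hP.vec K 0 ⨯₃ hP.vec K 1)))
        = √(firstForm E.metric F u).det) ∧
      ∀ u : U, ∀ ν, IsPatchNormal E F u ν → (shapeMatrix E.metric F ν u).trace = 2 * H →
        K.coords (F u) ν = SmoothFun.eval u ∘ ((ε * q) • (hP.vec K 0 ⨯₃ hP.vec K 1)) ∨
          (H = 0 ∧ K.coords (F u) ν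
            = -(SmoothFun.eval u ∘ ((ε * q) • (hP.vec K 0 ⨯₃ hP.vec K 1)))) := by
  have hG := hP.eval_cross_dot K
  have hGpos : ∀ u : U, 0 < (firstForm E.metric F u).det := fun u => hP.det_firstForm_pos K u.2
  have hg := hP.eval_vec_dot_pos K
  have hG' : ∀ u, 0 < SmoothFun.eval u
      ((hP.vec K 0 ⨯₃ hP.vec K 1) ⬝ᵥ (hP.vec K 0 ⨯₃ hP.vec K 1)) := fun u => by
    rw [hG]; exact hGpos u
  have hq := SmoothFun.exists_invSqrt _ hG'
  have hr := SmoothFun.exists_invSqrt _ hg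
  obtain ⟨q, hq, hq'⟩ := hq
  obtain ⟨r, hr, -⟩ := hr
  set x := hP.vec K with hx
  -- `n` is the unit normal in the orientation of the coordinates. Since q² = 1/det g, the function
  -- `m` below is the trace of the shape operator with respect to `n`.
  obtain ⟨n, hn⟩ : ∃ n, n = q • (x 0 ⨯₃ x 1) := ⟨_, rfl⟩
  obtain ⟨h, hh⟩ : ∃ h, h = coordForm (partialD U) (algebraMap ℝ _ τ) x (hP.conn K) n := ⟨_, rfl⟩
  obtain ⟨m, hm⟩ : ∃ m, m = q ^ 2 * ((x 1 ⬝ᵥ x 1) * h 0 0 - (x 0 ⬝ᵥ x 1) * h 1 0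
    - (x 1 ⬝ᵥ x 0) * h 0 1 + (x 0 ⬝ᵥ x 0) * h 1 1) := ⟨_, rfl⟩
  -- Every unit normal is ± n at each point, and the trace of its shape operator changes sign with
  -- it.
  have hnu : ∀ (u : U) (ν), IsPatchNormal E F u ν →
      ∃ s : ℝ, s ^ 2 = 1 ∧ K.coords (F u) ν = s • (SmoothFun.eval u ∘ n) ∧
        (shapeMatrix E.metric F ν u).trace = s * SmoothFun.eval u m := by
    intro u ν hν
    obtain ⟨h1, h2⟩ := hP.isPatchNormal_coords K u.2 hν
    have hqu : SmoothFun.eval u q ^ 2 * (firstForm E.metric F u).det = 1 := by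
      rw [← hG, ← map_pow, ← map_mul, hq, map_one]
    have hqu' := hqu
    rw [hP.det_firstForm K u.2] at hqu'
    have hnn : SmoothFun.eval u ∘ n = SmoothFun.eval u q •
        (K.coords (F u) (pd 0 F u) ⨯₃ K.coords (F u) (pd 1 F u)) := by
      rw [hn, SmoothFun.eval_smul, SmoothFun.eval_cross, hx, hP.eval_vec, hP.eval_vec]
    have hs : ∀ s : ℝ, K.coords (F u) ν = s • (SmoothFun.eval u ∘ n) →
        (shapeMatrix E.metric F ν u).trace = s * SmoothFun.eval u m := by
      intro s hs
      have hsec : ∀ i j, secondForm E.metric F ν u i j = s * SmoothFun.eval u (h i j) := by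
        intro i j
        rw [hP.secondForm_eq K u.2 hν.mem_tangent, hs, dotProduct_smul, ← hP.eval_cov K u,
          smul_eq_mul, hh, coordForm, SmoothFun.eval_dot]
      have hfir : ∀ i j, firstForm E.metric F u i j = SmoothFun.eval u (x i ⬝ᵥ x j) := by
        intro i j
        rw [hP.firstForm_eq K u.2, SmoothFun.eval_dot, hx, hP.eval_vec, hP.eval_vec]
      rw [shapeMatrix, trace_inv_mul_fin_two, inv_eq_of_mul_eq_one_left hqu]
      simp only [hsec, hfir, hm, map_mul, map_sub, map_add, map_pow]
      ring
    rcases eq_or_eq_neg_of_orthogonal (h2 0) (h2 1) h1 hqu' with h3 | h3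
    · have h4 : K.coords (F u) ν = (1 : ℝ) • (SmoothFun.eval u ∘ n) := by rw [hnn, one_smul, h3]
      exact ⟨1, by norm_num, h4, hs 1 h4⟩
    · have h4 : K.coords (F u) ν = (-1 : ℝ) • (SmoothFun.eval u ∘ n) := by
        rw [hnn, neg_one_smul, h3]
      exact ⟨-1, by norm_num, h4, hs (-1) h4⟩
  have hε : ∃ ε : SmoothFun U, ε ^ 2 = 1 ∧ ∀ (u : U) (ν), IsPatchNormal E F u ν →
      (shapeMatrix E.metric F ν u).trace = 2 * H →
        K.coords (F u) ν = SmoothFun.eval u ∘ (ε • n) ∨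
          (H = 0 ∧ K.coords (F u) ν = -(SmoothFun.eval u ∘ (ε • n))) := by
    -- For H = 0 the trace does not distinguish the two normals, and `n` itself serves. For H ≠ 0
    -- the condition s·m = 2H forces s = m/(2H), which is smooth and takes the values ±1.
    by_cases H0 : H = 0
    · refine ⟨1, one_pow _, fun u ν hν _ => ?_⟩
      obtain ⟨s, hs, h1, -⟩ := hnu u ν hν
      rw [sq] at hs
      rw [one_smul, h1]
      rcases mul_self_eq_one_iff.mp hs with rfl | rfl
      · left; rw [one_smul]
      · right; exact ⟨H0, by rw [neg_one_smul]⟩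
    · refine ⟨(1 / (2 * H)) • m, SmoothFun.eq_of_eval fun u => ?_, fun u ν hν ht => ?_⟩
      · obtain ⟨ν, hν, ht⟩ := hH u u.2
        obtain ⟨s, hs, -, h2⟩ := hnu u ν hν
        rw [h2] at ht
        have hm2 : SmoothFun.eval u m ^ 2 = (2 * H) ^ 2 := by
          rw [← ht, mul_pow, hs, one_mul]
        rw [map_pow, map_smul, map_one, smul_eq_mul, mul_pow, hm2]
        field_simp
      · left
        obtain ⟨s, hs, h1, h2⟩ := hnu u ν hν
        rw [h2] at ht
        have hm2 : SmoothFun.eval u m = s * (2 * H) := by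
          rw [← ht, ← mul_assoc, ← sq, hs, one_mul]
        rw [h1]
        rw [SmoothFun.eval_smul, map_smul, hm2, smul_eq_mul]
        congr 1
        field_simp
  obtain ⟨ε, hε, hcoord⟩ := hε
  have hy : (ε * q) • (x 0 ⨯₃ x 1) = ε • n := by rw [hn, smul_smul]
  refine ⟨q, r, ε, hq, hr, hε, fun u => ?_, by rwa [hy]⟩
  rw [map_mul, hq', hG, inv_mul_eq_div, Real.div_sqrt]

theorem frame_trace {H : ℝ} {B : Fin 2 → Fin 2 → SmoothFun U} {e : Fin 2 → Fin 3 → SmoothFun U}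
    {y : Fin 3 → SmoothFun U} (hF : AdaptedFrame (hP.vec K) B e y)
    (hH : ∀ u ∈ U, ∃ ν, IsPatchNormal E F u ν ∧ (shapeMatrix E.metric F ν u).trace = 2 * H)
    (hcoord : ∀ u : U, ∀ ν, IsPatchNormal E F u ν → (shapeMatrix E.metric F ν u).trace = 2 * H →
      K.coords (F u) ν = SmoothFun.eval u ∘ y ∨
        (H = 0 ∧ K.coords (F u) ν = -(SmoothFun.eval u ∘ y))) :
    frameForm (partialD U) (algebraMap ℝ _ τ) (hP.vec K) (hP.conn K) B e y 0 0
      + frameForm (partialD U) (algebraMap ℝ _ τ) (hP.vec K) (hP.conn K) B e y 1 1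
      = 2 * algebraMap ℝ _ H := by
  refine SmoothFun.eq_of_eval fun u => ?_
  obtain ⟨ν, hν, ht⟩ := hH u u.2
  have hr : SmoothFun.eval u (2 * algebraMap ℝ _ H) = 2 * H := by
    rw [two_mul, two_mul]; rfl
  rw [hr]
  refine (map_add (SmoothFun.eval u) _ _).trans ?_
  rcases hcoord u ν hν ht with h1 | ⟨h0, h1⟩
  · obtain ⟨P, hPu, h2⟩ := hP.shapeMatrix_eq K hF u hν.mem_tangent 1 (by rw [one_smul, h1])
    rw [h2, trace_conj hPu, one_smul, Matrix.trace_fin_two] at ht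
    exact ht
  · obtain ⟨P, hPu, h2⟩ := hP.shapeMatrix_eq K hF u hν.mem_tangent (-1)
      (by rw [neg_one_smul, h1])
    rw [h2, trace_conj hPu, Matrix.trace_smul, Matrix.trace_fin_two, h0, smul_eq_mul] at ht
    rw [h0, mul_zero]
    simp only [Matrix.of_apply] at ht
    linarith

/-- A smooth unit normal with the prescribed mean curvature, and an adapted frame. -/
theorem exists_adaptedFrame {H : ℝ} (hH : ∀ u ∈ U, ∃ ν, IsPatchNormal E F u ν ∧
      (shapeMatrix E.metric F ν u).trace = 2 * H) :
    ∃ (B : Fin 2 → Fin 2 → SmoothFun U) (e : Fin 2 → Fin 3 → SmoothFun U)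
      (y : Fin 3 → SmoothFun U) (ρ : SmoothFun U), AdaptedFrame (hP.vec K) B e y ∧
      ρ ^ 2 * (B 0 0 * B 1 1 - B 0 1 * B 1 0) ^ 2 = 1 ∧
      (∀ u : U, SmoothFun.eval u ρ = √(firstForm E.metric F u).det) ∧
      frameForm (partialD U) (algebraMap ℝ _ τ) (hP.vec K) (hP.conn K) B e y 0 0
        + frameForm (partialD U) (algebraMap ℝ _ τ) (hP.vec K) (hP.conn K) B e y 1 1
        = 2 * algebraMap ℝ _ H ∧
      ∀ u : U, ∀ ν, IsPatchNormal E F u ν → (shapeMatrix E.metric F ν u).trace = 2 * H →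
        K.coords (F u) ν = SmoothFun.eval u ∘ y ∨
          (H = 0 ∧ K.coords (F u) ν = -(SmoothFun.eval u ∘ y)) := by
  obtain ⟨q, r, ε, hq, hr, hε, hρ, hcoord⟩ := hP.exists_smooth_normal K hH
  have hF := adaptedFrame_of_invSqrt hq hr hε
  refine ⟨_, _, _, q * ((hP.vec K 0 ⨯₃ hP.vec K 1) ⬝ᵥ (hP.vec K 0 ⨯₃ hP.vec K 1)), hF, ?_, hρ, ?_, hcoord⟩
  · exact adaptedFrame_det hq hr hε rfl
  · exact hP.frame_trace K hF hH hcoord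

end IsImmersedPatch

/-! ### Change of chart -/

section chartChange

/-- The matrix of partial derivatives `∂ᵢφᵏ`. -/
def jacobian (φ : Coord 2 → Coord 2) (u : Coord 2) : Matrix (Fin 2) (Fin 2) ℝ :=
  Matrix.of fun i k => pd i φ u k

theorem pd_comp {V : Type*} [NormedAddCommGroup V] [NormedSpace ℝ V] {φ : Coord 2 → Coord 2}
    {a : Coord 2 → V} {u : Coord 2} (hφ : DifferentiableAt ℝ φ u)
    (ha : DifferentiableAt ℝ a (φ u)) (i : Fin 2) :
    pd i (a ∘ φ) u = jacobian φ u i 0 • pd 0 a (φ u) + jacobian φ u i 1 • pd 1 a (φ u) := by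
  have h : pd i φ u = jacobian φ u i 0 • EuclideanSpace.single 0 1
      + jacobian φ u i 1 • EuclideanSpace.single 1 1 := by
    ext k
    fin_cases k <;> simp [jacobian]
  rw [pd, fderiv_comp u ha hφ, ContinuousLinearMap.comp_apply]
  change fderiv ℝ a (φ u) (pd i φ u) = _
  rw [h, map_add, map_smul, map_smul]
  rfl

theorem pd_congr_nhds {V : Type*} [NormedAddCommGroup V] [NormedSpace ℝ V] {F G : Coord 2 → V}
    {u : Coord 2} (h : F =ᶠ[𝓝 u] G) (i : Fin 2) : pd i F u = pd i G u := by
  rw [pd, pd, h.fderiv_eq]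

variable {E : FiberedModel} {κ τ : ℝ} {F F' : Coord 2 → Coord E.dim} {U U' : Opens (Coord 2)}
  (hP : IsImmersedPatch E F U) (hP' : IsImmersedPatch E F' U') (K : Coframe E κ τ)
  {φ : Coord 2 → Coord 2} {u : Coord 2} (hu : u ∈ U) (hu' : φ u ∈ U') (hφ : ContDiffAt ℝ ∞ φ u)
  (hF : F =ᶠ[𝓝 u] F' ∘ φ)

include hP hP' hu hu' hφ hF

theorem pd_patch_eventually : ∀ᶠ v in 𝓝 u, φ v ∈ U' ∧ F v = F' (φ v) ∧ ∀ i,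
    pd i F v = jacobian φ v i 0 • pd 0 F' (φ v) + jacobian φ v i 1 • pd 1 F' (φ v) := by
  filter_upwards [hφ.continuousAt.preimage_mem_nhds (U'.isOpen.mem_nhds hu'),
    (hφ.of_le (m := 1) (by simp)).eventually (by simp), hF.eventually_nhds] with v h1 h2 h3
  refine ⟨h1, h3.self_of_nhds, fun i => ?_⟩
  rw [pd_congr_nhds h3, pd_comp (h2.differentiableAt (by simp)) (hP'.differentiableAt h1)]

theorem coords_patch_eventually : ∀ᶠ v in 𝓝 u, ∀ i,
    K.coords (F v) (pd i F v) = jacobian φ v i 0 • K.coords (F' (φ v)) (pd 0 F' (φ v))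
      + jacobian φ v i 1 • K.coords (F' (φ v)) (pd 1 F' (φ v)) := by
  filter_upwards [pd_patch_eventually hP hP' hu hu' hφ hF] with v ⟨_, h2, h3⟩ i
  funext m
  rw [h3, h2]
  simp [Coframe.coords]

include K in
theorem firstForm_chart_change :
    firstForm E.metric F u = jacobian φ u * firstForm E.metric F' (φ u) * (jacobian φ u)ᵀ := by
  have h := (coords_patch_eventually hP hP' K hu hu' hφ hF).self_of_nhds
  ext i j
  rw [hP.firstForm_eq K hu, h, h]
  simp only [Matrix.mul_apply, Fin.sum_univ_two, Matrix.transpose_apply, hP'.firstForm_eq K hu',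
    add_dotProduct, dotProduct_add, smul_dotProduct, dotProduct_smul, smul_eq_mul]
  ring

include K in
theorem isUnit_det_jacobian : IsUnit (jacobian φ u).det := by
  have h := hP.det_firstForm_pos K hu
  rw [firstForm_chart_change hP hP' K hu hu' hφ hF, det_mul, det_mul] at h
  exact isUnit_iff_ne_zero.2 fun h0 => by simp [h0] at h

/-- The connection is not tensorial in `j`: the derivatives of the Jacobian appear. They multiply
tangent vectors only, so they disappear when paired with a normal. -/
theorem coordCov_chart_change (i j : Fin 2) : ∃ r s : ℝ, K.coordCov F i j u
    = (∑ k, ∑ l, (jacobian φ u i k * jacobian φ u j l) • K.coordCov F' k l (φ u))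
      + r • K.coords (F' (φ u)) (pd 0 F' (φ u)) + s • K.coords (F' (φ u)) (pd 1 F' (φ u)) := by
  have h := coords_patch_eventually hP hP' K hu hu' hφ hF
  have hd := hφ.differentiableAt (by simp)
  have hJ : ∀ j l, DifferentiableAt ℝ (fun v => jacobian φ v j l) u := by
    intro j l
    have h1 : ContDiffAt ℝ ∞ (fun v => fderiv ℝ φ v (EuclideanSpace.single j 1)) u :=
      (hφ.fderiv_right (m := ∞) (by simp)).clm_apply contDiffAt_const
    exact (((contDiffAt_euclidean.1 h1) l).differentiableAt (by simp))
  have ha : ∀ (l : Fin 2) (m : Fin 3),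
      DifferentiableAt ℝ (fun v => K.coords (F' v) (pd l F' v) m) (φ u) := fun l m =>
    ((hP'.contDiffOn_coords K (contDiffOn_pd hP'.contDiffOn l) m).contDiffAt
      (U'.isOpen.mem_nhds hu')).differentiableAt (by simp)
  refine ⟨pd i (fun v => jacobian φ v j 0) u, pd i (fun v => jacobian φ v j 1) u, ?_⟩
  have hpd : ∀ m, pd i (fun v => K.coords (F v) (pd j F v) m) u
      = pd i (fun v => jacobian φ v j 0) u * K.coords (F' (φ u)) (pd 0 F' (φ u)) m
      + pd i (fun v => jacobian φ v j 1) u * K.coords (F' (φ u)) (pd 1 F' (φ u)) m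
      + ∑ k, ∑ l, jacobian φ u i k * jacobian φ u j l
        * pd k (fun v => K.coords (F' v) (pd l F' v) m) (φ u) := by
    intro m
    have e : (fun v => K.coords (F v) (pd j F v) m) =ᶠ[𝓝 u] fun v =>
        jacobian φ v j 0 * ((fun v => K.coords (F' v) (pd 0 F' v) m) ∘ φ) v
        + jacobian φ v j 1 * ((fun v => K.coords (F' v) (pd 1 F' v) m) ∘ φ) v := by
      filter_upwards [h] with v hv
      rw [hv]; rfl
    have c0 := (ha 0 m).comp u hd
    have c1 := (ha 1 m).comp u hd
    have p0 := pd_comp hd (ha 0 m) i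
    have p1 := pd_comp hd (ha 1 m) i
    rw [pd_congr_nhds e]
    have s := ((hJ j 0).hasFDerivAt.mul c0.hasFDerivAt).add ((hJ j 1).hasFDerivAt.mul c1.hasFDerivAt)
    rw [pd] at p0 p1
    rw [pd]
    erw [s.fderiv]
    simp only [_root_.add_apply, _root_.smul_apply, smul_eq_mul, p0, p1, Fin.sum_univ_two,
      Function.comp_apply]
    simp only [pd]
    ring
  have hF0 := (pd_patch_eventually hP hP' hu hu' hφ hF).self_of_nhds
  have hα : K.α (F u) (pd i F u) = jacobian φ u i 0 * K.α (F' (φ u)) (pd 0 F' (φ u))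
      + jacobian φ u i 1 * K.α (F' (φ u)) (pd 1 F' (φ u)) := by
    rw [hF0.2.2, hF0.2.1, map_add, map_smul, map_smul, smul_eq_mul, smul_eq_mul]
  have hx := h.self_of_nhds
  funext m
  simp only [Coframe.coordCov, Pi.add_apply, Pi.smul_apply, smul_eq_mul, hpd, hα, hx i, hx j,
    Fin.sum_univ_two, map_add, map_smul, LinearMap.add_apply, LinearMap.smul_apply]
  ring

include K in
theorem secondForm_chart_change {ν : Coord E.dim} (hν : IsPatchNormal E F' (φ u) ν) :
    secondForm E.metric F ν u
      = jacobian φ u * secondForm E.metric F' ν (φ u) * (jacobian φ u)ᵀ := by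
  have hFu : F u = F' (φ u) := hF.self_of_nhds
  have hn := (hP'.isPatchNormal_coords K hu' hν).2
  ext i j
  obtain ⟨r, s, h⟩ := coordCov_chart_change hP hP' K hu hu' hφ hF i j
  rw [hP.secondForm_eq K hu (by rw [hFu]; exact hν.mem_tangent), h, hFu]
  simp only [Matrix.mul_apply, Fin.sum_univ_two, Matrix.transpose_apply,
    hP'.secondForm_eq K hu' hν.mem_tangent,
    add_dotProduct, smul_dotProduct, smul_eq_mul, hn]
  ring

include K in
theorem shapeMatrix_chart_change {ν : Coord E.dim} (hν : IsPatchNormal E F' (φ u) ν) :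
    ∃ P : Matrix (Fin 2) (Fin 2) ℝ, IsUnit P.det ∧
      shapeMatrix E.metric F ν u = P⁻¹ * shapeMatrix E.metric F' ν (φ u) * P := by
  have hJ := isUnit_det_jacobian hP hP' K hu hu' hφ hF
  refine ⟨(jacobian φ u)ᵀ, by rwa [det_transpose], ?_⟩
  rw [shapeMatrix, shapeMatrix, firstForm_chart_change hP hP' K hu hu' hφ hF,
    secondForm_chart_change hP hP' K hu hu' hφ hF hν, inv_mul_congr hJ]

end chartChange

/-- The pairing of a covector `p` with the vector field of Simons' formula, whose gradient part is
given by the covector `w`; `ξ` is the covector dual to the tangential part of the vertical field,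
`n` the vertical component of `∂₀F × ∂₁F`. -/
def fieldPairing (τ c : ℝ) (g : Matrix (Fin 2) (Fin 2) ℝ) (w ξ : Fin 2 → ℝ) (n : ℝ)
    (p : Fin 2 → ℝ) : ℝ :=
  p ⬝ᵥ (g⁻¹ *ᵥ w) + 2 * c * τ * (n / g.det) * (p 0 * ξ 1 - p 1 * ξ 0)

/-- In the rotated term, `n` and the 2 × 2 determinant of `p` and `ξ` each acquire a factor det J,
while det g acquires its square. Hence the expression is invariant also when the orientation is
reversed. -/
theorem fieldPairing_congr {τ c n : ℝ} {J g : Matrix (Fin 2) (Fin 2) ℝ} {w ξ p : Fin 2 → ℝ}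
    (hJ : IsUnit J.det) : fieldPairing τ c (J * g * Jᵀ) (J *ᵥ w) (J *ᵥ ξ) (J.det * n) (J *ᵥ p)
      = fieldPairing τ c g w ξ n p := by
  have h1 : (J *ᵥ p) ⬝ᵥ ((J * g * Jᵀ)⁻¹ *ᵥ (J *ᵥ w)) = p ⬝ᵥ (g⁻¹ *ᵥ w) := by
    rw [Matrix.mul_inv_rev, Matrix.mul_inv_rev, Matrix.mulVec_mulVec, Matrix.mul_assoc,
      Matrix.mul_assoc, Matrix.nonsing_inv_mul _ hJ, Matrix.mul_one, ← Matrix.mulVec_mulVec,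
      Matrix.dotProduct_mulVec, ← Matrix.mulVec_transpose, Matrix.mulVec_mulVec,
      ← Matrix.transpose_nonsing_inv, Matrix.transpose_transpose, Matrix.nonsing_inv_mul _ hJ,
      Matrix.one_mulVec]
  have h2 : (J *ᵥ p) 0 * (J *ᵥ ξ) 1 - (J *ᵥ p) 1 * (J *ᵥ ξ) 0 = J.det * (p 0 * ξ 1 - p 1 * ξ 0) := by
    simp only [Matrix.mulVec, dotProduct, Fin.sum_univ_two, Matrix.det_fin_two]
    ring
  have h0 : J.det ≠ 0 := hJ.ne_zero
  rw [fieldPairing, fieldPairing, h1, h2, det_mul, det_mul, det_transpose]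
  congr 1
  by_cases hg : g.det = 0
  · simp [hg]
  · field_simp

theorem fieldPairing_zero (τ c n : ℝ) (g : Matrix (Fin 2) (Fin 2) ℝ) (w ξ : Fin 2 → ℝ) :
    fieldPairing τ c g w ξ n 0 = 0 := by
  simp [fieldPairing]

theorem fieldPairing_sum {ι : Type*} (s : Finset ι) (τ c n : ℝ) (g : Matrix (Fin 2) (Fin 2) ℝ)
    (w ξ : Fin 2 → ℝ) (p : ι → Fin 2 → ℝ) :
    fieldPairing τ c g w ξ n (∑ i ∈ s, p i) = ∑ i ∈ s, fieldPairing τ c g w ξ n (p i) := by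
  simp only [fieldPairing, sum_dotProduct, Finset.sum_add_distrib, Finset.sum_apply,
    Finset.sum_mul, ← Finset.sum_sub_distrib, Finset.mul_sum]

/-! ### Immersed surfaces read in charts -/

section manifold

variable {M : Type*} [TopologicalSpace M] [ChartedSpace (Coord 2) M] [IsManifold (𝓡 2) ∞ M]

/-- The image of the chart at `p`. -/
def chartOpens (p : M) : Opens (Coord 2) :=
  ⟨(chartAt (Coord 2) p).target, (chartAt (Coord 2) p).open_target⟩

theorem contDiffOn_comp_chart_symm {V : Type*} [NormedAddCommGroup V] [NormedSpace ℝ V] {g : M → V}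
    {s : Set M} (hg : ContMDiffOn (𝓡 2) 𝓘(ℝ, V) ∞ g s) (p : M) :
    ContDiffOn ℝ ∞ (g ∘ (chartAt (Coord 2) p).symm)
      ((chartAt (Coord 2) p).target ∩ (chartAt (Coord 2) p).symm ⁻¹' s) := by
  rw [← contMDiffOn_iff_contDiffOn]
  exact hg.comp ((contMDiffOn_chart_symm (n := ∞)).mono inter_subset_left) inter_subset_right

theorem contDiffOn_comp_chart_symm' {V : Type*} [NormedAddCommGroup V] [NormedSpace ℝ V] {g : M → V}
    (hg : ContMDiff (𝓡 2) 𝓘(ℝ, V) ∞ g) (p : M) :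
    ContDiffOn ℝ ∞ (g ∘ (chartAt (Coord 2) p).symm) (chartAt (Coord 2) p).target := by
  simpa using contDiffOn_comp_chart_symm (s := univ) hg.contMDiffOn p

theorem contDiffAt_transition (p p' : M) {u : Coord 2} (hu : u ∈ (chartAt (Coord 2) p).target)
    (hu' : (chartAt (Coord 2) p).symm u ∈ (chartAt (Coord 2) p').source) :
    ContDiffAt ℝ ∞ (chartAt (Coord 2) p' ∘ (chartAt (Coord 2) p).symm) u := by
  have h := contDiffOn_comp_chart_symm (contMDiffOn_chart (I := 𝓡 2) (n := ∞) (x := p')) p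
  exact h.contDiffAt (((chartAt (Coord 2) p).isOpen_inter_preimage_symm
    (chartAt (Coord 2) p').open_source).mem_nhds ⟨hu, hu'⟩)

theorem comp_chart_symm_eventuallyEq {V : Type*} (g : M → V) (p p' : M) {u : Coord 2}
    (hu : u ∈ (chartAt (Coord 2) p).target)
    (hu' : (chartAt (Coord 2) p).symm u ∈ (chartAt (Coord 2) p').source) :
    g ∘ (chartAt (Coord 2) p).symm =ᶠ[𝓝 u] (g ∘ (chartAt (Coord 2) p').symm)
      ∘ (chartAt (Coord 2) p' ∘ (chartAt (Coord 2) p).symm) := by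
  filter_upwards [((chartAt (Coord 2) p).isOpen_inter_preimage_symm
    (chartAt (Coord 2) p').open_source).mem_nhds ⟨hu, hu'⟩] with v hv
  simp only [Function.comp_apply]
  rw [(chartAt (Coord 2) p').left_inv hv.2]

variable {E : FiberedModel} {f : M → Coord E.dim} (hf : IsSmoothImmersion E f)

include hf

theorem fderiv_patch (p : M) {u : Coord 2} (hu : u ∈ (chartAt (Coord 2) p).target) (v : Coord 2) :
    fderiv ℝ (patch E f p) u v
      = mfderiv (𝓡 2) 𝓘(ℝ, Coord E.dim) f ((chartAt (Coord 2) p).symm u)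
        (mfderiv (𝓡 2) (𝓡 2) (chartAt (Coord 2) p).symm u v) := by
  have : IsManifold (𝓡 2) 1 M := .of_le (n := ∞) (by simp)
  rw [← mfderiv_eq_fderiv, patch, mfderiv_comp u (hf.contMDiff.mdifferentiable (by simp) _)
    ((mdifferentiable_chart p).symm.mdifferentiableAt hu)]
  rfl

theorem isImmersedPatch (p : M) : IsImmersedPatch E (patch E f p) (chartOpens p) where
  contDiffOn := contDiffOn_comp_chart_symm' hf.contMDiff p
  mem u _ := hf.mem_carrier _
  injective u hu := by
    have : IsManifold (𝓡 2) 1 M := .of_le (n := ∞) (by simp)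
    intro v w h
    rw [fderiv_patch hf p hu, fderiv_patch hf p hu] at h
    exact (mdifferentiable_chart p).symm.mfderiv_injective hu (hf.injective_mfderiv _ h)

theorem isPatchNormal_iff (K : Coframe E κ τ) (p : M) {u : Coord 2}
    (hu : u ∈ (chartAt (Coord 2) p).target) (ν : Coord E.dim) :
    IsUnitNormal E f ((chartAt (Coord 2) p).symm u) ν ↔ IsPatchNormal E (patch E f p) u ν := by
  have : IsManifold (𝓡 2) 1 M := .of_le (n := ∞) (by simp)
  have hP := isImmersedPatch hf p
  constructor
  · intro h
    exact ⟨h.mem_tangent, h.unit, fun i => by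
      rw [pd, fderiv_patch hf p hu]; exact h.normal _⟩
  · intro h
    refine ⟨h.mem_tangent, h.unit, fun v => ?_⟩
    obtain ⟨w, rfl⟩ := (mdifferentiable_chart p).symm.mfderiv_surjective hu v
    refine (congrArg (fun X : Coord E.dim => E.metric (f ((chartAt (Coord 2) p).symm u)) X ν)
      (fderiv_patch hf p hu w).symm).trans ?_
    change Coord 2 at w
    have hw : w = w 0 • EuclideanSpace.single 0 1 + w 1 • EuclideanSpace.single 1 1 := by
      ext k; fin_cases k <;> simp
    have h0 := (hP.isPatchNormal_coords K hu h).2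
    change E.metric (patch E f p u) _ _ = 0
    rw [K.metric_eq_dot (hP.mem u hu) h.mem_tangent]
    have : K.coords (patch E f p u) (fderiv ℝ (patch E f p) u w)
        = w 0 • K.coords (patch E f p u) (pd 0 (patch E f p) u)
          + w 1 • K.coords (patch E f p u) (pd 1 (patch E f p) u) := by
      conv_lhs => rw [hw]
      funext j
      simp [Coframe.coords, pd]
    rw [this, add_dotProduct, smul_dotProduct, smul_dotProduct, h0, h0]
    simp

/-- The shape operator at a point can be computed in any chart, up to conjugation. -/
theorem shapeOperator_conj (K : Coframe E κ τ) (p : M) {u : Coord 2}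
    (hu : u ∈ (chartAt (Coord 2) p).target) {ν : Coord E.dim}
    (hν : IsUnitNormal E f ((chartAt (Coord 2) p).symm u) ν) :
    ∃ P : Matrix (Fin 2) (Fin 2) ℝ, IsUnit P.det ∧ shapeMatrix E.metric (patch E f p) ν u
      = P⁻¹ * shapeOperator E f ((chartAt (Coord 2) p).symm u) ν * P := by
  set q := (chartAt (Coord 2) p).symm u with hq
  have hu' : q ∈ (chartAt (Coord 2) q).source := mem_chart_source _ q
  have ht : chartAt (Coord 2) q q ∈ (chartAt (Coord 2) q).target := mem_chart_target _ q
  refine shapeMatrix_chart_change (isImmersedPatch hf p) (isImmersedPatch hf q) K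
    (φ := chartAt (Coord 2) q ∘ (chartAt (Coord 2) p).symm) hu ht
    (contDiffAt_transition p q hu hu') (comp_chart_symm_eventuallyEq f p q hu hu') ?_
  refine (isPatchNormal_iff hf K q ht ν).1 ?_
  rwa [(chartAt (Coord 2) q).left_inv hu']

variable {N : M → Coord E.dim} {H : ℝ} (hN : ∀ p, IsUnitNormal E f p (N p))
  (hH : HasConstantMeanCurvature E f N H)

include hN hH

/-- The hypothesis uses at each point the chart centred there. Conjugation invariance of the trace
carries it over to one fixed chart. -/
theorem patch_meanCurvature (K : Coframe E κ τ) (p : M) {u : Coord 2} (hu : u ∈ chartOpens p) :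
    IsPatchNormal E (patch E f p) u (N ((chartAt (Coord 2) p).symm u)) ∧
      (shapeMatrix E.metric (patch E f p) (N ((chartAt (Coord 2) p).symm u)) u).trace = 2 * H := by
  refine ⟨(isPatchNormal_iff hf K p hu _).1 (hN _), ?_⟩
  obtain ⟨P, hP, h⟩ := shapeOperator_conj hf K p hu (hN _)
  rw [h, trace_conj hP, hH]

theorem normSqA_eq (q : M) : normSqA E f N q = normSqPhi E f N H q + 2 * H ^ 2 := by
  have h := hH q
  rw [Matrix.trace_fin_two] at h
  simp only [normSqA, normSqPhi, Matrix.trace_fin_two, Matrix.mul_apply, Fin.sum_univ_two,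
    Matrix.sub_apply, Matrix.smul_apply, smul_eq_mul, Matrix.one_apply_eq, ne_eq, zero_ne_one,
    one_ne_zero, not_false_eq_true, Matrix.one_apply_ne]
  linear_combination 2 * H * h

end manifold

/-! ### Adapted frames in the charts of the surface -/

/-- Data in the chart at `p`: a smooth normal `y` of mean curvature `H`, an adapted frame `e` and
the area density `ρ`. -/
structure ChartFrame {M : Type*} [TopologicalSpace M] [ChartedSpace (Coord 2) M]
    [IsManifold (𝓡 2) ∞ M] {E : FiberedModel} {κ τ : ℝ} (K : Coframe E κ τ) {f : M → Coord E.dim}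
    (hf : IsSmoothImmersion E f) (N : M → Coord E.dim) (H : ℝ) (p : M) where
  B : Fin 2 → Fin 2 → SmoothFun (chartOpens p)
  e : Fin 2 → Fin 3 → SmoothFun (chartOpens p)
  y : Fin 3 → SmoothFun (chartOpens p)
  ρ : SmoothFun (chartOpens p)
  frame : AdaptedFrame ((isImmersedPatch hf p).vec K) B e y
  density : ρ ^ 2 * (B 0 0 * B 1 1 - B 0 1 * B 1 0) ^ 2 = 1
  density_eq : ∀ u, SmoothFun.eval u ρ = √(firstForm E.metric (patch E f p) u).det
  trace : frameForm (partialD _) (algebraMap ℝ _ τ) ((isImmersedPatch hf p).vec K)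
      ((isImmersedPatch hf p).conn K) B e y 0 0
    + frameForm (partialD _) (algebraMap ℝ _ τ) ((isImmersedPatch hf p).vec K)
      ((isImmersedPatch hf p).conn K) B e y 1 1 = 2 * algebraMap ℝ _ H
  coords_eq : ∀ u : chartOpens p, K.coords (patch E f p u) (N ((chartAt (Coord 2) p).symm u))
      = SmoothFun.eval u ∘ y ∨ (H = 0 ∧
        K.coords (patch E f p u) (N ((chartAt (Coord 2) p).symm u)) = -(SmoothFun.eval u ∘ y))

section chartFrame

variable {M : Type*} [TopologicalSpace M] [ChartedSpace (Coord 2) M] [IsManifold (𝓡 2) ∞ M]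
  {E : FiberedModel} {κ τ : ℝ} (K : Coframe E κ τ) {f N : M → Coord E.dim} {H : ℝ}
  (hf : IsSmoothImmersion E f) (hN : ∀ p, IsUnitNormal E f p (N p))

/-- The data of `ChartFrame` exist. -/
def chartFrame (hH : HasConstantMeanCurvature E f N H) (p : M) : ChartFrame K hf N H p :=
  Classical.choice <| by
    obtain ⟨B, e, y, ρ, h1, h2, h3, h4, h5⟩ := (isImmersedPatch hf p).exists_adaptedFrame K (H := H)
      fun u hu => ⟨_, patch_meanCurvature hf hN hH K p hu⟩
    exact ⟨⟨B, e, y, ρ, h1, h2, h3, h4, fun u =>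
      h5 u _ (patch_meanCurvature hf hN hH K p u.2).1 (patch_meanCurvature hf hN hH K p u.2).2⟩⟩

namespace ChartFrame

variable {K hf} {p : M} (C : ChartFrame K hf N H p)

/-- `|Φ|²/2` in the chart. -/
def halfNorm : SmoothFun (chartOpens p) :=
  AdaptedFrame.halfNormSq (partialD _) (algebraMap ℝ _ τ) (algebraMap ℝ _ H)
    ((isImmersedPatch hf p).vec K) ((isImmersedPatch hf p).conn K) C.B C.e C.y

include hN

theorem angle_eq (u : chartOpens p) :
    angle E f N ((chartAt (Coord 2) p).symm u) = SmoothFun.eval u (C.y 2) ∨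
      (H = 0 ∧ angle E f N ((chartAt (Coord 2) p).symm u) = -SmoothFun.eval u (C.y 2)) := by
  have h : angle E f N ((chartAt (Coord 2) p).symm u)
      = K.coords (patch E f p u) (N ((chartAt (Coord 2) p).symm u)) 2 :=
    K.metric_xi (hf.mem_carrier _) (hN _).mem_tangent
  rw [h]
  rcases C.coords_eq u with h1 | ⟨h0, h1⟩
  · exact .inl (by rw [h1]; rfl)
  · exact .inr ⟨h0, by rw [h1]; rfl⟩

/-- For H = 0 the given normal may jump between the two signs, so C itself need not be smooth. The
invariant quantities C² and HC are all that is used of it. -/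
theorem angle_sq (u : chartOpens p) : angle E f N ((chartAt (Coord 2) p).symm u) ^ 2
    = SmoothFun.eval u (C.y 2) ^ 2 := by
  rcases C.angle_eq hN u with h | ⟨-, h⟩ <;> rw [h]
  ring

theorem mul_angle (u : chartOpens p) : H * angle E f N ((chartAt (Coord 2) p).symm u)
    = H * SmoothFun.eval u (C.y 2) := by
  rcases C.angle_eq hN u with h | ⟨h0, h⟩ <;> rw [h]
  simp [h0]

theorem normSqPhi_eq (u : chartOpens p) :
    normSqPhi E f N H ((chartAt (Coord 2) p).symm u) = 2 * SmoothFun.eval u C.halfNorm := by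
  obtain ⟨P, hP, h1⟩ := shapeOperator_conj hf K p u.2 (hN _)
  -- The relation s·H = H holds also for s = -1, which occurs only with H = 0. It makes the
  -- traceless parts with respect to the two normals agree up to the sign `s`.
  have hs : ∃ s : ℝ, s ^ 2 = 1 ∧ s * H = H ∧
      K.coords (patch E f p u) (N ((chartAt (Coord 2) p).symm u))
        = s • (SmoothFun.eval u ∘ C.y) := by
    rcases C.coords_eq u with h | ⟨h0, h⟩
    · exact ⟨1, by norm_num, one_mul _, by rw [h, one_smul]⟩
    · exact ⟨-1, by norm_num, by rw [h0, mul_zero], by rw [h, neg_one_smul]⟩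
  obtain ⟨s, hs, hsH, hc⟩ := hs
  obtain ⟨Q, hQ, h2⟩ := (isImmersedPatch hf p).shapeMatrix_eq K C.frame u (hN _).mem_tangent s hc
  have h3 := trace_conj_mul_self (S := shapeOperator E f ((chartAt (Coord 2) p).symm u)
    (N ((chartAt (Coord 2) p).symm u)) - H • 1) hP
  rw [← conj_sub_smul_one hP, ← h1, h2, conj_sub_smul_one hQ, trace_conj_mul_self hQ] at h3
  rw [normSqPhi, ← h3]
  have ht := congrArg (SmoothFun.eval u) C.trace
  have hsym := C.frame.frameForm_symm (D := partialD _) ((isImmersedPatch hf p).ambientEquations K)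
  rw [two_mul] at ht
  replace ht := (map_add (SmoothFun.eval u) _ _).symm.trans ht
  replace ht : _ = H + H := ht
  rw [halfNorm, AdaptedFrame.halfNormSq]
  generalize frameForm (partialD _) (algebraMap ℝ _ τ) ((isImmersedPatch hf p).vec K)
      ((isImmersedPatch hf p).conn K) C.B C.e C.y = k at *
  rw [map_add, map_pow, map_pow, map_sub, AlgHom.commutes, Algebra.algebraMap_self_apply]
  simp only [Matrix.trace_fin_two, Matrix.mul_apply, Fin.sum_univ_two,
    Matrix.sub_apply, Matrix.smul_apply, smul_eq_mul, Matrix.one_apply_eq, ne_eq, zero_ne_one,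
    one_ne_zero, not_false_eq_true, Matrix.one_apply_ne, Matrix.of_apply, hsym]
  generalize SmoothFun.eval u (k 0 0) = a at *
  generalize SmoothFun.eval u (k 1 1) = b at *
  generalize SmoothFun.eval u (k 1 0) = d at *
  linear_combination (a ^ 2 + b ^ 2 + 2 * d ^ 2) * hs - 2 * (a + b) * hsH + (b - a) * ht

end ChartFrame

end chartFrame

/-- The integrand of Simons' formula for a surface in a fibered model with parameters `τ` and
`c = κ - 4τ²`. -/
def simonsFun {M : Type*} [TopologicalSpace M] [ChartedSpace (Coord 2) M] (E : FiberedModel)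
    (τ c H : ℝ) (f N : M → Coord E.dim) (q : M) : ℝ :=
  normSqPhi E f N H q ^ 2 - (2 * (H ^ 2 + τ ^ 2) + c * (5 * angle E f N q ^ 2 - 1))
      * normSqPhi E f N H q
    + 2 * c * (H ^ 2 + τ ^ 2) * (3 * angle E f N q ^ 2 - 1)

/-- The lower bound for `|∇A|²` by the Codazzi equation. -/
def angleTerm {M : Type*} [TopologicalSpace M] [ChartedSpace (Coord 2) M] (E : FiberedModel)
    (c : ℝ) (f N : M → Coord E.dim) (q : M) : ℝ :=
  c ^ 2 * (angle E f N q ^ 2 * (1 - angle E f N q ^ 2))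

/-- The pairing of `dφ` with the vector field of Simons' formula, computed in the chart at `p`. -/
def chartPairing {M : Type*} [TopologicalSpace M] [ChartedSpace (Coord 2) M] {E : FiberedModel}
    {κ τ : ℝ} (K : Coframe E κ τ) (f N : M → Coord E.dim) (H : ℝ) (φ : M → ℝ) (p q : M) : ℝ :=
  fieldPairing τ (κ - 4 * τ ^ 2) (firstForm E.metric (patch E f p) (chartAt (Coord 2) p q))
    (fun j => pd j ((fun x => normSqPhi E f N H x / 2) ∘ (chartAt (Coord 2) p).symm)
        (chartAt (Coord 2) p q)
      - 2 * (κ - 4 * τ ^ 2) * (H * angle E f N q)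
        * K.coords (patch E f p (chartAt (Coord 2) p q))
          (pd j (patch E f p) (chartAt (Coord 2) p q)) 2)
    (fun j => K.coords (patch E f p (chartAt (Coord 2) p q))
      (pd j (patch E f p) (chartAt (Coord 2) p q)) 2)
    ((K.coords (patch E f p (chartAt (Coord 2) p q))
        (pd 0 (patch E f p) (chartAt (Coord 2) p q)) ⨯₃
      K.coords (patch E f p (chartAt (Coord 2) p q))
        (pd 1 (patch E f p) (chartAt (Coord 2) p q))) 2)
    (fun i => pd i (φ ∘ (chartAt (Coord 2) p).symm) (chartAt (Coord 2) p q))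

namespace ChartFrame

variable {M : Type*} [TopologicalSpace M] [ChartedSpace (Coord 2) M] [IsManifold (𝓡 2) ∞ M]
  {E : FiberedModel} {κ τ : ℝ} {K : Coframe E κ τ} {f N : M → Coord E.dim} {H : ℝ}
  {hf : IsSmoothImmersion E f} {p : M} (C : ChartFrame K hf N H p)

/-- The vector field of Simons' formula in the chart. -/
def field (i : Fin 2) : SmoothFun (chartOpens p) :=
  C.B 0 i * AdaptedFrame.simonsField (partialD _) (algebraMap ℝ _ τ)
      (algebraMap ℝ _ (κ - 4 * τ ^ 2)) (algebraMap ℝ _ H) ((isImmersedPatch hf p).vec K)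
      ((isImmersedPatch hf p).conn K) C.B C.e C.y 0
    + C.B 1 i * AdaptedFrame.simonsField (partialD _) (algebraMap ℝ _ τ)
      (algebraMap ℝ _ (κ - 4 * τ ^ 2)) (algebraMap ℝ _ H) ((isImmersedPatch hf p).vec K)
      ((isImmersedPatch hf p).conn K) C.B C.e C.y 1

theorem eval_simonsPoly (hN : ∀ p, IsUnitNormal E f p (N p)) (u : chartOpens p) :
    SmoothFun.eval u (AdaptedFrame.simonsPoly (algebraMap ℝ _ τ) (algebraMap ℝ _ (κ - 4 * τ ^ 2))
      (algebraMap ℝ _ H) C.halfNorm (C.y 2))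
      = simonsFun E τ (κ - 4 * τ ^ 2) H f N ((chartAt (Coord 2) p).symm u) := by
  rw [simonsFun, C.normSqPhi_eq hN, C.angle_sq hN, AdaptedFrame.simonsPoly]
  rfl

/-- Simons' formula as a differential inequality. -/
theorem le_divergence (hN : ∀ p, IsUnitNormal E f p (N p)) (u : chartOpens p) :
    SmoothFun.eval u C.ρ * (angleTerm E (κ - 4 * τ ^ 2) f N ((chartAt (Coord 2) p).symm u)
        - simonsFun E τ (κ - 4 * τ ^ 2) H f N ((chartAt (Coord 2) p).symm u))
      ≤ SmoothFun.eval u (partialD _ 0 (C.ρ * C.field 0))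
        + SmoothFun.eval u (partialD _ 1 (C.ρ * C.field 1)) := by
  have hA := (isImmersedPatch hf p).ambientEquations K
  have hd := AdaptedFrame.divergence_eq hA C.frame C.density (AdaptedFrame.simonsField (partialD _)
    (algebraMap ℝ _ τ) (algebraMap ℝ _ (κ - 4 * τ ^ 2)) (algebraMap ℝ _ H)
    ((isImmersedPatch hf p).vec K) ((isImmersedPatch hf p).conn K) C.B C.e C.y)
  obtain ⟨q₁, q₂, q₃, q₄, hs⟩ := AdaptedFrame.simons_formula (H := algebraMap ℝ _ H) hA C.frame
    (fun i => partialD_algebraMap i _) C.trace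
  rw [hs] at hd
  have h := congrArg (SmoothFun.eval u) hd
  have hρ : 0 ≤ SmoothFun.eval u C.ρ := by rw [C.density_eq]; exact Real.sqrt_nonneg _
  rw [← C.eval_simonsPoly hN, angleTerm, C.angle_sq hN]
  refine le_of_le_of_eq ?_ ((map_add (SmoothFun.eval u) _ _).symm.trans h).symm
  rw [map_mul]
  refine mul_le_mul_of_nonneg_left ?_ hρ
  -- Evaluation of the squares; being nonnegative, they may be dropped and leave the Codazzi lower
  -- bound.
  have e : ∀ a b c d g : SmoothFun (chartOpens p), SmoothFun.eval u
      ((algebraMap ℝ _ (κ - 4 * τ ^ 2) * d) ^ 2 * (1 - d ^ 2) + (a ^ 2 + b ^ 2 + c ^ 2 + g ^ 2))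
      = ((κ - 4 * τ ^ 2) * SmoothFun.eval u d) ^ 2 * (1 - SmoothFun.eval u d ^ 2)
      + (SmoothFun.eval u a ^ 2 + SmoothFun.eval u b ^ 2 + SmoothFun.eval u c ^ 2
        + SmoothFun.eval u g ^ 2) := fun a b c d g => rfl
  refine le_of_le_of_eq ?_ (map_sub (SmoothFun.eval u) _ _).symm
  rw [e]
  refine sub_le_sub_right ?_ _
  nlinarith [sq_nonneg (SmoothFun.eval u q₁), sq_nonneg (SmoothFun.eval u q₂),
    sq_nonneg (SmoothFun.eval u q₃), sq_nonneg (SmoothFun.eval u q₄)]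

/-- With g = MMᵀ and `B` inverse to M, the inverse metric is BᵀB. -/
theorem firstForm_inv (u : chartOpens p) : (firstForm E.metric (patch E f p) u)⁻¹
    = Matrix.of fun i j => SmoothFun.eval u (C.B 0 i) * SmoothFun.eval u (C.B 0 j)
      + SmoothFun.eval u (C.B 1 i) * SmoothFun.eval u (C.B 1 j) := by
  set M' : Matrix (Fin 2) (Fin 2) ℝ :=
    Matrix.of fun i a => SmoothFun.eval u ((isImmersedPatch hf p).vec K i ⬝ᵥ C.e a) with hM
  set B' : Matrix (Fin 2) (Fin 2) ℝ := Matrix.of fun a j => SmoothFun.eval u (C.B a j) with hB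
  have h1 : M' * B' = 1 := by
    ext i j
    have h := C.frame.dual_mul_apply i j
    rw [Matrix.mul_apply, Fin.sum_univ_two, Matrix.one_apply]
    refine (congrArg (SmoothFun.eval u) h).trans ?_
    split_ifs <;> simp
  have h2 : firstForm E.metric (patch E f p) u = M' * M'ᵀ := by
    ext i j
    rw [(isImmersedPatch hf p).firstForm_eq K u.2, ← (isImmersedPatch hf p).eval_vec K u,
      ← (isImmersedPatch hf p).eval_vec K u, ← SmoothFun.eval_dot, C.frame.metric_eq i j, map_sum]
    simp [Matrix.mul_apply, hM]
  have h3 : (Matrix.of fun i j => SmoothFun.eval u (C.B 0 i) * SmoothFun.eval u (C.B 0 j)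
      + SmoothFun.eval u (C.B 1 i) * SmoothFun.eval u (C.B 1 j)) = B'ᵀ * B' := by
    ext i j
    simp [Matrix.mul_apply, Fin.sum_univ_two, hB]
  rw [h3, h2]
  refine Matrix.inv_eq_right_inv ?_
  calc M' * M'ᵀ * (B'ᵀ * B') = M' * (B' * M')ᵀ * B' := by
        simp only [Matrix.transpose_mul, Matrix.mul_assoc]
    _ = 1 := by rw [mul_eq_one_comm.mp h1, Matrix.transpose_one, Matrix.mul_one, h1]

theorem pd_halfNorm (hN : ∀ p, IsUnitNormal E f p (N p)) (u : chartOpens p) (j : Fin 2) :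
    pd j ((fun x => normSqPhi E f N H x / 2) ∘ (chartAt (Coord 2) p).symm) u
      = SmoothFun.eval u (partialD _ j C.halfNorm) := by
  rw [SmoothFun.eval_partialD]
  refine pd_congr (fun v hv => ?_) j u.2
  rw [SmoothFun.eval_ext _ ⟨v, hv⟩, Function.comp_apply, C.normSqPhi_eq hN ⟨v, hv⟩]
  ring

/-- In the term with τ the determinant of `B` occurs twice, once in C and once in the rotation J.
Its square is 1/det g, which accounts for the quotient n/det g in `fieldPairing`. -/
theorem chartPairing_eq (hN : ∀ p, IsUnitNormal E f p (N p)) (φ : M → ℝ) (u : chartOpens p) :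
    chartPairing K f N H φ p ((chartAt (Coord 2) p).symm u)
      = pd 0 (φ ∘ (chartAt (Coord 2) p).symm) u * SmoothFun.eval u (C.field 0)
        + pd 1 (φ ∘ (chartAt (Coord 2) p).symm) u * SmoothFun.eval u (C.field 1) := by
  have hu : chartAt (Coord 2) p ((chartAt (Coord 2) p).symm u) = u :=
    (chartAt (Coord 2) p).right_inv u.2
  have hdet : ((firstForm E.metric (patch E f p) u).det)⁻¹
      = (SmoothFun.eval u (C.B 0 0) * SmoothFun.eval u (C.B 1 1)
        - SmoothFun.eval u (C.B 0 1) * SmoothFun.eval u (C.B 1 0)) ^ 2 := by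
    refine inv_eq_of_mul_eq_one_right ?_
    have h := congrArg (SmoothFun.eval u) C.density
    rw [map_mul, map_pow, C.density_eq,
      Real.sq_sqrt ((isImmersedPatch hf p).det_firstForm_pos K u.2).le] at h
    exact h
  have hn : SmoothFun.eval u (C.y 2) = (SmoothFun.eval u (C.B 0 0) * SmoothFun.eval u (C.B 1 1)
        - SmoothFun.eval u (C.B 0 1) * SmoothFun.eval u (C.B 1 0))
      * (K.coords (patch E f p u) (pd 0 (patch E f p) u) ⨯₃
        K.coords (patch E f p u) (pd 1 (patch E f p) u)) 2 := by
    rw [← (isImmersedPatch hf p).eval_vec K u, ← (isImmersedPatch hf p).eval_vec K u,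
      ← SmoothFun.eval_cross]
    exact congrArg (SmoothFun.eval u) (congrFun C.frame.normal_eq 2)
  have he : ∀ a, SmoothFun.eval u (C.e a 2) = SmoothFun.eval u (C.B a 0)
        * K.coords (patch E f p u) (pd 0 (patch E f p) u) 2
      + SmoothFun.eval u (C.B a 1) * K.coords (patch E f p u) (pd 1 (patch E f p) u) 2 := fun a =>
    congrArg (SmoothFun.eval u) (congrFun (C.frame.expand a) 2)
  have hV : ∀ i, SmoothFun.eval u (C.field i) = SmoothFun.eval u (C.B 0 i)
      * (SmoothFun.eval u (C.B 0 0) * SmoothFun.eval u (partialD _ 0 C.halfNorm)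
        + SmoothFun.eval u (C.B 0 1) * SmoothFun.eval u (partialD _ 1 C.halfNorm)
        - 2 * (κ - 4 * τ ^ 2) * SmoothFun.eval u (C.y 2)
          * (H * SmoothFun.eval u (C.e 0 2) - τ * SmoothFun.eval u (C.e 1 2)))
      + SmoothFun.eval u (C.B 1 i)
      * (SmoothFun.eval u (C.B 1 0) * SmoothFun.eval u (partialD _ 0 C.halfNorm)
        + SmoothFun.eval u (C.B 1 1) * SmoothFun.eval u (partialD _ 1 C.halfNorm)
        - 2 * (κ - 4 * τ ^ 2) * SmoothFun.eval u (C.y 2)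
          * (H * SmoothFun.eval u (C.e 1 2) + τ * SmoothFun.eval u (C.e 0 2))) := fun i => rfl
  rw [hV, hV, he, he, chartPairing, hu, fieldPairing, C.firstForm_inv, div_eq_mul_inv,
    hdet, C.mul_angle hN, hn]
  simp only [C.pd_halfNorm hN, Matrix.mulVec, dotProduct, Fin.sum_univ_two, Matrix.of_apply]
  ring

end ChartFrame

/-! ### Chart independence of the vector field of Simons' formula -/

section pairing

variable {M : Type*} [TopologicalSpace M] [ChartedSpace (Coord 2) M] [IsManifold (𝓡 2) ∞ M]
  {E : FiberedModel} {κ τ : ℝ} (K : Coframe E κ τ) {f N : M → Coord E.dim} {H : ℝ}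
  (hf : IsSmoothImmersion E f) (hN : ∀ p, IsUnitNormal E f p (N p))
  (hH : HasConstantMeanCurvature E f N H)

theorem pd_comp_chart_symm {g : M → ℝ} {p p' q : M} (hq : q ∈ (chartAt (Coord 2) p).source)
    (hq' : q ∈ (chartAt (Coord 2) p').source)
    (hg : DifferentiableAt ℝ (g ∘ (chartAt (Coord 2) p').symm) (chartAt (Coord 2) p' q))
    (i : Fin 2) : pd i (g ∘ (chartAt (Coord 2) p).symm) (chartAt (Coord 2) p q)
      = (jacobian (chartAt (Coord 2) p' ∘ (chartAt (Coord 2) p).symm) (chartAt (Coord 2) p q) *ᵥ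
        fun k => pd k (g ∘ (chartAt (Coord 2) p').symm) (chartAt (Coord 2) p' q)) i := by
  have hu := (chartAt (Coord 2) p).map_source hq
  have hqq := (chartAt (Coord 2) p).left_inv hq
  have hu' : (chartAt (Coord 2) p).symm (chartAt (Coord 2) p q)
    ∈ (chartAt (Coord 2) p').source := by rwa [hqq]
  have e : (chartAt (Coord 2) p' ∘ (chartAt (Coord 2) p).symm) (chartAt (Coord 2) p q)
    = chartAt (Coord 2) p' q := by rw [Function.comp_apply, hqq]
  rw [pd_congr_nhds (comp_chart_symm_eventuallyEq g p p' hu hu'),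
    pd_comp ((contDiffAt_transition p p' hu hu').differentiableAt (by simp)) (by rwa [e]), e]
  simp [Matrix.mulVec, dotProduct, Fin.sum_univ_two]

theorem contDiffOn_normSqPhi (C : ChartFrame K hf N H p) (hN : ∀ p, IsUnitNormal E f p (N p)) :
    ContDiffOn ℝ ∞ (normSqPhi E f N H ∘ (chartAt (Coord 2) p).symm)
      (chartAt (Coord 2) p).target := by
  refine ((SmoothFun.contDiffOn_ext C.halfNorm).const_smul (2 : ℝ)).congr fun u hu => ?_
  rw [Function.comp_apply, C.normSqPhi_eq hN ⟨u, hu⟩, SmoothFun.eval_ext _ ⟨u, hu⟩, smul_eq_mul]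

include hf hN hH in
/-- The pairing with the vector field of Simons' formula does not depend on the chart. -/
theorem chartPairing_congr {φ : M → ℝ} (hφ : ContMDiff (𝓡 2) 𝓘(ℝ, ℝ) ∞ φ) {p p' q : M}
    (hq : q ∈ (chartAt (Coord 2) p).source) (hq' : q ∈ (chartAt (Coord 2) p').source) :
    chartPairing K f N H φ p q = chartPairing K f N H φ p' q := by
  have hu := (chartAt (Coord 2) p).map_source hq
  have hqq := (chartAt (Coord 2) p).left_inv hq
  have hu' : (chartAt (Coord 2) p).symm (chartAt (Coord 2) p q)
    ∈ (chartAt (Coord 2) p').source := by rwa [hqq]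
  set T := chartAt (Coord 2) p' ∘ (chartAt (Coord 2) p).symm with hT
  have e : T (chartAt (Coord 2) p q) = chartAt (Coord 2) p' q := by
    rw [hT, Function.comp_apply, hqq]
  have ht : T (chartAt (Coord 2) p q) ∈ chartOpens p' := by
    rw [e]; exact (chartAt (Coord 2) p').map_source hq'
  have hnhds : (chartAt (Coord 2) p').target ∈ 𝓝 (chartAt (Coord 2) p' q) :=
    (chartAt (Coord 2) p').open_target.mem_nhds ((chartAt (Coord 2) p').map_source hq')
  have hcd := contDiffAt_transition p p' hu hu'
  have hP := isImmersedPatch hf p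
  have hP' := isImmersedPatch hf p'
  have hFF := comp_chart_symm_eventuallyEq f p p' hu hu'
  have h1 := firstForm_chart_change hP hP' K hu ht hcd hFF
  have hJ := isUnit_det_jacobian hP hP' K hu ht hcd hFF
  have h2 := (coords_patch_eventually hP hP' K hu ht hcd hFF).self_of_nhds
  rw [e] at h1
  simp only [e] at h2
  have dφ := pd_comp_chart_symm hq hq'
    (((contDiffOn_comp_chart_symm' hφ p').contDiffAt hnhds).differentiableAt (by simp))
  have dS := pd_comp_chart_symm (g := fun x => normSqPhi E f N H x / 2) hq hq'
    (by
      have := ((contDiffOn_normSqPhi K hf (chartFrame K hf hN hH p') hN).contDiffAt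
        hnhds).differentiableAt (by simp)
      exact (this.mul_const (1 / 2)).congr_of_eventuallyEq (.of_forall fun v => by
        simp [div_eq_mul_inv]))
  rw [← hT] at dφ dS
  set J := jacobian T (chartAt (Coord 2) p q) with hJdef
  have hξ : (fun j => K.coords (patch E f p (chartAt (Coord 2) p q))
      (pd j (patch E f p) (chartAt (Coord 2) p q)) 2) = J *ᵥ fun j =>
        K.coords (patch E f p' (chartAt (Coord 2) p' q))
          (pd j (patch E f p') (chartAt (Coord 2) p' q)) 2 := by
    funext j
    rw [h2 j]
    simp [Matrix.mulVec, dotProduct, Fin.sum_univ_two]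
  have hw : (fun j => pd j ((fun x => normSqPhi E f N H x / 2) ∘ (chartAt (Coord 2) p).symm)
        (chartAt (Coord 2) p q)
      - 2 * (κ - 4 * τ ^ 2) * (H * angle E f N q)
        * K.coords (patch E f p (chartAt (Coord 2) p q))
          (pd j (patch E f p) (chartAt (Coord 2) p q)) 2)
    = J *ᵥ fun j => pd j ((fun x => normSqPhi E f N H x / 2) ∘ (chartAt (Coord 2) p').symm)
        (chartAt (Coord 2) p' q)
      - 2 * (κ - 4 * τ ^ 2) * (H * angle E f N q)
        * K.coords (patch E f p' (chartAt (Coord 2) p' q))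
          (pd j (patch E f p') (chartAt (Coord 2) p' q)) 2 := by
    funext j
    rw [dS j, congrFun hξ j]
    simp only [Matrix.mulVec, dotProduct, Fin.sum_univ_two]
    ring
  have hn : (K.coords (patch E f p (chartAt (Coord 2) p q))
        (pd 0 (patch E f p) (chartAt (Coord 2) p q)) ⨯₃
      K.coords (patch E f p (chartAt (Coord 2) p q))
        (pd 1 (patch E f p) (chartAt (Coord 2) p q))) 2
    = J.det * (K.coords (patch E f p' (chartAt (Coord 2) p' q))
        (pd 0 (patch E f p') (chartAt (Coord 2) p' q)) ⨯₃
      K.coords (patch E f p' (chartAt (Coord 2) p' q))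
        (pd 1 (patch E f p') (chartAt (Coord 2) p' q))) 2 := by
    rw [h2 0, h2 1, cross_two, cross_two, Matrix.det_fin_two]
    simp only [Pi.add_apply, Pi.smul_apply, smul_eq_mul]
    ring
  have h1' : firstForm E.metric (patch E f p) (chartAt (Coord 2) p q)
    = J * firstForm E.metric (patch E f p') (chartAt (Coord 2) p' q) * Jᵀ := h1
  rw [chartPairing, hw, hξ, hn, funext dφ, h1', fieldPairing_congr hJ, chartPairing]

end pairing

/-! ### The area measure -/

theorem det_fderiv (T : Coord 2 → Coord 2) (u : Coord 2) :
    (fderiv ℝ T u).det = (jacobian T u).det := by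
  have h : LinearMap.toMatrix (EuclideanSpace.basisFun (Fin 2) ℝ).toBasis
      (EuclideanSpace.basisFun (Fin 2) ℝ).toBasis (fderiv ℝ T u : Coord 2 →ₗ[ℝ] Coord 2)
      = (jacobian T u)ᵀ := by
    ext i j
    rw [LinearMap.toMatrix_apply]
    simp [jacobian, pd]
  rw [ContinuousLinearMap.det, ← LinearMap.det_toMatrix
    (EuclideanSpace.basisFun (Fin 2) ℝ).toBasis, h, Matrix.det_transpose]

section area

variable {M : Type*} [TopologicalSpace M] [ChartedSpace (Coord 2) M] [IsManifold (𝓡 2) ∞ M]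
  [MeasurableSpace M] [BorelSpace M]
  {E : FiberedModel} {κ τ : ℝ} (K : Coframe E κ τ) {f : M → Coord E.dim}
  (hf : IsSmoothImmersion E f)

/-- The area density in the chart at `p`. -/
def areaDensity (E : FiberedModel) {M : Type*} [TopologicalSpace M] [ChartedSpace (Coord 2) M]
    (f : M → Coord E.dim) (p : M) (u : Coord 2) : ℝ :=
  √(firstForm E.metric (patch E f p) u).det

/-- The area measure of the domain of the chart at `p`. -/
def chartArea (E : FiberedModel) {M : Type*} [TopologicalSpace M] [ChartedSpace (Coord 2) M]
    [MeasurableSpace M] (f : M → Coord E.dim) (p : M) : Measure M :=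
  Measure.map (chartAt (Coord 2) p).symm ((volume.restrict (chartAt (Coord 2) p).target).withDensity
    fun u => ENNReal.ofReal (areaDensity E f p u))

theorem areaMeasure_eq_iSup : areaMeasure E f = ⨆ p, chartArea E f p := rfl

theorem aemeasurable_chart_symm (p : M) :
    AEMeasurable (chartAt (Coord 2) p).symm
      ((volume.restrict (chartAt (Coord 2) p).target).withDensity
        fun u => ENNReal.ofReal (areaDensity E f p u)) :=
  ((chartAt (Coord 2) p).continuousOn_symm.aemeasurable
    (chartAt (Coord 2) p).open_target.measurableSet).mono_ac (withDensity_absolutelyContinuous _ _)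

theorem measurableSet_preimage_chart_symm (p : M) {s : Set M} (hs : MeasurableSet s) :
    MeasurableSet ((chartAt (Coord 2) p).target ∩ (chartAt (Coord 2) p).symm ⁻¹' s) := by
  have h : Measurable ((chartAt (Coord 2) p).target.domRestrict (chartAt (Coord 2) p).symm) :=
    (continuousOn_iff_continuous_domRestrict.1 (chartAt (Coord 2) p).continuousOn_symm).measurable
  have := (chartAt (Coord 2) p).open_target.measurableSet.subtype_image (h hs)
  convert this using 1
  ext u
  constructor
  · rintro ⟨h1, h2⟩
    exact ⟨⟨u, h1⟩, h2, rfl⟩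
  · rintro ⟨⟨v, hv⟩, h2, rfl⟩
    exact ⟨hv, h2⟩

theorem chartArea_apply (p : M) {s : Set M} (hs : MeasurableSet s) :
    chartArea E f p s = ∫⁻ u in (chartAt (Coord 2) p).target ∩ (chartAt (Coord 2) p).symm ⁻¹' s,
      ENNReal.ofReal (areaDensity E f p u) := by
  have hm := measurableSet_preimage_chart_symm p hs
  have ht := (chartAt (Coord 2) p).open_target.measurableSet
  rw [chartArea, Measure.map_apply_of_aemeasurable (aemeasurable_chart_symm p) hs]
  set ν := (volume.restrict (chartAt (Coord 2) p).target).withDensity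
    fun u => ENNReal.ofReal (areaDensity E f p u) with hν
  -- Outside the target the inverse of the chart has no geometric meaning; the measure puts no mass
  -- there.
  have h0 : ν (chartAt (Coord 2) p).targetᶜ = 0 := by
    apply withDensity_absolutelyContinuous
    rw [Measure.restrict_apply ht.compl, compl_inter_self, measure_empty]
  have h1 : ν ((chartAt (Coord 2) p).symm ⁻¹' s)
      = ν ((chartAt (Coord 2) p).target ∩ (chartAt (Coord 2) p).symm ⁻¹' s) := by
    refine le_antisymm ?_ (measure_mono inter_subset_right)
    calc ν _ ≤ ν (((chartAt (Coord 2) p).target ∩ (chartAt (Coord 2) p).symm ⁻¹' s)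
          ∪ (chartAt (Coord 2) p).targetᶜ) := measure_mono fun u hu => by
          by_cases h : u ∈ (chartAt (Coord 2) p).target
          · exact .inl ⟨h, hu⟩
          · exact .inr h
      _ ≤ _ := (measure_union_le _ _).trans (by rw [h0, add_zero])
  rw [h1, hν, withDensity_apply _ hm, Measure.restrict_restrict hm,
    inter_eq_left.mpr inter_subset_left]

include hf K

theorem areaDensity_transition {p p' : M} {u : Coord 2} (hu : u ∈ (chartAt (Coord 2) p).target)
    (hu' : (chartAt (Coord 2) p).symm u ∈ (chartAt (Coord 2) p').source) :
    areaDensity E f p u = |(fderiv ℝ (chartAt (Coord 2) p' ∘ (chartAt (Coord 2) p).symm) u).det|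
      * areaDensity E f p' ((chartAt (Coord 2) p' ∘ (chartAt (Coord 2) p).symm) u) := by
  have h := firstForm_chart_change (isImmersedPatch hf p) (isImmersedPatch hf p') K hu
    ((chartAt (Coord 2) p').map_source hu') (contDiffAt_transition p p' hu hu')
    (comp_chart_symm_eventuallyEq f p p' hu hu')
  rw [areaDensity, h, det_mul, det_mul, det_transpose, det_fderiv, areaDensity, ← Real.sqrt_sq_eq_abs,
    ← Real.sqrt_mul (sq_nonneg _)]
  congr 1
  ring

/-- Change of variables along the transition map: its Jacobian is exactly the factor by which the
densities differ. -/
theorem chartArea_congr (p p' : M) {s : Set M} (hs : MeasurableSet s)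
    (h : s ⊆ (chartAt (Coord 2) p).source) (h' : s ⊆ (chartAt (Coord 2) p').source) :
    chartArea E f p s = chartArea E f p' s := by
  rw [chartArea_apply p hs, chartArea_apply p' hs]
  set T := chartAt (Coord 2) p' ∘ (chartAt (Coord 2) p).symm with hT
  have himg : (chartAt (Coord 2) p').target ∩ (chartAt (Coord 2) p').symm ⁻¹' s
      = T '' ((chartAt (Coord 2) p).target ∩ (chartAt (Coord 2) p).symm ⁻¹' s) := by
    ext v
    constructor
    · rintro ⟨hv, hvs⟩
      refine ⟨chartAt (Coord 2) p ((chartAt (Coord 2) p').symm v),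
        ⟨(chartAt (Coord 2) p).map_source (h hvs), ?_⟩, ?_⟩
      · rw [mem_preimage, (chartAt (Coord 2) p).left_inv (h hvs)]; exact hvs
      · rw [hT, Function.comp_apply, (chartAt (Coord 2) p).left_inv (h hvs),
          (chartAt (Coord 2) p').right_inv hv]
    · rintro ⟨u, ⟨hu, hus⟩, rfl⟩
      refine ⟨(chartAt (Coord 2) p').map_source (h' hus), ?_⟩
      rw [mem_preimage, hT, Function.comp_apply, (chartAt (Coord 2) p').left_inv (h' hus)]
      exact hus
  have hd : ∀ u ∈ (chartAt (Coord 2) p).target ∩ (chartAt (Coord 2) p).symm ⁻¹' s,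
      HasFDerivWithinAt T (fderiv ℝ T u)
        ((chartAt (Coord 2) p).target ∩ (chartAt (Coord 2) p).symm ⁻¹' s) u := fun u hu =>
    ((contDiffAt_transition p p' hu.1 (h' hu.2)).differentiableAt
      (by simp)).hasFDerivAt.hasFDerivWithinAt
  have hi : InjOn T ((chartAt (Coord 2) p).target ∩ (chartAt (Coord 2) p).symm ⁻¹' s) := by
    intro u hu v hv e
    have e1 := (chartAt (Coord 2) p').injOn (h' hu.2) (h' hv.2) e
    exact (chartAt (Coord 2) p).symm.injOn hu.1 hv.1 e1
  rw [himg, lintegral_image_eq_lintegral_abs_det_fderiv_mul volume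
    (measurableSet_preimage_chart_symm p hs) hd hi]
  refine setLIntegral_congr_fun (measurableSet_preimage_chart_symm p hs) fun u hu => ?_
  rw [areaDensity_transition K hf hu.1 (h' hu.2), ENNReal.ofReal_mul (abs_nonneg _)]

omit hf K in
theorem chartArea_compl_source (p : M) :
    chartArea E f p (chartAt (Coord 2) p).sourceᶜ = 0 := by
  rw [chartArea_apply p (chartAt (Coord 2) p).open_source.measurableSet.compl]
  have : (chartAt (Coord 2) p).target ∩ (chartAt (Coord 2) p).symm ⁻¹'
      (chartAt (Coord 2) p).sourceᶜ = ∅ := by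
    ext u
    simp only [mem_inter_iff, mem_preimage, mem_compl_iff, mem_empty_iff_false, iff_false, not_and,
      not_not]
    exact fun hu => (chartAt (Coord 2) p).map_target hu
  rw [this, Measure.restrict_empty, lintegral_zero_measure]

/-- On the domain of a chart the area measure is given by the density in this chart. -/
theorem areaMeasure_apply (p : M) {s : Set M} (hs : MeasurableSet s)
    (h : s ⊆ (chartAt (Coord 2) p).source) : areaMeasure E f s = chartArea E f p s := by
  have hsrc : ∀ q : M, MeasurableSet (chartAt (Coord 2) q).source := fun q =>
    (chartAt (Coord 2) q).open_source.measurableSet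
  refine le_antisymm ?_ (Measure.le_iff'.1 (le_iSup (chartArea E f) p) s)
  -- The measure equal to the chart area on the domain of the chart and to ⊤ off it dominates all
  -- chart areas. It therefore dominates their supremum, while on the domain it gives the desired
  -- value.
  set ν : Measure M := (chartArea E f p).restrict (chartAt (Coord 2) p).source
    + (⊤ : Measure M).restrict (chartAt (Coord 2) p).sourceᶜ with hν
  have hle : areaMeasure E f ≤ ν := by
    rw [areaMeasure_eq_iSup]
    refine iSup_le fun q => Measure.le_iff.2 fun t ht => ?_
    rw [← measure_inter_add_sdiff t (hsrc p), hν, Measure.add_apply, Measure.restrict_apply ht,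
      Measure.restrict_apply ht]
    refine add_le_add ?_ ?_
    · have hm := ht.inter (hsrc p)
      have h0 : chartArea E f q ((t ∩ (chartAt (Coord 2) p).source)
          \ (chartAt (Coord 2) q).source) = 0 :=
        measure_mono_null (fun x hx => hx.2) (chartArea_compl_source q)
      rw [← measure_inter_add_sdiff (t ∩ (chartAt (Coord 2) p).source) (hsrc q),
        h0, add_zero,
        chartArea_congr K hf q p (hm.inter (hsrc q)) inter_subset_right
          (inter_subset_left.trans inter_subset_right)]
      exact measure_mono inter_subset_left
    · rw [sdiff_eq]
      exact Measure.le_iff'.1 le_top _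
  refine (Measure.le_iff'.1 hle s).trans ?_
  rw [hν, Measure.add_apply, Measure.restrict_apply hs, Measure.restrict_apply hs,
    inter_eq_left.2 h, ← sdiff_eq, sdiff_eq_empty.2 h, measure_empty, add_zero]

theorem areaMeasure_restrict (p : M) :
    (areaMeasure E f).restrict (chartAt (Coord 2) p).source = chartArea E f p := by
  have hsrc := (chartAt (Coord 2) p).open_source.measurableSet
  ext s hs
  rw [Measure.restrict_apply hs, areaMeasure_apply K hf p (hs.inter hsrc) inter_subset_right]
  have h0 : chartArea E f p (s \ (chartAt (Coord 2) p).source) = 0 :=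
    measure_mono_null (fun x hx => hx.2) (chartArea_compl_source p)
  conv_rhs => rw [← measure_inter_add_sdiff s hsrc, h0, add_zero]

omit K in
theorem continuousOn_areaDensity (K : Coframe E κ τ) (p : M) :
    ContinuousOn (areaDensity E f p) (chartAt (Coord 2) p).target := by
  have hP := isImmersedPatch hf p
  refine ContinuousOn.sqrt ?_
  have : ∀ i j, ContinuousOn (fun u => firstForm E.metric (patch E f p) u i j)
      (chartAt (Coord 2) p).target := by
    intro i j
    have h : ContinuousOn (fun u => ∑ l, K.coords (patch E f p u) (pd i (patch E f p) u) l
        * K.coords (patch E f p u) (pd j (patch E f p) u) l) (chartAt (Coord 2) p).target :=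
      continuousOn_finsetSum _ fun l _ =>
        (hP.contDiffOn_coords K (contDiffOn_pd hP.contDiffOn i) l).continuousOn.mul
          (hP.contDiffOn_coords K (contDiffOn_pd hP.contDiffOn j) l).continuousOn
    exact h.congr fun u hu => hP.firstForm_eq K hu i j
  simp only [Matrix.det_fin_two]
  exact ((this 0 0).mul (this 1 1)).sub ((this 0 1).mul (this 1 0))

omit hf K in
theorem areaDensity_pos (K : Coframe E κ τ) (hf : IsSmoothImmersion E f) (p : M) {u : Coord 2}
    (hu : u ∈ (chartAt (Coord 2) p).target) : 0 < areaDensity E f p u :=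
  Real.sqrt_pos.2 ((isImmersedPatch hf p).det_firstForm_pos K hu)

/-- Makes continuous functions on the compact surface integrable. -/
theorem isLocallyFiniteMeasure_areaMeasure : IsLocallyFiniteMeasure (areaMeasure E f) where
  finiteAtNhds q := by
    obtain ⟨k, hk, hkt, hkc⟩ := local_compact_nhds ((chartAt (Coord 2) q).open_target.mem_nhds
      (mem_chart_target (Coord 2) q))
    refine ⟨(chartAt (Coord 2) q).source ∩ chartAt (Coord 2) q ⁻¹' interior k, ?_, ?_⟩
    · exact ((chartAt (Coord 2) q).isOpen_inter_preimage isOpen_interior).mem_nhds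
        ⟨mem_chart_source _ q, mem_interior_iff_mem_nhds.2 hk⟩
    · have hm := ((chartAt (Coord 2) q).isOpen_inter_preimage
        (isOpen_interior (s := k))).measurableSet
      rw [areaMeasure_apply K hf q hm inter_subset_left, chartArea_apply q hm]
      refine (lintegral_mono_set (t := k) fun u hu => ?_).trans_lt ?_
      · have h := hu.2.2
        rw [mem_preimage, (chartAt (Coord 2) q).right_inv hu.1] at h
        exact interior_subset h
      · have hi : IntegrableOn (areaDensity E f q) k volume :=
          ((continuousOn_areaDensity hf K q).mono hkt).integrableOn_compact hkc
        exact hi.lintegral_lt_top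

/-- Needed in the equality case: a continuous nonnegative function with integral zero vanishes
everywhere, not only almost everywhere. -/
theorem isOpenPosMeasure_areaMeasure : (areaMeasure E f).IsOpenPosMeasure where
  open_pos V hV hne h0 := by
    obtain ⟨q, hq⟩ := hne
    have hm : MeasurableSet (V ∩ (chartAt (Coord 2) q).source) :=
      (hV.inter (chartAt (Coord 2) q).open_source).measurableSet
    have h1 := measure_mono_null (inter_subset_left (t := (chartAt (Coord 2) q).source)) h0
    have hmeas := measurableSet_preimage_chart_symm q hm
    have hopen := (chartAt (Coord 2) q).isOpen_inter_preimage_symm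
      (hV.inter (chartAt (Coord 2) q).open_source)
    rw [areaMeasure_apply K hf q hm inter_subset_right, chartArea_apply q hm,
      setLIntegral_eq_zero_iff' hmeas] at h1
    · have h2 : volume ((chartAt (Coord 2) q).target ∩ (chartAt (Coord 2) q).symm ⁻¹'
          (V ∩ (chartAt (Coord 2) q).source)) = 0 := by
        refine measure_mono_null (fun u hu => ?_) h1
        simp only [mem_compl_iff, mem_ofPred_eq, not_forall]
        exact ⟨hu, (ENNReal.ofReal_pos.2 (areaDensity_pos K hf q hu.1)).ne'⟩
      refine (hopen.measure_pos volume ⟨chartAt (Coord 2) q q, mem_chart_target _ q, ?_⟩).ne' h2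
      rw [mem_preimage, (chartAt (Coord 2) q).left_inv (mem_chart_source _ q)]
      exact ⟨hq, mem_chart_source _ q⟩
    · exact (((continuousOn_areaDensity hf K q).mono
        inter_subset_left).aemeasurable hmeas).ennreal_ofReal

theorem integral_areaMeasure (p : M) {g : M → ℝ} (hg : Continuous g)
    (h : ∀ q, q ∉ (chartAt (Coord 2) p).source → g q = 0) :
    ∫ q, g q ∂areaMeasure E f = ∫ u in (chartAt (Coord 2) p).target,
      areaDensity E f p u * g ((chartAt (Coord 2) p).symm u) := by
  rw [← setIntegral_eq_integral_of_forall_compl_eq_zero h, areaMeasure_restrict K hf, chartArea,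
    integral_map (aemeasurable_chart_symm p) hg.aestronglyMeasurable,
    integral_withDensity_eq_integral_toReal_smul₀]
  · refine integral_congr_ae (.of_forall fun u => ?_)
    simp only [smul_eq_mul]
    rw [ENNReal.toReal_ofReal (show 0 ≤ areaDensity E f p u from Real.sqrt_nonneg _)]
  · exact ((continuousOn_areaDensity hf K p).aemeasurable
      (chartAt (Coord 2) p).open_target.measurableSet).ennreal_ofReal
  · exact .of_forall fun u => ENNReal.ofReal_lt_top

end area

/-- The integral of a divergence with compact support vanishes. -/
theorem integral_pd_eq_zero {W : Coord 2 → ℝ} {U : Opens (Coord 2)} {k : Set (Coord 2)}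
    (hW : ContDiffOn ℝ ∞ W U) (hk : IsCompact k) (hkU : k ⊆ U) (h0 : ∀ u, u ∉ k → W u = 0)
    (i : Fin 2) : IntegrableOn (pd i W) U ∧ ∫ u in U, pd i W u = 0 := by
  have hnear : ∀ u, u ∉ k → W =ᶠ[𝓝 u] 0 := fun u hu => by
    filter_upwards [hk.isClosed.isOpen_compl.mem_nhds hu] with v hv using h0 v hv
  have hc : ContDiff ℝ ∞ W := contDiff_iff_contDiffAt.2 fun u => by
    by_cases hu : u ∈ U
    · exact hW.contDiffAt (U.isOpen.mem_nhds hu)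
    · exact contDiffAt_const.congr_of_eventuallyEq (hnear u fun h => hu (hkU h))
  have hs : HasCompactSupport W := HasCompactSupport.intro hk fun u hu => h0 u hu
  have hcont : Continuous (pd i W) :=
    (hc.continuous_fderiv (by simp)).clm_apply continuous_const
  have hp0 : ∀ u, u ∉ k → pd i W u = 0 := fun u hu => by
    rw [pd, (hnear u hu).fderiv_eq]; simp
  have hint : Integrable (pd i W) := hcont.integrable_of_hasCompactSupport
    (HasCompactSupport.intro hk fun u hu => hp0 u hu)
  refine ⟨hint.integrableOn, ?_⟩
  rw [setIntegral_eq_integral_of_forall_compl_eq_zero fun u hu => hp0 u fun h => hu (hkU h)]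
  -- Integration by parts against the constant function 1.
  have h := integral_mul_fderiv_eq_neg_fderiv_mul_of_integrable (μ := volume) (f := fun _ => (1 : ℝ))
    (g := W) (v := EuclideanSpace.single i 1) (by simp) (by simp only [one_mul]; exact hint)
    (by simpa using hc.continuous.integrable_of_hasCompactSupport hs)
    (fun u _ => differentiableAt_const _) (fun u _ => hc.differentiable (by simp) u)
  simpa [pd] using h

/-! ### The integrated inequality -/

section global

variable {M : Type*} [TopologicalSpace M] [ChartedSpace (Coord 2) M] [IsManifold (𝓡 2) ∞ M]
  {E : FiberedModel} {κ τ : ℝ} (K : Coframe E κ τ) {f N : M → Coord E.dim} {H : ℝ}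
  (hf : IsSmoothImmersion E f) (hN : ∀ p, IsUnitNormal E f p (N p))
  (hH : HasConstantMeanCurvature E f N H)

theorem continuous_of_chart {X : Type*} [TopologicalSpace X] {g : M → X}
    (h : ∀ p, ContinuousOn (g ∘ (chartAt (Coord 2) p).symm) (chartAt (Coord 2) p).target) :
    Continuous g := continuous_iff_continuousAt.2 fun p => by
  have h1 := ((h p).comp (chartAt (Coord 2) p).continuousOn (chartAt (Coord 2) p).mapsTo)
  refine (h1.congr fun q hq => ?_).continuousAt ((chartAt (Coord 2) p).open_source.mem_nhds
    (mem_chart_source _ p))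
  simp only [Function.comp_apply]
  rw [(chartAt (Coord 2) p).left_inv hq]

include K hf hN hH

theorem continuous_normSqPhi : Continuous (normSqPhi E f N H) :=
  continuous_of_chart fun p =>
    (contDiffOn_normSqPhi K hf (chartFrame K hf hN hH p) hN).continuousOn

theorem continuous_angle_sq : Continuous fun q => angle E f N q ^ 2 :=
  continuous_of_chart fun p => by
    set C := chartFrame K hf hN hH p
    refine ((SmoothFun.contDiffOn_ext (C.y 2)).continuousOn.pow 2).congr fun u hu => ?_
    rw [Function.comp_apply, C.angle_sq hN ⟨u, hu⟩, ← SmoothFun.eval_ext _ ⟨u, hu⟩, Pi.pow_apply]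

theorem continuous_angleTerm (c : ℝ) : Continuous (angleTerm E c f N) := by
  have := continuous_angle_sq K hf hN hH
  unfold angleTerm
  fun_prop

theorem continuous_simonsFun (τ' c : ℝ) : Continuous (simonsFun E τ' c H f N) := by
  have h1 := continuous_angle_sq K hf hN hH
  have h2 := continuous_normSqPhi K hf hN hH
  unfold simonsFun
  fun_prop

theorem continuousOn_chartPairing {φ : M → ℝ} (hφ : ContMDiff (𝓡 2) 𝓘(ℝ, ℝ) ∞ φ) (p : M) :
    ContinuousOn ((fun q => chartPairing K f N H φ p q) ∘ (chartAt (Coord 2) p).symm)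
      (chartAt (Coord 2) p).target := by
  set C := chartFrame K hf hN hH p
  have h := fun i => (contDiffOn_pd (U := chartOpens p)
    (contDiffOn_comp_chart_symm' hφ p) i).continuousOn
  refine (((h 0).mul (SmoothFun.contDiffOn_ext (C.field 0)).continuousOn).add
    ((h 1).mul (SmoothFun.contDiffOn_ext (C.field 1)).continuousOn)).congr fun u hu => ?_
  rw [Function.comp_apply, C.chartPairing_eq hN φ ⟨u, hu⟩]
  simp only [Pi.add_apply, Pi.mul_apply, SmoothFun.eval_ext _ ⟨u, hu⟩]

/-- The chart used at `q` changes with `q`. Near a given point it may be replaced by one fixed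
chart. -/
theorem continuous_chartPairing {φ : M → ℝ} (hφ : ContMDiff (𝓡 2) 𝓘(ℝ, ℝ) ∞ φ) :
    Continuous fun q => chartPairing K f N H φ q q :=
  continuous_of_chart fun p => (continuousOn_chartPairing K hf hN hH hφ p).congr fun _ hu =>
    chartPairing_congr K hf hN hH hφ (mem_chart_source _ _) ((chartAt (Coord 2) p).map_target hu)

omit hf hN hH in
theorem chartPairing_of_notMem_tsupport {φ : M → ℝ} {q : M} (h : q ∉ tsupport φ) :
    chartPairing K f N H φ q q = 0 := by
  have h0 : φ =ᶠ[𝓝 q] 0 := notMem_tsupport_iff_eventuallyEq.1 h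
  have h1 : φ ∘ (chartAt (Coord 2) q).symm =ᶠ[𝓝 (chartAt (Coord 2) q q)] 0 := by
    have ht := (chartAt (Coord 2) q).continuousAt_symm (mem_chart_target (Coord 2) q)
    rw [ContinuousAt, (chartAt (Coord 2) q).left_inv (mem_chart_source _ q)] at ht
    exact ht.eventually h0
  have h2 : (fun i => pd i (φ ∘ (chartAt (Coord 2) q).symm) (chartAt (Coord 2) q q)) = 0 := by
    funext i
    rw [pd, h1.fderiv_eq]
    simp
  rw [chartPairing, h2, fieldPairing_zero]

/-- The expression is bounded by χ div V + dχ(V) = div(χV), because χ ≥ 0. This divergence has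
compact support in one chart, so its integral is zero. -/
theorem integral_le_zero_of_tsupport_subset [T2Space M] [CompactSpace M] [MeasurableSpace M]
    [BorelSpace M] {χ : M → ℝ} (hχ : ContMDiff (𝓡 2) 𝓘(ℝ, ℝ) ∞ χ) (h0 : ∀ q, 0 ≤ χ q) {p : M}
    (hs : tsupport χ ⊆ (chartAt (Coord 2) p).source) :
    ∫ q, (χ q * (angleTerm E (κ - 4 * τ ^ 2) f N q - simonsFun E τ (κ - 4 * τ ^ 2) H f N q)
      + chartPairing K f N H χ q q) ∂areaMeasure E f ≤ 0 := by
  set C := chartFrame K hf hN hH p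
  set k : Set (Coord 2) := chartAt (Coord 2) p '' tsupport χ with hk
  have hkc : IsCompact k := (isClosed_tsupport χ).isCompact.image_of_continuousOn
    ((chartAt (Coord 2) p).continuousOn.mono hs)
  have hkt : k ⊆ chartOpens p := by
    rintro _ ⟨q, hq, rfl⟩
    exact (chartAt (Coord 2) p).map_source (hs hq)
  have hoff : ∀ u ∈ chartOpens p, u ∉ k → (chartAt (Coord 2) p).symm u ∉ tsupport χ :=
    fun u hu huk h => huk ⟨_, h, (chartAt (Coord 2) p).right_inv hu⟩
  have hχ0 : ∀ u ∈ chartOpens p, u ∉ k → χ ((chartAt (Coord 2) p).symm u) = 0 :=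
    fun u hu huk => image_eq_zero_of_notMem_tsupport (hoff u hu huk)
  have hcχ := contDiffOn_comp_chart_symm' hχ p
  -- The coordinate components of ρχV. With the density included, the Riemannian divergence becomes
  -- a sum of partial derivatives.
  set W : Fin 2 → Coord 2 → ℝ := fun i u =>
    (χ ∘ (chartAt (Coord 2) p).symm) u * SmoothFun.ext (C.ρ * C.field i) u with hW
  have hWd : ∀ i, ContDiffOn ℝ ∞ (W i) (chartOpens p) := fun i =>
    hcχ.mul (SmoothFun.contDiffOn_ext _)
  have hW0 : ∀ i u, u ∉ k → W i u = 0 := by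
    intro i u hu
    by_cases hut : u ∈ chartOpens p
    · simp only [hW, Function.comp_apply, hχ0 u hut hu, zero_mul]
    · have : SmoothFun.ext (C.ρ * C.field i) u = 0 :=
        Function.extend_apply' _ _ _ fun ⟨v, hv⟩ => hut (hv ▸ v.2)
      simp only [hW, this, mul_zero]
  have hdiv := fun i => integral_pd_eq_zero (hWd i) hkc hkt (hW0 i) i
  set g : M → ℝ := fun q => χ q * (angleTerm E (κ - 4 * τ ^ 2) f N q
    - simonsFun E τ (κ - 4 * τ ^ 2) H f N q) + chartPairing K f N H χ q q with hg
  have hgc : Continuous g := (hχ.continuous.mul ((continuous_angleTerm K hf hN hH _).sub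
    (continuous_simonsFun K hf hN hH _ _))).add (continuous_chartPairing K hf hN hH hχ)
  have hg0 : ∀ q, q ∉ tsupport χ → g q = 0 := fun q hq => by
    simp only [hg]
    rw [chartPairing_of_notMem_tsupport K hq, image_eq_zero_of_notMem_tsupport hq, zero_mul,
      add_zero]
  rw [integral_areaMeasure K hf p hgc fun q hq => hg0 q fun h => hq (hs h)]
  have hsum : ∫ u in chartOpens p, (pd 0 (W 0) u + pd 1 (W 1) u) = 0 := by
    rw [integral_add (hdiv 0).1 (hdiv 1).1, (hdiv 0).2, (hdiv 1).2, add_zero]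
  rw [← hsum]
  have hcont : ContinuousOn (fun u => areaDensity E f p u * g ((chartAt (Coord 2) p).symm u))
      (chartOpens p) := (continuousOn_areaDensity hf K p).mul
    (hgc.comp_continuousOn (chartAt (Coord 2) p).continuousOn_symm)
  refine setIntegral_mono_on ?_ ((hdiv 0).1.add (hdiv 1).1) (chartOpens p).isOpen.measurableSet
    fun u hu => ?_
  · refine ((hcont.mono hkt).integrableOn_compact hkc).of_forall_sdiff_eq_zero
      (chartOpens p).isOpen.measurableSet fun u hu => ?_
    rw [hg0 _ (hoff u hu.1 hu.2), mul_zero]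
  · have hle := C.le_divergence hN ⟨u, hu⟩
    have hpd : ∀ i, pd i (W i) u = pd i (χ ∘ (chartAt (Coord 2) p).symm) u
          * (areaDensity E f p u * SmoothFun.eval ⟨u, hu⟩ (C.field i))
        + χ ((chartAt (Coord 2) p).symm u)
          * SmoothFun.eval ⟨u, hu⟩ (partialD _ i (C.ρ * C.field i)) := by
      intro i
      have h1 : DifferentiableAt ℝ (χ ∘ (chartAt (Coord 2) p).symm) u :=
        (hcχ.contDiffAt ((chartOpens p).isOpen.mem_nhds hu)).differentiableAt (by simp)
      have h2 := SmoothFun.differentiableAt_ext (C.ρ * C.field i) hu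
      have h3 : SmoothFun.ext (C.ρ * C.field i) u
          = areaDensity E f p u * SmoothFun.eval ⟨u, hu⟩ (C.field i) := by
        rw [SmoothFun.eval_ext _ ⟨u, hu⟩, map_mul, C.density_eq]
        rfl
      rw [SmoothFun.eval_partialD, ← h3]
      simp only [pd, hW]
      rw [fderiv_fun_mul h1 h2]
      simp only [_root_.add_apply, _root_.smul_apply, smul_eq_mul, Function.comp_apply]
      ring
    have hP : chartPairing K f N H χ ((chartAt (Coord 2) p).symm u)
        ((chartAt (Coord 2) p).symm u) = chartPairing K f N H χ p ((chartAt (Coord 2) p).symm u) :=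
      chartPairing_congr K hf hN hH hχ (mem_chart_source _ _) ((chartAt (Coord 2) p).map_target hu)
    have hρ : SmoothFun.eval ⟨u, hu⟩ C.ρ = areaDensity E f p u := C.density_eq _
    rw [hρ] at hle
    rw [hpd, hpd, hg]
    simp only
    rw [hP, C.chartPairing_eq hN χ ⟨u, hu⟩]
    nlinarith [mul_le_mul_of_nonneg_left hle (h0 ((chartAt (Coord 2) p).symm u))]

/-- The integrated Simons formula. -/
theorem integral_angleTerm_le [T2Space M] [CompactSpace M] [MeasurableSpace M] [BorelSpace M] :
    ∫ q, angleTerm E (κ - 4 * τ ^ 2) f N q ∂areaMeasure E f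
      ≤ ∫ q, simonsFun E τ (κ - 4 * τ ^ 2) H f N q ∂areaMeasure E f := by
  have := isLocallyFiniteMeasure_areaMeasure K hf
  obtain ⟨t, ht⟩ := isCompact_univ.elim_finite_subcover
    (fun p : M => (chartAt (Coord 2) p).source) (fun p => (chartAt (Coord 2) p).open_source)
    fun p _ => mem_iUnion.2 ⟨p, mem_chart_source _ p⟩
  obtain ⟨χ, hχ⟩ := SmoothPartitionOfUnity.exists_isSubordinate (𝓡 2) isClosed_univ
    (fun p : t => (chartAt (Coord 2) (p : M)).source) (fun p => (chartAt (Coord 2) _).open_source)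
    (by simpa [iUnion_subtype] using ht)
  have hsum : ∀ q, ∑ i, χ i q = 1 := fun q => by
    rw [← finsum_eq_sum_of_fintype]; exact χ.sum_eq_one (mem_univ q)
  have hint : ∀ g : M → ℝ, Continuous g → Integrable g (areaMeasure E f) := fun g hg =>
    hg.integrable_of_hasCompactSupport (HasCompactSupport.of_compactSpace g)
  have hd : Continuous fun q => angleTerm E (κ - 4 * τ ^ 2) f N q
      - simonsFun E τ (κ - 4 * τ ^ 2) H f N q :=
    (continuous_angleTerm K hf hN hH _).sub (continuous_simonsFun K hf hN hH _ _)
  -- The functions χᵢ sum to 1, so their differentials sum to zero and the terms dχᵢ(V) cancel.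
  have hP : ∀ q, ∑ i, chartPairing K f N H (χ i) q q = 0 := by
    intro q
    simp only [chartPairing]
    rw [← fieldPairing_sum]
    have h1 : ∑ i, (fun j => pd j (χ i ∘ (chartAt (Coord 2) q).symm) (chartAt (Coord 2) q q)) = 0 := by
      funext j
      have hdi : ∀ i ∈ Finset.univ, DifferentiableAt ℝ (χ i ∘ (chartAt (Coord 2) q).symm)
          (chartAt (Coord 2) q q) := fun i _ =>
        ((contDiffOn_comp_chart_symm' (χ i).contMDiff q).contDiffAt
          ((chartAt (Coord 2) q).open_target.mem_nhds (mem_chart_target _ q))).differentiableAt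
          (by simp)
      rw [Finset.sum_apply, Pi.zero_apply]
      have h2 := congrArg (fun L => L (EuclideanSpace.single j 1)) (fderiv_fun_sum hdi)
      simp only [Function.comp_apply, hsum, fderiv_const_apply] at h2
      simpa [pd] using h2.symm
    rw [h1, fieldPairing_zero]
  have hle := Finset.sum_nonpos fun i (_ : i ∈ Finset.univ) =>
    integral_le_zero_of_tsupport_subset K hf hN hH (χ i).contMDiff (fun q => χ.nonneg i q) (hχ i)
  have hi : ∀ i ∈ Finset.univ, Integrable (fun q => χ i q * (angleTerm E (κ - 4 * τ ^ 2) f N q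
      - simonsFun E τ (κ - 4 * τ ^ 2) H f N q) + chartPairing K f N H (χ i) q q)
      (areaMeasure E f) := fun i _ => hint _ (((χ i).contMDiff.continuous.mul hd).add
    (continuous_chartPairing K hf hN hH (χ i).contMDiff))
  rw [← integral_finsetSum _ hi] at hle
  simp only [Finset.sum_add_distrib, hP, ← Finset.sum_mul, hsum, one_mul, add_zero] at hle
  rw [integral_sub (hint _ (continuous_angleTerm K hf hN hH _))
    (hint _ (continuous_simonsFun K hf hN hH _ _))] at hle
  linarith

end global

/-! ### Surfaces with parallel second fundamental form -/

namespace AdaptedFrame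

variable {A : Type*} [CommRing A] [Algebra ℝ A]
  {D : Fin 2 → Derivation ℝ A A} {τ c : A} {x : Fin 2 → Fin 3 → A} {α : Fin 2 → A}
  {B : Fin 2 → Fin 2 → A} {e : Fin 2 → Fin 3 → A} {y : Fin 3 → A}

/-- The curvature term of the Codazzi equation in an adapted frame. -/
theorem codazzi_term (hF : AdaptedFrame x B e y) (a : Fin 2) :
    (B 0 0 * B 1 1 - B 0 1 * B 1 0) * ∑ j, B a j *
      ((-τ ^ 2 • (x 0 ⨯₃ x 1) - (c * (x 0 ⨯₃ x 1) 2) • vert A) ⨯₃ x j ⬝ᵥ y)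
    = -(c * y 2) * (vert A ⨯₃ e a ⬝ᵥ y) := by
  have h : ∀ w : Fin 3 → A, y ⨯₃ w ⬝ᵥ y = 0 := fun w => by
    rw [dotProduct_comm, dot_self_cross]
  have key : ((-τ ^ 2 • y - (c * y 2) • vert A) ⨯₃ e a) ⬝ᵥ y = -(c * y 2) * (vert A ⨯₃ e a ⬝ᵥ y) := by
    simp only [map_sub, map_smul, LinearMap.sub_apply, LinearMap.smul_apply, sub_dotProduct,
      smul_dotProduct, h, smul_eq_mul]
    ring
  rw [← key]
  obtain ⟨d, hd⟩ : ∃ d, d = B 0 0 * B 1 1 - B 0 1 * B 1 0 := ⟨_, rfl⟩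
  obtain ⟨n, hnn⟩ : ∃ n, n = x 0 ⨯₃ x 1 := ⟨_, rfl⟩
  have hy : y = d • n := by rw [hd, hnn]; exact hF.normal_eq
  rw [← hd, ← hnn, hF.expand a]
  have hl : -τ ^ 2 • y - (c * y 2) • vert A = d • (-τ ^ 2 • n - (c * n 2) • vert A) := by
    rw [hy, Pi.smul_apply, smul_eq_mul]; module
  rw [hl, Fin.sum_univ_two]
  simp only [map_smul, map_add, LinearMap.smul_apply, add_dotProduct, smul_dotProduct, smul_eq_mul]
  ring

/-- The coefficients `B` and their determinant convert the coordinate expression to the orthonormal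
frame. There its two components are cCt₁ and -cCt₀ up to a common sign, and |T|² = 1 - C². -/
theorem codazzi_term_sq (hF : AdaptedFrame x B e y) :
    ∑ a, ((B 0 0 * B 1 1 - B 0 1 * B 1 0) * ∑ j, B a j *
      ((-τ ^ 2 • (x 0 ⨯₃ x 1) - (c * (x 0 ⨯₃ x 1) 2) • vert A) ⨯₃ x j ⬝ᵥ y)) ^ 2
    = c ^ 2 * (y 2 ^ 2 * (1 - y 2 ^ 2)) := by
  have h0 : vert A ⨯₃ e 0 ⬝ᵥ y = -e 1 2 := by
    have := congrFun hF.cross_left 2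
    rw [Pi.neg_apply, cross_two] at this
    rw [← this]
    simp only [dotProduct, Fin.sum_univ_three, cross_zero, cross_one, cross_two, vert]
    simp
    ring
  have h1 : vert A ⨯₃ e 1 ⬝ᵥ y = e 0 2 := by
    have := congrFun hF.cross_right 2
    rw [cross_two] at this
    rw [← this]
    simp only [dotProduct, Fin.sum_univ_three, cross_zero, cross_one, cross_two, vert]
    simp
    ring
  rw [Fin.sum_univ_two, hF.codazzi_term, hF.codazzi_term, h0, h1]
  linear_combination (c * y 2) ^ 2 * hF.vert_sq

/-- The Christoffel symbols of the induced metric in terms of an adapted frame. -/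
def christoffelSymbol (D : Fin 2 → Derivation ℝ A A) (τ : A) (x : Fin 2 → Fin 3 → A)
    (α : Fin 2 → A) (B : Fin 2 → Fin 2 → A) (e : Fin 2 → Fin 3 → A) (l k i : Fin 2) : A :=
  ∑ a, B a l * (cov (D k) τ (x k) (α k) (x i) ⬝ᵥ e a)

theorem gaussFormula (hF : AdaptedFrame x B e y) :
    GaussFormula D τ x α y (christoffelSymbol D τ x α B e) := by
  intro k i
  rw [coordForm]
  obtain ⟨v, hv⟩ : ∃ v, v = cov (D k) τ (x k) (α k) (x i) := ⟨_, rfl⟩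
  simp only [christoffelSymbol, ← hv, Fin.sum_univ_two]
  have h : v = (v ⬝ᵥ e 0) • e 0 + (v ⬝ᵥ e 1) • e 1 + (v ⬝ᵥ y) • y := by
    apply hF.ext_dot <;>
    simp only [add_dotProduct, smul_dotProduct, hF.unit, hF.orth, dotProduct_comm (e 1) (e 0),
      hF.dot_left, hF.dot_right, dotProduct_comm y, hF.normal_unit, smul_eq_mul] <;> ring
  obtain ⟨r, hr⟩ : ∃ r, r = v ⬝ᵥ e 0 := ⟨_, rfl⟩
  obtain ⟨s, hs⟩ : ∃ s, s = v ⬝ᵥ e 1 := ⟨_, rfl⟩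
  obtain ⟨t, ht⟩ : ∃ t, t = v ⬝ᵥ y := ⟨_, rfl⟩
  rw [← hr, ← hs, ← ht] at h ⊢
  rw [h, hF.expand 0, hF.expand 1]
  module

end AdaptedFrame

namespace ChartFrame

variable {M : Type*} [TopologicalSpace M] [ChartedSpace (Coord 2) M] [IsManifold (𝓡 2) ∞ M]
  {E : FiberedModel} {κ τ : ℝ} {K : Coframe E κ τ} {f N : M → Coord E.dim} {H : ℝ}
  {hf : IsSmoothImmersion E f} {p : M} (C : ChartFrame K hf N H p)

/-- The Christoffel symbols of the induced metric in the chart. -/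
def Γ (l k i : Fin 2) : SmoothFun (chartOpens p) :=
  AdaptedFrame.christoffelSymbol (partialD _) (algebraMap ℝ _ τ) ((isImmersedPatch hf p).vec K)
    ((isImmersedPatch hf p).conn K) C.B C.e l k i

/-- The components of `∇h` in the chart. -/
def covDeriv (k i j : Fin 2) : SmoothFun (chartOpens p) :=
  coordCovDeriv (partialD _) (algebraMap ℝ _ τ) ((isImmersedPatch hf p).vec K)
    ((isImmersedPatch hf p).conn K) C.y C.Γ k i j

theorem pd_firstForm (u : chartOpens p) (k i m : Fin 2) :
    pd k (fun v => firstForm E.metric (patch E f p) v i m) u = SmoothFun.eval u (partialD _ k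
      ((isImmersedPatch hf p).vec K i ⬝ᵥ (isImmersedPatch hf p).vec K m)) := by
  rw [SmoothFun.eval_partialD]
  refine pd_congr (fun v hv => ?_) k u.2
  rw [SmoothFun.eval_ext _ ⟨v, hv⟩, SmoothFun.eval_dot, (isImmersedPatch hf p).eval_vec,
    (isImmersedPatch hf p).eval_vec, (isImmersedPatch hf p).firstForm_eq K hv]

/-- The bracket of derivatives of the metric is a tangential component of the ambient connection by
`koszul`. Raising the index with g⁻¹ = BᵀB gives the frame expression. -/
theorem inducedChristoffel_eq (u : chartOpens p) (l k i : Fin 2) :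
    inducedChristoffel E.metric (patch E f p) u l k i = SmoothFun.eval u (C.Γ l k i) := by
  have hA := (isImmersedPatch hf p).ambientEquations K
  have hk : ∀ m, (pd k (fun v => firstForm E.metric (patch E f p) v i m) u
      + pd i (fun v => firstForm E.metric (patch E f p) v k m) u
      - pd m (fun v => firstForm E.metric (patch E f p) v k i) u) / 2
      = SmoothFun.eval u (cov (partialD _ k) (algebraMap ℝ _ τ) ((isImmersedPatch hf p).vec K k)
        ((isImmersedPatch hf p).conn K k) ((isImmersedPatch hf p).vec K i)
        ⬝ᵥ (isImmersedPatch hf p).vec K m) := by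
    intro m
    rw [pd_firstForm (K := K) (hf := hf), pd_firstForm (K := K) (hf := hf),
      pd_firstForm (K := K) (hf := hf)]
    have h := congrArg (SmoothFun.eval u) (koszul hA k i m)
    have h' : _ = 2 * SmoothFun.eval u (cov (partialD _ k) (algebraMap ℝ _ τ)
        ((isImmersedPatch hf p).vec K k) ((isImmersedPatch hf p).conn K k)
        ((isImmersedPatch hf p).vec K i) ⬝ᵥ (isImmersedPatch hf p).vec K m) := h
    rw [div_eq_iff two_ne_zero, mul_comm, ← h']
    rfl
  simp only [inducedChristoffel, hk, C.firstForm_inv]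
  have he : ∀ (w : Fin 3 → SmoothFun (chartOpens p)) (a : Fin 2), SmoothFun.eval u (w ⬝ᵥ C.e a)
      = SmoothFun.eval u (C.B a 0) * SmoothFun.eval u (w ⬝ᵥ (isImmersedPatch hf p).vec K 0)
        + SmoothFun.eval u (C.B a 1) * SmoothFun.eval u (w ⬝ᵥ (isImmersedPatch hf p).vec K 1) := by
    intro w a
    rw [C.frame.expand a, dotProduct_add, dotProduct_smul, dotProduct_smul]
    rfl
  rw [Γ, AdaptedFrame.christoffelSymbol, map_sum]
  simp only [Fin.sum_univ_two, Matrix.of_apply, map_mul, he]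
  ring

/-- The covariant derivative of the second fundamental form with respect to a normal field that
is a multiple of the normal of the chart frame. -/
theorem covDerivSecondForm_eq (u : chartOpens p) {ν : Coord 2 → Coord E.dim} {s : ℝ}
    (hν : ∀ᶠ v in 𝓝 (u : Coord 2), ν v ∈ E.tangent (patch E f p v) ∧
      ∀ hv : v ∈ chartOpens p,
        K.coords (patch E f p v) (ν v) = s • (SmoothFun.eval ⟨v, hv⟩ ∘ C.y)) (k i j : Fin 2) :
    covDerivSecondForm E.metric (patch E f p) ν u k i j = s * SmoothFun.eval u (C.covDeriv k i j) := by
  have hev : ∀ i j, (fun v => secondForm E.metric (patch E f p) (ν v) v i j) =ᶠ[𝓝 (u : Coord 2)]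
      fun v => s * SmoothFun.ext (coordForm (partialD _) (algebraMap ℝ _ τ)
        ((isImmersedPatch hf p).vec K) ((isImmersedPatch hf p).conn K) C.y i j) v := by
    intro i j
    filter_upwards [hν, (chartOpens p).isOpen.mem_nhds u.2] with v hv hvt
    rw [(isImmersedPatch hf p).secondForm_eq K hvt hv.1, hv.2 hvt, dotProduct_smul,
      SmoothFun.eval_ext _ ⟨v, hvt⟩, coordForm, SmoothFun.eval_dot, (isImmersedPatch hf p).eval_cov,
      smul_eq_mul]
  have hval : ∀ i j, secondForm E.metric (patch E f p) (ν u) u i j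
      = s * SmoothFun.eval u (coordForm (partialD _) (algebraMap ℝ _ τ)
        ((isImmersedPatch hf p).vec K) ((isImmersedPatch hf p).conn K) C.y i j) := fun i j => by
    rw [← SmoothFun.eval_ext]; exact (hev i j).self_of_nhds
  have hpd : pd k (fun v => secondForm E.metric (patch E f p) (ν v) v i j) u
      = s * SmoothFun.eval u (partialD _ k (coordForm (partialD _) (algebraMap ℝ _ τ)
        ((isImmersedPatch hf p).vec K) ((isImmersedPatch hf p).conn K) C.y i j)) := by
    rw [SmoothFun.eval_partialD, pd, (hev i j).fderiv_eq, pd,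
      fderiv_const_mul (SmoothFun.differentiableAt_ext _ u.2)]
    rfl
  simp only [covDerivSecondForm, hpd, hval, C.inducedChristoffel_eq, Fin.sum_univ_two]
  have hr : SmoothFun.eval u (C.covDeriv k i j) = SmoothFun.eval u (partialD _ k
        (coordForm (partialD _) (algebraMap ℝ _ τ) ((isImmersedPatch hf p).vec K)
          ((isImmersedPatch hf p).conn K) C.y i j))
      - ∑ l, SmoothFun.eval u (C.Γ l k i) * SmoothFun.eval u (coordForm (partialD _)
        (algebraMap ℝ _ τ) ((isImmersedPatch hf p).vec K) ((isImmersedPatch hf p).conn K) C.y l j)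
      - ∑ l, SmoothFun.eval u (C.Γ l k j) * SmoothFun.eval u (coordForm (partialD _)
        (algebraMap ℝ _ τ) ((isImmersedPatch hf p).vec K) ((isImmersedPatch hf p).conn K) C.y i l) := by
    rw [covDeriv, coordCovDeriv]
    simp only [Fin.sum_univ_two]
    rfl
  rw [hr]
  simp only [Fin.sum_univ_two]
  ring

/-- A surface with `∇h = 0` at a point is vertical or horizontal there. -/
theorem angle_sq_mul_eq_zero (hc : κ - 4 * τ ^ 2 ≠ 0) (u : chartOpens p)
    (h : ∀ k i j, SmoothFun.eval u (C.covDeriv k i j) = 0) :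
    SmoothFun.eval u (C.y 2) ^ 2 * (1 - SmoothFun.eval u (C.y 2) ^ 2) = 0 := by
  have hA := (isImmersedPatch hf p).ambientEquations K
  have hs : ∀ l, C.Γ l 0 1 = C.Γ l 1 0 := fun l => by
    simp only [Γ, AdaptedFrame.christoffelSymbol, hA.torsion]
  have hcod := coord_codazzi hA C.frame.coord_dot_normal C.frame.normal_unit C.frame.gaussFormula hs
  have h1 := congrArg (SmoothFun.eval u) (C.frame.codazzi_term_sq
    (τ := algebraMap ℝ _ τ) (c := algebraMap ℝ _ (κ - 4 * τ ^ 2)))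
  have h0 : ∀ j, SmoothFun.eval u (((-(algebraMap ℝ (SmoothFun (chartOpens p)) τ) ^ 2 •
      ((isImmersedPatch hf p).vec K 0 ⨯₃ (isImmersedPatch hf p).vec K 1)
      - (algebraMap ℝ (SmoothFun (chartOpens p)) (κ - 4 * τ ^ 2)
        * ((isImmersedPatch hf p).vec K 0 ⨯₃ (isImmersedPatch hf p).vec K 1) 2)
        • vert (SmoothFun (chartOpens p)))
      ⨯₃ (isImmersedPatch hf p).vec K j) ⬝ᵥ C.y) = 0 := fun j => by
    rw [← hcod j]
    exact (map_sub (SmoothFun.eval u) _ _).trans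
      ((congrArg₂ (· - ·) (h 0 1 j) (h 1 0 j)).trans (sub_zero 0))
  have hz : ∀ k : Fin 2 → SmoothFun (chartOpens p), (∀ j, SmoothFun.eval u (k j) = 0) →
      SmoothFun.eval u (∑ a, ((C.B 0 0 * C.B 1 1 - C.B 0 1 * C.B 1 0) * ∑ j, C.B a j * k j) ^ 2)
        = 0 := fun k hk => by
    simp only [map_sum, map_pow, map_mul, hk, mul_zero, Finset.sum_const_zero]
    simp
  have h2 : (0 : ℝ) = (κ - 4 * τ ^ 2) ^ 2 * (SmoothFun.eval u (C.y 2) ^ 2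
      * (1 - SmoothFun.eval u (C.y 2) ^ 2)) := (hz _ h0).symm.trans h1
  exact (mul_eq_zero.1 h2.symm).resolve_left (pow_ne_zero 2 hc)

end ChartFrame

namespace ChartFrame

variable {M : Type*} [TopologicalSpace M] [ChartedSpace (Coord 2) M] [IsManifold (𝓡 2) ∞ M]
  {E : FiberedModel} {κ τ : ℝ} {K : Coframe E κ τ} {f N : M → Coord E.dim} {H : ℝ}
  {hf : IsSmoothImmersion E f} {p : M} (C : ChartFrame K hf N H p)

theorem eval_normal_unit (u : chartOpens p) :
    (SmoothFun.eval u ∘ C.y) ⬝ᵥ (SmoothFun.eval u ∘ C.y) = 1 := by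
  rw [← SmoothFun.eval_dot, C.frame.normal_unit, map_one]

theorem coords_normal_eq (u : chartOpens p) {ν : Coord E.dim}
    (hν : IsPatchNormal E (patch E f p) u ν) :
    (K.coords (patch E f p u) ν ⬝ᵥ (SmoothFun.eval u ∘ C.y)) ^ 2 = 1 ∧
      K.coords (patch E f p u) ν = (K.coords (patch E f p u) ν ⬝ᵥ (SmoothFun.eval u ∘ C.y))
        • (SmoothFun.eval u ∘ C.y) := by
  obtain ⟨h1, h2⟩ := (isImmersedPatch hf p).isPatchNormal_coords K u.2 hν
  obtain ⟨d, hd⟩ : ∃ d, d = C.B 0 0 * C.B 1 1 - C.B 0 1 * C.B 1 0 := ⟨_, rfl⟩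
  have hy : SmoothFun.eval u ∘ C.y = SmoothFun.eval u d •
      (K.coords (patch E f p u) (pd 0 (patch E f p) u)
        ⨯₃ K.coords (patch E f p u) (pd 1 (patch E f p) u)) := by
    have h := C.frame.normal_eq
    rw [← hd] at h
    rw [← (isImmersedPatch hf p).eval_vec K u, ← (isImmersedPatch hf p).eval_vec K u,
      ← SmoothFun.eval_cross, ← SmoothFun.eval_smul]
    exact congrArg (SmoothFun.eval u ∘ ·) h
  have hyy := C.eval_normal_unit u
  have hq := hyy
  rw [hy, smul_dotProduct, dotProduct_smul, smul_smul, ← sq, smul_eq_mul] at hq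
  rcases eq_or_eq_neg_of_orthogonal (h2 0) (h2 1) h1 hq with h3 | h3
  · rw [← hy] at h3
    rw [h3, hyy]; simp
  · rw [← hy] at h3
    rw [h3, neg_dotProduct, hyy]; simp

end ChartFrame

/-! ### The inequality and the case of equality -/

section conclusions

variable {M : Type*} [TopologicalSpace M] [ChartedSpace (Coord 2) M] [IsManifold (𝓡 2) ∞ M]
  {E : FiberedModel} {κ τ : ℝ} (K : Coframe E κ τ) {f N : M → Coord E.dim} {H : ℝ}
  (hf : IsSmoothImmersion E f) (hN : ∀ p, IsUnitNormal E f p (N p))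
  (hH : HasConstantMeanCurvature E f N H)

include K hf hN

theorem angle_sq_le_one (q : M) : angle E f N q ^ 2 ≤ 1 := by
  have h1 : angle E f N q = K.coords (f q) (N q) 2 := K.metric_xi (hf.mem_carrier q) (hN q).mem_tangent
  have h2 := (hN q).unit
  rw [K.metric_eq_dot (hf.mem_carrier q) (hN q).mem_tangent, dotProduct, Fin.sum_univ_three] at h2
  rw [h1]
  nlinarith [sq_nonneg (K.coords (f q) (N q) 0), sq_nonneg (K.coords (f q) (N q) 1)]

theorem angleTerm_nonneg (c : ℝ) (q : M) : 0 ≤ angleTerm E c f N q :=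
  mul_nonneg (sq_nonneg _) (mul_nonneg (sq_nonneg _)
    (sub_nonneg.2 (angle_sq_le_one K hf hN q)))

include hH

/-- The angle function of a surface with parallel second fundamental form. -/
theorem angle_sq_mul_of_parallel (hc : κ - 4 * τ ^ 2 ≠ 0) (h : HasParallelSecondForm E f) (p : M) :
    angle E f N p ^ 2 * (1 - angle E f N p ^ 2) = 0 := by
  obtain ⟨U, ν, hU, hpU, hν, hνN, hpar⟩ := h p
  set C := chartFrame K hf hN hH p
  have hP := isImmersedPatch hf p
  have ht := mem_chart_target (Coord 2) p
  have hsymm : (chartAt (Coord 2) p).symm (chartAt (Coord 2) p p) = p :=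
    (chartAt (Coord 2) p).left_inv (mem_chart_source _ p)
  let u₀ : chartOpens p := ⟨chartAt (Coord 2) p p, ht⟩
  set O : Opens (Coord 2) := ⟨(chartAt (Coord 2) p).target ∩ (chartAt (Coord 2) p).symm ⁻¹' U,
    (chartAt (Coord 2) p).isOpen_inter_preimage_symm hU⟩ with hO
  have hu₀ : (u₀ : Coord 2) ∈ O := ⟨ht, by rw [mem_preimage, hsymm]; exact hpU⟩
  have hPO : IsImmersedPatch E (patch E f p) O := ⟨hP.contDiffOn.mono inter_subset_left,
    fun u hu => hP.mem u hu.1, fun u hu => hP.injective u hu.1⟩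
  have hνO : ContDiffOn ℝ ∞ (patch E ν p) O := contDiffOn_comp_chart_symm hν p
  have hnorm : ∀ v ∈ O, IsPatchNormal E (patch E f p) v (patch E ν p v) := fun v hv =>
    (isPatchNormal_iff hf K p hv.1 _).1 (hνN _ hv.2)
  set g : Coord 2 → ℝ := fun v =>
    ∑ l, K.coords (patch E f p v) (patch E ν p v) l * SmoothFun.ext (C.y l) v with hg
  have hgc : ContinuousOn g O := continuousOn_finsetSum _ fun l _ =>
    (hPO.contDiffOn_coords K hνO l).continuousOn.mul
      ((SmoothFun.contDiffOn_ext (C.y l)).continuousOn.mono inter_subset_left)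
  have hgeq : ∀ v (hv : v ∈ O), g v = K.coords (patch E f p v) (patch E ν p v)
      ⬝ᵥ (SmoothFun.eval (⟨v, hv.1⟩ : chartOpens p) ∘ C.y) := fun v hv =>
    Finset.sum_congr rfl fun l _ => by
      rw [SmoothFun.eval_ext _ (⟨v, hv.1⟩ : chartOpens p)]; rfl
  have hsq : ∀ v ∈ O, g v = 1 ∨ g v = -1 := fun v hv => by
    have := (C.coords_normal_eq ⟨v, hv.1⟩ (hnorm v hv)).1
    rw [← hgeq v hv] at this
    rwa [sq, mul_self_eq_one_iff] at this
  -- The given local normal and that of the chart frame differ by the sign `g`, which is continuous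
  -- and hence constant near the point. Thus ∇h for one is a nonzero multiple of ∇h for the other.
  have hev : ∀ᶠ v in 𝓝 (u₀ : Coord 2), g v = g u₀ := by
    have hcont := hgc.continuousAt (O.isOpen.mem_nhds hu₀)
    filter_upwards [O.isOpen.mem_nhds hu₀, Metric.tendsto_nhds.1 hcont 1 one_pos] with v hv hd
    rw [Real.dist_eq] at hd
    rcases hsq v hv with h1 | h1 <;> rcases hsq u₀ hu₀ with h2 | h2 <;> rw [h1, h2] at hd ⊢ <;>
      norm_num at hd
  have key := C.covDerivSecondForm_eq u₀ (ν := patch E ν p) (s := g u₀) (by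
    filter_upwards [hev, O.isOpen.mem_nhds hu₀] with v hv hvO
    refine ⟨(hnorm v hvO).mem_tangent, fun hvt => ?_⟩
    rw [← hv, hgeq v hvO]
    exact (C.coords_normal_eq ⟨v, hvO.1⟩ (hnorm v hvO)).2)
  have hs0 : g u₀ ≠ 0 := by rcases hsq u₀ hu₀ with h1 | h1 <;> rw [h1] <;> norm_num
  have hz := C.angle_sq_mul_eq_zero hc u₀ fun k i j =>
    (mul_eq_zero.1 ((key k i j).symm.trans (hpar k i j))).resolve_left hs0
  rw [← C.angle_sq hN u₀] at hz
  rwa [show (chartAt (Coord 2) p).symm u₀ = p from hsymm] at hz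

/-- No surface is horizontal. -/
theorem exists_angle_sq_ne_one [Nonempty M] (hτ : τ ≠ 0) : ∃ q, angle E f N q ^ 2 ≠ 1 := by
  by_contra! h
  obtain ⟨p⟩ := ‹Nonempty M›
  set C := chartFrame K hf hN hH p
  have hy : ∀ u, SmoothFun.eval u (C.y 2) ^ 2 = 1 := fun u => by rw [← C.angle_sq hN]; exact h _
  have hv : ∀ u, SmoothFun.eval u (C.e 0 2) ^ 2 + SmoothFun.eval u (C.e 1 2) ^ 2 = 0 := fun u => by
    have h1 := congrArg (SmoothFun.eval u) C.frame.vert_sq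
    have h2 : SmoothFun.eval u (C.e 0 2) ^ 2 + SmoothFun.eval u (C.e 1 2) ^ 2
      + SmoothFun.eval u (C.y 2) ^ 2 = 1 := h1
    linarith [hy u]
  have h0 : C.e 0 2 = 0 := SmoothFun.eq_of_eval fun u => by
    rw [map_zero]
    exact pow_eq_zero_iff two_ne_zero |>.1 (by
      linarith [hv u, sq_nonneg (SmoothFun.eval u (C.e 0 2)), sq_nonneg (SmoothFun.eval u (C.e 1 2))])
  have h1 : C.e 1 2 = 0 := SmoothFun.eq_of_eval fun u => by
    rw [map_zero]
    exact pow_eq_zero_iff two_ne_zero |>.1 (by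
      linarith [hv u, sq_nonneg (SmoothFun.eval u (C.e 0 2)), sq_nonneg (SmoothFun.eval u (C.e 1 2))])
  have he : ∀ a, C.e a 2 = 0 := Fin.forall_fin_two.2 ⟨h0, h1⟩
  have h0 := C.frame.tau_mul_angle_of_horizontal ((isImmersedPatch hf p).ambientEquations K) he
  let u₀ : chartOpens p := ⟨chartAt (Coord 2) p p, mem_chart_target _ p⟩
  have h1 : τ * SmoothFun.eval u₀ (C.y 2) = 0 := congrArg (SmoothFun.eval u₀) h0
  have h2 := (mul_eq_zero.1 h1).resolve_left hτ
  have h3 := hy u₀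
  rw [h2] at h3
  norm_num at h3

/-- The continuous function C² has values in {0, 1}. Its zero set is open and closed, and it is not
empty because no surface is horizontal. -/
theorem angle_eq_zero [ConnectedSpace M] (hτ : τ ≠ 0)
    (h : ∀ q, angle E f N q ^ 2 * (1 - angle E f N q ^ 2) = 0) (q : M) : angle E f N q = 0 := by
  have hc := continuous_angle_sq K hf hN hH
  have hor : ∀ q, angle E f N q ^ 2 = 0 ∨ angle E f N q ^ 2 = 1 := fun q =>
    (mul_eq_zero.1 (h q)).imp_right fun h => by linarith
  have hcl : IsClopen {q | angle E f N q ^ 2 = 0} := by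
    refine ⟨isClosed_eq hc continuous_const, ?_⟩
    have : {q | angle E f N q ^ 2 = 0} = {q | angle E f N q ^ 2 = 1}ᶜ := by
      ext q
      simp only [mem_ofPred_eq, mem_compl_iff]
      rcases hor q with h1 | h1 <;> rw [h1] <;> norm_num
    rw [this]
    exact (isClosed_eq hc continuous_const).isOpen_compl
  obtain ⟨q₁, hq₁⟩ := exists_angle_sq_ne_one K hf hN hH hτ
  have hu := hcl.eq_univ ⟨q₁, (hor q₁).resolve_right hq₁⟩
  exact pow_eq_zero_iff two_ne_zero |>.1 (hu.symm ▸ mem_univ q : q ∈ {q | angle E f N q ^ 2 = 0})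

section vertical

variable (h0 : ∀ q, angle E f N q = 0)

include h0

omit hH in
theorem ChartFrame.angle_eq_zero {p : M} (C : ChartFrame K hf N H p) : C.y 2 = 0 :=
  SmoothFun.eq_of_eval fun u => by
    rw [map_zero]
    exact pow_eq_zero_iff two_ne_zero |>.1 (by rw [← C.angle_sq hN, h0]; norm_num)

theorem normSqPhi_of_vertical (q : M) : normSqPhi E f N H q = 2 * (H ^ 2 + τ ^ 2) := by
  set C := chartFrame K hf hN hH q
  have h := C.normSqPhi_eq hN ⟨chartAt (Coord 2) q q, mem_chart_target _ q⟩
  simp only at h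
  rw [(chartAt (Coord 2) q).left_inv (mem_chart_source _ q)] at h
  rw [h, ChartFrame.halfNorm, C.frame.halfNormSq_of_vertical
    (ChartFrame.angle_eq_zero K hf hN h0 C) C.trace ((isImmersedPatch hf q).ambientEquations K)]
  rfl

theorem simonsFun_of_vertical (q : M) : simonsFun E τ (κ - 4 * τ ^ 2) H f N q = 0 := by
  rw [simonsFun, normSqPhi_of_vertical K hf hN hH h0, h0]
  ring

theorem normSqA_of_vertical (q : M) : normSqA E f N q = 2 * (2 * H ^ 2 + τ ^ 2) := by
  rw [normSqA_eq hf hN hH, normSqPhi_of_vertical K hf hN hH h0]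
  ring

/-- The required smooth local normal is that of the chart frame, since `N` itself may fail to be
continuous when H = 0. -/
theorem hasParallelSecondForm_of_vertical : HasParallelSecondForm E f := by
  intro p
  set C := chartFrame K hf hN hH p
  have hP := isImmersedPatch hf p
  set n : Coord 2 → Coord E.dim := fun v =>
    K.ofCoords (patch E f p v) fun l => SmoothFun.ext (C.y l) v with hn
  have hnd : ContDiffOn ℝ ∞ n (chartAt (Coord 2) p).target := by
    refine ContDiffOn.sum fun l _ => (SmoothFun.contDiffOn_ext (C.y l)).smul ?_
    exact (K.contDiffOn_frame l).comp hP.contDiffOn (hP.mapsTo_dom K)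
  have hco : ∀ (v) (hv : v ∈ chartOpens p), n v = K.ofCoords (patch E f p v)
      (SmoothFun.eval ⟨v, hv⟩ ∘ C.y) := fun v hv => by
    simp only [hn]
    congr 1
    funext l
    rw [SmoothFun.eval_ext _ ⟨v, hv⟩]; rfl
  have hnn : ∀ v ∈ chartOpens p, IsPatchNormal E (patch E f p) v (n v) := fun v hv => by
    rw [hco v hv]
    refine hP.isPatchNormal_of_coords K hv (C.eval_normal_unit _) fun i => ?_
    rw [← hP.eval_vec K ⟨v, hv⟩, ← SmoothFun.eval_dot, C.frame.coord_dot_normal, map_zero]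
  refine ⟨(chartAt (Coord 2) p).source, n ∘ chartAt (Coord 2) p, (chartAt (Coord 2) p).open_source,
    mem_chart_source _ p, ?_, fun q hq => ?_, fun k i j => ?_⟩
  · exact hnd.contMDiffOn.comp (contMDiffOn_chart (n := ∞)) (chartAt (Coord 2) p).mapsTo
  · have h := (isPatchNormal_iff hf K p ((chartAt (Coord 2) p).map_source hq) _).2
      (hnn _ ((chartAt (Coord 2) p).map_source hq))
    rwa [(chartAt (Coord 2) p).left_inv hq] at h
  · have h := C.covDerivSecondForm_eq ⟨chartAt (Coord 2) p p, mem_chart_target _ p⟩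
      (ν := patch E (n ∘ chartAt (Coord 2) p) p) (s := 1) (by
        filter_upwards [(chartOpens p).isOpen.mem_nhds (mem_chart_target (Coord 2) p)] with v hv
        have e : patch E (n ∘ chartAt (Coord 2) p) p v = n v := by
          rw [patch, Function.comp_apply, Function.comp_apply, (chartAt (Coord 2) p).right_inv hv]
        rw [e]
        refine ⟨(hnn v hv).mem_tangent, fun _ => ?_⟩
        rw [hco v hv, K.coords_ofCoords (hP.mem v hv), one_smul]) k i j
    refine h.trans ?_
    have hz : C.covDeriv k i j = 0 := C.frame.coordCovDeriv_of_vertical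
      (ChartFrame.angle_eq_zero K hf hN h0 C) C.trace (hP.ambientEquations K)
      (fun i => partialD_algebraMap i _) C.frame.gaussFormula k i j
    rw [hz, map_zero, mul_zero]

end vertical

section integral

variable [T2Space M] [CompactSpace M] [ConnectedSpace M] [MeasurableSpace M] [BorelSpace M]

theorem integrable_simonsFun (τ' c : ℝ) :
    Integrable (simonsFun E τ' c H f N) (areaMeasure E f) := by
  have := isLocallyFiniteMeasure_areaMeasure K hf
  exact (continuous_simonsFun K hf hN hH _ _).integrable_of_hasCompactSupport
    (HasCompactSupport.of_compactSpace _)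

theorem integral_simonsFun_nonneg :
    0 ≤ ∫ q, simonsFun E τ (κ - 4 * τ ^ 2) H f N q ∂areaMeasure E f :=
  (integral_nonneg fun q => angleTerm_nonneg K hf hN _ q).trans (integral_angleTerm_le K hf hN hH)

/-- Equality squeezes the integral of c²C²(1 - C²) to zero. This integrand is continuous and
nonnegative, so it vanishes identically, and c ≠ 0. -/
theorem angle_eq_zero_of_integral (hτ : τ ≠ 0) (hc : κ - 4 * τ ^ 2 ≠ 0)
    (h : ∫ q, simonsFun E τ (κ - 4 * τ ^ 2) H f N q ∂areaMeasure E f = 0) (q : M) :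
    angle E f N q = 0 := by
  have := isLocallyFiniteMeasure_areaMeasure K hf
  have := isOpenPosMeasure_areaMeasure K hf
  have hcont := continuous_angleTerm K hf hN hH (κ - 4 * τ ^ 2)
  have hi : ∫ q, angleTerm E (κ - 4 * τ ^ 2) f N q ∂areaMeasure E f = 0 :=
    le_antisymm (h ▸ integral_angleTerm_le K hf hN hH)
      (integral_nonneg fun q => angleTerm_nonneg K hf hN _ q)
  rw [integral_eq_zero_iff_of_nonneg (fun q => angleTerm_nonneg K hf hN _ q)
    (hcont.integrable_of_hasCompactSupport (HasCompactSupport.of_compactSpace _))] at hi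
  replace hi := (hcont.ae_eq_iff_eq (areaMeasure E f) continuous_zero).1 hi
  refine angle_eq_zero K hf hN hH hτ (fun q => ?_) q
  exact (mul_eq_zero.1 (congrFun hi q)).resolve_left (pow_ne_zero 2 hc)

theorem integral_simonsFun_eq_zero_iff (hτ : τ ≠ 0) (hc : κ - 4 * τ ^ 2 ≠ 0) :
    ∫ q, simonsFun E τ (κ - 4 * τ ^ 2) H f N q ∂areaMeasure E f = 0 ↔ HasParallelSecondForm E f := by
  refine ⟨fun h => hasParallelSecondForm_of_vertical K hf hN hH
    (angle_eq_zero_of_integral K hf hN hH hτ hc h), fun h => ?_⟩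
  have h0 := angle_eq_zero K hf hN hH hτ (angle_sq_mul_of_parallel K hf hN hH hc h)
  simp [simonsFun_of_vertical K hf hN hH h0]

end integral

end conclusions

/-! ### Vertical surfaces: derivative of the normal and the constant vector -/

section verticalFrame

variable {A : Type*} [CommRing A] [Algebra ℝ A]
  {D : Fin 2 → Derivation ℝ A A} {τ c H : A} {x : Fin 2 → Fin 3 → A} {α : Fin 2 → A}
  {B : Fin 2 → Fin 2 → A} {e : Fin 2 → Fin 3 → A} {y : Fin 3 → A}

namespace AdaptedFrame

theorem ext_coord (hF : AdaptedFrame x B e y) {v w : Fin 3 → A} (h : ∀ i, x i ⬝ᵥ v = x i ⬝ᵥ w)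
    (hy : y ⬝ᵥ v = y ⬝ᵥ w) : v = w := by
  have he : ∀ a, v ⬝ᵥ e a = w ⬝ᵥ e a := fun a => by
    rw [dotProduct_comm v, dotProduct_comm w, hF.expand a]
    simp only [add_dotProduct, smul_dotProduct, h]
  exact hF.ext_dot (he 0) (he 1) (by rw [dotProduct_comm v, dotProduct_comm w, hy])

variable (hF : AdaptedFrame x B e y) (hC : y 2 = 0)

include hF hC

theorem cross_two_of_vertical : (x 0 ⨯₃ x 1) 2 = 0 := by
  have h := congrFun hF.normal_eq 2
  rw [hC, Pi.smul_apply, smul_eq_mul] at h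
  exact (hF.det_unit.mul_right_eq_zero).mp h.symm

theorem sq_add_sq_of_vertical : y 0 ^ 2 + y 1 ^ 2 = 1 := by
  have h := hF.normal_unit
  simp only [dotProduct, Fin.sum_univ_three, hC] at h
  linear_combination h

theorem coord_of_vertical (i : Fin 2) : x i 0 = (x i 0 * y 1 - x i 1 * y 0) * y 1 ∧
    x i 1 = -(x i 0 * y 1 - x i 1 * y 0) * y 0 := by
  have h := hF.sq_add_sq_of_vertical hC
  have h1 := hF.coord_dot_normal i
  simp only [dotProduct, Fin.sum_univ_three, hC] at h1
  constructor
  · linear_combination -x i 0 * h + y 0 * h1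
  · linear_combination -x i 1 * h + y 1 * h1

theorem deriv_normal_of_vertical (hA : AmbientEquations D τ c x α)
    (tr : frameForm D τ x α B e y 0 0 + frameForm D τ x α B e y 1 1 = 2 * H) (i : Fin 2) :
    D i (y 0) = (2 * τ * x i 2 + α i) * y 1 - 2 * H * (x i 0 * y 1 - x i 1 * y 0) * y 1 ∧
    D i (y 1) = -(2 * τ * x i 2 + α i) * y 0 + 2 * H * (x i 0 * y 1 - x i 1 * y 0) * y 0 := by
  have hform := fun j => hF.coordForm_of_vertical hC tr hA i j
  -- On a vertical surface A is known, so the Weingarten equation gives the covariant derivative of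
  -- the normal. Its components along ∂₀F, ∂₁F and `y` determine it.
  have h : cov (D i) τ (x i) (α i) y = ![(τ * x i 2 - 2 * H * (x i 0 * y 1 - x i 1 * y 0)) * y 1,
      -(τ * x i 2 - 2 * H * (x i 0 * y 1 - x i 1 * y 0)) * y 0,
      τ * (x i 0 * y 1 - x i 1 * y 0)] := by
    refine hF.ext_coord (fun j => ?_) ?_
    · rw [cov_dot_eq hF.coord_dot_normal, hform]
      simp only [dotProduct, Fin.sum_univ_three, cons_val]
      ring
    · rw [cov_unit_dot hF.normal_unit]
      simp only [dotProduct, Fin.sum_univ_three, cons_val, hC]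
      ring
  have h0 := congrFun h 0
  have h1 := congrFun h 1
  simp only [cov_zero, cov_one, hC, cons_val] at h0 h1
  constructor
  · linear_combination h0
  · linear_combination h1

end AdaptedFrame

/-- The Hopf map in `ℝ⁴`. -/
def hopf (p : Fin 4 → A) : Fin 3 → A :=
  ![2 * (p 0 * p 2 + p 1 * p 3), 2 * (p 1 * p 2 - p 0 * p 3), p 0 ^ 2 + p 1 ^ 2 - p 2 ^ 2 - p 3 ^ 2]

/-- The images under the differential of the Hopf map of the horizontal frame. -/
def hopfFrame : Fin 2 → (Fin 4 → A) → Fin 3 → A :=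
  ![fun p => ![2 * (p 0 * p 1 - p 2 * p 3), p 1 ^ 2 + p 3 ^ 2 - p 0 ^ 2 - p 2 ^ 2,
      -2 * (p 0 * p 3 + p 1 * p 2)],
    fun p => ![p 0 ^ 2 - p 1 ^ 2 - p 2 ^ 2 + p 3 ^ 2, 2 * (p 0 * p 1 + p 2 * p 3),
      2 * (p 1 * p 3 - p 0 * p 2)]]

/-- The normal vector of the circle to which a vertical surface projects. -/
def circleNormal (m : A) (p : Fin 4 → A) (y : Fin 3 → A) : Fin 3 → A :=
  y 0 • hopfFrame 0 p + y 1 • hopfFrame 1 p + m • hopf p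

/-- The point moves with velocity (a, b) in the horizontal frame and `c` along the fibre. Motion
along the fibre turns `hopfFrame` at speed 2c, which the rotation of `y` compensates up to a turn at
speed 2w. The remainder is cancelled by the derivative of m·hopf, by `ha` and `hb`. The component
along hopf vanishes by `hy`. -/
theorem deriv_circleNormal (D : Derivation ℝ A A) {p : Fin 4 → A} {y : Fin 3 → A} {a b c m w : A}
    (h0 : D (p 0) = -a * p 3 - b * p 2 - c * p 1) (h1 : D (p 1) = -a * p 2 + b * p 3 + c * p 0)
    (h2 : D (p 2) = a * p 1 + b * p 0 - c * p 3) (h3 : D (p 3) = a * p 0 - b * p 1 + c * p 2)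
    (y0 : D (y 0) = 2 * (c - w) * y 1) (y1 : D (y 1) = -2 * (c - w) * y 0)
    (hm : D m = 0) (ha : m * a = w * y 1) (hb : m * b = -w * y 0) (hy : a * y 0 + b * y 1 = 0)
    (l : Fin 3) : D (circleNormal m p y l) = 0 := by
  have two : D 2 = 0 := by simpa using D.map_natCast 2
  fin_cases l <;>
  simp only [circleNormal, hopf, hopfFrame, Pi.add_apply, Pi.smul_apply, smul_eq_mul, cons_val,
    Fin.zero_eta, Fin.mk_one, Fin.reduceFinMk, map_add, map_sub, map_neg, Derivation.leibniz, two,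
    derivation_pow_two, h0, h1, h2, h3, y0, y1, hm]
  · linear_combination 2 * (2 * (p 0 * p 1 - p 2 * p 3)) * ha
      + 2 * (p 0 ^ 2 - p 1 ^ 2 - p 2 ^ 2 + p 3 ^ 2) * hb
      - 2 * (2 * (p 0 * p 2 + p 1 * p 3)) * hy
  · linear_combination 2 * (p 1 ^ 2 + p 3 ^ 2 - p 0 ^ 2 - p 2 ^ 2) * ha
      + 2 * (2 * (p 0 * p 1 + p 2 * p 3)) * hb
      - 2 * (2 * (p 1 * p 2 - p 0 * p 3)) * hy
  · linear_combination 2 * (-2 * (p 0 * p 3 + p 1 * p 2)) * ha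
      + 2 * (2 * (p 1 * p 3 - p 0 * p 2)) * hb
      - 2 * (p 0 ^ 2 + p 1 ^ 2 - p 2 ^ 2 - p 3 ^ 2) * hy

end verticalFrame

/-! ### No compact vertical surfaces for κ ≤ 0 -/

section cartanVertical

variable {M : Type*} [TopologicalSpace M] [ChartedSpace (Coord 2) M] [IsManifold (𝓡 2) ∞ M]

theorem pd_eq_zero_of_isMaxOn {F : Coord 2 → Coord 3} {u : Coord 2} (hF : DifferentiableAt ℝ F u)
    (h : IsLocalMax (fun v => F v 2) u) (i : Fin 2) : pd i F u 2 = 0 := by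
  have h1 : HasFDerivAt (fun v => F v 2) ((dx 2 : Coord 3 →L[ℝ] ℝ).comp (fderiv ℝ F u)) u :=
    (dx 2 : Coord 3 →L[ℝ] ℝ).hasFDerivAt.comp u hF.hasFDerivAt
  have h2 := h.hasFDerivAt_eq_zero h1
  exact congrArg (fun L : Coord 2 →L[ℝ] ℝ => L (EuclideanSpace.single i 1)) h2

/-- For `κ ≤ 0` there are no compact vertical surfaces. -/
theorem cartan_not_vertical [CompactSpace M] [Nonempty M] {κ τ H : ℝ} {f N : M → Coord 3}
    (hf : IsSmoothImmersion (cartanModel κ τ) f)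
    (hN : ∀ p, IsUnitNormal (cartanModel κ τ) f p (N p))
    (hH : HasConstantMeanCurvature (cartanModel κ τ) f N H)
    (h0 : ∀ q, angle (cartanModel κ τ) f N q = 0) : False := by
  set K := cartanCoframe κ τ with hK
  have hcont : Continuous fun q => f q 2 :=
    (dx 2 : Coord 3 →L[ℝ] ℝ).continuous.comp hf.contMDiff.continuous
  -- At a maximum of z the tangent plane is dz = 0. There θ₂ is a combination of θ₀ and θ₁, which is
  -- the content of `hx` below.
  obtain ⟨p, -, hp⟩ := isCompact_univ.exists_isMaxOn univ_nonempty hcont.continuousOn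
  set C := chartFrame K hf hN hH p
  have hP := isImmersedPatch hf p
  let u₀ : chartOpens p := ⟨chartAt (Coord 2) p p, mem_chart_target _ p⟩
  set F : Coord 2 → Coord 3 := patch (cartanModel κ τ) f p with hF
  have hFp : F u₀ = f p := congrArg f ((chartAt (Coord 2) p).left_inv (mem_chart_source _ p))
  have hmax : IsLocalMax (fun v => F v 2) u₀ := .of_forall fun v => by
    change F v 2 ≤ F u₀ 2
    rw [hFp]; exact hp (mem_univ _)
  have hz := pd_eq_zero_of_isMaxOn (hP.differentiableAt u₀.2) hmax
  have hx : ∀ i, K.coords (F u₀) (pd i F u₀) 2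
      = τ * (F u₀ 1 * K.coords (F u₀) (pd i F u₀) 0 - F u₀ 0 * K.coords (F u₀) (pd i F u₀) 1) := by
    intro i
    have e : K.coords (F u₀) (pd i F u₀) 2 = pd i F u₀ 2 + τ * conformalFactor κ (F u₀)
      * (F u₀ 1 * pd i F u₀ 0 - F u₀ 0 * pd i F u₀ 1) := rfl
    have e0 : K.coords (F u₀) (pd i F u₀) 0 = conformalFactor κ (F u₀) * pd i F u₀ 0 := rfl
    have e1 : K.coords (F u₀) (pd i F u₀) 1 = conformalFactor κ (F u₀) * pd i F u₀ 1 := rfl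
    rw [e, e0, e1, hz]
    ring
  have hc2 : (K.coords (F u₀) (pd 0 F u₀) ⨯₃ K.coords (F u₀) (pd 1 F u₀)) 2 = 0 := by
    have h := congrArg (SmoothFun.eval u₀) (C.frame.cross_two_of_vertical
      (ChartFrame.angle_eq_zero K hf hN h0 C))
    rw [map_zero] at h
    rw [← hP.eval_vec K u₀, ← hP.eval_vec K u₀, ← SmoothFun.eval_cross]
    exact h
  have hpos := hP.cross_pos K u₀.2
  change 0 < (K.coords (F u₀) (pd 0 F u₀) ⨯₃ K.coords (F u₀) (pd 1 F u₀))
    ⬝ᵥ (K.coords (F u₀) (pd 0 F u₀) ⨯₃ K.coords (F u₀) (pd 1 F u₀)) at hpos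
  have hx0 := hx 0
  have hx1 := hx 1
  generalize K.coords (F u₀) (pd 0 F u₀) = a at *
  generalize K.coords (F u₀) (pd 1 F u₀) = b at *
  have hc2' := hc2
  rw [cross_two] at hc2'
  -- Verticality says that the horizontal parts of the two tangent vectors are dependent. Since
  -- their vertical parts are the same combination of the horizontal ones, the vectors themselves
  -- are dependent, contrary to the immersion.
  have hzero : a ⨯₃ b = 0 := by
    refine ext_three ?_ ?_ hc2
    · rw [cross_zero, hx0, hx1, Pi.zero_apply]
      linear_combination -τ * F u₀ 1 * hc2'
    · rw [cross_one, hx0, hx1, Pi.zero_apply]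
      linear_combination τ * F u₀ 0 * hc2'
  rw [hzero, zero_dotProduct] at hpos
  exact lt_irrefl _ hpos

end cartanVertical

/-! ### The Hopf map and circles on the sphere -/

section hopfMap

/-- The bracket with the factor 2 is the squared modulus of the Hermitian product of `p` and `q`.
The identity yields both the unit length of the image and the description of the fibres. -/
theorem hopf_dot_hopf (p q : Fin 4 → ℝ) : hopf p ⬝ᵥ hopf q
    = 2 * ((p 0 * q 0 + p 1 * q 1 + p 2 * q 2 + p 3 * q 3) ^ 2
        + (-p 1 * q 0 + p 0 * q 1 - p 3 * q 2 + p 2 * q 3) ^ 2)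
      - (p 0 ^ 2 + p 1 ^ 2 + p 2 ^ 2 + p 3 ^ 2) * (q 0 ^ 2 + q 1 ^ 2 + q 2 ^ 2 + q 3 ^ 2) := by
  simp only [hopf, dotProduct, Fin.sum_univ_three, cons_val]
  ring

variable {p : Fin 4 → ℝ} (hp : p 0 ^ 2 + p 1 ^ 2 + p 2 ^ 2 + p 3 ^ 2 = 1)

include hp

theorem hopf_dot_self : hopf p ⬝ᵥ hopf p = 1 := by
  rw [hopf_dot_hopf]
  linear_combination (p 0 ^ 2 + p 1 ^ 2 + p 2 ^ 2 + p 3 ^ 2 + 1) * hp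

theorem hopfFrame_dot (a b : Fin 2) : hopfFrame a p ⬝ᵥ hopfFrame b p = if a = b then 1 else 0 := by
  fin_cases a <;> fin_cases b <;>
  simp only [hopfFrame, dotProduct, Fin.sum_univ_three, cons_val, Fin.zero_eta, Fin.mk_one,
    Fin.isValue, ite_true, zero_ne_one, one_ne_zero, ite_false]
  · linear_combination (p 0 ^ 2 + p 1 ^ 2 + p 2 ^ 2 + p 3 ^ 2 + 1) * hp
  · ring
  · ring
  · linear_combination (p 0 ^ 2 + p 1 ^ 2 + p 2 ^ 2 + p 3 ^ 2 + 1) * hp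

omit hp in
theorem hopf_dot_hopfFrame (p : Fin 4 → ℝ) (a : Fin 2) : hopf p ⬝ᵥ hopfFrame a p = 0 := by
  fin_cases a <;>
  simp only [hopf, hopfFrame, dotProduct, Fin.sum_univ_three, cons_val, Fin.zero_eta, Fin.mk_one]
  <;> ring

theorem hopf_dot_circleNormal (m : ℝ) (y : Fin 3 → ℝ) : hopf p ⬝ᵥ circleNormal m p y = m := by
  simp only [circleNormal, dotProduct_add, dotProduct_smul, hopf_dot_hopfFrame, hopf_dot_self hp,
    smul_eq_mul]
  ring

/-- The fibres of the Hopf map are circles. -/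
theorem exists_angle_of_hopf_eq {q : Fin 4 → ℝ} (hq : q 0 ^ 2 + q 1 ^ 2 + q 2 ^ 2 + q 3 ^ 2 = 1)
    (h : hopf p = hopf q) : ∃ c s : ℝ, c ^ 2 + s ^ 2 = 1 ∧ q 0 = c * p 0 - s * p 1 ∧
      q 1 = c * p 1 + s * p 0 ∧ q 2 = c * p 2 - s * p 3 ∧ q 3 = c * p 3 + s * p 2 := by
  have h1 := hopf_dot_hopf p q
  rw [← h, hopf_dot_self hp, hp, hq] at h1
  -- `c` and `s` are the real and imaginary parts of the Hermitian product. It has modulus 1, which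
  -- is equality in the Cauchy–Schwarz inequality, so q = (c + is)p.
  obtain ⟨c, hc⟩ : ∃ c, c = p 0 * q 0 + p 1 * q 1 + p 2 * q 2 + p 3 * q 3 := ⟨_, rfl⟩
  obtain ⟨s, hs⟩ : ∃ s, s = -p 1 * q 0 + p 0 * q 1 - p 3 * q 2 + p 2 * q 3 := ⟨_, rfl⟩
  rw [← hc, ← hs] at h1
  have h2 : c ^ 2 + s ^ 2 = 1 := by linarith
  have h3 : (q 0 - (c * p 0 - s * p 1)) ^ 2 + (q 1 - (c * p 1 + s * p 0)) ^ 2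
      + (q 2 - (c * p 2 - s * p 3)) ^ 2 + (q 3 - (c * p 3 + s * p 2)) ^ 2 = 0 := by
    linear_combination hq + (c ^ 2 + s ^ 2) * hp + 2 * c * hc + 2 * s * hs - h2
  have hz : ∀ a b c d : ℝ, a ^ 2 + b ^ 2 + c ^ 2 + d ^ 2 = 0 → a = 0 ∧ b = 0 ∧ c = 0 ∧ d = 0 := by
    intro a b c d h
    refine ⟨?_, ?_, ?_, ?_⟩ <;>
    exact pow_eq_zero_iff two_ne_zero |>.1
      (by linarith [sq_nonneg a, sq_nonneg b, sq_nonneg c, sq_nonneg d])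
  obtain ⟨e0, e1, e2, e3⟩ := hz _ _ _ _ h3
  exact ⟨c, s, h2, sub_eq_zero.1 e0, sub_eq_zero.1 e1, sub_eq_zero.1 e2, sub_eq_zero.1 e3⟩

omit hp in
theorem exists_cos_sin {a b : ℝ} (h : a ^ 2 + b ^ 2 = 1) : ∃ t, Real.cos t = a ∧ Real.sin t = b := by
  have h1 : ‖(⟨a, b⟩ : ℂ)‖ = 1 := by
    rw [Complex.norm_def, Complex.normSq_mk, Real.sqrt_eq_one]; linarith
  have h2 : (⟨a, b⟩ : ℂ) ≠ 0 := fun h => by rw [h, norm_zero] at h1; exact zero_ne_one h1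
  exact ⟨Complex.arg ⟨a, b⟩, by rw [Complex.cos_arg h2, h1, div_one],
    by rw [Complex.sin_arg, h1, div_one]⟩

-- An explicit preimage: away from the south pole the first complex coordinate can be taken real and
-- positive.
omit hp in
theorem hopf_surjective {x : Fin 3 → ℝ} (hx : x ⬝ᵥ x = 1) : ∃ p : Coord 4,
    p ∈ Metric.sphere (0 : Coord 4) 1 ∧ hopf p.ofLp = x := by
  simp only [dotProduct, Fin.sum_univ_three] at hx
  have hmem : ∀ p : Coord 4, p 0 ^ 2 + p 1 ^ 2 + p 2 ^ 2 + p 3 ^ 2 = 1 →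
      p ∈ Metric.sphere (0 : Coord 4) 1 := fun p hp => by
    rw [mem_sphere_zero_iff_norm, EuclideanSpace.norm_eq, Real.sqrt_eq_one, Fin.sum_univ_four]
    simpa using hp
  by_cases hz : x 2 = -1
  · refine ⟨!₂[0, 0, 1, 0], hmem _ (by simp), ?_⟩
    have h0 : x 0 = 0 := by nlinarith [sq_nonneg (x 0), sq_nonneg (x 1)]
    have h1 : x 1 = 0 := by nlinarith [sq_nonneg (x 0), sq_nonneg (x 1)]
    apply ext_three <;> simp [hopf, h0, h1, hz]
  · have hlt : 0 < (1 + x 2) / 2 := by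
      have : -1 ≤ x 2 := by nlinarith [sq_nonneg (x 0), sq_nonneg (x 1)]
      have := lt_of_le_of_ne this (Ne.symm hz)
      linarith
    -- The modulus of the first coordinate is determined by |z|² + |w|² = 1 and |z|² - |w|² = x₂;
    -- the other coordinate then follows from 2zw̄.
    obtain ⟨r, hr⟩ : ∃ r, r = √((1 + x 2) / 2) := ⟨_, rfl⟩
    have hr0 : 0 < r := hr ▸ Real.sqrt_pos.2 hlt
    have hr2 : r ^ 2 = (1 + x 2) / 2 := hr ▸ Real.sq_sqrt hlt.le
    have hs : (x 0 / (2 * r)) ^ 2 + (-x 1 / (2 * r)) ^ 2 = (1 - x 2) / 2 := by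
      field_simp
      rw [hr2]
      linear_combination hx
    refine ⟨!₂[r, 0, x 0 / (2 * r), -x 1 / (2 * r)], hmem _ ?_, ?_⟩
    · simp only [cons_val]
      linear_combination hr2 + hs
    · apply ext_three <;> simp only [hopf, cons_val]
      · field_simp
        ring
      · field_simp
        ring
      · linear_combination hr2 - hs

end hopfMap

section circle

variable {p : Fin 4 → ℝ} (hp : p 0 ^ 2 + p 1 ^ 2 + p 2 ^ 2 + p 3 ^ 2 = 1) {y : Fin 3 → ℝ}
  (hy : y 0 ^ 2 + y 1 ^ 2 = 1) (m : ℝ)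

/-- The circle `{x | |x| = 1, ⟨x, V⟩ = m}` for `V = circleNormal m p y`. -/
def hopfCircle (m : ℝ) (p : Fin 4 → ℝ) (y : Fin 3 → ℝ) (t : ℝ) : Fin 3 → ℝ :=
  (m / (1 + m ^ 2)) • circleNormal m p y + (1 / √(1 + m ^ 2)) •
    (Real.cos t • (1 / √(1 + m ^ 2)) • (hopf p - m • (y 0 • hopfFrame 0 p + y 1 • hopfFrame 1 p))
      + Real.sin t • (y 1 • hopfFrame 0 p - y 0 • hopfFrame 1 p))

include hp hy

theorem eq_of_hopf_dot {v w : Fin 3 → ℝ} (h0 : hopf p ⬝ᵥ v = hopf p ⬝ᵥ w)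
    (h1 : (y 0 • hopfFrame 0 p + y 1 • hopfFrame 1 p) ⬝ᵥ v
      = (y 0 • hopfFrame 0 p + y 1 • hopfFrame 1 p) ⬝ᵥ w)
    (h2 : (y 1 • hopfFrame 0 p - y 0 • hopfFrame 1 p) ⬝ᵥ v
      = (y 1 • hopfFrame 0 p - y 0 • hopfFrame 1 p) ⬝ᵥ w) : v = w := by
  have a0 : hopfFrame 0 p ⬝ᵥ v = hopfFrame 0 p ⬝ᵥ w := by
    simp only [add_dotProduct, sub_dotProduct, smul_dotProduct, smul_eq_mul] at h1 h2
    linear_combination y 0 * h1 + y 1 * h2 - (hopfFrame 0 p ⬝ᵥ v - hopfFrame 0 p ⬝ᵥ w) * hy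
  have a1 : hopfFrame 1 p ⬝ᵥ v = hopfFrame 1 p ⬝ᵥ w := by
    simp only [add_dotProduct, sub_dotProduct, smul_dotProduct, smul_eq_mul] at h1 h2
    linear_combination y 1 * h1 - y 0 * h2 - (hopfFrame 1 p ⬝ᵥ v - hopfFrame 1 p ⬝ᵥ w) * hy
  have hO : (Matrix.of ![hopfFrame 0 p, hopfFrame 1 p, hopf p])
      * (Matrix.of ![hopfFrame 0 p, hopfFrame 1 p, hopf p])ᵀ = 1 := by
    ext i j
    change ![hopfFrame 0 p, hopfFrame 1 p, hopf p] i ⬝ᵥ ![hopfFrame 0 p, hopfFrame 1 p, hopf p] j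
      = _
    fin_cases i <;> fin_cases j <;>
    simp [hopfFrame_dot hp, hopf_dot_hopfFrame, hopf_dot_self hp, dotProduct_comm _ (hopf p)]
  have hO' := mul_eq_one_comm.1 hO
  have key : ∀ z : Fin 3 → ℝ, z = (Matrix.of ![hopfFrame 0 p, hopfFrame 1 p, hopf p])ᵀ *ᵥ
      ![hopfFrame 0 p ⬝ᵥ z, hopfFrame 1 p ⬝ᵥ z, hopf p ⬝ᵥ z] := fun z => by
    have : ![hopfFrame 0 p ⬝ᵥ z, hopfFrame 1 p ⬝ᵥ z, hopf p ⬝ᵥ z]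
      = Matrix.of ![hopfFrame 0 p, hopfFrame 1 p, hopf p] *ᵥ z := by
      funext i; fin_cases i <;> rfl
    rw [this, Matrix.mulVec_mulVec, hO', Matrix.one_mulVec]
  rw [key v, key w, a0, a1, h0]

theorem hopf_orthonormal : hopf p ⬝ᵥ (y 0 • hopfFrame 0 p + y 1 • hopfFrame 1 p) = 0 ∧
    hopf p ⬝ᵥ (y 1 • hopfFrame 0 p - y 0 • hopfFrame 1 p) = 0 ∧
    (y 0 • hopfFrame 0 p + y 1 • hopfFrame 1 p) ⬝ᵥ (y 0 • hopfFrame 0 p + y 1 • hopfFrame 1 p) = 1 ∧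
    (y 0 • hopfFrame 0 p + y 1 • hopfFrame 1 p) ⬝ᵥ (y 1 • hopfFrame 0 p - y 0 • hopfFrame 1 p) = 0 ∧
    (y 1 • hopfFrame 0 p - y 0 • hopfFrame 1 p) ⬝ᵥ (y 1 • hopfFrame 0 p - y 0 • hopfFrame 1 p) = 1
    := by
  simp only [dotProduct_add, dotProduct_sub, dotProduct_smul, add_dotProduct, sub_dotProduct,
    smul_dotProduct, hopf_dot_hopfFrame, hopfFrame_dot hp, smul_eq_mul, ite_true, zero_ne_one,
    one_ne_zero, ite_false]
  refine ⟨by ring, by ring, ?_, by ring, ?_⟩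
  · linear_combination hy
  · linear_combination hy

/-- For V = n + m·hopf with n a unit vector orthogonal to hopf, |V|² = 1 + m². So the plane ⟨x, V⟩ =
m has foot point mV/(1 + m²) and cuts the sphere in a circle of radius 1/√(1 + m²). The directions
(hopf - m·n)/√(1 + m²) and t are an orthonormal basis of the plane. -/
theorem mem_range_hopfCircle {x : Fin 3 → ℝ} :
    x ∈ range (hopfCircle m p y) ↔ x ⬝ᵥ x = 1 ∧ x ⬝ᵥ circleNormal m p y = m := by
  obtain ⟨o1, o2, o3, o4, o5⟩ := hopf_orthonormal hp hy
  have o0 := hopf_dot_self hp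
  have hV : circleNormal m p y = (y 0 • hopfFrame 0 p + y 1 • hopfFrame 1 p) + m • hopf p := rfl
  have hext := fun v w => eq_of_hopf_dot (v := v) (w := w) hp hy
  unfold hopfCircle
  rw [hV]
  generalize y 0 • hopfFrame 0 p + y 1 • hopfFrame 1 p = n at *
  generalize y 1 • hopfFrame 0 p - y 0 • hopfFrame 1 p = t at *
  generalize hopf p = h at *
  have hm : 0 < 1 + m ^ 2 := by positivity
  obtain ⟨r, hr⟩ : ∃ r, r = √(1 + m ^ 2) := ⟨_, rfl⟩
  have hr0 : 0 < r := hr ▸ Real.sqrt_pos.2 hm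
  have hr2 : r ^ 2 = 1 + m ^ 2 := hr ▸ Real.sq_sqrt hm.le
  rw [← hr, ← hr2]
  have o1' : n ⬝ᵥ h = 0 := by rw [dotProduct_comm, o1]
  have o2' : t ⬝ᵥ h = 0 := by rw [dotProduct_comm, o2]
  have o4' : t ⬝ᵥ n = 0 := by rw [dotProduct_comm, o4]
  constructor
  · rintro ⟨s, rfl⟩
    have hcs := Real.cos_sq_add_sin_sq s
    simp only [add_dotProduct, sub_dotProduct, smul_dotProduct, dotProduct_add, dotProduct_sub,
      dotProduct_smul, o0, o1, o2, o3, o4, o5, o1', o2', o4', smul_eq_mul]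
    constructor
    · field_simp
      linear_combination r ^ 2 * hcs - (r ^ 2 + m ^ 2 + Real.cos s ^ 2) * hr2
    · field_simp
      linear_combination -m * hr2
  · rintro ⟨hx1, hx2⟩
    obtain ⟨a, ha⟩ : ∃ a, a = x ⬝ᵥ h := ⟨_, rfl⟩
    obtain ⟨b, hb⟩ : ∃ b, b = x ⬝ᵥ n := ⟨_, rfl⟩
    obtain ⟨g, hg⟩ : ∃ g, g = x ⬝ᵥ t := ⟨_, rfl⟩
    have hexp : x = a • h + b • n + g • t := by
      apply hext <;> simp only [dotProduct_add, dotProduct_smul, o0, o1, o2, o3, o4, o5, o1', o2',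
        o4', smul_eq_mul, dotProduct_comm _ x, ← ha, ← hb, ← hg] <;> ring
    have h1 : a ^ 2 + b ^ 2 + g ^ 2 = 1 := by
      rw [hexp] at hx1
      simp only [add_dotProduct, smul_dotProduct, dotProduct_add, dotProduct_smul, o0, o1, o2, o3,
        o4, o5, o1', o2', o4', smul_eq_mul] at hx1
      linear_combination hx1
    have h2 : b + m * a = m := by
      rw [dotProduct_add, dotProduct_smul, ← hb, ← ha, smul_eq_mul] at hx2; exact hx2
    -- Cosine and sine are the products of x with the two unit directions divided by the radius;
    -- with r = √(1 + m²) they are a - mb and rg.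
    obtain ⟨s, hs1, hs2⟩ := exists_cos_sin (a := a - m * b) (b := r * g) (by
      linear_combination g ^ 2 * hr2 + (1 + m ^ 2) * h1 - (b + m * a + m) * h2)
    refine ⟨s, ?_⟩
    simp only [hs1, hs2]
    rw [hexp]
    apply hext <;>
    simp only [dotProduct_add, dotProduct_sub, dotProduct_smul, o0, o1, o2, o3, o4, o5, o1', o2',
        o4', smul_eq_mul] <;> field_simp
    · rw [hr2]; linear_combination -m * h2
    · rw [hr2]; linear_combination -h2
    · ring

end circle

theorem AdaptedFrame.deriv_circleNormal_of_vertical {A : Type*} [CommRing A] [Algebra ℝ A]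
    {D : Fin 2 → Derivation ℝ A A} {τ c H : A} {x : Fin 2 → Fin 3 → A} {α : Fin 2 → A}
    {B : Fin 2 → Fin 2 → A} {e : Fin 2 → Fin 3 → A} {y : Fin 3 → A} (hF : AdaptedFrame x B e y)
    (hC : y 2 = 0) (hA : AmbientEquations D τ c x α)
    (tr : frameForm D τ x α B e y 0 0 + frameForm D τ x α B e y 1 1 = 2 * H) (i : Fin 2)
    {s t m : A} {p : Fin 4 → A} (hα : 2 * τ * x i 2 + α i = 2 * (t * x i 2)) (hm : m * s = H)
    (hmD : D i m = 0)
    (h0 : D i (p 0) = -(s * x i 0) * p 3 - (s * x i 1) * p 2 - (t * x i 2) * p 1)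
    (h1 : D i (p 1) = -(s * x i 0) * p 2 + (s * x i 1) * p 3 + (t * x i 2) * p 0)
    (h2 : D i (p 2) = (s * x i 0) * p 1 + (s * x i 1) * p 0 - (t * x i 2) * p 3)
    (h3 : D i (p 3) = (s * x i 0) * p 0 - (s * x i 1) * p 1 + (t * x i 2) * p 2) (l : Fin 3) :
    D i (circleNormal m p y l) = 0 := by
  have hd := hF.deriv_normal_of_vertical hC hA tr i
  have hc := hF.coord_of_vertical hC i
  have hxy := hF.coord_dot_normal i
  simp only [dotProduct, Fin.sum_univ_three, hC, mul_zero, add_zero] at hxy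
  -- The surplus turn of the normal is H times the component of ∂ᵢF along y × ξ.
  refine deriv_circleNormal (w := H * (x i 0 * y 1 - x i 1 * y 0))
    (D i) h0 h1 h2 h3 ?_ ?_ hmD ?_ ?_ ?_ l
  · rw [hd.1]
    linear_combination y 1 * hα
  · rw [hd.2]
    linear_combination -y 0 * hα
  · linear_combination x i 0 * hm + H * hc.1
  · linear_combination x i 1 * hm + H * hc.2
  · linear_combination s * hxy

/-! ### Vertical surfaces in Berger spheres project to a circle -/

section bergerVertical

variable {M : Type*} [TopologicalSpace M] [ChartedSpace (Coord 2) M] [IsManifold (𝓡 2) ∞ M]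
  {κ τ H : ℝ} (hκ : 0 < κ) (hτ : τ ≠ 0) {f N : M → Coord 4}
  (hf : IsSmoothImmersion (bergerSphere κ τ) f)
  (hN : ∀ p, IsUnitNormal (bergerSphere κ τ) f p (N p))
  (hH : HasConstantMeanCurvature (bergerSphere κ τ) f N H)
  (h0 : ∀ q, angle (bergerSphere κ τ) f N q = 0)

theorem pd_apply {n : ℕ} {F : Coord 2 → Coord n} {u : Coord 2} (hF : DifferentiableAt ℝ F u)
    (i : Fin 2) (j : Fin n) : pd i (fun v => F v j) u = pd i F u j := by
  have h1 : HasFDerivAt (fun v => F v j) ((dx j : Coord n →L[ℝ] ℝ).comp (fderiv ℝ F u)) u :=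
    (dx j : Coord n →L[ℝ] ℝ).hasFDerivAt.comp u hF.hasFDerivAt
  rw [pd, h1.fderiv]
  rfl

/-- The coordinates of a spherical immersion in a chart. -/
def coordFun (hf : IsSmoothImmersion (bergerSphere κ τ) f) (p : M) (j : Fin 4) :
    SmoothFun (chartOpens p) :=
  SmoothFun.mk (fun u => patch (bergerSphere κ τ) f p u j)
    (contDiffOn_euclidean.1 (isImmersedPatch hf p).contDiffOn j)

include hf in
theorem eval_partialD_coordFun (p : M) (u : chartOpens p) (i : Fin 2) (j : Fin 4) :
    SmoothFun.eval u (partialD (chartOpens p) i (coordFun hf p j))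
      = SmoothFun.eval u ((isImmersedPatch hf p).vec (bergerCoframe hκ hτ) i 0) * (√κ / 2 *
          ![-SmoothFun.eval u (coordFun hf p 3), -SmoothFun.eval u (coordFun hf p 2),
            SmoothFun.eval u (coordFun hf p 1), SmoothFun.eval u (coordFun hf p 0)] j)
        + SmoothFun.eval u ((isImmersedPatch hf p).vec (bergerCoframe hκ hτ) i 1) * (√κ / 2 *
          ![-SmoothFun.eval u (coordFun hf p 2), SmoothFun.eval u (coordFun hf p 3),
            SmoothFun.eval u (coordFun hf p 0), -SmoothFun.eval u (coordFun hf p 1)] j)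
        + SmoothFun.eval u ((isImmersedPatch hf p).vec (bergerCoframe hκ hτ) i 2) * (κ / (4 * τ) *
          ![-SmoothFun.eval u (coordFun hf p 1), SmoothFun.eval u (coordFun hf p 0),
            -SmoothFun.eval u (coordFun hf p 3), SmoothFun.eval u (coordFun hf p 2)] j) := by
  have hP := isImmersedPatch hf p
  refine ((SmoothFun.eval_partialD_mk i _ u).trans (pd_apply (hP.differentiableAt u.2) i j)).trans ?_
  have h := (bergerCoframe hκ hτ).expand _ (hP.mem u u.2) _
    (hP.pd_mem (bergerCoframe hκ hτ) u.2 i)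
  rw [Fin.sum_univ_three] at h
  exact congrArg (fun X : Coord 4 => X j) h

include hf in
theorem partialD_coordFun (p : M) (i : Fin 2) {a b c : SmoothFun (chartOpens p)}
    (ha : a = algebraMap ℝ _ (√κ / 2) * (isImmersedPatch hf p).vec (bergerCoframe hκ hτ) i 0)
    (hb : b = algebraMap ℝ _ (√κ / 2) * (isImmersedPatch hf p).vec (bergerCoframe hκ hτ) i 1)
    (hc : c = algebraMap ℝ _ (κ / (4 * τ)) * (isImmersedPatch hf p).vec (bergerCoframe hκ hτ) i 2) :
    partialD (chartOpens p) i (coordFun hf p 0)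
      = -a * coordFun hf p 3 - b * coordFun hf p 2 - c * coordFun hf p 1 ∧
    partialD (chartOpens p) i (coordFun hf p 1)
      = -a * coordFun hf p 2 + b * coordFun hf p 3 + c * coordFun hf p 0 ∧
    partialD (chartOpens p) i (coordFun hf p 2)
      = a * coordFun hf p 1 + b * coordFun hf p 0 - c * coordFun hf p 3 ∧
    partialD (chartOpens p) i (coordFun hf p 3)
      = a * coordFun hf p 0 - b * coordFun hf p 1 + c * coordFun hf p 2 := by
  have hd := fun u => eval_partialD_coordFun hκ hτ hf p u i
  generalize (isImmersedPatch hf p).vec (bergerCoframe hκ hτ) i = x at *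
  generalize coordFun hf p = φ at *
  subst ha hb hc
  refine ⟨?_, ?_, ?_, ?_⟩ <;>
  · refine SmoothFun.eq_of_eval fun u => (hd u _).trans ?_
    simp only [map_add, map_sub, map_neg, map_mul, AlgHom.commutes, Algebra.algebraMap_self_apply,
      cons_val]
    ring

/-- The rate at which the normal turns along the fibre, 2τθ₂ + α, is twice the coefficient in ξ =
κ/(4τ)·ip. It thus matches the rotation of the images of the horizontal frame under the Hopf map. -/
theorem conn_berger (hf : IsSmoothImmersion (bergerSphere κ τ) f) (p : M) (i : Fin 2) :
    2 * algebraMap ℝ _ τ * (isImmersedPatch hf p).vec (bergerCoframe hκ hτ) i 2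
        + (isImmersedPatch hf p).conn (bergerCoframe hκ hτ) i
      = 2 * (algebraMap ℝ _ (κ / (4 * τ))
        * (isImmersedPatch hf p).vec (bergerCoframe hκ hτ) i 2) := by
  refine SmoothFun.eq_of_eval fun u => ?_
  have e : SmoothFun.eval u ((isImmersedPatch hf p).conn (bergerCoframe hκ hτ) i)
      = (κ - 4 * τ ^ 2) / (2 * τ)
        * SmoothFun.eval u ((isImmersedPatch hf p).vec (bergerCoframe hκ hτ) i 2) := rfl
  generalize (isImmersedPatch hf p).vec (bergerCoframe hκ hτ) i 2 = x at *
  generalize (isImmersedPatch hf p).conn (bergerCoframe hκ hτ) i = α at *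
  rw [map_add, e, map_mul, map_mul, map_mul, map_mul, AlgHom.commutes, AlgHom.commutes, map_ofNat]
  simp only [Algebra.algebraMap_self_apply]
  field_simp
  ring

variable {p : M} (C : ChartFrame (bergerCoframe hκ hτ) hf N H p)

include h0 hN in
-- The horizontal unit vectors have Euclidean length √κ/2, hence the constant m = 2H/√κ. It is the
-- geodesic curvature of the circle on the unit sphere.
theorem partialD_circleNormal (i : Fin 2) (l : Fin 3) : partialD (chartOpens p) i
    (circleNormal (algebraMap ℝ _ (2 * H / √κ)) (coordFun hf p) C.y l) = 0 := by
  have hs : √κ ≠ 0 := (Real.sqrt_pos.2 hκ).ne'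
  have hm : (algebraMap ℝ (SmoothFun (chartOpens p)) (2 * H / √κ))
      * algebraMap ℝ _ (√κ / 2) = algebraMap ℝ _ H := by
    rw [← map_mul]; congr 1; field_simp
  obtain ⟨e0, e1, e2, e3⟩ := partialD_coordFun hκ hτ hf p i rfl rfl rfl
  exact C.frame.deriv_circleNormal_of_vertical (ChartFrame.angle_eq_zero _ hf hN h0 C)
    ((isImmersedPatch hf p).ambientEquations (bergerCoframe hκ hτ)) C.trace i
    (conn_berger hκ hτ hf p i) hm (partialD_algebraMap i _) e0 e1 e2 e3 l

end bergerVertical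

theorem map_circleNormal {A A' : Type*} [CommRing A] [CommRing A'] (φ : A →+* A') (m : A)
    (p : Fin 4 → A) (y : Fin 3 → A) :
    φ ∘ circleNormal m p y = circleNormal (φ m) (φ ∘ p) (φ ∘ y) := by
  funext l
  have two : φ 2 = 2 := map_ofNat φ 2
  fin_cases l <;> simp [circleNormal, hopf, hopfFrame, two]

theorem SmoothFun.eventually_eq_of_partialD {U : Opens (Coord 2)} {a : SmoothFun U}
    (h : ∀ i, partialD U i a = 0) (u : U) : ∀ᶠ v in 𝓝 (u : Coord 2), ext a v = ext a u := by
  obtain ⟨r, hr, hball⟩ := Metric.isOpen_iff.1 U.isOpen u u.2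
  have hd : ∀ v ∈ U, fderiv ℝ (ext a) v = 0 := fun v hv => by
    have h2 : ∀ i, fderiv ℝ (ext a) v (EuclideanSpace.single i 1) = 0 := fun i => by
      change pd i (ext a) v = 0
      rw [← eval_partialD i a ⟨v, hv⟩, h, map_zero]
    ext w
    have hw : w = w 0 • EuclideanSpace.single 0 1 + w 1 • EuclideanSpace.single 1 1 := by
      ext k; fin_cases k <;> simp
    rw [hw, map_add, map_smul, map_smul, h2, h2]
    simp
  filter_upwards [Metric.ball_mem_nhds (u : Coord 2) hr] with v hv
  exact Metric.isOpen_ball.is_const_of_fderiv_eq_zero (convex_ball _ _).isPreconnected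
    (fun w hw => (differentiableAt_ext a (hball hw)).differentiableWithinAt)
    (fun w hw => hd w (hball hw)) hv (Metric.mem_ball_self hr)

section bergerVertical

variable {M : Type*} [TopologicalSpace M] [ChartedSpace (Coord 2) M] [IsManifold (𝓡 2) ∞ M]
  {κ τ H : ℝ} (hκ : 0 < κ) (hτ : τ ≠ 0) {f N : M → Coord 4}
  (hf : IsSmoothImmersion (bergerSphere κ τ) f)
  (hN : ∀ p, IsUnitNormal (bergerSphere κ τ) f p (N p))
  (hH : HasConstantMeanCurvature (bergerSphere κ τ) f N H)
  (h0 : ∀ q, angle (bergerSphere κ τ) f N q = 0)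

/-- The vector `circleNormal` at a point of a surface in a Berger sphere. -/
def bergerNormal (κ τ H : ℝ) (f N : M → Coord 4) (q : M) : Fin 3 → ℝ :=
  circleNormal (2 * H / √κ) (f q).ofLp fun l => bergerForm κ τ l (f q) (N q)

/-- The vector `circleNormal`, up to sign for minimal surfaces. -/
def bergerNormalSet (κ τ H : ℝ) (f N : M → Coord 4) (q : M) : Set (Fin 3 → ℝ) :=
  {v | v = bergerNormal κ τ H f N q ∨ (H = 0 ∧ v = -bergerNormal κ τ H f N q)}

include hN h0

/-- For H = 0 the normal may change sign from point to point. Then m = 0 and the vector is odd in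
the normal, so the pair ±V is locally constant although V need not be. -/
theorem bergerNormalSet_eventually {p : M} (C : ChartFrame (bergerCoframe hκ hτ) hf N H p) :
    ∀ᶠ q in 𝓝 p, bergerNormalSet κ τ H f N q = bergerNormalSet κ τ H f N p := by
  set w : Fin 3 → SmoothFun (chartOpens p) :=
    circleNormal (algebraMap ℝ _ (2 * H / √κ)) (coordFun hf p) C.y with hw
  have heval : ∀ u : chartOpens p, SmoothFun.eval u ∘ w
      = circleNormal (2 * H / √κ) (patch (bergerSphere κ τ) f p u).ofLp (SmoothFun.eval u ∘ C.y) :=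
    fun u => map_circleNormal (SmoothFun.eval u : SmoothFun (chartOpens p) →+* ℝ) _ _ _
  have hset : ∀ u : chartOpens p, bergerNormalSet κ τ H f N ((chartAt (Coord 2) p).symm u)
      = {v | v = SmoothFun.eval u ∘ w ∨ (H = 0 ∧ v = -(SmoothFun.eval u ∘ w))} := by
    intro u
    rcases C.coords_eq u with h | ⟨hH0, h⟩
    · have : bergerNormal κ τ H f N ((chartAt (Coord 2) p).symm u) = SmoothFun.eval u ∘ w := by
        rw [heval, ← h]; rfl
      rw [bergerNormalSet, this]
    · have : bergerNormal κ τ H f N ((chartAt (Coord 2) p).symm u) = -(SmoothFun.eval u ∘ w) := by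
        have e : bergerNormal κ τ H f N ((chartAt (Coord 2) p).symm u)
          = circleNormal (2 * H / √κ) (patch (bergerSphere κ τ) f p u).ofLp
            (-(SmoothFun.eval u ∘ C.y)) := by rw [← h]; rfl
        have hm : 2 * H / √κ = 0 := by rw [hH0]; simp
        rw [e, heval, hm]
        simp only [circleNormal, zero_smul, add_zero, Pi.neg_apply, neg_smul]
        abel
      rw [bergerNormalSet, this, neg_neg]
      ext v
      simp only [mem_ofPred_eq, hH0, true_and]
      exact or_comm
  let u₀ : chartOpens p := ⟨chartAt (Coord 2) p p, mem_chart_target _ p⟩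
  have hconst : ∀ᶠ v in 𝓝 (u₀ : Coord 2), ∀ l, SmoothFun.ext (w l) v = SmoothFun.ext (w l) u₀ :=
    Filter.eventually_all.2 fun l => SmoothFun.eventually_eq_of_partialD
      (fun i => partialD_circleNormal hκ hτ hf hN h0 C i l) u₀
  have hc := ((chartAt (Coord 2) p).continuousAt (mem_chart_source _ p)).eventually hconst
  filter_upwards [hc, (chartAt (Coord 2) p).open_source.mem_nhds (mem_chart_source _ p)] with q hq hqs
  have e1 := hset ⟨chartAt (Coord 2) p q, (chartAt (Coord 2) p).map_source hqs⟩
  have e2 := hset u₀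
  simp only [u₀] at e1 e2
  rw [(chartAt (Coord 2) p).left_inv hqs] at e1
  rw [(chartAt (Coord 2) p).left_inv (mem_chart_source _ p)] at e2
  have e3 : SmoothFun.eval ⟨chartAt (Coord 2) p q, (chartAt (Coord 2) p).map_source hqs⟩ ∘ w
      = SmoothFun.eval u₀ ∘ w := by
    funext l
    have := hq l
    rw [SmoothFun.eval_ext _ u₀,
      SmoothFun.eval_ext _ ⟨chartAt (Coord 2) p q, (chartAt (Coord 2) p).map_source hqs⟩] at this
    exact this
  rw [e1, e2, e3]

include hκ hτ hf hH

theorem bergerNormal_mem [ConnectedSpace M] (q q' : M) :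
    bergerNormal κ τ H f N q ∈ bergerNormalSet κ τ H f N q' := by
  have h : IsLocallyConstant (bergerNormalSet κ τ H f N) :=
    (IsLocallyConstant.iff_eventually_eq _).2 fun p => bergerNormalSet_eventually hκ hτ hf hN h0
      (chartFrame (bergerCoframe hκ hτ) hf hN hH p)
  rw [h.apply_eq_of_preconnectedSpace q' q]
  exact .inl rfl

omit hκ hτ hf hH h0 hN in
theorem patch_sq (hf : IsSmoothImmersion (bergerSphere κ τ) f) (q : M) :
    f q 0 ^ 2 + f q 1 ^ 2 + f q 2 ^ 2 + f q 3 ^ 2 = 1 := sphere_eq (hf.mem_carrier q)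

theorem hopf_dot_bergerNormal [ConnectedSpace M] (q q' : M) :
    hopf (f q').ofLp ⬝ᵥ bergerNormal κ τ H f N q = 2 * H / √κ := by
  have h := hopf_dot_circleNormal (patch_sq hf q') (2 * H / √κ)
    fun l => bergerForm κ τ l (f q') (N q')
  rcases bergerNormal_mem hκ hτ hf hN hH h0 q q' with h1 | ⟨hH0, h1⟩
  · rw [h1]; exact h
  · rw [h1, dotProduct_neg, bergerNormal, h, hH0]; simp

end bergerVertical

/-! ### Immersions into level sets -/

/-- A strictly differentiable map with injective derivative is locally injective. -/
theorem HasStrictFDerivAt.eventually_eq_of_injective {V W : Type*} [NormedAddCommGroup V]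
    [NormedSpace ℝ V] [FiniteDimensional ℝ V] [NormedAddCommGroup W] [NormedSpace ℝ W]
    {g : V → W} {g' : V →L[ℝ] W} {a : V} (hg : HasStrictFDerivAt g g' a)
    (hi : Function.Injective g') : ∀ᶠ z : V × V in 𝓝 (a, a), g z.1 = g z.2 → z.1 = z.2 := by
  obtain ⟨c, hc, hac⟩ := (g' : V →ₗ[ℝ] W).exists_antilipschitzWith (LinearMap.ker_eq_bot.2 hi)
  have hc0 : (0 : ℝ) < c := hc
  -- With `c` the constant in |v| ≤ c|g'v|, an error below 1/(2c) absorbs half of the distance of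
  -- two points with the same image.
  have hb := hg.isLittleO.def (show (0 : ℝ) < 1 / (2 * c) by positivity)
  filter_upwards [hb] with z hz he
  have h1 := hac.le_mul_dist z.1 z.2
  rw [he, sub_self, zero_sub, norm_neg] at hz
  rw [dist_eq_norm, dist_eq_norm] at h1
  have h2 : ‖g' z.1 - g' z.2‖ ≤ 1 / (2 * c) * ‖z.1 - z.2‖ := by rw [← map_sub]; exact hz
  have h3 : ‖z.1 - z.2‖ ≤ c * (1 / (2 * c) * ‖z.1 - z.2‖) :=
    h1.trans (mul_le_mul_of_nonneg_left h2 hc0.le)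
  have h4 : c * (1 / (2 * c) * ‖z.1 - z.2‖) = ‖z.1 - z.2‖ / 2 := by field_simp
  rw [h4] at h3
  have h5 : ‖z.1 - z.2‖ = 0 := by linarith [norm_nonneg (z.1 - z.2)]
  exact sub_eq_zero.1 (norm_eq_zero.1 h5)

/-- An immersion into a level set of a map, onto the kernel of its derivative, is open onto the
level set. -/
theorem eventually_mem_image_of_level {U V W : Type*} [NormedAddCommGroup U] [NormedSpace ℝ U]
    [FiniteDimensional ℝ U] [NormedAddCommGroup V] [NormedSpace ℝ V] [FiniteDimensional ℝ V]
    [NormedAddCommGroup W] [NormedSpace ℝ W] {F : U → V} {F' : U →L[ℝ] V} {g : V → W}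
    {g' : V →L[ℝ] W} {u : U} {s : Set U} (hs : s ∈ 𝓝 u) (hF : HasStrictFDerivAt F F' u)
    (hg : HasStrictFDerivAt g g' (F u)) (hi : Function.Injective F')
    (hker : ∀ v, g' v = 0 → ∃ w, F' w = v) (hlev : ∀ᶠ v in 𝓝 u, g (F v) = g (F u)) :
    ∀ᶠ x in 𝓝 (F u), g x = g (F u) → x ∈ F '' s := by
  have : CompleteSpace U := FiniteDimensional.complete ℝ U
  -- A left inverse `L` of F' makes L ∘ F open at `u`, so near points x satisfy Lx = L(Fv) for some
  -- v. On the level set also g x = g(Fv), and x ↦ (Lx, g x) is locally injective because ker g'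
  -- lies in the range of F'. Hence x = Fv.
  obtain ⟨l, hl⟩ := (F' : U →ₗ[ℝ] V).exists_leftInverse_of_injective (LinearMap.ker_eq_bot.2 hi)
  let L : V →L[ℝ] U := LinearMap.toContinuousLinearMap l
  have hL : ∀ w, L (F' w) = w := fun w => LinearMap.congr_fun hl w
  have h1 : HasStrictFDerivAt (fun v => L (F v)) (L.comp F') u :=
    L.hasStrictFDerivAt.comp u hF
  have h2 := h1.map_nhds_eq_of_surj (LinearMap.range_eq_top.2 fun w => ⟨w, hL w⟩)
  have h3 : HasStrictFDerivAt (fun x => (L x, g x)) (L.prod g') (F u) :=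
    L.hasStrictFDerivAt.prodMk hg
  have h4 : Function.Injective (L.prod g') := by
    refine (injective_iff_map_eq_zero _).2 fun v hv => ?_
    obtain ⟨w, rfl⟩ := hker v (congrArg Prod.snd hv)
    have : L (F' w) = 0 := congrArg Prod.fst hv
    rw [hL] at this
    rw [this, map_zero]
  have h5 := HasStrictFDerivAt.eventually_eq_of_injective h3 h4
  rw [nhds_prod_eq] at h5
  obtain ⟨S, hS, hSS⟩ := Filter.mem_prod_same_iff.1 h5
  have h6 : s ∩ {v | g (F v) = g (F u)} ∩ F ⁻¹' S ∈ 𝓝 u :=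
    Filter.inter_mem (Filter.inter_mem hs hlev) (hF.continuousAt hS)
  have h7 := Filter.image_mem_map (m := fun v => L (F v)) h6
  rw [h2] at h7
  filter_upwards [hS, L.continuous.continuousAt h7] with x hx ⟨v, ⟨⟨hvs, hvl⟩, hvS⟩, hv⟩ hgx
  refine ⟨v, hvs, hSS (a := (F v, x)) ⟨hvS, hx⟩ (Prod.ext hv ?_)⟩
  change g (F v) = g x
  rw [hgx]; exact hvl

/-- The function on the sphere with level sets the preimages of circles. -/
def hopfHeight (V : Fin 3 → ℝ) (x : Coord 4) : ℝ × ℝ :=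
  (x 0 ^ 2 + x 1 ^ 2 + x 2 ^ 2 + x 3 ^ 2, hopf x.ofLp ⬝ᵥ V)

theorem contDiff_hopfHeight (V : Fin 3 → ℝ) : ContDiff ℝ ∞ (hopfHeight V) := by
  unfold hopfHeight
  simp only [hopf, dotProduct, Fin.sum_univ_three, cons_val]
  fun_prop

/-- Both components are quadratic forms, so the derivative is the coefficient of t in the expansion
at x + tw. -/
theorem fderiv_hopfHeight (V : Fin 3 → ℝ) (x w : Coord 4) : fderiv ℝ (hopfHeight V) x w
    = (2 * (x 0 * w 0 + x 1 * w 1 + x 2 * w 2 + x 3 * w 3),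
      2 * ((x 0 * w 2 + w 0 * x 2 + x 1 * w 3 + w 1 * x 3) * V 0
        + (x 1 * w 2 + w 1 * x 2 - x 0 * w 3 - w 0 * x 3) * V 1
        + (x 0 * w 0 + x 1 * w 1 - x 2 * w 2 - x 3 * w 3) * V 2)) := by
  have h1 : HasDerivAt (fun t : ℝ => hopfHeight V (x + t • w)) (fderiv ℝ (hopfHeight V) x w) 0 := by
    have h2 : HasDerivAt (fun t : ℝ => x + t • w) w 0 := by
      simpa using ((hasDerivAt_id (0 : ℝ)).smul_const w).const_add x
    have h3 := ((contDiff_hopfHeight V).differentiable (by simp) x).hasFDerivAt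
    have h4 : HasFDerivAt (hopfHeight V) (fderiv ℝ (hopfHeight V) x) (x + (0 : ℝ) • w) := by
      simpa using h3
    exact h4.comp_hasDerivAt 0 h2
  obtain ⟨a, ha⟩ : ∃ a : ℝ × ℝ, a = (2 * (x 0 * w 0 + x 1 * w 1 + x 2 * w 2 + x 3 * w 3),
      2 * ((x 0 * w 2 + w 0 * x 2 + x 1 * w 3 + w 1 * x 3) * V 0
        + (x 1 * w 2 + w 1 * x 2 - x 0 * w 3 - w 0 * x 3) * V 1
        + (x 0 * w 0 + x 1 * w 1 - x 2 * w 2 - x 3 * w 3) * V 2)) := ⟨_, rfl⟩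
  have h5 : (fun t : ℝ => hopfHeight V (x + t • w))
      = fun t : ℝ => hopfHeight V x + t • a + t ^ 2 • hopfHeight V w := by
    funext t
    simp only [ha, hopfHeight, hopf, dotProduct, Fin.sum_univ_three, cons_val, Prod.mk_add_mk,
      Prod.smul_mk, smul_eq_mul, PiLp.add_apply, PiLp.smul_apply]
    refine Prod.ext ?_ ?_ <;> dsimp only <;> ring
  have h6 : HasDerivAt (fun t : ℝ => hopfHeight V x + t • a + t ^ 2 • hopfHeight V w) a 0 := by
    have h7 := (((hasDerivAt_id (0 : ℝ)).smul_const a).const_add (hopfHeight V x)).add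
      ((hasDerivAt_pow 2 (0 : ℝ)).smul_const (hopfHeight V w))
    exact HasDerivAt.congr_deriv h7 (by simp)
  rw [← ha]
  rw [h5] at h1
  exact h1.unique h6

/-- The kernel of the derivative of `hopfHeight` is two-dimensional. -/
theorem exists_eq_of_fderiv_hopfHeight {x : Coord 4}
    (hx : x 0 ^ 2 + x 1 ^ 2 + x 2 ^ 2 + x 3 ^ 2 = 1) {y : Fin 3 → ℝ} (hy : y 0 ^ 2 + y 1 ^ 2 = 1)
    {m : ℝ} {V : Fin 3 → ℝ} (hV : V = circleNormal m x.ofLp y ∨ V = -circleNormal m x.ofLp y)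
    {F' : Coord 2 →L[ℝ] Coord 4} (hi : Function.Injective F')
    (hF : ∀ w, fderiv ℝ (hopfHeight V) x (F' w) = 0) {v : Coord 4}
    (hv : fderiv ℝ (hopfHeight V) x v = 0) : ∃ w, F' w = v := by
  obtain ⟨T, hT⟩ : ∃ T : Coord 4 →ₗ[ℝ] ℝ × ℝ, T = (fderiv ℝ (hopfHeight V) x : Coord 4 →ₗ[ℝ] ℝ × ℝ)
    := ⟨_, rfl⟩
  have hTa : ∀ w, T w = fderiv ℝ (hopfHeight V) x w := fun w => by rw [hT]; rfl
  obtain ⟨b, hb⟩ : ∃ b, T x = (2, b) := by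
    refine ⟨(T x).2, Prod.ext ?_ rfl⟩
    rw [hTa, fderiv_hopfHeight]
    linear_combination 2 * hx
  obtain ⟨e, c, hc, he⟩ : ∃ e c, c ≠ 0 ∧ T e = (0, c) := by
    obtain ⟨e, h⟩ : ∃ e, fderiv ℝ (hopfHeight (circleNormal m x.ofLp y)) x e = (0, 2) := by
      -- The horizontal vector on S³ with components `y` in the unit frame. The differential of the
      -- Hopf map sends it to twice the horizontal part of V, whose product with V is 2.
      refine ⟨!₂[-(y 0 * x 3) - y 1 * x 2, -(y 0 * x 2) + y 1 * x 3,
        y 0 * x 1 + y 1 * x 0, y 0 * x 0 - y 1 * x 1], ?_⟩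
      rw [fderiv_hopfHeight]
      simp only [circleNormal, hopf, hopfFrame, cons_val, Pi.add_apply, Pi.smul_apply, smul_eq_mul]
      refine Prod.ext ?_ ?_ <;> dsimp only
      · simp; ring
      · simp
        linear_combination (x 0 ^ 2 + x 1 ^ 2 + x 2 ^ 2 + x 3 ^ 2) ^ 2 * hy
          + (x 0 ^ 2 + x 1 ^ 2 + x 2 ^ 2 + x 3 ^ 2 + 1) * hx
    rcases hV with hV | hV
    · exact ⟨e, 2, two_ne_zero, by rw [hTa, hV, h]⟩
    · refine ⟨e, -2, by norm_num, ?_⟩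
      rw [hTa, hV]
      rw [fderiv_hopfHeight] at h ⊢
      have h1 := congrArg Prod.fst h
      have h2 := congrArg Prod.snd h
      refine Prod.ext h1 ?_
      dsimp only [Pi.neg_apply] at h2 ⊢
      linear_combination -h2
  have hsurj : LinearMap.range T = ⊤ := by
    refine LinearMap.range_eq_top.2 fun z => ⟨(z.1 / 2) • x + ((z.2 - z.1 / 2 * b) / c) • e, ?_⟩
    rw [map_add, map_smul, map_smul, hb, he]
    refine Prod.ext ?_ ?_ <;> simp
    field_simp; ring
  -- The derivative maps ℝ⁴ onto ℝ², so its kernel has dimension 2, the dimension of the range of F'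
  -- contained in it.
  have h1 := T.finrank_range_add_finrank_ker
  rw [hsurj, finrank_top, Module.finrank_prod, finrank_euclideanSpace_fin] at h1
  have h2 : LinearMap.range (F' : Coord 2 →ₗ[ℝ] Coord 4) ≤ LinearMap.ker T := by
    rintro _ ⟨w, rfl⟩
    rw [LinearMap.mem_ker, hTa]
    exact hF w
  have h3 := LinearMap.finrank_range_of_inj (f := (F' : Coord 2 →ₗ[ℝ] Coord 4)) hi
  have h4 := Submodule.eq_of_le_of_finrank_eq h2 (by
    rw [h3, finrank_euclideanSpace_fin]; simp at h1; omega)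
  have h5 : v ∈ LinearMap.ker T := by rw [LinearMap.mem_ker, hTa]; exact hv
  rw [← h4] at h5
  exact h5

/-! ### The image is the whole preimage of the circle -/

section bergerVertical

variable {M : Type*} [TopologicalSpace M] [ChartedSpace (Coord 2) M] [IsManifold (𝓡 2) ∞ M]
  {κ τ H : ℝ} (hκ : 0 < κ) (hτ : τ ≠ 0) {f N : M → Coord 4}
  (hf : IsSmoothImmersion (bergerSphere κ τ) f)
  (hN : ∀ p, IsUnitNormal (bergerSphere κ τ) f p (N p))
  (hH : HasConstantMeanCurvature (bergerSphere κ τ) f N H)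
  (h0 : ∀ q, angle (bergerSphere κ τ) f N q = 0)

include hκ hτ hf hN h0

theorem bergerForm_normal_sq (q : M) :
    bergerForm κ τ 0 (f q) (N q) ^ 2 + bergerForm κ τ 1 (f q) (N q) ^ 2 = 1 := by
  have h1 := (bergerCoframe hκ hτ).metric_eq (f q) (hf.mem_carrier q) (N q) (N q)
    (hN q).mem_tangent
  have h2 : angle (bergerSphere κ τ) f N q = bergerForm κ τ 2 (f q) (N q) :=
    (bergerCoframe hκ hτ).metric_xi (hf.mem_carrier q) (hN q).mem_tangent
  rw [h0] at h2
  have h3 : (bergerSphere κ τ).metric (f q) (N q) (N q)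
      = ∑ j, bergerForm κ τ j (f q) (N q) * bergerForm κ τ j (f q) (N q) := h1
  rw [(hN q).unit, Fin.sum_univ_three, ← h2] at h3
  linear_combination -h3

include hH

/-- The image is open in the preimage of the circle. -/
theorem eventually_mem_range_of_hopf [ConnectedSpace M] (q p : M) : ∀ᶠ x in 𝓝 (f p),
    x 0 ^ 2 + x 1 ^ 2 + x 2 ^ 2 + x 3 ^ 2 = 1 →
      hopf x.ofLp ⬝ᵥ bergerNormal κ τ H f N q = 2 * H / √κ → x ∈ range f := by
  obtain ⟨V, hV⟩ : ∃ V, V = bergerNormal κ τ H f N q := ⟨_, rfl⟩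
  have hP := isImmersedPatch hf p
  have hlev : ∀ q', hopfHeight V (f q') = (1, 2 * H / √κ) := fun q' =>
    Prod.ext (patch_sq hf q') (by rw [hV]; exact hopf_dot_bergerNormal hκ hτ hf hN hH h0 q q')
  obtain ⟨F, hF⟩ : ∃ F : Coord 2 → Coord 4, F = patch (bergerSphere κ τ) f p := ⟨_, rfl⟩
  obtain ⟨u, hu⟩ : ∃ u, u = chartAt (Coord 2) p p := ⟨_, rfl⟩
  have hut : u ∈ (chartAt (Coord 2) p).target := hu ▸ mem_chart_target _ p
  have hun := (chartAt (Coord 2) p).open_target.mem_nhds hut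
  have hFu : F u = f p := by
    rw [hF, hu]; exact congrArg f ((chartAt (Coord 2) p).left_inv (mem_chart_source _ p))
  have hFs : HasStrictFDerivAt F (fderiv ℝ F u) u := by
    rw [hF]
    exact (hP.contDiffOn.contDiffAt hun).hasStrictFDerivAt (by simp)
  have hFi : Function.Injective (fderiv ℝ F u) := by rw [hF]; exact hP.injective u hut
  have hg : HasStrictFDerivAt (hopfHeight V) (fderiv ℝ (hopfHeight V) (F u)) (F u) :=
    (contDiff_hopfHeight V).contDiffAt.hasStrictFDerivAt (by simp)
  have hFlev : ∀ v, hopfHeight V (F v) = hopfHeight V (F u) := fun v => by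
    rw [hFu, hlev, hF]; exact hlev _
  have hcomp : ∀ w, fderiv ℝ (hopfHeight V) (F u) (fderiv ℝ F u w) = 0 := by
    have h1 := hg.hasFDerivAt.comp u hFs.hasFDerivAt
    have h2 : hopfHeight V ∘ F = fun _ => hopfHeight V (F u) := funext hFlev
    rw [h2] at h1
    have h3 := h1.unique (hasFDerivAt_const _ _)
    exact fun w => DFunLike.congr_fun h3 w
  have hVp : V = circleNormal (2 * H / √κ) (F u).ofLp (fun l => bergerForm κ τ l (f p) (N p))
      ∨ V = -circleNormal (2 * H / √κ) (F u).ofLp (fun l => bergerForm κ τ l (f p) (N p)) := by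
    rw [hV, hFu]
    exact (bergerNormal_mem hκ hτ hf hN hH h0 q p).imp id fun h => h.2
  have hsq : F u 0 ^ 2 + F u 1 ^ 2 + F u 2 ^ 2 + F u 3 ^ 2 = 1 := by
    rw [hFu]; exact patch_sq hf p
  have hmain := eventually_mem_image_of_level Filter.univ_mem hFs hg hFi
    (fun v hv => exists_eq_of_fderiv_hopfHeight hsq
      (bergerForm_normal_sq hκ hτ hf hN h0 p) hVp hFi hcomp hv) (.of_forall hFlev)
  rw [hFu] at hmain
  filter_upwards [hmain] with x hx h1 h2
  obtain ⟨v, -, rfl⟩ := hx (by rw [hlev]; exact Prod.ext h1 (by rw [hV]; exact h2))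
  rw [hF]
  exact ⟨_, rfl⟩

end bergerVertical

theorem continuous_hopf : Continuous fun x : Coord 4 => hopf x.ofLp := by
  refine continuous_pi fun l => ?_
  fin_cases l <;> simp only [hopf, Fin.zero_eta, Fin.mk_one, Fin.reduceFinMk, cons_val] <;> fun_prop

/-- A nonempty compact subset of the preimage of a connected set under the Hopf map that is
relatively open is the whole preimage. -/
theorem eq_hopf_preimage {Γ : Set (Fin 3 → ℝ)} (hΓ : IsPreconnected Γ) (hΓc : IsClosed Γ)
    (hΓ1 : ∀ x ∈ Γ, x ⬝ᵥ x = 1) {A : Set (Coord 4)} (hA : IsCompact A) (hne : A.Nonempty)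
    (hAΓ : ∀ x ∈ A, x ∈ Metric.sphere (0 : Coord 4) 1 ∧ hopf x.ofLp ∈ Γ)
    (hopen : ∀ x ∈ A, ∀ᶠ z in 𝓝 x,
      z ∈ Metric.sphere (0 : Coord 4) 1 ∧ hopf z.ofLp ∈ Γ → z ∈ A) :
    A = {x | x ∈ Metric.sphere (0 : Coord 4) 1 ∧ hopf x.ofLp ∈ Γ} := by
  obtain ⟨S, hS⟩ : ∃ S : Set (Coord 4), S = {x | x ∈ Metric.sphere (0 : Coord 4) 1 ∧ hopf x.ofLp ∈ Γ}
    := ⟨_, rfl⟩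
  have hSm : ∀ x, x ∈ S ↔ x ∈ Metric.sphere (0 : Coord 4) 1 ∧ hopf x.ofLp ∈ Γ := fun x => by
    rw [hS]; rfl
  have hSc : IsCompact S := by
    have : S = Metric.sphere (0 : Coord 4) 1 ∩ (fun x : Coord 4 => hopf x.ofLp) ⁻¹' Γ := by
      rw [hS]; rfl
    rw [this]
    exact (isCompact_sphere _ _).inter_right (hΓc.preimage continuous_hopf)
  rw [← hS]
  -- `O` is an open set with S ∩ O = A, so `S` is the disjoint union of the compact sets `A` and S \
  -- O.
  obtain ⟨O, hO⟩ : ∃ O : Set (Coord 4), O = {x | ∀ᶠ z in 𝓝 x, z ∈ S → z ∈ A} := ⟨_, rfl⟩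
  have hOo : IsOpen O := by rw [hO]; exact isOpen_setOfPred_eventually_nhds
  have hAO : A ⊆ O := fun x hx => by
    rw [hO]
    exact (hopen x hx).mono fun z hz h => hz ((hSm z).1 h)
  have hOS : ∀ x ∈ O, x ∈ S → x ∈ A := fun x hx => by
    rw [hO] at hx
    exact Filter.Eventually.self_of_nhds (p := fun z => z ∈ S → z ∈ A) hx
  have hBc : IsCompact (S \ O) := hSc.diff hOo
  have hcov : S ⊆ A ∪ S \ O := fun x hx => by
    by_cases h : x ∈ O
    · exact .inl (hOS x h hx)
    · exact .inr ⟨hx, h⟩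
  have hAS : A ⊆ S := fun x hx => (hSm x).2 (hAΓ x hx)
  -- Each fibre is a circle contained in `S` and connected, so it cannot meet both pieces.
  have hfib : ∀ a ∈ A, ∀ b ∈ S \ O, hopf a.ofLp ≠ hopf b.ofLp := by
    intro a ha b hb hab
    obtain ⟨c, s, hcs, e0, e1, e2, e3⟩ := exists_angle_of_hopf_eq
      (sphere_eq ((hSm a).1 (hAS ha)).1) (sphere_eq ((hSm b).1 hb.1).1) hab
    obtain ⟨t₀, rfl, rfl⟩ := exists_cos_sin hcs
    let g : ℝ → Coord 4 := fun t => Real.cos t • a + Real.sin t • mulI a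
    have hg : Continuous g := by fun_prop
    have hgS : range g ⊆ S := by
      rintro _ ⟨t, rfl⟩
      have h1 := sphere_eq ((hSm a).1 (hAS ha)).1
      have h2 := Real.sin_sq_add_cos_sq t
      have h3 : hopf (g t).ofLp = hopf a.ofLp := by
        funext l
        fin_cases l <;> simp [hopf, g, mulI]
        · linear_combination (a 0 * a 2 + a 1 * a 3) * h2
        · linear_combination (a 1 * a 2 - a 0 * a 3) * h2
        · linear_combination (a 0 ^ 2 + a 1 ^ 2 - a 2 ^ 2 - a 3 ^ 2) * h2
      refine (hSm _).2 ⟨?_, h3 ▸ ((hSm a).1 (hAS ha)).2⟩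
      rw [mem_sphere_zero_iff_norm, EuclideanSpace.norm_eq, Real.sqrt_eq_one, Fin.sum_univ_four]
      simp [g, mulI]
      linear_combination (Real.sin t ^ 2 + Real.cos t ^ 2) * h1 + h2
    obtain ⟨z, -, hz⟩ := isPreconnected_closed_iff.1 (isPreconnected_range hg) A (S \ O)
      hA.isClosed hBc.isClosed (hgS.trans hcov) ⟨a, ⟨0, by simp [g]⟩, ha⟩
      ⟨b, ⟨t₀, by
        ext k
        fin_cases k <;> simp [g, mulI, e0, e1, e2, e3] <;> ring⟩, hb⟩
    exact hz.2.2 (hAO hz.1)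
  refine hAS.antisymm fun b hb => ?_
  by_contra hbA
  have hb' : b ∈ S \ O := (hcov hb).resolve_left hbA
  obtain ⟨a, ha⟩ := hne
  -- The images of the two pieces are closed and cover Γ. As Γ is connected, they would have a
  -- common point, whose fibre would meet both pieces.
  obtain ⟨z, -, ⟨a', ha', rfl⟩, ⟨b', hb'', h⟩⟩ := isPreconnected_closed_iff.1 hΓ
    ((fun x : Coord 4 => hopf x.ofLp) '' A) ((fun x : Coord 4 => hopf x.ofLp) '' (S \ O))
    (hA.image continuous_hopf).isClosed (hBc.image continuous_hopf).isClosed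
    (fun x hx => by
      obtain ⟨p, hp, rfl⟩ := hopf_surjective (hΓ1 x hx)
      rcases hcov ((hSm p).2 ⟨hp, hx⟩) with h | h
      · exact .inl ⟨p, h, rfl⟩
      · exact .inr ⟨p, h, rfl⟩)
    ⟨_, (hAΓ a ha).2, a, ha, rfl⟩ ⟨_, ((hSm b).1 hb).2, b, hb', rfl⟩
  exact hfib a' ha' b' hb'' h.symm

theorem contDiff_hopfCircle (m : ℝ) (p : Fin 4 → ℝ) (y : Fin 3 → ℝ) :
    ContDiff ℝ ∞ (hopfCircle m p y) := by
  unfold hopfCircle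
  fun_prop

theorem hopfCircle_periodic (m : ℝ) (p : Fin 4 → ℝ) (y : Fin 3 → ℝ) :
    Function.Periodic (hopfCircle m p y) (2 * Real.pi) := fun t => by
  simp only [hopfCircle, Real.cos_add_two_pi, Real.sin_add_two_pi]

theorem deriv_hopfCircle_ne_zero {m : ℝ} {p : Fin 4 → ℝ} {y : Fin 3 → ℝ}
    (hp : p 0 ^ 2 + p 1 ^ 2 + p 2 ^ 2 + p 3 ^ 2 = 1) (hy : y 0 ^ 2 + y 1 ^ 2 = 1) (t : ℝ) :
    deriv (hopfCircle m p y) t ≠ 0 := by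
  obtain ⟨o1, o2, o3, o4, o5⟩ := hopf_orthonormal hp hy
  have o0 := hopf_dot_self hp
  have hm : (0 : ℝ) < 1 + m ^ 2 := by positivity
  have hr : (1 / √(1 + m ^ 2)) ^ 2 * (1 + m ^ 2) = 1 := by
    rw [div_pow, Real.sq_sqrt hm.le]; field_simp
  have hr0 : 1 / √(1 + m ^ 2) ≠ 0 := fun h => by rw [h] at hr; simp at hr
  unfold hopfCircle
  generalize hopf p = u at *
  generalize y 0 • hopfFrame 0 p + y 1 • hopfFrame 1 p = v at *
  generalize y 1 • hopfFrame 0 p - y 0 • hopfFrame 1 p = w at *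
  generalize 1 / √(1 + m ^ 2) = r at *
  have h : HasDerivAt (fun t => (m / (1 + m ^ 2)) • circleNormal m p y + r •
      (Real.cos t • r • (u - m • v) + Real.sin t • w))
      (r • ((-Real.sin t) • r • (u - m • v) + Real.cos t • w)) t :=
    ((((Real.hasDerivAt_cos t).smul_const _).add
      ((Real.hasDerivAt_sin t).smul_const _)).const_smul r).const_add _
  rw [h.deriv]
  intro h0
  have h1 := (smul_eq_zero.1 h0).resolve_left hr0
  have h2 := congrArg (fun z => z ⬝ᵥ z) h1
  have o1' : v ⬝ᵥ u = 0 := by rw [dotProduct_comm]; exact o1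
  have o2' : w ⬝ᵥ u = 0 := by rw [dotProduct_comm]; exact o2
  have o4' : w ⬝ᵥ v = 0 := by rw [dotProduct_comm]; exact o4
  simp only [dotProduct_add, dotProduct_sub, dotProduct_smul, add_dotProduct, sub_dotProduct,
    smul_dotProduct, smul_eq_mul, o0, o1, o2, o3, o4, o5, o1', o2', o4', dotProduct_zero] at h2
  have h3 := Real.sin_sq_add_cos_sq t
  have : (1 : ℝ) = 0 := by linear_combination h2 - h3 - Real.sin t ^ 2 * hr
  exact one_ne_zero this

section bergerVertical

variable {M : Type*} [TopologicalSpace M] [ChartedSpace (Coord 2) M] [IsManifold (𝓡 2) ∞ M]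
  [CompactSpace M] [ConnectedSpace M]
  {κ τ H : ℝ} (hκ : 0 < κ) (hτ : τ ≠ 0) {f N : M → Coord 4}
  (hf : IsSmoothImmersion (bergerSphere κ τ) f)
  (hN : ∀ p, IsUnitNormal (bergerSphere κ τ) f p (N p))
  (hH : HasConstantMeanCurvature (bergerSphere κ τ) f N H)
  (h0 : ∀ q, angle (bergerSphere κ τ) f N q = 0)

include hκ hτ hf hN hH h0

theorem isHopfCylinder_of_vertical : IsHopfCylinder (bergerSphere κ τ) f := by
  obtain ⟨q⟩ : Nonempty M := inferInstance
  obtain ⟨y, hy⟩ : ∃ y : Fin 3 → ℝ, y = fun l => bergerForm κ τ l (f q) (N q) := ⟨_, rfl⟩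
  have hy1 : y 0 ^ 2 + y 1 ^ 2 = 1 := by rw [hy]; exact bergerForm_normal_sq hκ hτ hf hN h0 q
  have hp := patch_sq hf q
  obtain ⟨m, hm⟩ : ∃ m, m = 2 * H / √κ := ⟨_, rfl⟩
  have hV : bergerNormal κ τ H f N q = circleNormal m (f q).ofLp y := by rw [hy, hm]; rfl
  have hΓ := fun x => mem_range_hopfCircle hp hy1 m (x := x)
  have hs : √κ ≠ 0 := (Real.sqrt_pos.2 hκ).ne'
  have hfΓ : ∀ q', hopf (f q').ofLp ∈ range (hopfCircle m (f q).ofLp y) := fun q' =>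
    (hΓ _).2 ⟨hopf_dot_self (patch_sq hf q'), by
      rw [← hV, hm]; exact hopf_dot_bergerNormal hκ hτ hf hN hH h0 q q'⟩
  have hper := hopfCircle_periodic m (f q).ofLp y
  have hcd := contDiff_hopfCircle m (f q).ofLp y
  have hrc : IsCompact (range (hopfCircle m (f q).ofLp y)) :=
    hper.compact_of_continuous Real.two_pi_pos.ne' hcd.continuous
  have hrange : range f = {x | x ∈ Metric.sphere (0 : Coord 4) 1 ∧
      hopf x.ofLp ∈ range (hopfCircle m (f q).ofLp y)} := by
    refine eq_hopf_preimage (isPreconnected_range hcd.continuous) hrc.isClosed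
      (fun x hx => ((hΓ x).1 hx).1) (isCompact_range hf.contMDiff.continuous) ⟨_, q, rfl⟩ ?_ ?_
    · rintro _ ⟨q', rfl⟩
      exact ⟨hf.mem_carrier q', hfΓ q'⟩
    · rintro _ ⟨q', rfl⟩
      filter_upwards [eventually_mem_range_of_hopf hκ hτ hf hN hH h0 q q'] with x hx ⟨h1, h2⟩
      refine hx (sphere_eq h1) ?_
      rw [hV, ← hm]
      exact ((hΓ _).1 h2).2
  -- The circle on the unit sphere is scaled to the base sphere of radius 1/√κ.
  refine ⟨fun t => (1 / √κ) • WithLp.toLp 2 (hopfCircle m (f q).ofLp y t), 2 * Real.pi,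
    Real.two_pi_pos, ?_, fun t => ?_, fun t => ⟨?_, ?_⟩, ?_⟩
  · exact ((PiLp.contDiff_toLp).comp hcd).const_smul _
  · simp only [hper t]
  · change _ ∈ Metric.sphere (0 : Coord 3) (1 / √κ)
    rw [mem_sphere_zero_iff_norm, norm_smul, EuclideanSpace.norm_eq]
    have h1 := ((hΓ _).1 ⟨t, rfl⟩).1
    have h2 : ∑ i, ‖(WithLp.toLp 2 (hopfCircle m (f q).ofLp y t) : Coord 3).ofLp i‖ ^ 2 = 1 := by
      rw [← h1, dotProduct]
      exact Finset.sum_congr rfl fun i _ => by rw [Real.norm_eq_abs, sq_abs, sq]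
    rw [h2, Real.sqrt_one, mul_one, Real.norm_of_nonneg (by positivity)]
  · have h1 : HasDerivAt (hopfCircle m (f q).ofLp y) _ t :=
      (hcd.differentiable (by simp) t).hasDerivAt
    have h2 := ((PiLp.continuousLinearEquiv 2 ℝ (fun _ : Fin 3 => ℝ)).symm.toContinuousLinearMap.hasFDerivAt.comp_hasDerivAt t h1).const_smul
      (1 / √κ)
    have h3 : deriv (fun t => (1 / √κ) • (WithLp.toLp 2 (hopfCircle m (f q).ofLp y t) : Coord 3)) t
      = (1 / √κ) • (WithLp.toLp 2 (deriv (hopfCircle m (f q).ofLp y) t) : Coord 3) := h2.deriv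
    rw [h3]
    intro h4
    have h5 := (smul_eq_zero.1 h4).resolve_left (one_div_ne_zero hs)
    exact deriv_hopfCircle_ne_zero hp hy1 t (congrArg WithLp.ofLp h5)
  · change range f = {x | x ∈ Metric.sphere (0 : Coord 4) 1 ∧
      (1 / √κ) • (WithLp.toLp 2 (hopf x.ofLp) : Coord 3) ∈ range
        fun t => (1 / √κ) • (WithLp.toLp 2 (hopfCircle m (f q).ofLp y t) : Coord 3)}
    rw [hrange]
    ext x
    refine and_congr_right fun _ => exists_congr fun t => ?_
    rw [(smul_right_injective _ (one_div_ne_zero hs)).eq_iff]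
    exact (WithLp.toLp_injective 2).eq_iff.symm

end bergerVertical

/-! ### Assembly of the theorem -/

section main

variable {M : Type*} [TopologicalSpace M] [T2Space M] [CompactSpace M] [ConnectedSpace M]
  [ChartedSpace (Coord 2) M] [IsManifold (𝓡 2) ∞ M] [MeasurableSpace M] [BorelSpace M]

theorem integral_simonsFun_of_coframe {E : FiberedModel} {κ τ : ℝ} (K : Coframe E κ τ) (hτ : τ ≠ 0)
    (hκτ : κ ≠ 4 * τ ^ 2) {f N : M → Coord E.dim} {H : ℝ} (hf : IsSmoothImmersion E f)
    (hN : ∀ p, IsUnitNormal E f p (N p)) (hH : HasConstantMeanCurvature E f N H)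
    (hcyl : (∀ q, angle E f N q = 0) → IsHopfCylinder E f) :
    Integrable (simonsFun E τ (κ - 4 * τ ^ 2) H f N) (areaMeasure E f) ∧
    0 ≤ ∫ p, simonsFun E τ (κ - 4 * τ ^ 2) H f N p ∂areaMeasure E f ∧
    (∫ p, simonsFun E τ (κ - 4 * τ ^ 2) H f N p ∂areaMeasure E f = 0 ↔ HasParallelSecondForm E f) ∧
    (∫ p, simonsFun E τ (κ - 4 * τ ^ 2) H f N p ∂areaMeasure E f = 0 →
      IsHopfCylinder E f ∧ ∀ p, normSqA E f N p = 2 * (2 * H ^ 2 + τ ^ 2)) := by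
  have hc : κ - 4 * τ ^ 2 ≠ 0 := sub_ne_zero.2 hκτ
  refine ⟨integrable_simonsFun K hf hN hH _ _, integral_simonsFun_nonneg K hf hN hH,
    integral_simonsFun_eq_zero_iff K hf hN hH hτ hc, fun h => ?_⟩
  have h0 := angle_eq_zero_of_integral K hf hN hH hτ hc h
  exact ⟨hcyl h0, normSqA_of_vertical K hf hN hH h0⟩

/-- The model is kept as a variable `E` with an equation, so that the case distinction on the sign
of κ can be substituted into the types of the maps `f` and `N`. -/
theorem integral_simonsFun_homSpace {E : FiberedModel} {κ τ : ℝ} (hE : homSpace κ τ = E)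
    (hτ : τ ≠ 0) (hκτ : κ ≠ 4 * τ ^ 2) {f N : M → Coord E.dim} {H : ℝ}
    (hf : IsSmoothImmersion E f) (hN : ∀ p, IsUnitNormal E f p (N p))
    (hH : HasConstantMeanCurvature E f N H) :
    Integrable (simonsFun E τ (κ - 4 * τ ^ 2) H f N) (areaMeasure E f) ∧
    0 ≤ ∫ p, simonsFun E τ (κ - 4 * τ ^ 2) H f N p ∂areaMeasure E f ∧
    (∫ p, simonsFun E τ (κ - 4 * τ ^ 2) H f N p ∂areaMeasure E f = 0 ↔ HasParallelSecondForm E f) ∧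
    (∫ p, simonsFun E τ (κ - 4 * τ ^ 2) H f N p ∂areaMeasure E f = 0 →
      IsHopfCylinder E f ∧ ∀ p, normSqA E f N p = 2 * (2 * H ^ 2 + τ ^ 2)) := by
  rcases lt_or_ge 0 κ with hκ | hκ
  · rw [homSpace, if_pos hκ] at hE
    subst hE
    exact integral_simonsFun_of_coframe (bergerCoframe hκ hτ) hτ hκτ hf hN hH
      (isHopfCylinder_of_vertical hκ hτ hf hN hH)
  · rw [homSpace, if_neg hκ.not_gt] at hE
    subst hE
    exact integral_simonsFun_of_coframe (cartanCoframe κ τ) hτ hκτ hf hN hH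
      fun h0 => (cartan_not_vertical hf hN hH h0).elim

end main

end CMCSurface

end

theorem theorem1 (κ τ H : ℝ) (hτ : τ ≠ 0) (hκτ : κ ≠ 4 * τ ^ 2)
    {M : Type*} [TopologicalSpace M] [T2Space M] [CompactSpace M] [ConnectedSpace M]
    [ChartedSpace (Coord 2) M] [IsManifold (𝓡 2) ∞ M] [MeasurableSpace M] [BorelSpace M]
    (f N : M → Coord (homSpace κ τ).dim)
    (hf : IsSmoothImmersion (homSpace κ τ) f)
    (hN : ∀ p, IsUnitNormal (homSpace κ τ) f p (N p))
    (hH : HasConstantMeanCurvature (homSpace κ τ) f N H) :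
    Integrable (simonsIntegrand κ τ H f N) (areaMeasure (homSpace κ τ) f) ∧
    0 ≤ ∫ p, simonsIntegrand κ τ H f N p ∂areaMeasure (homSpace κ τ) f ∧
    (∫ p, simonsIntegrand κ τ H f N p ∂areaMeasure (homSpace κ τ) f = 0 ↔
      HasParallelSecondForm (homSpace κ τ) f) ∧
    (∫ p, simonsIntegrand κ τ H f N p ∂areaMeasure (homSpace κ τ) f = 0 →
      IsHopfCylinder (homSpace κ τ) f ∧
      ∀ p, normSqA (homSpace κ τ) f N p = 2 * (2 * H ^ 2 + τ ^ 2)) :=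
  -- `simonsIntegrand` and `simonsFun` with c = κ - 4τ² agree by definition.
  integral_simonsFun_homSpace rfl hτ hκτ hf hN hH
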